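/- **Setting.** Let $\mathcal M\subset\mathcal B(K)$ be a von Neumann algebra with a normal semifinite faithful trace $\tau$, and let $\mathcal T=(T_t)_{t\ge 0}$ be a Markovian semigroup on $(\mathcal M,\tau)$: $T_0=\mathrm{id}$, $T_sT_t=T_{s+t}$, $t\mapsto T_t$ is pointwise weak-$*$ continuous, and each $T_t$ is linear, unital, completely positive, $\tau$-preserving, weak-$*$ continuous, and symmetric, i.e. $\tau(f^*\,T_tg)=\tau((T_tf)^*g)$ for $f,g\in\mathcal M\cap L^2(\mathcal M,\tau)$. Write $T_t=e^{-tA}$, where $A$ is the weak-$*$ generator, and let $P_s=e^{-sA^{1/2}}=\frac{1}{2\sqrt\pi}\int_0^\infty s\,e^{-s^2/4v}\,v^{-3/2}\,T_v\,dv$ be the associated Poisson semigroup. Let $\mathcal S\subset\mathcal M$ be a test algebra: a weak-$*$ dense $*$-subalgebra with $\mathcal S\subset L^1(\mathcal M,\tau)$, with $\mathcal S\subset\mathrm{dom}(A^{1/2})$ and $A^{1/2}\mathcal S\subset\mathcal S$, and with $T_t\mathcal S\subset\mathcal S$, $P_s\mathcal S\subset\mathcal S$ for $s,t>0$. For $f,g\in\mathcal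 S$ put $$2\Gamma(f,g)=(Af)^*g+f^*(Ag)-A(f^*g),\qquad 2\Gamma^2(f,g)=\Gamma(Af,g)+\Gamma(f,Ag)-A\,\Gamma(f,g),$$ and assume $\Gamma^2\ge 0$, i.e. $\Gamma^2(f,f)\ge0$ for all $f\in\mathcal S$. With $\widehat A=A-\partial_s^2$ acting on $\mathcal M$-valued functions of $s>0$, let $2\widehat\Gamma(F,G)=(\widehat AF)^*G+F^*(\widehat AG)-\widehat A(F^*G)$, and let $\widehat\Gamma[P_sf]$ denote the value at $s$ of $\widehat\Gamma(F,F)$ for $F(r)=P_rf$; it equals $\Gamma(P_sf,P_sf)+|\partial_sP_sf|^2$. For $H=\ell^2(I)$ let $\mathcal M[H^c]$ be the Hilbert $W^*$-module of bounded columns $(X_i)_{i\in I}$ with entries in $\mathcal M$, regarded as operators $K\to K\otimes H$, with $\langle X,Y\rangle=\sum_iX_i^*Y_i$. For $0<\alpha<1$, the homogeneous Hölder class $\Lambda_\alpha^\circ(\mathcal T)$ is the weak-$*$ closure in $L^\infty(\mathbf R_+;\mathcal M)$ of the set of all bounded functions of the form $s\mapsto s^{1-\alpha}\partial_sP_sf$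 with $f\in\mathcal M$ (an $f$ being identified, modulo $\ker A^{1/2}$, with this function), with the norm of $L^\infty(\mathbf R_+;\mathcal M)$. Likewise $\Lambda_\alpha^\circ(\mathcal T;H^c)$ is the weak-$*$ closure in $L^\infty(\mathbf R_+;\mathcal M[H^c])$ of the set of all bounded functions $s\mapsto s^{1-\alpha}\partial_s(P_s\otimes\mathrm{id})X$ with $X\in\mathcal M[H^c]$. **Theorem.** For every $0<\alpha<1$ there is a constant $C=C(\alpha)$ depending only on $\alpha$ such that, in every such setting: 1. For all $f\in\mathcal S$, $$C^{-1}\sup_{s>0}s^{1-\alpha}\|\partial_sP_sf\|\;\le\;\sup_{s>0}s^{1-\alpha}\big\|\widehat\Gamma[P_sf]\big\|^{1/2}\;\le\;C\sup_{s>0}s^{1-\alpha}\|\partial_sP_sf\|.$$ 2. Let $\delta:\mathcal S\to\mathcal M[H^c]$ be linear with $\langle\delta(f),\delta(g)\rangle=\Gamma(f,g)$ for $f,g\in\mathcal S$, and let $\overline\delta$ be the closure of $\delta$ for the weak-$*$ topologies of $\mathcal M$ and $\mathcal M[H^c]$. Then, for every $f\in\mathcal M$ and $s>0$, the element $P_sf$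 lies in the domain of $\overline\delta$ and $\overline\delta(P_sf)$ is uniquely determined; and the inequalities of 1 hold for every $f\in\mathcal M$ (as inequalities in $[0,\infty]$), with $\widehat\Gamma[P_sf]=\langle\overline\delta(P_sf),\overline\delta(P_sf)\rangle+|\partial_sP_sf|^2$. 3. If moreover $\delta$ intertwines the semigroup, i.e. $\delta\,T_t=(T_t\otimes\mathrm{id})\,\delta$ on $\mathcal S$ for all $t>0$, then the Riesz transform $\mathcal R=\delta A^{-1/2}$, initially defined on $A^{1/2}[\mathcal S]$ by $\mathcal R(A^{1/2}g)=\delta(g)$, is bounded from $\Lambda_\alpha^\circ(\mathcal T)$ to $\Lambda_\alpha^\circ(\mathcal T;H^c)$: the closure of its graph for the product of the two weak-$*$ topologies is the graph of an everywhere defined linear operator $\mathcal R:\Lambda_\alpha^\circ(\mathcal T)\to\Lambda_\alpha^\circ(\mathcal T;H^c)$ with $\|\mathcal R\|\le C$. -/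

import Mathlib

open MeasureTheory Filter Topology
open scoped ENNReal ComplexOrder

universe u v

noncomputable section

namespace SemigroupRiesz

/-! ### The weak-* (ultraweak) topology -/

section Ultraweak

variable {E F : Type*} [NormedAddCommGroup E] [InnerProductSpace ℂ E]
  [NormedAddCommGroup F] [InnerProductSpace ℂ F]

/-- The normal functionals `X ↦ ∑ₙ ⟪ηₙ, X ξₙ⟫` with `∑ ‖ξₙ‖² < ∞`, `∑ ‖ηₙ‖² < ∞`: the predual of
the bounded operators from `E` to `F`. -/
def IsNormalFunctional (ω : (E →L[ℂ] F) →ₗ[ℂ] ℂ) : Prop :=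
  ∃ (ξ : ℕ → E) (η : ℕ → F), Summable (fun n => ‖ξ n‖ ^ 2) ∧ Summable (fun n => ‖η n‖ ^ 2) ∧
    ∀ X : E →L[ℂ] F, HasSum (fun n => inner ℂ (η n) (X (ξ n))) (ω X)

variable (E F) in
/-- Joint evaluation of all normal functionals. -/
def normalEval :
    (E →L[ℂ] F) →ₗ[ℂ] ({ω : (E →L[ℂ] F) →ₗ[ℂ] ℂ // IsNormalFunctional ω} → ℂ) :=
  LinearMap.pi fun ω => ω.1

variable (E F) in
/-- The weak-* topology on the bounded operators from `E` to `F`. -/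
@[reducible]
def ultraweak : TopologicalSpace (E →L[ℂ] F) :=
  TopologicalSpace.induced (normalEval E F) inferInstance

/-- The weak-* closure of a linear subspace of the bounded operators from `E` to `F`. -/
def ultraweakClosure (W : Submodule ℂ (E →L[ℂ] F)) : Submodule ℂ (E →L[ℂ] F) :=
  letI : TopologicalSpace (E →L[ℂ] F) := ultraweak E F
  haveI : IsTopologicalAddGroup (E →L[ℂ] F) := topologicalAddGroup_induced (normalEval E F)
  haveI : ContinuousSMul ℂ (E →L[ℂ] F) := continuousSMul_induced (normalEval E F)
  W.topologicalClosure

end Ultraweak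

/-- Closure of a set of pairs of operators for the product of the two weak-* topologies. -/
def ultraweakPairClosure {E F E' F' : Type*} [NormedAddCommGroup E] [InnerProductSpace ℂ E]
    [NormedAddCommGroup F] [InnerProductSpace ℂ F] [NormedAddCommGroup E']
    [InnerProductSpace ℂ E'] [NormedAddCommGroup F'] [InnerProductSpace ℂ F']
    (G : Set ((E →L[ℂ] F) × (E' →L[ℂ] F'))) : Set ((E →L[ℂ] F) × (E' →L[ℂ] F')) :=
  @closure _ (@instTopologicalSpaceProd _ _ (ultraweak E F) (ultraweak E' F')) G

variable {K : Type u} [NormedAddCommGroup K] [InnerProductSpace ℂ K] [CompleteSpace K]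

/-- The elements of a von Neumann algebra acting on the Hilbert space `K`. -/
abbrev Elem (M : VonNeumannAlgebra K) : Type u := ↥M.toStarSubalgebra

/-- The weak-* topology of a von Neumann algebra. -/
@[reducible]
def weakStar (M : VonNeumannAlgebra K) : TopologicalSpace (Elem M) :=
  TopologicalSpace.induced (fun x : Elem M => (x : K →L[ℂ] K)) (ultraweak K K)

/-! ### Traces -/

/-- `τ` is a normal semifinite faithful trace on `M`. Only the values of `τ` on the positive cone
of `M` (for the usual order of operators) are relevant. -/
structure IsNSFTrace (M : VonNeumannAlgebra K) (τ : (K →L[ℂ] K) → ℝ≥0∞) : Prop where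
  add : ∀ x ∈ M, ∀ y ∈ M, 0 ≤ x → 0 ≤ y → τ (x + y) = τ x + τ y
  smul : ∀ x ∈ M, 0 ≤ x → ∀ c : ℝ, 0 ≤ c → τ ((c : ℂ) • x) = ENNReal.ofReal c * τ x
  conj : ∀ x ∈ M, 0 ≤ x → ∀ w ∈ M, w ∈ unitary (K →L[ℂ] K) → τ (w * x * star w) = τ x
  normal : ∀ D : Set (K →L[ℂ] K), D.Nonempty → (∀ d ∈ D, d ∈ M ∧ 0 ≤ d) →
    DirectedOn (· ≤ ·) D → ∀ x ∈ M, IsLUB D x → τ x = ⨆ d ∈ D, τ d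
  semifinite : ∀ x ∈ M, 0 ≤ x → τ x = ∞ → ∃ y ∈ M, 0 ≤ y ∧ y ≤ x ∧ 0 < τ y ∧ τ y < ∞
  faithful : ∀ x ∈ M, 0 ≤ x → τ x = 0 → x = 0

/-- `τ(f* g)` for `f, g ∈ M ∩ L²(M, τ)`, by polarization of `τ(h* h)`. -/
def traceInner (τ : (K →L[ℂ] K) → ℝ≥0∞) (f g : K →L[ℂ] K) : ℂ :=
  (1 / 4 : ℂ) * ∑ k ∈ Finset.range 4, Complex.I ^ k *
    ((τ (star (g + Complex.I ^ k • f) * (g + Complex.I ^ k • f))).toReal : ℂ)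

/-! ### Markovian semigroups -/

/-- Positivity of an `m × m` matrix of operators on `K`, as an operator on `K^m`. -/
def MatrixPositive {m : ℕ} (x : Fin m → Fin m → (K →L[ℂ] K)) : Prop :=
  ∀ ξ : Fin m → K, 0 ≤ ∑ i, ∑ j, inner ℂ (ξ i) (x i j (ξ j))

/-- Markovian operators on `(M, τ)`. -/
structure IsMarkovOperator (M : VonNeumannAlgebra K) (τ : (K →L[ℂ] K) → ℝ≥0∞)
    (T : Elem M → Elem M) : Prop where
  linear : IsLinearMap ℂ T
  unital : T 1 = 1
  completelyPositive : ∀ (m : ℕ) (x : Fin m → Fin m → Elem M),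
    MatrixPositive (fun i j => (x i j : K →L[ℂ] K)) →
      MatrixPositive (fun i j => (T (x i j) : K →L[ℂ] K))
  tracePreserving : ∀ x : Elem M, 0 ≤ (x : K →L[ℂ] K) → τ (T x) = τ x
  weakStarContinuous : @Continuous _ _ (weakStar M) (weakStar M) T
  symmetric : ∀ f g : Elem M, τ (star f * f : Elem M) < ∞ → τ (star g * g : Elem M) < ∞ →
    traceInner τ f (T g) = traceInner τ (T f) g

/-- Markovian semigroups `(T_t)_{t ≥ 0}` on `(M, τ)` (values at negative times are irrelevant). -/
structure IsMarkovSemigroup (M : VonNeumannAlgebra K) (τ : (K →L[ℂ] K) → ℝ≥0∞)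
    (T : ℝ → Elem M → Elem M) : Prop where
  zero : T 0 = id
  add : ∀ t s : ℝ, 0 ≤ t → 0 ≤ s → T (s + t) = T t ∘ T s
  markov : ∀ t : ℝ, 0 ≤ t → IsMarkovOperator M τ (T t)
  weakStarContinuous : ∀ f : Elem M,
    @ContinuousOn _ _ _ (weakStar M) (fun t => T t f) (Set.Ici 0)

section Generators

variable {M : VonNeumannAlgebra K}

/-- `f` is in the weak-* domain of the generator `A` of the semigroup `T_t = e^{-tA}`, and
`A f = y`. -/
def IsGeneratorAt (T : ℝ → Elem M → Elem M) (f y : Elem M) : Prop :=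
  Tendsto (fun t : ℝ => ((t⁻¹ : ℝ) : ℂ) • (f - T t f)) (𝓝[>] 0) (@nhds _ (weakStar M) y)

open Classical in
/-- The generator `A` of the semigroup `T_t = e^{-tA}` (with value `0` outside of the domain). -/
def generator (T : ℝ → Elem M → Elem M) (f : Elem M) : Elem M :=
  if h : ∃ y, IsGeneratorAt T f y then h.choose else 0

/-- The density `φ_s(v) = s e^{-s²/4v} v^{-3/2} / (2√π)`, for which
`e^{-s √a} = ∫₀^∞ φ_s(v) e^{-va} dv` for all `a ≥ 0`. -/
def subordinator (s v : ℝ) : ℝ :=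
  s * Real.exp (-(s ^ 2) / (4 * v)) * v ^ (-(3 / 2) : ℝ) / (2 * √Real.pi)

/-- `y = ∫₀^∞ φ_s(v) T_v f dv`, as a weak integral. -/
def IsSubordinated (T : ℝ → Elem M → Elem M) (s : ℝ) (f y : Elem M) : Prop :=
  ∀ ξ η : K, inner ℂ ξ ((y : K →L[ℂ] K) η) =
    ∫ v in Set.Ioi (0 : ℝ), (subordinator s v : ℂ) * inner ℂ ξ ((T v f : K →L[ℂ] K) η)

open Classical in
/-- The Poisson semigroup `P_s = e^{-s A^{1/2}}` of the semigroup `T_t = e^{-tA}`, given for `s > 0`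
by subordination: `P_s f = ∫₀^∞ φ_s(v) T_v f dv`. -/
def poisson (T : ℝ → Elem M → Elem M) (s : ℝ) (f : Elem M) : Elem M :=
  if s ≤ 0 then f
  else if h : ∃ y, IsSubordinated T s f y then h.choose else 0

/-- The square root `A^{1/2}` of the generator of `T`, as the generator of the Poisson
semigroup. -/
def sqrtGenerator (T : ℝ → Elem M → Elem M) : Elem M → Elem M :=
  generator (poisson T)

/-- `∂_s P_s f`. (For a Markovian semigroup, `s ↦ P_s f` is smooth in norm on `s > 0`.) -/
def poissonDeriv (T : ℝ → Elem M → Elem M) (s : ℝ) (f : Elem M) : K →L[ℂ] K :=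
  deriv (fun r : ℝ => (poisson T r f : K →L[ℂ] K)) s

end Generators

/-! ### Test algebras and gradient forms -/

section Gradient

variable {M : VonNeumannAlgebra K}

/-- `S` is a test algebra for the semigroup `T`. -/
structure IsTestAlgebra (τ : (K →L[ℂ] K) → ℝ≥0∞) (T : ℝ → Elem M → Elem M)
    (S : NonUnitalStarSubalgebra ℂ (Elem M)) : Prop where
  dense : @closure _ (weakStar M) (S : Set (Elem M)) = Set.univ
  integrable : ∀ f ∈ S, τ (CFC.abs (f : K →L[ℂ] K)) < ∞
  sqrtGenerator_mem : ∀ f ∈ S, ∃ y ∈ S, IsGeneratorAt (poisson T) f y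
  semigroup_mem : ∀ t : ℝ, 0 < t → ∀ f ∈ S, T t f ∈ S
  poisson_mem : ∀ s : ℝ, 0 < s → ∀ f ∈ S, poisson T s f ∈ S

/-- The derived form `2 B'(f, g) = B(Af, g) + B(f, Ag) - A B(f, g)` of a sesquilinear form. -/
def derivedForm (T : ℝ → Elem M → Elem M) (B : Elem M → Elem M → Elem M) (f g : Elem M) :
    Elem M :=
  (1 / 2 : ℂ) • (B (generator T f) g + B f (generator T g) - generator T (B f g))

/-- The gradient form (carré du champ)
`2 Γ(f, g) = (Af)* g + f* (Ag) - A(f* g)`. -/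
def gradientForm (T : ℝ → Elem M → Elem M) : Elem M → Elem M → Elem M :=
  derivedForm T fun f g => star f * g

/-- The iterated gradient form `Γ²`. -/
def gradientForm₂ (T : ℝ → Elem M → Elem M) : Elem M → Elem M → Elem M :=
  derivedForm T (gradientForm T)

/-- The property `Γ² ≥ 0`. -/
def GradientForm₂Nonneg (T : ℝ → Elem M → Elem M)
    (S : NonUnitalStarSubalgebra ℂ (Elem M)) : Prop :=
  ∀ f ∈ S, 0 ≤ (gradientForm₂ T f f : K →L[ℂ] K)

/-- The space-time generator `(Â F)(s) = A (F s) - F''(s)` on functions of `s > 0`. -/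
def spaceTimeGenerator (T : ℝ → Elem M → Elem M) (F : ℝ → Elem M) (s : ℝ) : K →L[ℂ] K :=
  (generator T (F s) : K →L[ℂ] K) - iteratedDeriv 2 (fun r => (F r : K →L[ℂ] K)) s

/-- The space-time gradient form `2 Γ̂(F, G) = (ÂF)* G + F* (ÂG) - Â(F* G)`. -/
def spaceTimeGradient (T : ℝ → Elem M → Elem M) (F G : ℝ → Elem M) (s : ℝ) : K →L[ℂ] K :=
  (1 / 2 : ℂ) • (star (spaceTimeGenerator T F s) * (G s : K →L[ℂ] K)
    + star (F s : K →L[ℂ] K) * spaceTimeGenerator T G s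
    - spaceTimeGenerator T (fun r => star (F r) * G r) s)

end Gradient

/-- `sup_{s > 0} s^{1-α} N(s)`, in `[0, ∞]`. -/
def weightedSup (α : ℝ) (N : ℝ → ℝ) : ℝ≥0∞ :=
  ⨆ (s : ℝ) (_ : 0 < s), ENNReal.ofReal (s ^ (1 - α) * N s)

/-! ### The Hilbert module `M[H^c]` for `H = ℓ²(ι)` -/

/-- The Hilbert space `K ⊗ ℓ²(ι)`. -/
abbrev Ampl (K : Type u) [NormedAddCommGroup K] (ι : Type v) : Type (max u v) :=
  lp (fun _ : ι => K) 2

/-- The `i`-th entry of a column operator. -/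
def entry {ι : Type v} (i : ι) (X : K →L[ℂ] Ampl K ι) : K →L[ℂ] K :=
  (lp.evalCLM ℂ (fun _ : ι => K) 2 i) ∘L X

/-- The Hilbert `W*`-module `M[H^c]`, `H = ℓ²(ι)`: bounded columns `(X_i)_{i ∈ ι}` with entries in
`M`, regarded as operators from `K` to `K ⊗ ℓ²(ι)`. Its `M`-valued inner product is
`⟨X, Y⟩ = X* Y = ∑ᵢ X_i* Y_i`, and its norm `‖⟨X, X⟩‖^{1/2}` is the operator norm. -/
def columnModule (M : VonNeumannAlgebra K) (ι : Type v) : Submodule ℂ (K →L[ℂ] Ampl K ι) where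
  carrier := {X | ∀ i, entry i X ∈ M}
  add_mem' := by
    intro X Y hX hY i
    have h : entry i (X + Y) = entry i X + entry i Y := by simp [entry]
    rw [h]
    exact add_mem (hX i) (hY i)
  zero_mem' := by
    intro i
    have h : entry i (0 : K →L[ℂ] Ampl K ι) = 0 := by simp [entry]
    rw [h]
    exact zero_mem M
  smul_mem' := by
    intro c X hX i
    have h : entry i (c • X) = c • entry i X := by simp [entry]
    rw [h]
    exact M.toStarSubalgebra.smul_mem (hX i) c

section Module

variable {M : VonNeumannAlgebra K} {ι : Type v}

/-- The entries of an element of `M[H^c]`, as elements of `M`. -/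
def coord (X : columnModule M ι) (i : ι) : Elem M :=
  ⟨entry i (X : K →L[ℂ] Ampl K ι), X.2 i⟩

/-- `Y = (Φ ⊗ id) X`, where `X` is an element of `M[H^c]`: entrywise application of `Φ`. -/
def IsAmplification (Φ : Elem M → K →L[ℂ] K) (X : columnModule M ι)
    (Y : K →L[ℂ] Ampl K ι) : Prop :=
  ∀ i, entry i Y = Φ (coord X i)

/-- The linear map `δ : S → M[H^c]` factors the gradient form: `Γ(f, g) = ⟨δ f, δ g⟩`. -/
def Factorizes (T : ℝ → Elem M → Elem M) {S : NonUnitalStarSubalgebra ℂ (Elem M)}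
    (δ : S →ₗ[ℂ] columnModule M ι) : Prop :=
  ∀ f g : S, (gradientForm T f g : K →L[ℂ] K) =
    ContinuousLinearMap.adjoint (δ f : K →L[ℂ] Ampl K ι) ∘L (δ g : K →L[ℂ] Ampl K ι)

/-- The intertwining identity `δ T_t = (T_t ⊗ id) δ` on `S`. -/
def Intertwines (T : ℝ → Elem M → Elem M) {S : NonUnitalStarSubalgebra ℂ (Elem M)}
    (δ : S →ₗ[ℂ] columnModule M ι) : Prop :=
  ∀ t : ℝ, 0 < t → ∀ f g : S, (g : Elem M) = T t f →
    IsAmplification (fun x => (T t x : K →L[ℂ] K)) (δ f) (δ g : K →L[ℂ] Ampl K ι)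

/-- The graph of the weak-* closure of `δ`. -/
def closedGraph {S : NonUnitalStarSubalgebra ℂ (Elem M)} (δ : S →ₗ[ℂ] columnModule M ι) :
    Set ((K →L[ℂ] K) × (K →L[ℂ] Ampl K ι)) :=
  ultraweakPairClosure {p | ∃ f : S, p.1 = ((f : Elem M) : K →L[ℂ] K) ∧
    p.2 = (δ f : K →L[ℂ] Ampl K ι)}

end Module

/-! ### Homogeneous Hölder classes -/

/-- The Hilbert space `L²(ℝ₊; E)`. -/
abbrev L2Pos (E : Type*) [NormedAddCommGroup E] : Type _ :=
  Lp E 2 (volume.restrict (Set.Ioi (0 : ℝ)))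

/-- `Θ` is the operator `L²(ℝ₊; E) → L²(ℝ₊; F)` of multiplication by the operator-valued function
`G` on `ℝ₊`. In this way `L^∞(ℝ₊; M)` acts on `L²(ℝ₊; K) = L²(ℝ₊) ⊗ K` as the von Neumann tensor
product of `L^∞(ℝ₊)` and `M`, its norm is the operator norm, and its weak-* topology is the
ultraweak one; similarly for `L^∞(ℝ₊; M[H^c])`. -/
def IsMultiplication {E F : Type*} [NormedAddCommGroup E] [InnerProductSpace ℂ E]
    [NormedAddCommGroup F] [InnerProductSpace ℂ F] (G : ℝ → E →L[ℂ] F)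
    (Θ : L2Pos E →L[ℂ] L2Pos F) : Prop :=
  ∀ h : L2Pos E, Θ h =ᵐ[volume.restrict (Set.Ioi (0 : ℝ))] fun s => G s (h s)

section Holder

variable {M : VonNeumannAlgebra K}

/-- The function `Φ_α(f)(s) = s^{1-α} ∂_s P_s f`. -/
def holderSymbol (T : ℝ → Elem M → Elem M) (α : ℝ) (f : Elem M) (s : ℝ) : K →L[ℂ] K :=
  ((s ^ (1 - α) : ℝ) : ℂ) • poissonDeriv T s f

/-- `G(s) = s^{1-α} ∂_s (P_s ⊗ id) X` for all `s > 0`, where `X` is an element of `M[H^c]`. -/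
def IsHolderColumnSymbol {ι : Type v} (T : ℝ → Elem M → Elem M) (α : ℝ) (X : columnModule M ι)
    (G : ℝ → K →L[ℂ] Ampl K ι) : Prop :=
  ∀ s : ℝ, 0 < s → IsAmplification (fun x => holderSymbol T α x s) X (G s)

/-- The homogeneous Hölder class `Λ_α°(T)`: the weak-* closure in `L^∞(ℝ₊; M)` of the set of all
`Φ_α(f)`, `f ∈ M`, `sup_{s > 0} ‖s^{1-α} ∂_s P_s f‖ < ∞`. The seminorm of `f` is the norm
of `Φ_α(f)`, and `Φ_α(f)` determines `f` modulo the kernel of `A^{1/2}`. -/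
def holderClass (T : ℝ → Elem M → Elem M) (α : ℝ) : Submodule ℂ (L2Pos K →L[ℂ] L2Pos K) :=
  ultraweakClosure (Submodule.span ℂ
    {Θ | ∃ f : Elem M, (∃ c : ℝ, ∀ s : ℝ, 0 < s → ‖holderSymbol T α f s‖ ≤ c) ∧
      IsMultiplication (holderSymbol T α f) Θ})

/-- The homogeneous Hölder class `Λ_α°(T; H^c)`, `H = ℓ²(ι)`: the weak-* closure in
`L^∞(ℝ₊; M[H^c])` of the set of all `s ↦ s^{1-α} ∂_s (P_s ⊗ id) X` that are bounded on `s > 0`,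
for `X ∈ M[H^c]`. -/
def holderColumnClass (T : ℝ → Elem M → Elem M) (α : ℝ) (ι : Type v) :
    Submodule ℂ (L2Pos K →L[ℂ] L2Pos (Ampl K ι)) :=
  ultraweakClosure (Submodule.span ℂ
    {Θ | ∃ (X : columnModule M ι) (G : ℝ → K →L[ℂ] Ampl K ι), IsHolderColumnSymbol T α X G ∧
      (∃ c : ℝ, ∀ s : ℝ, 0 < s → ‖G s‖ ≤ c) ∧ IsMultiplication G Θ})

/-- The graph of the weak-* closure of the Riesz transform `δ A^{-1/2}`, which is initially defined
on `A^{1/2}[S]` by `A^{1/2} g ↦ δ g`, as an operator from `Λ_α°(T)` to `Λ_α°(T; H^c)`. -/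
def rieszGraph {ι : Type v} (T : ℝ → Elem M → Elem M) (α : ℝ)
    {S : NonUnitalStarSubalgebra ℂ (Elem M)} (δ : S →ₗ[ℂ] columnModule M ι) :
    Set ((L2Pos K →L[ℂ] L2Pos K) × (L2Pos K →L[ℂ] L2Pos (Ampl K ι))) :=
  ultraweakPairClosure
    {p | ∃ (g : S) (G : ℝ → K →L[ℂ] Ampl K ι), IsHolderColumnSymbol T α (δ g) G ∧
      IsMultiplication (holderSymbol T α (sqrtGenerator T g)) p.1 ∧ IsMultiplication G p.2}

end Holder

end SemigroupRiesz

end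

/-!
Write `B = A^{1/2}` for the generator of the Poisson semigroup. Its subordination density `φ_s` has
`∫ φ_s(v) v⁻¹ dv = 2 / s²`, and convolution and heat equation of the densities give, on all of `M`,
`P_s P_r = P_{s+r}` and the norm differentiability of `s ↦ P_s f` with `‖∂_s P_s f‖ ≤ 2 ‖f‖ / s`.

**The two-sided bounds.** On the test algebra, `∂_s P_s f = -P_s B f` and `A = B²`, whence
`Γ̂[P_s f] = Γ(P_s f) + |∂_s P_s f|²`, and one of the two inequalities is immediate. For the other,
`Γ² ≥ 0` makes `u ↦ T_{t-u} Γ(T_u f)` monotone, so `Γ(T_t f) ≤ T_t Γ(f)` and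
`2 t Γ(T_t f) ≤ T_t |f|² - |T_t f|²` (`IsTestAlgebra.gradientForm_semigroup_le`,
`IsTestAlgebra.norm_gradientForm_semigroup_le`). A Jensen inequality for the subordination integral
turns this into `‖Γ(P_s f)‖ ≤ ‖f‖² / s²`. Applied to
`P_s f - P_{2s} f = P_{s/2} (P_{s/2} f - P_{3s/2} f)`, where the norm in brackets is at most a
multiple of `s^α sup r^{1-α} ‖∂_r P_r f‖`, it bounds `‖Γ(P_s f)‖^{1/2}` by `‖Γ(P_{2s} f)‖^{1/2}`
plus a multiple of `s^{α-1}`; these bounds sum over the dyadic points `2ⁿ s` because `α < 1`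
(`dyadic_bound`, `weightedSup_equiv`).

**Passage to `M`.** The pairing `f ↦ τ(k f)`, for `k` in the test algebra, is a normal functional;
this rests on a description of `τ` on its square integrable elements by vector functionals
(`exists_normal_of_chain`, `exists_normal_of_approx`). These functionals separate the points of
`M`, and `T_t`, `A` and `P_s` are symmetric for them. Hence `P_s` has a weak-* closed graph, and
`δ` is closable: `2 τ(h Γ(g, f)) = τ(q f)` with `q` in the test algebra, so that `f_i → 0` and
`δ(f_i) → X` force `⟨δ(g), X⟩ = 0` for all `g`, and then `⟨X, X⟩ = 0`
(`eq_zero_of_mem_closedGraph`). Elements of `M` are limits of bounded nets from the test algebra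
(`exists_bounded_net`, a form of the Kaplansky density theorem), along which `δ(P_s f_i)` stays
bounded by the gradient estimate. So `P_s M` lies in the domain of the closure, the estimates
persist, and the dyadic argument applies once more.

**The Riesz transform.** Symbols are multiplication operators on `L²(ℝ₊)`, and all information is
extracted through slices `∫ ρ^{α-1} w(ρ) Θ(ρ) dρ`. When `w` is the indicator function of `(a, b]`,
the slice of the symbol of `f` is `P_b f - P_a f`; for a trapezoid it is a second difference of
`ρ ↦ P_ρ B⁻¹ f`. For a pair `(F, Y)` in the graph of `R`, the relation `R(B g) = δ(g)` thus says
that a difference of interval slices of `Y` is the image under the closure of `δ` of a trapezoidal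
slice of `F` (`rieszGraph_slices`). Since `δ P_s = (P_s ⊗ id) δ`, the gradient estimate and the
dyadic summation bound the short slices of `Y` by those of `F`; off-diagonal slices vanish and
dyadic step functions are dense, hence `‖Y‖ ≤ C ‖F‖` on the whole closed graph
(`norm_le_of_mem_rieszGraph`). So the closed graph is the graph of an operator, whose domain has
weak-* closed intersections with balls by compactness, and is weak-* closed by the Krein–Šmulian
theorem (`kreinSmulian`). It contains the symbol of each `f` in `M`: approximate `f` by the elements
`P_ε f - P_{ε+R} f = B P_ε ∫₀^R P_r f dr`, and these by elements `B P_ε g_i` with a bounded net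
`g_i` in the test algebra (`exists_rieszGraph_symbol`). Therefore the domain is the whole Hölder
class.
-/

noncomputable section

namespace SemigroupRiesz

open Set (Ioi Ioc mem_Ioi Ici uIcc mem_Ici Icc Ioo uIcc_of_le Ioi_subset_Ici_self)
open ContinuousLinearMap (adjoint adjoint_inner_right star_eq_adjoint opNorm_nonneg
  adjoint_inner_left opNorm_le_bound le_opNorm norm_id_le norm_adjoint_comp_self comp_id)
open Complex (I norm_real nonneg_iff conj_ofReal re_ofReal_mul coe_smul zero_le_real sub_re
  ofReal_mul ofReal_re real_le_real I_mul_I)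
open Real (exp norm_of_nonneg rpow_nonneg sq_sqrt norm_eq_abs sqrt_sq sqrt_nonneg sqrt_pos
  sqrt_le_left rpow_add mul_self_sqrt sqrt_mul)

local notation "π" => Real.pi
local notation "ℬ(" K ")" => K →L[ℂ] K
local notation "ℬ(" E ", " F ")" => E →L[ℂ] F
local notation "𝓝ᵤ" => @nhds _ (ultraweak _ _)

variable {K : Type u} [NormedAddCommGroup K] [InnerProductSpace ℂ K] [CompleteSpace K]
  {M : VonNeumannAlgebra K} {τ : ℬ(K) → ℝ≥0∞} {T : ℝ → Elem M → Elem M}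
  {S : NonUnitalStarSubalgebra ℂ (Elem M)}

-- Shortcuts for instances on `Elem M` that are otherwise found only after a long search.
local instance (M : VonNeumannAlgebra K) : AddCommMonoid (Elem M) := inferInstance

local instance (M : VonNeumannAlgebra K) : Module ℂ (Elem M) := inferInstance

/-! ### Normal functionals and the ultraweak topology -/

section NormalFunctionals

variable {E F E' F' : Type*} [NormedAddCommGroup E] [InnerProductSpace ℂ E]
  [NormedAddCommGroup F] [InnerProductSpace ℂ F]
  [NormedAddCommGroup E'] [InnerProductSpace ℂ E']
  [NormedAddCommGroup F'] [InnerProductSpace ℂ F']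

lemma norm_inner_apply_le (X : ℬ(E, F)) (w : F) (v : E) :
    ‖inner ℂ w (X v)‖ ≤ ‖X‖ * (‖v‖ ^ 2 + ‖w‖ ^ 2) := by
  have h1 : ‖inner ℂ w (X v)‖ ≤ ‖w‖ * ‖X v‖ := norm_inner_le_norm _ _
  have h2 : ‖X v‖ ≤ ‖X‖ * ‖v‖ := X.le_opNorm v
  have h3 : ‖w‖ * ‖X v‖ ≤ ‖w‖ * (‖X‖ * ‖v‖) := mul_le_mul_of_nonneg_left h2 (norm_nonneg _)
  have h4 : ‖w‖ * ‖v‖ ≤ ‖v‖ ^ 2 + ‖w‖ ^ 2 := by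
    nlinarith [sq_nonneg (‖v‖ - ‖w‖), sq_nonneg ‖v‖, sq_nonneg ‖w‖]
  nlinarith [mul_le_mul_of_nonneg_left h4 (norm_nonneg X)]

/-- Uncountable index sets are harmless: only countably many vectors are nonzero. -/
lemma isNormalFunctional_of_hasSum {J : Type*} {ω : ℬ(E, F) →ₗ[ℂ] ℂ} (ξ : J → E) (η : J → F)
    (hξ : Summable fun j => ‖ξ j‖ ^ 2) (hη : Summable fun j => ‖η j‖ ^ 2)
    (h : ∀ X : ℬ(E, F), HasSum (fun j => inner ℂ (η j) (X (ξ j))) (ω X)) :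
    IsNormalFunctional ω := by
  have hc : (Function.support fun j => ‖ξ j‖ ^ 2).Countable := hξ.countable_support
  set S : Set J := Function.support fun j => ‖ξ j‖ ^ 2 with hS
  have : Countable S := hc
  obtain ⟨e, he⟩ := exists_injective_nat S
  have hz : ∀ j ∉ S, ξ j = 0 := by
    intro j hj
    by_contra hne
    exact hj (by simp [hS, hne])
  refine ⟨Function.extend e (fun j : S => ξ j) 0, Function.extend e (fun j : S => η j) 0,
    ?_, ?_, ?_⟩
  · have h1 : (fun n => ‖Function.extend e (fun j : S => ξ j) 0 n‖ ^ 2)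
        = Function.extend e (fun j : S => ‖ξ j‖ ^ 2) 0 := by
      funext n
      by_cases hn : ∃ a, e a = n
      · obtain ⟨a, rfl⟩ := hn
        simp [he.extend_apply]
      · simp [Function.extend_apply' _ _ _ hn]
    rw [h1]
    exact (hasSum_extend_zero he).2 (hξ.subtype S).hasSum |>.summable
  · have h1 : (fun n => ‖Function.extend e (fun j : S => η j) 0 n‖ ^ 2)
        = Function.extend e (fun j : S => ‖η j‖ ^ 2) 0 := by
      funext n
      by_cases hn : ∃ a, e a = n
      · obtain ⟨a, rfl⟩ := hn
        simp [he.extend_apply]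
      · simp [Function.extend_apply' _ _ _ hn]
    rw [h1]
    exact (hasSum_extend_zero he).2 (hη.subtype S).hasSum |>.summable
  · intro X
    have h1 : (fun n => inner ℂ (Function.extend e (fun j : S => η j) 0 n)
          (X (Function.extend e (fun j : S => ξ j) 0 n)))
        = Function.extend e (fun j : S => inner ℂ (η j) (X (ξ j))) 0 := by
      funext n
      by_cases hn : ∃ a, e a = n
      · obtain ⟨a, rfl⟩ := hn
        simp [he.extend_apply]
      · simp [Function.extend_apply' _ _ _ hn]
    rw [h1, hasSum_extend_zero he]
    refine (hasSum_subtype_iff_of_support_subset ?_).2 (h X)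
    intro j hj
    by_contra hjS
    exact hj (by simp [hz j hjS])

/-- The vector functional `X ↦ ⟪w, X v⟫`. -/
def vectorFunctional (w : F) (v : E) : ℬ(E, F) →ₗ[ℂ] ℂ where
  toFun X := inner ℂ w (X v)
  map_add' X Y := by simp
  map_smul' c X := by simp

@[simp] lemma vectorFunctional_apply (w : F) (v : E) (X : ℬ(E, F)) :
    vectorFunctional w v X = inner ℂ w (X v) := rfl

lemma isNormalFunctional_vector (w : F) (v : E) :
    IsNormalFunctional (vectorFunctional w v : ℬ(E, F) →ₗ[ℂ] ℂ) :=
  isNormalFunctional_of_hasSum (J := Unit) (fun _ => v) (fun _ => w)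
    (hasSum_fintype _).summable (hasSum_fintype _).summable
    fun X => by simpa using hasSum_fintype fun _ : Unit => inner ℂ w (X v)

lemma IsNormalFunctional.add {ω₁ ω₂ : ℬ(E, F) →ₗ[ℂ] ℂ} (h₁ : IsNormalFunctional ω₁)
    (h₂ : IsNormalFunctional ω₂) : IsNormalFunctional (ω₁ + ω₂) := by
  obtain ⟨ξ₁, η₁, a₁, b₁, c₁⟩ := h₁
  obtain ⟨ξ₂, η₂, a₂, b₂, c₂⟩ := h₂
  refine isNormalFunctional_of_hasSum (J := ℕ ⊕ ℕ) (Sum.elim ξ₁ ξ₂) (Sum.elim η₁ η₂) ?_ ?_ ?_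
  · exact (HasSum.sum (f := fun j => ‖Sum.elim ξ₁ ξ₂ j‖ ^ 2) a₁.hasSum a₂.hasSum).summable
  · exact (HasSum.sum (f := fun j => ‖Sum.elim η₁ η₂ j‖ ^ 2) b₁.hasSum b₂.hasSum).summable
  · intro X
    exact HasSum.sum (f := fun j => inner ℂ (Sum.elim η₁ η₂ j) (X (Sum.elim ξ₁ ξ₂ j)))
      (c₁ X) (c₂ X)

lemma IsNormalFunctional.smul {ω : ℬ(E, F) →ₗ[ℂ] ℂ} (h : IsNormalFunctional ω) (c : ℂ) :
    IsNormalFunctional (c • ω) := by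
  obtain ⟨ξ, η, a, b, d⟩ := h
  refine ⟨ξ, fun n => (starRingEnd ℂ c) • η n, a, ?_, fun X => ?_⟩
  · simpa [norm_smul, mul_pow] using b.mul_left (‖c‖ ^ 2)
  · simpa [inner_smul_left, mul_comm] using (d X).mul_left c

lemma isNormalFunctional_zero : IsNormalFunctional (0 : ℬ(E, F) →ₗ[ℂ] ℂ) :=
  ⟨0, 0, by simp, by simp, fun X => by simp⟩

variable (E F) in
/-- The predual of the bounded operators from `E` to `F`, as a space of linear functionals. -/
def normalFunctionals : Submodule ℂ (ℬ(E, F) →ₗ[ℂ] ℂ) where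
  carrier := {ω | IsNormalFunctional ω}
  add_mem' h₁ h₂ := h₁.add h₂
  zero_mem' := isNormalFunctional_zero
  smul_mem' c _ h := h.smul c

lemma IsNormalFunctional.sub {ω₁ ω₂ : ℬ(E, F) →ₗ[ℂ] ℂ} (h₁ : IsNormalFunctional ω₁)
    (h₂ : IsNormalFunctional ω₂) : IsNormalFunctional (ω₁ - ω₂) :=
  (normalFunctionals E F).sub_mem h₁ h₂

lemma IsNormalFunctional.exists_bound {ω : ℬ(E, F) →ₗ[ℂ] ℂ} (h : IsNormalFunctional ω) :
    ∃ c : ℝ, 0 ≤ c ∧ ∀ X, ‖ω X‖ ≤ c * ‖X‖ := by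
  obtain ⟨ξ, η, a, b, d⟩ := h
  refine ⟨∑' n, (‖ξ n‖ ^ 2 + ‖η n‖ ^ 2), tsum_nonneg fun n => by positivity, fun X => ?_⟩
  rw [← (d X).tsum_eq, mul_comm, ← tsum_mul_left]
  exact tsum_of_norm_bounded ((a.add b).mul_left ‖X‖).hasSum
    fun n => norm_inner_apply_le X (η n) (ξ n)

/-- The linear map `X ↦ A X B`. -/
def sandwich (A : ℬ(F, F')) (B : ℬ(E', E)) : ℬ(E, F) →ₗ[ℂ] ℬ(E', F') where
  toFun X := A ∘L X ∘L B
  map_add' X Y := by ext; simp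
  map_smul' c X := by ext; simp

@[simp] lemma sandwich_apply (A : ℬ(F, F')) (B : ℬ(E', E)) (X : ℬ(E, F)) :
    sandwich A B X = A ∘L X ∘L B := rfl

lemma IsNormalFunctional.comp_sandwich [CompleteSpace F] [CompleteSpace F']
    {ω : ℬ(E', F') →ₗ[ℂ] ℂ} (h : IsNormalFunctional ω) (A : ℬ(F, F')) (B : ℬ(E', E)) :
    IsNormalFunctional (ω ∘ₗ sandwich A B) := by
  obtain ⟨ξ, η, a, b, d⟩ := h
  refine ⟨fun n => B (ξ n), fun n => adjoint A (η n), ?_, ?_, fun X => ?_⟩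
  · refine Summable.of_nonneg_of_le (fun n => by positivity) (fun n => ?_) (a.mul_left (‖B‖ ^ 2))
    rw [← mul_pow]
    gcongr
    exact B.le_opNorm _
  · refine Summable.of_nonneg_of_le (fun n => by positivity) (fun n => ?_)
      (b.mul_left (‖adjoint A‖ ^ 2))
    rw [← mul_pow]
    gcongr
    exact le_opNorm _ _
  · simpa [adjoint_inner_left] using d (sandwich A B X)

lemma tendsto_ultraweak_iff {I : Type*} {l : Filter I} {X : I → ℬ(E, F)} {Y : ℬ(E, F)} :
    Tendsto X l (𝓝ᵤ Y) ↔
      ∀ ω : ℬ(E, F) →ₗ[ℂ] ℂ, IsNormalFunctional ω →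
        Tendsto (fun i => ω (X i)) l (𝓝 (ω Y)) := by
  rw [nhds_induced, tendsto_comap_iff, tendsto_pi_nhds]
  exact ⟨fun h ω hω => h ⟨ω, hω⟩, fun h ω => h ω.1 ω.2⟩

/-- On bounded sets, the ultraweak topology is the weak operator topology. -/
lemma tendsto_ultraweak_of_bounded {I : Type*} {l : Filter I} {X : I → ℬ(E, F)}
    {Y : ℬ(E, F)} {c : ℝ} (hc : ∀ᶠ i in l, ‖X i‖ ≤ c)
    (h : ∀ (w : F) (v : E), Tendsto (fun i => inner ℂ w (X i v)) l (𝓝 (inner ℂ w (Y v)))) :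
    Tendsto X l (𝓝ᵤ Y) := by
  rw [tendsto_ultraweak_iff]
  rintro ω ⟨ξ, η, a, b, d⟩
  have h1 : (fun i => ω (X i)) = fun i => ∑' n, inner ℂ (η n) (X i (ξ n)) :=
    funext fun i => (d (X i)).tsum_eq.symm
  rw [h1, ← (d Y).tsum_eq]
  refine tendsto_tsum_of_dominated_convergence ((a.add b).mul_left c)
    (fun n => h (η n) (ξ n)) ?_
  filter_upwards [hc] with i hi n
  exact (norm_inner_apply_le _ _ _).trans (mul_le_mul_of_nonneg_right hi (by positivity))

lemma eq_of_inner_eq {X Y : ℬ(E, F)} (h : ∀ w v, inner ℂ w (X v) = inner ℂ w (Y v)) : X = Y :=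
  ContinuousLinearMap.ext fun v => ext_inner_left ℂ fun w => h w v

lemma ultraweak_unique {I : Type*} {l : Filter I} [l.NeBot] {X : I → ℬ(E, F)}
    {Y Z : ℬ(E, F)} (hY : Tendsto X l (𝓝ᵤ Y))
    (hZ : Tendsto X l (𝓝ᵤ Z)) : Y = Z := by
  rw [tendsto_ultraweak_iff] at hY hZ
  exact eq_of_inner_eq fun w v => tendsto_nhds_unique
    (hY _ (isNormalFunctional_vector w v)) (hZ _ (isNormalFunctional_vector w v))

/-- A bounded sesquilinear form is given by a bounded operator. -/
lemma exists_operator_of_form [CompleteSpace F] (L : F → E → ℂ) {c : ℝ} (hc : 0 ≤ c)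
    (hadd : ∀ w v v', L w (v + v') = L w v + L w v')
    (hsmul : ∀ w (a : ℂ) v, L w (a • v) = a * L w v)
    (hadd' : ∀ w w' v, L (w + w') v = L w v + L w' v)
    (hsmul' : ∀ (a : ℂ) w v, L (a • w) v = (starRingEnd ℂ) a * L w v)
    (hb : ∀ w v, ‖L w v‖ ≤ c * (‖w‖ * ‖v‖)) :
    ∃ Y : ℬ(E, F), ‖Y‖ ≤ c ∧ ∀ w v, inner ℂ w (Y v) = L w v := by
  let f : E → StrongDual ℂ F := fun v =>
    LinearMap.mkContinuous
      { toFun := fun w => (starRingEnd ℂ) (L w v)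
        map_add' := fun w w' => by rw [hadd', map_add]
        map_smul' := fun a w => by simp [hsmul'] } (c * ‖v‖) fun w => by
      simpa [mul_assoc, mul_comm ‖v‖] using hb w v
  have hf : ∀ v w, f v w = (starRingEnd ℂ) (L w v) := fun _ _ => rfl
  let y : E → F := fun v => (InnerProductSpace.toDual ℂ F).symm (f v)
  have hy : ∀ w v, inner ℂ w (y v) = L w v := by
    intro w v
    rw [← inner_conj_symm, InnerProductSpace.toDual_symm_apply, hf]
    simp
  refine ⟨LinearMap.mkContinuous
    { toFun := y
      map_add' := fun v v' => ext_inner_left ℂ fun w => by rw [inner_add_right, hy, hy, hy, hadd]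
      map_smul' := fun a v => ext_inner_left ℂ fun w => by
        rw [inner_smul_right, hy, hy, hsmul]; simp } c fun v => ?_, ?_, hy⟩
  · show ‖y v‖ ≤ c * ‖v‖
    rw [LinearIsometryEquiv.norm_map]
    exact LinearMap.mkContinuous_norm_le _ (by positivity) _
  · exact LinearMap.mkContinuous_norm_le _ hc _

/-- Bounded sets of operators are relatively compact for the ultraweak topology. -/
lemma exists_ultraweak_limit [CompleteSpace F] {I : Type*} (U : Ultrafilter I)
    (X : I → ℬ(E, F)) {c : ℝ} (hc : 0 ≤ c) (h : ∀ᶠ i in (U : Filter I), ‖X i‖ ≤ c) :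
    ∃ Y : ℬ(E, F), ‖Y‖ ≤ c ∧ Tendsto X U (𝓝ᵤ Y) := by
  have hb : ∀ w v, ∀ᶠ i in (U : Filter I), ‖inner ℂ w (X i v)‖ ≤ c * (‖w‖ * ‖v‖) := by
    intro w v
    filter_upwards [h] with i hi
    calc ‖inner ℂ w (X i v)‖ ≤ ‖w‖ * ‖X i v‖ := norm_inner_le_norm _ _
      _ ≤ ‖w‖ * (c * ‖v‖) := by
          gcongr
          exact (X i).le_of_opNorm_le hi v
      _ = c * (‖w‖ * ‖v‖) := by ring
  have hlim : ∀ w v, ∃ z : ℂ, ‖z‖ ≤ c * (‖w‖ * ‖v‖) ∧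
      Tendsto (fun i => inner ℂ w (X i v)) U (𝓝 z) := by
    intro w v
    obtain ⟨z, hz, hz'⟩ := isCompact_iff_ultrafilter_le_nhds.1
      (isCompact_closedBall (0 : ℂ) (c * (‖w‖ * ‖v‖))) (U.map fun i => inner ℂ w (X i v)) (by
        rw [le_principal_iff]
        have h1 : ∀ᶠ i in (U : Filter I), inner ℂ w (X i v) ∈
            Metric.closedBall (0 : ℂ) (c * (‖w‖ * ‖v‖)) := by
          filter_upwards [hb w v] with i hi
          simpa using hi
        exact h1)
    exact ⟨z, by simpa using hz, hz'⟩
  choose L hL hT using hlim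
  obtain ⟨Y, hY, hYL⟩ := exists_operator_of_form L hc
    (fun w v v' => tendsto_nhds_unique (hT w (v + v')) (by
      simpa [inner_add_right] using (hT w v).add (hT w v')))
    (fun w a v => tendsto_nhds_unique (hT w (a • v)) (by
      simpa [inner_smul_right] using (hT w v).const_mul a))
    (fun w w' v => tendsto_nhds_unique (hT (w + w') v) (by
      simpa [inner_add_left] using (hT w v).add (hT w' v)))
    (fun a w v => tendsto_nhds_unique (hT (a • w) v) (by
      simpa [inner_smul_left, mul_comm] using (hT w v).const_mul ((starRingEnd ℂ) a)))
    hL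
  exact ⟨Y, hY, tendsto_ultraweak_of_bounded h fun w v => by rw [hYL]; exact hT w v⟩

lemma tendsto_sandwich [CompleteSpace F] [CompleteSpace F'] {I : Type*} {l : Filter I}
    {X : I → ℬ(E, F)} {Y : ℬ(E, F)} (h : Tendsto X l (𝓝ᵤ Y))
    (A : ℬ(F, F')) (B : ℬ(E', E)) :
    Tendsto (fun i => A ∘L X i ∘L B) l (𝓝ᵤ (A ∘L Y ∘L B)) := by
  rw [tendsto_ultraweak_iff] at h ⊢
  exact fun ω hω => h _ (hω.comp_sandwich A B)

lemma tendsto_ultraweak_of_norm {I : Type*} {l : Filter I} {X : I → ℬ(E, F)}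
    {Y : ℬ(E, F)} (h : Tendsto X l (𝓝 Y)) : Tendsto X l (𝓝ᵤ Y) := by
  rw [tendsto_ultraweak_iff]
  intro ω hω
  obtain ⟨c, _, hcb⟩ := hω.exists_bound
  exact (LinearMap.mkContinuous ω c hcb).continuous.continuousAt.tendsto.comp h

lemma mem_closure_ultraweak_iff {s : Set ℬ(E, F)} {Y : ℬ(E, F)} :
    Y ∈ @closure _ (ultraweak E F) s ↔ ∃ U : Ultrafilter ℬ(E, F),
      s ∈ U ∧ Tendsto (fun X => X) (U : Filter ℬ(E, F)) (𝓝ᵤ Y) := by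
  let := ultraweak E F
  exact mem_closure_iff_ultrafilter

lemma mem_ultraweakClosure_iff {W : Submodule ℂ ℬ(E, F)} {Y : ℬ(E, F)} :
    Y ∈ ultraweakClosure W ↔ Y ∈ @closure _ (ultraweak E F) (W : Set ℬ(E, F)) := Iff.rfl

/-- Limits of nets in a set of pairs, for the product of the two ultraweak topologies. -/
lemma mem_ultraweakPairClosure_iff {G : Set (ℬ(E, F) × ℬ(E', F'))}
    {p : ℬ(E, F) × ℬ(E', F')} :
    p ∈ ultraweakPairClosure G ↔ ∃ U : Ultrafilter (ℬ(E, F) × ℬ(E', F')), G ∈ U ∧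
      Tendsto Prod.fst (U : Filter (ℬ(E, F) × ℬ(E', F'))) (𝓝ᵤ p.1) ∧
      Tendsto Prod.snd (U : Filter (ℬ(E, F) × ℬ(E', F')))
        (𝓝ᵤ p.2) := by
  let := ultraweak E F
  let := ultraweak E' F'
  have h1 : p ∈ ultraweakPairClosure G ↔ p ∈ closure G := Iff.rfl
  rw [h1, mem_closure_iff_ultrafilter]
  refine exists_congr fun U => and_congr_right fun _ => ?_
  have h2 : (U : Filter (ℬ(E, F) × ℬ(E', F'))) ≤ 𝓝 p ↔
      Tendsto id (U : Filter (ℬ(E, F) × ℬ(E', F'))) (𝓝 p) := Iff.rfl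
  rw [h2, nhds_prod_eq, tendsto_prod_iff']
  rfl

/-- Limits of arbitrary nets of pairs stay in the closure. -/
lemma mem_ultraweakPairClosure_of_tendsto {G : Set (ℬ(E, F) × ℬ(E', F'))} {I : Type*}
    {l : Filter I} [l.NeBot] {X : I → ℬ(E, F)} {Y : I → ℬ(E', F')}
    {X₀ : ℬ(E, F)} {Y₀ : ℬ(E', F')} (h : ∀ᶠ i in l, (X i, Y i) ∈ ultraweakPairClosure G)
    (hX : Tendsto X l (𝓝ᵤ X₀))
    (hY : Tendsto Y l (𝓝ᵤ Y₀)) :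
    (X₀, Y₀) ∈ ultraweakPairClosure G := by
  let := ultraweak E F
  let := ultraweak E' F'
  have h1 : IsClosed (ultraweakPairClosure G) := isClosed_closure
  exact h1.mem_of_tendsto (hX.prodMk_nhds hY) h

/-- The closure of a linear relation is a linear relation. -/
lemma ultraweakPairClosure_linear {G : Set (ℬ(E, F) × ℬ(E', F'))}
    (W : Submodule ℂ (ℬ(E, F) × ℬ(E', F'))) (hW : (W : Set _) = G) :
    ∃ W' : Submodule ℂ (ℬ(E, F) × ℬ(E', F')), (W' : Set _) = ultraweakPairClosure G := by
  let : TopologicalSpace ℬ(E, F) := ultraweak E F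
  have : IsTopologicalAddGroup ℬ(E, F) := topologicalAddGroup_induced (normalEval E F)
  have : ContinuousSMul ℂ ℬ(E, F) := continuousSMul_induced (normalEval E F)
  let : TopologicalSpace ℬ(E', F') := ultraweak E' F'
  have : IsTopologicalAddGroup ℬ(E', F') := topologicalAddGroup_induced (normalEval E' F')
  have : ContinuousSMul ℂ ℬ(E', F') := continuousSMul_induced (normalEval E' F')
  exact ⟨W.topologicalClosure, by rw [Submodule.topologicalClosure_coe, hW]; rfl⟩

end NormalFunctionals

lemma mem_of_commute {Y : ℬ(K)} (h : ∀ z ∈ M.commutant, z * Y = Y * z) : Y ∈ M := by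
  rw [← VonNeumannAlgebra.commutant_commutant M, VonNeumannAlgebra.mem_commutant_iff]
  exact h

lemma commute_of_mem {x z : ℬ(K)} (hx : x ∈ M) (hz : z ∈ M.commutant) : z * x = x * z :=
  (VonNeumannAlgebra.mem_commutant_iff.1 hz x hx).symm

/-- A von Neumann algebra is ultraweakly closed. -/
lemma mem_of_tendsto_ultraweak {I : Type*} {l : Filter I} [l.NeBot] {X : I → ℬ(K)}
    {Y : ℬ(K)} (hX : ∀ᶠ i in l, X i ∈ M) (h : Tendsto X l (𝓝ᵤ Y)) :
    Y ∈ M := by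
  refine mem_of_commute fun z hz => ?_
  have h1 := tendsto_sandwich h z (ContinuousLinearMap.id ℂ K)
  have h2 := tendsto_sandwich h (ContinuousLinearMap.id ℂ K) z
  refine ultraweak_unique h1 (h2.congr' ?_)
  filter_upwards [hX] with i hi
  exact (commute_of_mem hi hz).symm

lemma isClosed_vonNeumann : IsClosed (M : Set ℬ(K)) := by
  refine isClosed_of_closure_subset fun x hx => ?_
  obtain ⟨y, hy, hyx⟩ := mem_closure_iff_seq_limit.1 hx
  exact mem_of_tendsto_ultraweak (.of_forall hy) (tendsto_ultraweak_of_norm hyx)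

instance : CompleteSpace (Elem M) :=
  (isClosed_vonNeumann (M := M)).completeSpace_coe

lemma tendsto_weakStar_iff {I : Type*} {l : Filter I} {x : I → Elem M} {y : Elem M} :
    Tendsto x l (@nhds _ (weakStar M) y) ↔
      Tendsto (fun i => (x i : ℬ(K))) l (𝓝ᵤ y) := by
  rw [@nhds_induced _ _ (ultraweak K K), tendsto_comap_iff]
  rfl

/-- The weak-* continuous functionals of a von Neumann algebra are the restrictions of the normal
functionals. -/
lemma exists_normal_of_continuous (φ : Elem M →ₗ[ℂ] ℂ)
    (hφ : @Continuous _ _ (weakStar M) _ φ) :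
    ∃ ω : ℬ(K) →ₗ[ℂ] ℂ, IsNormalFunctional ω ∧ ∀ x : Elem M, φ x = ω x := by
  have h0 : φ ⁻¹' Metric.ball 0 1 ∈ @nhds _ (weakStar M) 0 :=
    (@Continuous.continuousAt _ _ (weakStar M) _ φ 0 hφ) (by
      rw [map_zero]; exact Metric.ball_mem_nhds _ one_pos)
  have hws : weakStar M = TopologicalSpace.induced
      (fun x : Elem M => normalEval K K x.1) inferInstance := by
    rw [weakStar, ultraweak, induced_compose]
    rfl
  rw [hws, nhds_induced, mem_comap] at h0
  obtain ⟨t, ht, htφ⟩ := h0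
  have h00 : (normalEval K K ((0 : Elem M) : ℬ(K))) = 0 := by simp
  rw [h00, nhds_pi, Filter.mem_pi] at ht
  obtain ⟨I, hI, V, hV, hVt⟩ := ht
  have : Finite I := hI
  have hker : (⨅ i : I, (i.1.1 ∘ₗ (M.toStarSubalgebra.subtype.toAlgHom.toLinearMap :
      Elem M →ₗ[ℂ] ℬ(K))).ker) ≤ φ.ker := by
    intro x hx
    rw [Submodule.mem_iInf] at hx
    rw [LinearMap.mem_ker]
    by_contra hne
    have hx' : ∀ i ∈ I, i.1 x.1 = 0 := fun i hi => hx ⟨i, hi⟩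
    have hmem : (φ x)⁻¹ • x ∈ φ ⁻¹' Metric.ball 0 1 := by
      refine htφ (hVt fun i hi => ?_)
      have h2 : normalEval K K ((φ x)⁻¹ • x).1 i = 0 := by
        show i.1 ((φ x)⁻¹ • x).1 = 0
        have : ((φ x)⁻¹ • x).1 = (φ x)⁻¹ • x.1 := rfl
        rw [this, map_smul, hx' i hi, smul_zero]
      show normalEval K K ((φ x)⁻¹ • x).1 i ∈ V i
      rw [h2]
      exact mem_of_mem_nhds (hV i)
    simp [inv_mul_cancel₀ hne] at hmem
  have hspan := mem_span_of_iInf_ker_le_ker hker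
  have hmap : Submodule.span ℂ (Set.range fun i : I =>
      (i.1.1 ∘ₗ (M.toStarSubalgebra.subtype.toAlgHom.toLinearMap :
        Elem M →ₗ[ℂ] ℬ(K)))) ≤
      (normalFunctionals K K).map (LinearMap.lcomp ℂ ℂ
        (M.toStarSubalgebra.subtype.toAlgHom.toLinearMap : Elem M →ₗ[ℂ] ℬ(K))) := by
    rw [Submodule.span_le]
    rintro _ ⟨i, rfl⟩
    exact ⟨i.1.1, i.1.2, rfl⟩
  obtain ⟨ω, hω, hωφ⟩ := hmap hspan
  exact ⟨ω, hω, fun x => by rw [← hωφ]; rfl⟩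

/-! ### Bounded density of a weak-* dense subalgebra -/

lemma cfc_mem_vonNeumann {a : ℬ(K)} (ha : a ∈ M) (f : ℝ → ℝ) : cfc f a ∈ M :=
  mem_of_commute fun z hz =>
    ((show Commute a z from (commute_of_mem ha hz).symm).cfc_real f).eq.symm

lemma cfcₙ_mem_vonNeumann {a : ℬ(K)} (ha : a ∈ M) (f : ℝ → ℝ) : cfcₙ f a ∈ M :=
  mem_of_commute fun z hz =>
    ((show Commute a z from (commute_of_mem ha hz).symm).cfcₙ_real f).eq.symm

lemma cfcₙ_nnreal_mem_vonNeumann {a : ℬ(K)} (ha : a ∈ M) (f : NNReal → NNReal) :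
    cfcₙ f a ∈ M :=
  mem_of_commute fun z hz =>
    ((show Commute a z from (commute_of_mem ha hz).symm).cfcₙ_nnreal f).eq.symm

lemma sqrt_mem_vonNeumann {a : ℬ(K)} (ha : a ∈ M) : CFC.sqrt a ∈ M :=
  cfcₙ_nnreal_mem_vonNeumann ha _

lemma abs_mem_vonNeumann {a : ℬ(K)} (ha : a ∈ M) : CFC.abs a ∈ M :=
  sqrt_mem_vonNeumann (mul_mem (star_mem ha) ha)

lemma smul_mem_vonNeumann {a : ℬ(K)} (ha : a ∈ M) (c : ℂ) : c • a ∈ M :=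
  M.toStarSubalgebra.smul_mem ha c

/-- Self-adjoint elements of a von Neumann algebra are strong limits of self-adjoint elements of a
weak-* dense subalgebra, since convex sets have the same weak and strong closures. -/
lemma exists_selfAdjoint_near (S : NonUnitalStarSubalgebra ℂ (Elem M))
    (hS : @closure _ (weakStar M) (S : Set (Elem M)) = Set.univ) {b : ℬ(K)} (hb : b ∈ M)
    (hsa : IsSelfAdjoint b) (V : Finset K) {ε : ℝ} (hε : 0 < ε) :
    ∃ x ∈ S, IsSelfAdjoint x.1 ∧ ∀ v ∈ V, ‖x.1 v - b v‖ < ε := by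
  let H := PiLp 2 (fun _ : V => K)
  let _ : InnerProductSpace ℝ H := InnerProductSpace.rclikeToReal ℂ H
  let ev : ℬ(K) → H := fun x => WithLp.toLp 2 fun v => x v
  let R : Submodule ℝ H :=
    { carrier := {h | ∃ x ∈ S, IsSelfAdjoint x.1 ∧ h = ev x}
      add_mem' := by
        rintro _ _ ⟨x, hx, hxs, rfl⟩ ⟨y, hy, hys, rfl⟩
        exact ⟨x + y, add_mem hx hy, hxs.add hys, rfl⟩
      zero_mem' := ⟨0, zero_mem S, .zero _, rfl⟩
      smul_mem' := by
        rintro c _ ⟨x, hx, hxs, rfl⟩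
        refine ⟨(c : ℂ) • x, SMulMemClass.smul_mem _ hx, ?_, ?_⟩
        · show IsSelfAdjoint ((c : ℂ) • x.1)
          rw [isSelfAdjoint_iff, star_smul, hxs.star_eq]
          simp
        · rfl }
  have hmem : ev b ∈ R.topologicalClosure := by
    rw [← Submodule.orthogonal_orthogonal_eq_closure, Submodule.mem_orthogonal]
    intro h hh
    rw [Submodule.mem_orthogonal'] at hh
    have hcl : (⟨b, hb⟩ : Elem M) ∈ @closure _ (weakStar M) (S : Set (Elem M)) := hS ▸ trivial
    let := weakStar M
    obtain ⟨U, hSU, hU⟩ := mem_closure_iff_ultrafilter.1 hcl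
    have hU' := tendsto_ultraweak_iff.1 ((tendsto_weakStar_iff (x := fun x : Elem M => x)).1 hU)
    have hin : ∀ x : ℬ(K), inner ℝ h (ev x) = (∑ v, inner ℂ (h v) (x v)).re := fun x => by
      rw [real_inner_eq_re_inner ℂ, PiLp.inner_apply]
      rfl
    have h1 : ∀ w v, Tendsto (fun x : Elem M => inner ℂ w (x.1 v)) U
        (𝓝 (inner ℂ w (b v))) := fun w v => hU' _ (isNormalFunctional_vector w v)
    have h2 : ∀ w v, Tendsto (fun x : Elem M => inner ℂ w ((star x).1 v)) U
        (𝓝 (inner ℂ w (b v))) := by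
      intro w v
      have h3 := (Complex.continuous_conj.tendsto _).comp (h1 v w)
      rw [inner_conj_symm, ← adjoint_inner_right,
        ← star_eq_adjoint, hsa.star_eq] at h3
      refine h3.congr fun x => ?_
      show (starRingEnd ℂ) _ = _
      rw [inner_conj_symm, ← adjoint_inner_right,
        ← star_eq_adjoint]
      rfl
    have h3 : ∀ w v, Tendsto (fun x : Elem M =>
        inner ℂ w (((1 / 2 : ℂ) • (x + star x)).1 v)) U
        (𝓝 (inner ℂ w (b v))) := by
      intro w v
      have h4 := ((h1 w v).add (h2 w v)).const_mul (1 / 2 : ℂ)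
      rw [show (1 / 2 : ℂ) * (inner ℂ w (b v) + inner ℂ w (b v)) = inner ℂ w (b v) by ring] at h4
      refine h4.congr fun x => ?_
      rw [← inner_add_right, ← inner_smul_right]
      rfl
    have h4 : Tendsto (fun x : Elem M =>
        inner ℝ h (ev ((1 / 2 : ℂ) • (x + star x)).1)) U
        (𝓝 (inner ℝ h (ev b))) := by
      simp only [hin]
      exact (Complex.continuous_re.tendsto _).comp (tendsto_finsetSum _ fun v _ => h3 _ _)
    have h5 : ∀ᶠ x : Elem M in U,
        inner ℝ h (ev ((1 / 2 : ℂ) • (x + star x)).1) = 0 := by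
      filter_upwards [hSU] with x hx
      refine hh _ ⟨_, SMulMemClass.smul_mem _ (add_mem hx (star_mem hx)), ?_, rfl⟩
      show IsSelfAdjoint ((1 / 2 : ℂ) • (x.1 + star x.1))
      rw [isSelfAdjoint_iff, star_smul, star_add, star_star, add_comm]
      simp
    exact tendsto_nhds_unique h4 (tendsto_const_nhds.congr' (h5.mono fun x hx => hx.symm))
  obtain ⟨_, ⟨x, hx, hxs, rfl⟩, hd⟩ := Metric.mem_closure_iff.1 hmem ε hε
  refine ⟨x, hx, hxs, fun v hv => ?_⟩
  rw [dist_comm, dist_eq_norm] at hd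
  exact (PiLp.norm_apply_le (ev x - ev b) ⟨v, hv⟩).trans_lt hd

lemma norm_le_of_one_add_sq {x : ℬ(K)} (hx : IsSelfAdjoint x) (w : K) :
    ‖w‖ ≤ ‖w + x (x w)‖ := by
  have h1 : (inner ℂ w (w + x (x w))).re = ‖w‖ ^ 2 + ‖x w‖ ^ 2 := by
    have h2 : inner ℂ w (x (x w)) = inner ℂ (x w) (x w) := by
      rw [← adjoint_inner_left, ← star_eq_adjoint,
        hx.star_eq]
    rw [inner_add_right, h2, inner_self_eq_norm_sq_to_K, inner_self_eq_norm_sq_to_K]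
    norm_cast
  have h2 : (inner ℂ w (w + x (x w))).re ≤ ‖w‖ * ‖w + x (x w)‖ :=
    (Complex.re_le_norm _).trans (norm_inner_le_norm _ _)
  by_contra! hlt
  nlinarith [norm_nonneg w, norm_nonneg (w + x (x w)), sq_nonneg ‖x w‖]

/-- The key step of Kaplansky's density theorem, for self-adjoint contractions: write `a = g(b)`
with `g(t) = 2t/(1+t²)`, which is bounded by `1` and strongly continuous. -/
lemma exists_bounded_near_selfAdjoint (S : NonUnitalStarSubalgebra ℂ (Elem M))
    (hS : @closure _ (weakStar M) (S : Set (Elem M)) = Set.univ) {a : ℬ(K)} (ha : a ∈ M)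
    (hsa : IsSelfAdjoint a) (ha1 : ‖a‖ ≤ 1) (V : Finset K) {ε : ℝ} (hε : 0 < ε) :
    ∃ y ∈ S, ‖y‖ ≤ 2 ∧ ∀ v ∈ V, ‖y.1 v - a v‖ < ε := by
  classical
  let u : ℝ → ℝ := fun t => t / (1 + √(1 - t ^ 2))
  have hden : ∀ t : ℝ, 1 + √(1 - t ^ 2) ≠ 0 := fun t => by positivity
  have hu : Continuous u := continuous_id.div (by fun_prop) hden
  have hden' : ∀ t : ℝ, 1 + u t ^ 2 ≠ 0 := fun t => by positivity
  have hv : Continuous fun t => 1 / (1 + u t ^ 2) := continuous_const.div (by fun_prop) hden'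
  set b := cfc u a with hbdef
  set c := cfc (fun t => 1 / (1 + u t ^ 2)) a with hcdef
  have hb : b ∈ M := cfc_mem_vonNeumann ha _
  have hbs : IsSelfAdjoint b := cfc_predicate _ _
  have e1 : b * c = cfc (fun t => u t * (1 / (1 + u t ^ 2))) a :=
    (cfc_mul u _ a hu.continuousOn hv.continuousOn).symm
  have h1 : c + b * (b * c) = 1 := by
    have e2 : b * (b * c) = cfc (fun t => u t * (u t * (1 / (1 + u t ^ 2)))) a := by
      rw [e1]; exact (cfc_mul u _ a hu.continuousOn (hu.mul hv).continuousOn).symm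
    rw [e2, ← cfc_one ℝ a]
    refine (cfc_add (a := a) _ _ hv.continuousOn (hu.mul (hu.mul hv)).continuousOn).symm.trans ?_
    congr 1
    funext t
    have := hden' t
    simp only [Pi.one_apply, Pi.mul_apply]
    field_simp
  have h2 : a = (2 : ℝ) • (b * c) := by
    rw [e1, ← cfc_smul (2 : ℝ) (fun t => u t * (1 / (1 + u t ^ 2))) a (hu.mul hv).continuousOn]
    conv_lhs => rw [← cfc_id ℝ a]
    refine cfc_congr fun t ht => ?_
    have ht1 : |t| ≤ 1 := (spectrum.norm_le_norm_mul_of_mem ht).trans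
      (mul_le_one₀ ha1 (norm_nonneg _) norm_id_le)
    have hs := sq_sqrt (sub_nonneg.2 ((sq_le_one_iff_abs_le_one t).2 ht1))
    set r := √(1 - t ^ 2) with hr
    have hr0 : 1 + r ≠ 0 := hden t
    have h3 : t ^ 2 = 1 - r ^ 2 := by linarith
    have h4 : (1 + r) ^ 2 + t ^ 2 ≠ 0 := by positivity
    simp only [id, smul_eq_mul, u]
    rw [← hr]
    field_simp
    rw [h3]
    ring
  have h1v : ∀ v, v = c v + b (b (c v)) := fun v => by
    have := congrArg (fun T : ℬ(K) => T v) h1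
    simpa using this.symm
  have h2v : ∀ v, a v = (2 : ℂ) • b (c v) := fun v => by
    conv_lhs => rw [h2]
    show ((2 : ℝ) • b (c v)) = _
    exact RCLike.real_smul_eq_coe_smul (K := ℂ) 2 _
  obtain ⟨x, hxS, hxs, hx⟩ := exists_selfAdjoint_near S hS hb hbs
    (V.image (fun v => c v) ∪ V.image fun v => a v) (ε := ε / 8) (by positivity)
  let g : ℝ → ℝ := fun t => 2 * t / (1 + t ^ 2)
  have hg : Continuous g := .div (by fun_prop) (by fun_prop) fun t => by positivity
  set y := cfcₙ g x.1 with hydef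
  have hy1 : ‖y‖ ≤ 1 := by
    refine norm_cfcₙ_le fun t _ => ?_
    rw [norm_eq_abs, abs_div, abs_of_pos (by positivity : (0 : ℝ) < 1 + t ^ 2),
      div_le_one (by positivity), abs_le]
    constructor <;> nlinarith [sq_nonneg (t - 1), sq_nonneg (t + 1)]
  have hyx : y + x.1 * (x.1 * y) = (2 : ℝ) • x.1 := by
    have e0 : cfcₙ (fun t : ℝ => t) x.1 = x.1 := cfcₙ_id' ℝ _
    have e1 : x.1 * y = cfcₙ (fun t => t * g t) x.1 := by
      rw [cfcₙ_mul (fun t : ℝ => t) g _ (by fun_prop) (by simp) hg.continuousOn (by simp [g]), e0]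
    have e2 : x.1 * cfcₙ (fun t => t * g t) x.1 = cfcₙ (fun t => t * (t * g t)) x.1 := by
      rw [cfcₙ_mul (fun t : ℝ => t) (fun t => t * g t) _ (by fun_prop) (by simp)
        (continuous_id.mul hg).continuousOn (by simp), e0]
    rw [e1, e2, hydef, ← cfcₙ_add (a := x.1) g (fun t => t * (t * g t)) hg.continuousOn
      (by simp [g]) (continuous_id.mul (continuous_id.mul hg)).continuousOn (by simp)]
    conv_rhs => rw [← e0, ← cfcₙ_smul (2 : ℝ) (fun t : ℝ => t) _ (by fun_prop) (by simp)]
    congr 1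
    funext t
    have : 1 + t ^ 2 ≠ 0 := by positivity
    simp only [g, smul_eq_mul]
    field_simp
  have hyv : ∀ v, y v + x.1 (x.1 (y v)) = (2 : ℂ) • x.1 v := fun v => by
    have := congrArg (fun T : ℬ(K) => T v) hyx
    have h3 : ((2 : ℝ) • x.1) v = (2 : ℂ) • x.1 v :=
      RCLike.real_smul_eq_coe_smul (K := ℂ) 2 (x.1 v)
    simpa [h3] using this
  have hest : ∀ v ∈ V, ‖y v - a v‖ < ε / 2 := by
    intro v hv
    have hx1 := hx (c v) (by simp; exact .inl ⟨v, hv, rfl⟩)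
    have hx2 := hx (a v) (by simp; exact .inr ⟨v, hv, rfl⟩)
    set X := x.1
    set w := y v - a v - (1 / 2 : ℂ) • y (b (a v) - X (a v)) with hw
    -- `(1 + x²) w = 2 (x - b) c v`
    have h3 : w + X (X w) = (2 : ℂ) • (X (c v) - b (c v)) := by
      have e3 : w + X (X w) = (y v + X (X (y v))) - (a v + X (X (a v)))
          - (1 / 2 : ℂ) • (y (b (a v) - X (a v)) + X (X (y (b (a v) - X (a v))))) := by
        rw [hw]
        simp only [map_sub, map_smul, smul_add, smul_sub]
        abel
      have e4 : X v = X (c v) + X (b (b (c v))) := by rw [← map_add, ← h1v]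
      rw [e3, hyv v, hyv, e4, h2v v]
      simp only [map_sub, map_smul, smul_add, smul_sub, smul_smul]
      norm_num
      abel
    have h4 : ‖w‖ ≤ 2 * (ε / 8) := by
      refine (norm_le_of_one_add_sq hxs w).trans ?_
      rw [h3, norm_smul]
      simp only [Complex.norm_ofNat]
      gcongr
    have h5 : ‖(1 / 2 : ℂ) • y (b (a v) - X (a v))‖ ≤ 1 / 2 * (ε / 8) := by
      have h6 := y.le_of_opNorm_le hy1 (b (a v) - X (a v))
      rw [one_mul, norm_sub_rev] at h6
      rw [norm_smul, show ‖(1 / 2 : ℂ)‖ = 1 / 2 by norm_num]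
      linarith
    calc ‖y v - a v‖ = ‖w + (1 / 2 : ℂ) • y (b (a v) - X (a v))‖ := by rw [hw]; congr 1; abel
      _ ≤ ‖w‖ + ‖(1 / 2 : ℂ) • y (b (a v) - X (a v))‖ := norm_add_le _ _
      _ < ε / 2 := by linarith
  -- `y` is in the norm closure of `S`
  have hycl : y ∈ closure ((fun s : Elem M => s.1) '' (S : Set (Elem M))) := by
    let S' : NonUnitalStarSubalgebra ℂ ℬ(K) :=
      S.map (M.toStarSubalgebra.subtype : Elem M →⋆ₐ[ℂ] ℬ(K))
    show y ∈ (S'.topologicalClosure : Set ℬ(K))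
    have h3 : y ∈ NonUnitalStarAlgebra.elemental ℂ x.1 := by
      rw [hydef, cfcₙ_real_eq_complex g hxs]
      exact cfcₙ_mem_elemental _ _
    refine NonUnitalStarAlgebra.elemental.le_of_mem
      (NonUnitalStarSubalgebra.isClosed_topologicalClosure S') ?_ h3
    exact NonUnitalStarSubalgebra.le_topologicalClosure S' ⟨x, hxS, rfl⟩
  set N : ℝ := 1 + ∑ v ∈ V, ‖v‖ with hN
  have hN1 : 0 < N := by rw [hN]; positivity
  obtain ⟨_, ⟨s, hs, rfl⟩, hd⟩ := Metric.mem_closure_iff.1 hycl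
    (min 1 (ε / (2 * N))) (by positivity)
  rw [dist_eq_norm] at hd
  have hd1 := lt_min_iff.1 hd
  refine ⟨s, hs, ?_, fun v hv => ?_⟩
  · have : ‖s.1‖ ≤ ‖y‖ + ‖y - s.1‖ := by simpa using norm_sub_le y (y - s.1)
    show ‖s.1‖ ≤ 2
    linarith [hd1.1]
  · have h3 : ‖y v - s.1 v‖ ≤ ε / (2 * N) * ‖v‖ :=
      (y - s.1).le_of_opNorm_le hd1.2.le v
    have h4 : ‖v‖ ≤ N := by
      have := Finset.single_le_sum (f := fun v : K => ‖v‖) (fun _ _ => norm_nonneg _) hv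
      linarith
    have h5 : ε / (2 * N) * ‖v‖ ≤ ε / 2 := by
      calc ε / (2 * N) * ‖v‖ ≤ ε / (2 * N) * N := by gcongr
        _ = ε / 2 := by field_simp
    have h6 := norm_sub_le (y v - a v) (y v - s.1 v)
    rw [sub_sub_sub_cancel_left] at h6
    linarith [hest v hv]

/-- Bounded density: every element `f` is the weak-* limit of a net in the subalgebra that is
bounded by `4 ‖f‖`. -/
theorem exists_bounded_net (S : NonUnitalStarSubalgebra ℂ (Elem M))
    (hS : @closure _ (weakStar M) (S : Set (Elem M)) = Set.univ) (f : Elem M) :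
    ∃ g : Finset K × ℕ → Elem M, (∀ i, g i ∈ S ∧ ‖g i‖ ≤ 4 * ‖f‖) ∧
      Tendsto (fun i => (g i : ℬ(K))) atTop (𝓝ᵤ f) := by
  have key : ∀ a : ℬ(K), a ∈ M → IsSelfAdjoint a → ∀ (V : Finset K) (ε : ℝ), 0 < ε →
      ∃ y ∈ S, ‖y‖ ≤ 2 * ‖a‖ ∧ ∀ v ∈ V, ‖y.1 v - a v‖ < ε := by
    intro a ha hsa V ε hε
    by_cases h0 : ‖a‖ = 0
    · have ha0 : a = 0 := norm_eq_zero.1 h0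
      exact ⟨0, zero_mem S, by simp [h0], fun v _ => by simpa [ha0] using hε⟩
    have hpos : 0 < ‖a‖ := (norm_nonneg _).lt_of_ne' h0
    obtain ⟨y, hy, hy2, hyv⟩ := exists_bounded_near_selfAdjoint S hS
      (a := ((‖a‖⁻¹ : ℝ) : ℂ) • a) (smul_mem_vonNeumann ha _)
      (by rw [isSelfAdjoint_iff, star_smul, hsa.star_eq]; simp)
      (by rw [norm_smul]; simp [h0]) V (ε := ε / ‖a‖) (by positivity)
    refine ⟨(‖a‖ : ℂ) • y, SMulMemClass.smul_mem _ hy, ?_, fun v hv => ?_⟩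
    · rw [norm_smul]
      simp only [norm_real, norm_norm]
      nlinarith
    · have h1 := hyv v hv
      have h2 : ((‖a‖ : ℂ) • y).1 v - a v
          = (‖a‖ : ℂ) • (y.1 v - (((‖a‖⁻¹ : ℝ) : ℂ) • a) v) := by
        rw [smul_sub]
        simp only [smul_apply, smul_smul]
        rw [← ofReal_mul, mul_inv_cancel₀ h0]
        simp
      rw [h2, norm_smul]
      simp only [norm_real, norm_norm]
      calc ‖a‖ * _ < ‖a‖ * (ε / ‖a‖) := by gcongr
        _ = ε := by field_simp
  have key2 : ∀ i : Finset K × ℕ, ∃ y ∈ S, ‖y‖ ≤ 4 * ‖f‖ ∧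
      ∀ v ∈ i.1, ‖y.1 v - f.1 v‖ < 1 / ((i.2 : ℝ) + 1) := by
    rintro ⟨V, n⟩
    have hn : (0 : ℝ) < 1 / ((n : ℝ) + 1) / 2 := by positivity
    set F : ℬ(K) := f.1 with hF
    have hre : ((realPart F : selfAdjoint ℬ(K)) : ℬ(K)) ∈ M := by
      rw [realPart_apply_coe, RCLike.real_smul_eq_coe_smul (K := ℂ)]
      exact smul_mem_vonNeumann (add_mem f.2 (star_mem f.2)) _
    have him : ((imaginaryPart F : selfAdjoint ℬ(K)) : ℬ(K)) ∈ M := by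
      rw [imaginaryPart_apply_coe, RCLike.real_smul_eq_coe_smul (K := ℂ)]
      exact smul_mem_vonNeumann (smul_mem_vonNeumann (sub_mem f.2 (star_mem f.2)) _) _
    obtain ⟨y, hy, hyn, hyv⟩ := key _ hre (realPart F).2 V _ hn
    obtain ⟨z, hz, hzn, hzv⟩ := key _ him (imaginaryPart F).2 V _ hn
    have hr : ‖((realPart F : selfAdjoint ℬ(K)) : ℬ(K))‖ ≤ ‖f‖ := realPart.norm_le F
    have hi : ‖((imaginaryPart F : selfAdjoint ℬ(K)) : ℬ(K))‖ ≤ ‖f‖ :=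
      imaginaryPart.norm_le F
    refine ⟨y + I • z, add_mem hy (SMulMemClass.smul_mem _ hz), ?_, fun v hv => ?_⟩
    · refine (norm_add_le _ _).trans ?_
      rw [norm_smul, Complex.norm_I]
      linarith
    · have h1 : F v = ((realPart F : selfAdjoint ℬ(K)) : ℬ(K)) v
          + I • ((imaginaryPart F : selfAdjoint ℬ(K)) : ℬ(K)) v := by
        conv_lhs => rw [← realPart_add_I_smul_imaginaryPart F]
        rfl
      have h2 : (y + I • z).1 v
          = y.1 v + I • z.1 v := rfl
      rw [h1, h2, add_sub_add_comm, ← smul_sub]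
      refine (norm_add_le _ _).trans_lt ?_
      rw [norm_smul, Complex.norm_I]
      linarith [hyv v hv, hzv v hv]
  choose g hg hgn hgv using key2
  refine ⟨g, fun i => ⟨hg i, hgn i⟩, tendsto_ultraweak_of_bounded
    (.of_forall hgn) fun w v => ?_⟩
  have h1 : Tendsto (fun i => (g i : ℬ(K)) v) atTop (𝓝 (f.1 v)) := by
    rw [tendsto_iff_norm_sub_tendsto_zero]
    have h2 : Tendsto (fun i : Finset K × ℕ => 1 / ((i.2 : ℝ) + 1)) atTop (𝓝 0) := by
      rw [← prod_atTop_atTop_eq]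
      exact tendsto_one_div_add_atTop_nhds_zero_nat.comp tendsto_snd
    refine squeeze_zero' (.of_forall fun i => norm_nonneg _) ?_ h2
    filter_upwards [eventually_ge_atTop (({v} : Finset K), 0)] with i hi
    exact (hgv i v (hi.1 (Finset.mem_singleton_self v))).le
  exact (continuous_const.inner continuous_id).continuousAt.tendsto.comp h1

/-! ### The Krein–Šmulian theorem for spaces of operators -/

section KreinSmulian

variable {E : Type u} {F : Type v} [NormedAddCommGroup E] [InnerProductSpace ℂ E]
  [NormedAddCommGroup F] [InnerProductSpace ℂ F] [CompleteSpace F]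

lemma opNorm_le_of_pairs {X : ℬ(E, F)} {R : ℝ} (hR : 0 < R)
    (h : ∀ (ξ : E) (η : F), ‖ξ‖ ≤ 1 → ‖η‖ ≤ 1 / R → ‖inner ℂ η (X ξ)‖ ≤ 1) : ‖X‖ ≤ R := by
  refine X.opNorm_le_of_unit_norm (𝕜 := ℂ) hR.le fun ξ hξ => ?_
  obtain h0 | hpos := (norm_nonneg (X ξ)).eq_or_lt
  · exact h0 ▸ hR.le
  have h1 := h ξ (((1 / (R * ‖X ξ‖) : ℝ) : ℂ) • X ξ) hξ.le (by
    rw [norm_smul, norm_real, norm_of_nonneg (by positivity)]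
    exact le_of_eq (by field_simp))
  rw [inner_smul_left, inner_self_eq_norm_sq_to_K, norm_mul, RCLike.norm_conj, norm_real,
    norm_of_nonneg (by positivity), norm_pow, RCLike.norm_ofReal, abs_norm] at h1
  rwa [show 1 / (R * ‖X ξ‖) * ‖X ξ‖ ^ 2 = ‖X ξ‖ / R by field_simp, div_le_one hR] at h1

/-- A subspace whose intersections with balls are closed under ultraweak limits is ultraweakly
closed. -/
theorem kreinSmulian (D : Submodule ℂ ℬ(E, F))
    (hD : ∀ (c : ℝ) (U : Ultrafilter ℬ(E, F)) (Y : ℬ(E, F)),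
      (∀ᶠ X in (U : Filter ℬ(E, F)), X ∈ D ∧ ‖X‖ ≤ c) →
      Tendsto (fun X => X) (U : Filter ℬ(E, F)) (𝓝ᵤ Y) → Y ∈ D) :
    ultraweakClosure D ≤ D := by
  classical
  intro f₀ hf₀
  by_contra hf₀D
  -- the affine space `C = f₀ + D` avoids a ball
  have hclosed : IsClosed (D : Set ℬ(E, F)) := by
    refine isClosed_of_closure_subset fun x hx => ?_
    obtain ⟨y, hy, hyx⟩ := mem_closure_iff_seq_limit.1 hx
    have hle : Filter.map y atTop ≥ Ultrafilter.of (Filter.map y atTop) := Ultrafilter.of_le _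
    have hlim : Tendsto (fun X => X) (Filter.map y atTop) (𝓝 x) := tendsto_map'_iff.2 hyx
    refine hD (‖x‖ + 1) _ x (hle (eventually_map.2 ?_))
      (tendsto_ultraweak_of_norm (X := fun X => X) (hlim.mono_left hle))
    filter_upwards [hyx.norm.eventually (eventually_le_nhds (lt_add_one ‖x‖))] with n hn
    exact ⟨hy n, hn⟩
  obtain ⟨r, hr, hball⟩ := Metric.isOpen_iff.1 hclosed.isOpen_compl f₀ hf₀D
  let C : Set ℬ(E, F) := {f | f - f₀ ∈ D}
  let R : ℕ → ℝ := fun n => r / 2 * (n + 1)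
  have hRpos : ∀ n, 0 < R n := fun n => by positivity
  have hRmono : ∀ {m n}, m ≤ n → R m ≤ R n := fun {m n} h => by
    simp only [R]
    gcongr
  have hClim : ∀ (c : ℝ) {I : Type (max u v)} (U : Ultrafilter I) (X : I → ℬ(E, F))
      (Y : ℬ(E, F)), (∀ i, X i ∈ C ∧ ‖X i‖ ≤ c) →
      Tendsto X (U : Filter I) (𝓝ᵤ Y) → Y ∈ C := by
    intro c I U X Y hX hXY
    refine hD (c + ‖f₀‖) (U.map fun i => X i - f₀) (Y - f₀) ?_ ?_
    · rw [Ultrafilter.coe_map, eventually_map]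
      refine Eventually.of_forall fun i => ⟨(hX i).1, (norm_sub_le _ _).trans ?_⟩
      linarith [(hX i).2]
    · rw [Ultrafilter.coe_map]
      rw [tendsto_ultraweak_iff] at hXY ⊢
      refine fun ω hω => tendsto_map'_iff.2 ?_
      simpa [Function.comp_def] using (hXY ω hω).sub_const (ω f₀)
  let Good : ℕ → Finset (E × F) → Prop := fun n G =>
    ∀ f ∈ C, ‖f‖ ≤ R n → ∃ p ∈ G, 1 < ‖inner ℂ p.2 (f p.1)‖
  have hgood0 : Good 0 ∅ := by
    intro f hf hfn
    refine absurd (by simpa using D.neg_mem hf) (hball (?_ : f₀ - f ∈ _))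
    rw [mem_ball_iff_norm, sub_sub_cancel_left, norm_neg]
    refine hfn.trans_lt ?_
    simp only [R]
    push_cast
    linarith
  have hstep : ∀ n G, Good n G → ∃ P : Finset (E × F),
      (∀ p ∈ P, ‖p.1‖ ≤ 1 ∧ ‖p.2‖ ≤ 1 / R n) ∧ Good (n + 1) (G ∪ P) := by
    intro n G hG
    by_contra! hcon
    let Pairs := {p : E × F // ‖p.1‖ ≤ 1 ∧ ‖p.2‖ ≤ 1 / R n}
    have h1 : ∀ P : Finset Pairs, ∃ f ∈ C, ‖f‖ ≤ R (n + 1) ∧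
        ∀ p ∈ G ∪ P.image Subtype.val, ‖inner ℂ p.2 (f p.1)‖ ≤ 1 := by
      intro P
      have h2 := hcon (P.image Subtype.val) fun p hp => by
        obtain ⟨q, -, rfl⟩ := Finset.mem_image.1 hp
        exact q.2
      simp only [Good] at h2
      push Not at h2
      exact h2
    choose f hfC hfn hfG using h1
    let U : Ultrafilter (Finset Pairs) := Ultrafilter.of atTop
    have hU : (U : Filter (Finset Pairs)) ≤ atTop := Ultrafilter.of_le _
    obtain ⟨Y, -, hY⟩ := exists_ultraweak_limit U f (hRpos (n + 1)).le (.of_forall hfn)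
    have hle : ∀ p : E × F, (∀ᶠ P in (U : Filter (Finset Pairs)), ‖inner ℂ p.2 (f P p.1)‖ ≤ 1) →
        ‖inner ℂ p.2 (Y p.1)‖ ≤ 1 := fun p => le_of_tendsto
      (tendsto_ultraweak_iff.1 hY _ (isNormalFunctional_vector p.2 p.1)).norm
    have hYn : ‖Y‖ ≤ R n := by
      refine opNorm_le_of_pairs (hRpos n) fun ξ η hξ hη => hle (ξ, η) (hU ?_)
      filter_upwards [eventually_ge_atTop {(⟨(ξ, η), hξ, hη⟩ : Pairs)}] with P hP
      refine hfG P (ξ, η) (Finset.mem_union_right _ ?_)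
      exact Finset.mem_image.2 ⟨⟨(ξ, η), hξ, hη⟩, hP (Finset.mem_singleton_self _), rfl⟩
    obtain ⟨p, hp, hp1⟩ := hG Y (hClim _ U f Y (fun i => ⟨hfC i, hfn i⟩) hY) hYn
    exact absurd (hle p (.of_forall fun P => hfG P p (Finset.mem_union_left _ hp)))
      (not_le.2 hp1)
  choose! P hP hPG using hstep
  let G : ℕ → Finset (E × F) := fun n => Nat.rec ∅ (fun n G => G ∪ P n G) n
  have hG : ∀ n, Good n (G n) := fun n => Nat.rec hgood0 (fun n ih => hPG n (G n) ih) n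
  have hGP : ∀ n, ∀ p ∈ G n, ∃ m < n, p ∈ P m (G m) := by
    intro n
    induction n with
    | zero => exact fun p hp => absurd hp (Finset.notMem_empty _)
    | succ n ih =>
      intro p hp
      rcases Finset.mem_union.1 (show p ∈ G n ∪ P n (G n) from hp) with h | h
      · obtain ⟨m, hm, h'⟩ := ih p h
        exact ⟨m, hm.trans (Nat.lt_succ_self n), h'⟩
      · exact ⟨n, Nat.lt_succ_self n, h⟩
  -- the countable family of rank one functionals
  let I := Σ n : ℕ, {p // p ∈ P n (G n)}
  have hI : ∀ i : I, ‖i.2.1.1‖ ≤ 1 ∧ ‖i.2.1.2‖ ≤ 1 / R i.1 := fun i => hP i.1 _ (hG i.1) _ i.2.2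
  have hval : ∀ (f : ℬ(E, F)) (i : I), ‖inner ℂ i.2.1.2 (f i.2.1.1)‖ ≤ ‖f‖ / R i.1 := fun f i =>
    calc _ ≤ ‖i.2.1.2‖ * ‖f i.2.1.1‖ := norm_inner_le_norm _ _
      _ ≤ 1 / R i.1 * (‖f‖ * 1) := mul_le_mul (hI i).2
          ((f.le_opNorm _).trans (by gcongr; exact (hI i).1)) (norm_nonneg _)
          (one_div_nonneg.2 (hRpos i.1).le)
      _ = ‖f‖ / R i.1 := by ring
  have hval0 : ∀ (f : ℬ(E, F)) (i : I), ‖inner ℂ i.2.1.2 (f i.2.1.1)‖ ≤ ‖f‖ / R 0 := fun f i =>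
    (hval f i).trans (div_le_div_of_nonneg_left (norm_nonneg _) (hRpos 0) (hRmono (Nat.zero_le _)))
  let T : ℬ(E, F) →ₗ[ℂ] lp (fun _ : I => ℂ) ∞ :=
    { toFun := fun f => ⟨fun i => inner ℂ i.2.1.2 (f i.2.1.1), memℓp_infty
        ⟨‖f‖ / R 0, by rintro _ ⟨i, rfl⟩; exact hval0 f i⟩⟩
      map_add' := fun f g => by
        ext i
        exact inner_add_right _ _ _
      map_smul' := fun c f => by
        ext i
        exact inner_smul_right _ _ _ }
  have hTapp : ∀ f i, T f i = inner ℂ i.2.1.2 (f i.2.1.1) := fun _ _ => rfl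
  have hTC : ∀ f ∈ C, 1 ≤ ‖T f‖ := by
    intro f hf
    obtain ⟨n, hn⟩ : ∃ n : ℕ, ‖f‖ ≤ R n := by
      obtain ⟨n, hn⟩ := exists_nat_ge (‖f‖ / (r / 2))
      refine ⟨n, ?_⟩
      rw [div_le_iff₀ (by positivity)] at hn
      simp only [R]
      nlinarith
    obtain ⟨p, hp, hp1⟩ := hG n f hf hn
    obtain ⟨m, -, hm⟩ := hGP n p hp
    exact hp1.le.trans (lp.norm_apply_le_norm (by simp) (T f) ⟨m, ⟨p, hm⟩⟩)
  let V : Submodule ℂ (lp (fun _ : I => ℂ) ∞) := D.map T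
  have hq : ‖(Submodule.Quotient.mk (T f₀) : lp (fun _ : I => ℂ) ∞ ⧸ V)‖ ≠ 0 := by
    intro h0
    obtain ⟨m, hm, hm1⟩ := Submodule.Quotient.norm_mk_lt
      (Submodule.Quotient.mk (T f₀) : lp (fun _ : I => ℂ) ∞ ⧸ V) one_pos
    rw [h0, zero_add] at hm1
    rw [Submodule.Quotient.eq] at hm
    obtain ⟨d, hd, hdm⟩ := hm
    have h2 := hTC (f₀ + d) (by simpa [C] using hd)
    rw [map_add, hdm, add_sub_cancel] at h2
    linarith
  obtain ⟨Λ', -, hΛ'⟩ := exists_dual_vector ℂ _ hq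
  let Λ : StrongDual ℂ (lp (fun _ : I => ℂ) ∞) := Λ' ∘L V.mkQL
  have hΛD : ∀ d ∈ D, Λ (T d) = 0 := by
    intro d hd
    have : V.mkQL (T d) = 0 := (Submodule.Quotient.mk_eq_zero V).2 ⟨d, hd, rfl⟩
    simp only [Λ, ContinuousLinearMap.comp_apply, this, map_zero]
  have hΛf : Λ (T f₀) ≠ 0 := by
    show Λ' (Submodule.Quotient.mk (T f₀)) ≠ 0
    rw [hΛ']
    exact Complex.ofReal_ne_zero.2 hq
  let e : I → lp (fun _ : I => ℂ) ∞ := fun i => lp.single ∞ i 1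
  let lam : I → ℂ := fun i => Λ (e i)
  have hsumsingle : ∀ (s : Finset I) (a : I → ℂ) (j : I),
      (∑ i ∈ s, a i • e i) j = if j ∈ s then a j else 0 := by
    intro s a j
    rw [lp.coeFn_sum, Finset.sum_apply, ← Finset.sum_ite_eq s j a]
    refine Finset.sum_congr rfl fun i _ => ?_
    rw [lp.coeFn_smul, Pi.smul_apply]
    split_ifs with hij
    · subst hij; simp [e]
    · rw [lp.single_apply_ne _ _ _ hij, smul_zero]
  have hlam : Summable fun i => ‖lam i‖ := by
    refine summable_of_sum_le (fun i => norm_nonneg _) (c := ‖Λ‖) fun s => ?_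
    let a : I → ℂ := fun i => (starRingEnd ℂ) (lam i) / ‖lam i‖
    have ha : ∀ i, ‖a i‖ ≤ 1 := fun i => by
      simpa [a] using div_self_le_one ‖lam i‖
    have ha2 : ∀ i, a i * lam i = ‖lam i‖ := fun i => by
      by_cases h0 : lam i = 0
      · simp [h0]
      have : (‖lam i‖ : ℂ) ≠ 0 := by simpa using h0
      simp only [a]
      rw [div_mul_eq_mul_div, Complex.conj_mul', div_eq_iff this]
      ring
    have h1 : Λ (∑ i ∈ s, a i • e i) = ((∑ i ∈ s, ‖lam i‖ : ℝ) : ℂ) := by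
      rw [map_sum]
      push_cast
      exact Finset.sum_congr rfl fun i _ => by rw [map_smul, smul_eq_mul, ← ha2]
    have h2 : ‖∑ i ∈ s, a i • e i‖ ≤ 1 := by
      refine lp.norm_le_of_forall_le zero_le_one fun j => ?_
      rw [hsumsingle]
      split_ifs
      · exact ha j
      · simp
    have h3 := Λ.le_of_opNorm_le_of_le le_rfl h2
    rwa [h1, norm_real, mul_one,
      norm_of_nonneg (Finset.sum_nonneg fun _ _ => norm_nonneg _)] at h3
  -- on the range of `T`, which consists of null families, `Λ` is given by an `ℓ¹` family
  have hrep : ∀ f, HasSum (fun i => lam i * T f i) (Λ (T f)) := by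
    intro f
    have hs : Summable fun i => lam i * T f i := by
      refine Summable.of_norm_bounded (hlam.mul_right (‖f‖ / R 0)) fun i => ?_
      rw [norm_mul]
      gcongr
      exact hval0 f i
    let s : ℕ → Finset I := fun N => (Finset.range N).sigma fun n => Finset.univ
    have hsm : Monotone s := fun m n hmn =>
      Finset.sigma_mono (Finset.range_mono hmn) fun _ => le_rfl
    have hst : Tendsto s atTop atTop := tendsto_atTop_finset_of_monotone hsm fun i =>
      ⟨i.1 + 1, Finset.mem_sigma.2 ⟨Finset.mem_range.2 (Nat.lt_succ_self _), Finset.mem_univ _⟩⟩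
    have h1 := hs.hasSum.comp hst
    have h2 : Tendsto (fun N => ∑ i ∈ s N, lam i * T f i) atTop (𝓝 (Λ (T f))) := by
      have h3 : ∀ N, ∑ i ∈ s N, lam i * T f i = Λ (∑ i ∈ s N, T f i • e i) := fun N => by
        rw [map_sum]
        exact Finset.sum_congr rfl fun i _ => by rw [map_smul, smul_eq_mul, mul_comm]
      simp only [h3]
      refine (Λ.continuous.tendsto _).comp ?_
      rw [tendsto_iff_norm_sub_tendsto_zero]
      have hR : Tendsto (fun N => ‖f‖ / R N) atTop (𝓝 0) := tendsto_const_nhds.div_atTop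
        (.const_mul_atTop (by positivity)
          (tendsto_atTop_add_const_right _ _ tendsto_natCast_atTop_atTop))
      refine squeeze_zero (fun N => norm_nonneg _) (fun N => ?_) hR
      refine lp.norm_le_of_forall_le (div_nonneg (norm_nonneg _) (hRpos N).le) fun j => ?_
      rw [lp.coeFn_sub, Pi.sub_apply, hsumsingle]
      split_ifs with hj
      · simpa using div_nonneg (norm_nonneg _) (hRpos N).le
      · rw [zero_sub, norm_neg]
        refine (hval f j).trans (div_le_div_of_nonneg_left (norm_nonneg _) (hRpos N) (hRmono ?_))
        by_contra hlt
        exact hj (Finset.mem_sigma.2 ⟨Finset.mem_range.2 (not_le.1 hlt), Finset.mem_univ _⟩)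
    rw [← tendsto_nhds_unique h1 h2]
    exact hs.hasSum
  let ω : ℬ(E, F) →ₗ[ℂ] ℂ := Λ.toLinearMap ∘ₗ T
  have hω : IsNormalFunctional ω := by
    refine isNormalFunctional_of_hasSum (J := I) (fun i => ((√‖lam i‖ : ℝ) : ℂ) • i.2.1.1)
      (fun i => ((starRingEnd ℂ) (lam i) / ((√‖lam i‖ : ℝ) : ℂ)) • i.2.1.2) ?_ ?_ ?_
    · refine Summable.of_nonneg_of_le (fun i => by positivity) (fun i => ?_) hlam
      rw [norm_smul, mul_pow, norm_real, norm_of_nonneg (sqrt_nonneg _),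
        sq_sqrt (norm_nonneg _)]
      exact mul_le_of_le_one_right (norm_nonneg _) (pow_le_one₀ (norm_nonneg _) (hI i).1)
    · refine Summable.of_nonneg_of_le (fun i => by positivity) (fun i => ?_)
        (hlam.mul_right ((1 / R 0) ^ 2))
      rw [norm_smul, mul_pow, norm_div, RCLike.norm_conj, norm_real,
        norm_of_nonneg (sqrt_nonneg _), div_pow, sq_sqrt (norm_nonneg _)]
      have h1 : ‖lam i‖ ^ 2 / ‖lam i‖ ≤ ‖lam i‖ := by rw [pow_two, mul_self_div_self]
      have h2 : ‖i.2.1.2‖ ≤ 1 / R 0 := (hI i).2.trans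
        (one_div_le_one_div_of_le (hRpos 0) (hRmono (Nat.zero_le _)))
      gcongr
    · intro X
      show HasSum _ (Λ (T X))
      convert hrep X using 2 with i
      rw [hTapp, inner_smul_left, map_smul, inner_smul_right, ← mul_assoc]
      congr 1
      by_cases h0 : lam i = 0
      · simp [h0]
      have h1 : ((√‖lam i‖ : ℝ) : ℂ) ≠ 0 := by simpa using h0
      simp only [map_div₀, Complex.conj_conj, conj_ofReal]
      field_simp
  obtain ⟨U, hDU, hU⟩ := mem_closure_ultraweak_iff.1 (mem_ultraweakClosure_iff.1 hf₀)
  refine hΛf (tendsto_nhds_unique (tendsto_ultraweak_iff.1 hU ω hω)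
    (tendsto_const_nhds.congr' ?_))
  filter_upwards [hDU] with X hX using (hΛD X hX).symm

end KreinSmulian

/-! ### Normality of positive functionals -/

lemma nonneg_iff_inner {x : ℬ(K)} : 0 ≤ x ↔ ∀ v, 0 ≤ inner ℂ v (x v) := by
  rw [ContinuousLinearMap.nonneg_iff_isPositive, ContinuousLinearMap.isPositive_iff_complex]
  refine forall_congr' fun v => ?_
  rw [← inner_conj_symm v (x v)]
  constructor
  · rintro ⟨h1, h2⟩
    rw [← h1, conj_ofReal]
    exact zero_le_real.2 h2
  · intro h
    have h2 := nonneg_iff.1 (show 0 ≤ inner ℂ (x v) v by simpa using star_nonneg_iff.2 h)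
    exact ⟨Complex.ext (by simp) (by simpa using h2.2), h2.1⟩

lemma le_iff_inner {x y : ℬ(K)} : x ≤ y ↔ ∀ v, inner ℂ v (x v) ≤ inner ℂ v (y v) := by
  rw [← sub_nonneg, nonneg_iff_inner]
  simp only [sub_apply, inner_sub_right, sub_nonneg]

lemma nonneg_of_tendsto {I : Type*} {l : Filter I} [l.NeBot] {X : I → ℬ(K)} {Y : ℬ(K)}
    (h : Tendsto X l (𝓝ᵤ Y)) (hX : ∀ᶠ i in l, 0 ≤ X i) : 0 ≤ Y := by
  exact nonneg_iff_inner.2 fun v =>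
    ge_of_tendsto (tendsto_ultraweak_iff.1 h _ (isNormalFunctional_vector v v))
      (hX.mono fun i hi => nonneg_iff_inner.1 hi v)

/-- The limit of an increasing family along an ultrafilter is its supremum. -/
lemma isLUB_of_tendsto {I : Type*} [Preorder I] {U : Filter I} [U.NeBot] (hU : U ≤ atTop)
    {X : I → ℬ(K)} (hX : Monotone X) {Y : ℬ(K)}
    (h : Tendsto X U (𝓝ᵤ Y)) : IsLUB (Set.range X) Y := by
  have hsub : ∀ Z, Tendsto (fun i => X i - Z) U (𝓝ᵤ (Y - Z)) ∧
      Tendsto (fun i => Z - X i) U (𝓝ᵤ (Z - Y)) := by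
    simp only [tendsto_ultraweak_iff, map_sub] at h ⊢
    exact fun Z => ⟨fun ω hω => (h ω hω).sub_const _, fun ω hω => (h ω hω).const_sub _⟩
  constructor
  · rintro _ ⟨i, rfl⟩
    refine sub_nonneg.1 (nonneg_of_tendsto (hsub _).1 (hU ?_))
    filter_upwards [eventually_ge_atTop i] with j hj using sub_nonneg.2 (hX hj)
  · exact fun Z hZ => sub_nonneg.1 (nonneg_of_tendsto (hsub _).2
      (.of_forall fun i => sub_nonneg.2 (hZ ⟨i, rfl⟩)))

/-- `z x* x z ≤ (‖x‖² ‖z‖ + 1) z` for `z ≥ 0`. -/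
lemma smul_conj_le {z : ℬ(K)} (hz : 0 ≤ z) (x : ℬ(K)) :
    (((‖x‖ ^ 2 * ‖z‖ + 1)⁻¹ : ℝ) : ℂ) • (star (x * z) * (x * z)) ≤ z := by
  set c : ℝ := ‖x‖ ^ 2 * ‖z‖ + 1 with hcdef
  have hc : 0 < c := by positivity
  rw [le_iff_inner]
  intro v
  have h1 : inner ℂ v ((((c⁻¹ : ℝ) : ℂ) • (star (x * z) * (x * z))) v)
      = ((c⁻¹ * ‖x (z v)‖ ^ 2 : ℝ) : ℂ) := by
    rw [smul_apply, inner_smul_right, mul_apply_eq_comp,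
      star_eq_adjoint, adjoint_inner_right,
      mul_apply_eq_comp, inner_self_eq_norm_sq_to_K]
    push_cast; rfl
  have hs : CFC.sqrt z * CFC.sqrt z = z := CFC.sqrt_mul_sqrt_self _ hz
  have hss : IsSelfAdjoint (CFC.sqrt z) := .of_nonneg (CFC.sqrt_nonneg _)
  have h2 : inner ℂ v (z v) = ((‖CFC.sqrt z v‖ ^ 2 : ℝ) : ℂ) := by
    conv_lhs => rw [← hs]
    rw [mul_apply_eq_comp, ← adjoint_inner_left,
      ← star_eq_adjoint, hss.star_eq, inner_self_eq_norm_sq_to_K]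
    push_cast; rfl
  rw [h1, h2]
  have h3 : ‖z v‖ ^ 2 ≤ ‖z‖ * ‖CFC.sqrt z v‖ ^ 2 := by
    have h4 : ‖CFC.sqrt z‖ ^ 2 = ‖z‖ := by
      rw [pow_two, ← CStarRing.norm_star_mul_self, hss.star_eq, hs]
    conv_lhs => rw [← hs, mul_apply_eq_comp]
    rw [← h4, ← mul_pow]
    gcongr
    exact le_opNorm _ _
  rw [real_le_real, inv_mul_le_iff₀ hc]
  calc ‖x (z v)‖ ^ 2 ≤ (‖x‖ * ‖z v‖) ^ 2 := by gcongr; exact le_opNorm _ _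
    _ = ‖x‖ ^ 2 * ‖z v‖ ^ 2 := by ring
    _ ≤ ‖x‖ ^ 2 * (‖z‖ * ‖CFC.sqrt z v‖ ^ 2) := by gcongr
    _ ≤ c * ‖CFC.sqrt z v‖ ^ 2 := by
        rw [hcdef]; nlinarith [sq_nonneg ‖CFC.sqrt z v‖]

lemma star_mul_self_le (y : ℬ(K)) :
    star y * y ≤ ((‖y‖ ^ 2 : ℝ) : ℂ) • (1 : ℬ(K)) := by
  rw [le_iff_inner]
  intro v
  rw [smul_apply, inner_smul_right, mul_apply_eq_comp, star_eq_adjoint,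
    adjoint_inner_right, inner_self_eq_norm_sq_to_K, one_apply_eq_self,
    inner_self_eq_norm_sq_to_K]
  have h : ((‖y v‖ ^ 2 : ℝ) : ℂ) ≤ ((‖y‖ ^ 2 * ‖v‖ ^ 2 : ℝ) : ℂ) := by
    rw [real_le_real, ← mul_pow]
    gcongr
    exact y.le_opNorm v
  simpa using h

/-- A linear functional on a von Neumann algebra that is, uniformly on bounded sets, a limit of
normal functionals is normal. -/
theorem exists_normal_of_approx (φ : Elem M →ₗ[ℂ] ℂ)
    (h : ∀ ε > 0, ∃ ω : ℬ(K) →ₗ[ℂ] ℂ, IsNormalFunctional ω ∧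
      ∀ f : Elem M, ‖φ f - ω f‖ ≤ ε * ‖f‖) :
    ∃ ω : ℬ(K) →ₗ[ℂ] ℂ, IsNormalFunctional ω ∧ ∀ f : Elem M, φ f = ω f := by
  apply exists_normal_of_continuous
  let J : Elem M →ₗ[ℂ] ℬ(K) := M.toStarSubalgebra.toSubalgebra.val.toLinearMap
  let top : TopologicalSpace (Elem M) := weakStar M
  have htop : top = TopologicalSpace.induced ((normalEval K K).comp J) inferInstance := by
    rw [LinearMap.coe_comp, ← induced_compose]
    rfl
  have h1 : @IsTopologicalAddGroup _ top _ := by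
    rw [htop]; exact topologicalAddGroup_induced ((normalEval K K).comp J)
  have h2 : @ContinuousSMul ℂ _ _ _ top := by
    rw [htop]; exact continuousSMul_induced ((normalEval K K).comp J)
  refine (@LinearMap.continuous_iff_isClosed_ker ℂ _ (Elem M) _ _ top h1 h2 φ).2 ?_
  let D : Submodule ℂ ℬ(K) := φ.ker.map J
  have hD : ultraweakClosure D ≤ D := by
    refine kreinSmulian D fun c U Y hU hY => ?_
    have hYM : Y ∈ M := mem_of_tendsto_ultraweak (X := fun X => X) (hU.mono (by
      rintro _ ⟨⟨x, -, rfl⟩, -⟩; exact x.2)) hY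
    refine ⟨⟨Y, hYM⟩, ?_, rfl⟩
    rw [SetLike.mem_coe, LinearMap.mem_ker]
    have hbound : ∀ ε > 0, ‖φ ⟨Y, hYM⟩‖ ≤ ε * (‖Y‖ + c + 1) := fun ε hε => by
      obtain ⟨ω, hω, hφω⟩ := h ε hε
      obtain ⟨X, ⟨⟨⟨x, hx, rfl⟩, hxc⟩, hX⟩⟩ := (hU.and ((tendsto_iff_norm_sub_tendsto_zero.1
        (tendsto_ultraweak_iff.1 hY ω hω)).eventually_lt_const hε)).exists
      have h5 : ‖φ ⟨Y, hYM⟩ - ω Y‖ ≤ ε * ‖Y‖ := hφω ⟨Y, hYM⟩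
      have h6 := hφω x
      rw [LinearMap.mem_ker.1 hx, zero_sub, norm_neg] at h6
      have h7 : ‖ω x.1‖ ≤ ε * c := h6.trans (by gcongr; exact hxc)
      have h11 : ‖ω x.1 - ω Y‖ < ε := hX
      rw [norm_sub_rev] at h11
      have h9 := norm_add₃_le (a := φ ⟨Y, hYM⟩ - ω Y) (b := ω Y - ω x.1) (c := ω x.1)
      rw [sub_add_sub_cancel, sub_add_cancel] at h9
      linarith
    by_contra hne
    have hpos : 0 < ‖φ ⟨Y, hYM⟩‖ := norm_pos_iff.2 hne
    have hc : 0 ≤ ‖Y‖ + c + 1 := by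
      obtain ⟨X, hX⟩ := hU.exists
      have := (norm_nonneg X).trans hX.2
      positivity
    have h3 := hbound (‖φ ⟨Y, hYM⟩‖ / (2 * (‖Y‖ + c + 1 + 1))) (by positivity)
    rw [div_mul_eq_mul_div, le_div_iff₀ (by positivity)] at h3
    nlinarith
  have h3 : @IsClosed _ (ultraweak K K) (D : Set ℬ(K)) :=
    @isClosed_of_closure_subset _ (ultraweak K K) _ fun x hx =>
      hD (mem_ultraweakClosure_iff.2 hx)
  have h4 : (φ.ker : Set (Elem M)) = (fun x : Elem M => x.1) ⁻¹' D := by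
    ext x
    refine ⟨fun hx => ⟨x, hx, rfl⟩, ?_⟩
    rintro ⟨y, hy, hyx⟩
    exact (Subtype.ext hyx : y = x) ▸ hy
  rw [h4]
  exact @IsClosed.preimage _ _ top (ultraweak K K) _ continuous_induced_dom _ h3

/-- A linear functional `ψ` dominated by `v ↦ ‖T v‖` is of the form `v ↦ ⟪η, T v⟫`. -/
lemma exists_vector_of_le_norm {V : Type*} [AddCommGroup V] [Module ℂ V] (T : V →ₗ[ℂ] K)
    (ψ : V →ₗ[ℂ] ℂ) {C : ℝ} (h : ∀ v, ‖ψ v‖ ≤ C * ‖T v‖) : ∃ η : K, ∀ v, ψ v = inner ℂ η (T v) := by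
  have hker : T.ker ≤ ψ.ker := by
    intro v hv
    have := h v
    rw [LinearMap.mem_ker.1 hv, norm_zero, mul_zero] at this
    exact norm_le_zero_iff.1 this
  let g : T.range →ₗ[ℂ] ℂ := (T.ker.liftQ ψ hker).comp T.quotKerEquivRange.symm.toLinearMap
  have hg : ∀ v, g ⟨T v, v, rfl⟩ = ψ v := fun v => by
    have : T.quotKerEquivRange.symm ⟨T v, v, rfl⟩ = Submodule.Quotient.mk v := by
      rw [LinearEquiv.symm_apply_eq]
      rfl
    simp only [g, LinearMap.comp_apply, LinearEquiv.coe_coe, this]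
    rfl
  let G : StrongDual ℂ T.range := g.mkContinuous C (by
    rintro ⟨_, v, rfl⟩
    rw [hg]
    exact h v)
  obtain ⟨G', hG', -⟩ := exists_extension_norm_eq T.range G
  refine ⟨(InnerProductSpace.toDual ℂ K).symm G', fun v => ?_⟩
  rw [InnerProductSpace.toDual_symm_apply, ← hg]
  exact (hG' ⟨T v, v, rfl⟩).symm

/-- The functionals `f ↦ φ (f a)` are normal, for `a` in this left ideal. -/
def normalSlices (φ : Elem M →ₗ[ℂ] ℂ) : Submodule ℂ (Elem M) where
  carrier := {a | ∃ ω : ℬ(K) →ₗ[ℂ] ℂ, IsNormalFunctional ω ∧ ∀ f : Elem M, φ (f * a) = ω f}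
  add_mem' := by
    rintro a b ⟨ω, hω, h⟩ ⟨ω', hω', h'⟩
    refine ⟨ω + ω', hω.add hω', fun f => ?_⟩
    rw [mul_add, map_add, h, h']; rfl
  zero_mem' := ⟨0, isNormalFunctional_zero, fun f => by simp⟩
  smul_mem' := by
    rintro c a ⟨ω, hω, h⟩
    refine ⟨c • ω, hω.smul c, fun f => ?_⟩
    rw [mul_smul_comm, map_smul, h]; rfl

set_option maxHeartbeats 1000000 in
/-- A positive functional that is continuous along increasing chains is normal. -/
theorem exists_normal_of_chain (φ : Elem M →ₗ[ℂ] ℂ)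
    (hpos : ∀ f : Elem M, 0 ≤ f.1 → 0 ≤ φ f)
    (hcs : ∀ x y : Elem M,
      ‖φ (star x * y)‖ ^ 2 ≤ (φ (star x * x)).re * (φ (star y * y)).re)
    (hsup : ∀ (D : Set (Elem M)), D.Nonempty → IsChain (· ≤ ·) D →
      (∀ d ∈ D, 0 ≤ d.1) → ∀ (U : Ultrafilter D), (U : Filter D) ≤ atTop →
      ∀ x : Elem M,
      Tendsto (fun d : D => (d : Elem M).1) U (𝓝ᵤ x) →
      ∀ ε > 0, ∃ d ∈ D, (φ x).re < (φ d).re + ε) :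
    ∃ ω : ℬ(K) →ₗ[ℂ] ℂ, IsNormalFunctional ω ∧ ∀ f : Elem M, φ f = ω f := by
  have hmono : ∀ x y : Elem M, x ≤ y → (φ x).re ≤ (φ y).re := fun x y hxy => by
    have := (nonneg_iff.1 (hpos (y - x) (sub_nonneg.2 hxy))).1
    rw [map_sub, sub_re] at this
    linarith
  have hnormle : ∀ x p : Elem M, 0 ≤ x.1 → x ≤ p → ‖x‖ ≤ ‖p‖ := fun x p hx hxp =>
    CStarAlgebra.norm_le_norm_of_nonneg_of_le (a := x.1) (b := p.1) hx hxp
  have h0 : 0 ≤ (φ 1).re := (nonneg_iff.1 (hpos 1 zero_le_one)).1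
  -- suprema of bounded chains
  have hchain : ∀ (p : Elem M) (D : Set (Elem M)), D.Nonempty → IsChain (· ≤ ·) D →
      (∀ d ∈ D, 0 ≤ d.1 ∧ d ≤ p) → ∃ x : Elem M, (∀ d ∈ D, d ≤ x) ∧
        (∀ b : Elem M, (∀ d ∈ D, d ≤ b) → x ≤ b) ∧
        (∀ ε > 0, ∃ d ∈ D, (φ x).re < (φ d).re + ε) ∧
        (∀ v : K, ∀ c : ℂ, (∀ d ∈ D, inner ℂ v (d.1 v) ≤ c) → inner ℂ v (x.1 v) ≤ c) := by
    intro p D hne hD hDp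
    have hne' : Nonempty D := hne.to_subtype
    have hdir : IsDirectedOrder D := ⟨fun a b => (hD.total a.2 b.2).elim
      (fun h => ⟨b, h, le_rfl⟩) fun h => ⟨a, le_rfl, h⟩⟩
    let U : Ultrafilter D := Ultrafilter.of atTop
    have hU : (U : Filter D) ≤ atTop := Ultrafilter.of_le _
    obtain ⟨Y, -, hY⟩ := exists_ultraweak_limit U (fun d : D => d.1.1) (norm_nonneg p)
      (.of_forall fun d => hnormle _ _ (hDp d d.2).1 (hDp d d.2).2)
    have hYM : Y ∈ M := mem_of_tendsto_ultraweak (.of_forall fun d : D => d.1.2) hY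
    have hlub := isLUB_of_tendsto hU (fun a b h => h) hY
    refine ⟨⟨Y, hYM⟩, fun d hd => hlub.1 ⟨⟨d, hd⟩, rfl⟩, fun b hb => hlub.2 ?_,
      hsup D hne hD (fun d hd => (hDp d hd).1) U hU ⟨Y, hYM⟩ hY, fun v c hc => ?_⟩
    · rintro _ ⟨d, rfl⟩; exact hb d d.2
    · exact le_of_tendsto (tendsto_ultraweak_iff.1 hY _ (isNormalFunctional_vector v v))
        (.of_forall fun d => hc d d.2)
  -- below every positive element, `φ` is somewhere dominated by a vector functional
  have hdom : ∀ p : Elem M, 0 ≤ p.1 → p ≠ 0 → ∃ (z : Elem M) (ξ : K),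
      0 ≤ z.1 ∧ z ≤ p ∧ z ≠ 0 ∧ ∀ y : Elem M, 0 ≤ y.1 → y ≤ z → φ y ≤ inner ℂ ξ (y.1 ξ) := by
    intro p hp hp0
    obtain ⟨ξ, hξ⟩ : ∃ ξ : K, φ p < inner ℂ ξ (p.1 ξ) := by
      obtain ⟨v, hv⟩ : ∃ v : K, inner ℂ v (p.1 v) ≠ 0 := by
        by_contra! hcon
        exact hp0 (Subtype.ext (le_antisymm (le_iff_inner.2 fun v => by simp [hcon v]) hp))
      have hv' := nonneg_iff.1 (nonneg_iff_inner.1 hp v)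
      obtain ⟨r, hr0, hr⟩ : ∃ r : ℝ, 0 < r ∧ inner ℂ v (p.1 v) = (r : ℂ) :=
        ⟨_, hv'.1.lt_of_ne fun h => hv (Complex.ext h.symm hv'.2.symm),
          Complex.ext rfl hv'.2.symm⟩
      obtain ⟨q, hq0, hq⟩ : ∃ q : ℝ, 0 ≤ q ∧ φ p = (q : ℂ) :=
        have h1 := nonneg_iff.1 (hpos p hp)
        ⟨_, h1.1, Complex.ext rfl h1.2.symm⟩
      refine ⟨((√((q + 1) / r) : ℝ) : ℂ) • v, ?_⟩
      rw [map_smul, inner_smul_left, inner_smul_right, hr, hq, conj_ofReal, ← mul_assoc,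
        ← ofReal_mul, mul_self_sqrt (by positivity), ← ofReal_mul,
        div_mul_cancel₀ _ hr0.ne']
      exact_mod_cast lt_add_one q
    let X : Set (Elem M) := {x | 0 ≤ x.1 ∧ x ≤ p ∧ inner ℂ ξ (x.1 ξ) ≤ φ x}
    obtain ⟨m, -, hm⟩ := zorn_le_nonempty₀ X (by
      intro D hDX hD y hy
      obtain ⟨x, hx1, hx2, hx3, hx4⟩ := hchain p D ⟨y, hy⟩ hD fun d hd =>
        ⟨(hDX hd).1, (hDX hd).2.1⟩
      refine ⟨x, ⟨(hDX hy).1.trans (hx1 y hy), hx2 p fun d hd => (hDX hd).2.1, ?_⟩, hx1⟩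
      refine hx4 ξ _ fun d hd => (hDX hd).2.2.trans ?_
      have := hpos (x - d) (sub_nonneg.2 (hx1 d hd))
      rwa [map_sub, sub_nonneg] at this) 0 ⟨le_rfl, hp, by simp⟩
    have hmX := hm.prop
    refine ⟨p - m, ξ, sub_nonneg.2 hmX.2.1, sub_le_self p hmX.1, ?_, fun y hy hyz => ?_⟩
    · intro h
      rw [← sub_eq_zero.1 h] at hmX
      exact (hξ.trans_le hmX.2.2).false
    · by_contra hcon
      have hreal : ∀ a b : ℂ, 0 ≤ a → 0 ≤ b → ¬ a ≤ b → b ≤ a := by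
        intro a b ha hb hab
        rw [nonneg_iff] at ha hb
        rw [Complex.le_def] at hab ⊢
        have h1 : a.im = b.im := ha.2.symm.trans hb.2
        exact ⟨le_of_not_ge fun h => hab ⟨h, h1⟩, h1.symm⟩
      have h1 := hreal _ _ (hpos y hy) (nonneg_iff_inner.1 hy ξ) hcon
      have h2 : m + y ∈ X := by
        refine ⟨add_nonneg hmX.1 hy, le_sub_iff_add_le'.1 (show y.1 ≤ p.1 - m from hyz), ?_⟩
        show inner ℂ ξ (m.1 ξ + y.1 ξ) ≤ _
        rw [inner_add_right, map_add]
        exact add_le_add hmX.2.2 h1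
      have h3 : m.1 + y ≤ m := hm.le_of_ge h2 (show m.1 ≤ m + y from le_add_of_nonneg_right hy)
      have h5 : y = 0 := Subtype.ext (le_antisymm ((add_le_iff_nonpos_right _).1 h3) hy)
      exact hcon (by simp [h5])
  -- such elements lie in the ideal of normal slices
  have hslice : ∀ z : Elem M, 0 ≤ z.1 → ∀ ξ : K,
      (∀ y : Elem M, 0 ≤ y.1 → y ≤ z → φ y ≤ inner ℂ ξ (y.1 ξ)) →
      z ∈ normalSlices φ := by
    intro z hz ξ hzξ
    have hzs : star z = z := Subtype.ext (IsSelfAdjoint.of_nonneg hz)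
    have hhom : ∀ x : Elem M, (φ (star (x * z) * (x * z))).re ≤ ‖x.1 (z.1 ξ)‖ ^ 2 := by
      intro x
      let c : ℝ := ‖x‖ ^ 2 * ‖z‖ + 1
      have hc : 0 < c := by positivity
      let y : Elem M := star (x * z) * (x * z)
      have hy : 0 ≤ y.1 := star_mul_self_nonneg (x.1 * z)
      have hyz : (((c⁻¹ : ℝ) : ℂ) • y : Elem M) ≤ z := smul_conj_le hz x.1
      have hcy : 0 ≤ (((c⁻¹ : ℝ) : ℂ) • y).1 := by
        show 0 ≤ ((c⁻¹ : ℝ) : ℂ) • y.1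
        refine nonneg_iff_inner.2 fun v => ?_
        rw [smul_apply, inner_smul_right]
        exact mul_nonneg (zero_le_real.2 (by positivity)) (nonneg_iff_inner.1 hy v)
      have h5 : _ ≤ inner ℂ ξ (((c⁻¹ : ℝ) : ℂ) • y.1 ξ) := hzξ _ hcy hyz
      rw [inner_smul_right, map_smul, smul_eq_mul] at h5
      have h7 := (Complex.le_def.1 h5).1
      rw [re_ofReal_mul, re_ofReal_mul, mul_le_mul_iff_right₀ (by positivity)] at h7
      refine h7.trans (le_of_eq ?_)
      show (inner ℂ ξ (star (x.1 * z) (x.1 (z.1 ξ)))).re = _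
      rw [star_eq_adjoint, adjoint_inner_right, mul_apply_eq_comp, inner_self_eq_norm_sq_to_K]
      norm_cast
    let T : Elem M →ₗ[ℂ] K :=
      { toFun := fun x => x.1 (z.1 ξ)
        map_add' := fun x y => rfl
        map_smul' := fun c x => rfl }
    let ψ : Elem M →ₗ[ℂ] ℂ := φ.comp (LinearMap.mulRight ℂ z)
    obtain ⟨η, hη⟩ := exists_vector_of_le_norm T ψ (C := √(φ 1).re) fun x => by
      have h1 := hcs 1 (x * z)
      rw [star_one, one_mul, one_mul] at h1
      refine Real.le_sqrt_of_sq_le (h1.trans ?_) |>.trans (le_of_eq ?_) (b := √((φ 1).re *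
        ‖x.1 (z.1 ξ)‖ ^ 2))
      · exact mul_le_mul_of_nonneg_left (hhom x) h0
      · rw [sqrt_mul h0, sqrt_sq (norm_nonneg _)]; rfl
    exact ⟨vectorFunctional η (z.1 ξ), isNormalFunctional_vector _ _, fun f => hη f⟩
  -- a maximal element of the ideal below `1`
  let X : Set (Elem M) := {a | a ∈ normalSlices φ ∧ 0 ≤ a.1 ∧ a ≤ 1}
  obtain ⟨m, -, hm⟩ := zorn_le_nonempty₀ X (by
    intro D hDX hD y hy
    obtain ⟨a, ha1, ha2, ha3, -⟩ := hchain 1 D ⟨y, hy⟩ hD fun d hd => (hDX hd).2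
    have hale : a ≤ 1 := ha2 1 fun d hd => (hDX hd).2.2
    refine ⟨a, ⟨?_, (hDX hy).2.1.trans (ha1 y hy), hale⟩, ha1⟩
    refine exists_normal_of_approx (φ.comp (LinearMap.mulRight ℂ a)) fun ε hε => ?_
    obtain ⟨d, hd, hda⟩ := ha3 (ε ^ 2 / ((φ 1).re + 1)) (by positivity)
    obtain ⟨ω, hω, hωd⟩ := (hDX hd).1
    refine ⟨ω, hω, fun f => ?_⟩
    rw [← hωd]
    show ‖φ (f * a) - φ (f * d)‖ ≤ _
    rw [← map_sub, ← mul_sub]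
    -- Cauchy–Schwarz with the square root of `a - d`
    have hc0 : 0 ≤ (a - d).1 := sub_nonneg.2 (ha1 d hd)
    let s : Elem M := ⟨CFC.sqrt (a - d).1, sqrt_mem_vonNeumann (a - d).2⟩
    have hss : s * s = a - d := Subtype.ext (CFC.sqrt_mul_sqrt_self _ hc0)
    have hsa : star s = s := Subtype.ext (IsSelfAdjoint.of_nonneg (CFC.sqrt_nonneg _))
    have hs1 : ‖s‖ ≤ 1 := by
      have h2 : ‖s‖ * ‖s‖ ≤ 1 := by
        rw [← CStarRing.norm_star_mul_self, hsa, hss]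
        calc ‖a - d‖ ≤ ‖(1 : ℬ(K))‖ := hnormle (a - d) 1 hc0 ((sub_le_self a.1
              (hDX hd).2.1).trans hale)
          _ ≤ 1 := norm_id_le
      nlinarith [norm_nonneg s]
    have h2 := hcs (s * star f) s
    have h3 : star (s * star f) * s = f * (a - d) := by
      rw [star_mul, star_star, hsa, mul_assoc, hss]
    rw [h3, hsa, hss] at h2
    have h4 : (φ (star (s * star f) * (s * star f))).re ≤ ‖f‖ ^ 2 * (φ 1).re := by
      have h5 : star (s * star f) * (s * star f) ≤ (((‖f‖ ^ 2 : ℝ) : ℂ) • 1 : Elem M) := by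
        refine (star_mul_self_le (s.1 * star f.1)).trans (le_iff_inner.2 fun v => ?_)
        show _ ≤ inner ℂ v ((((‖f‖ ^ 2 : ℝ) : ℂ) • (1 : ℬ(K))) v)
        simp only [smul_apply, inner_smul_right, one_apply_eq_self]
        have h6 : ‖s.1 * star f.1‖ ≤ ‖f‖ := (norm_mul_le _ _).trans
          ((norm_star f.1).symm ▸ mul_le_of_le_one_left (norm_nonneg _) hs1)
        exact mul_le_mul_of_nonneg_right (real_le_real.2
          (pow_le_pow_left₀ (norm_nonneg _) h6 2)) (nonneg_iff_inner.1 zero_le_one v)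
      have h6 := hmono _ _ h5
      rwa [map_smul, smul_eq_mul, re_ofReal_mul] at h6
    have h5 : (φ (a - d)).re * ((φ 1).re + 1) ≤ ε ^ 2 := by
      rw [map_sub, sub_re, ← le_div_iff₀ (by positivity)]
      linarith
    have h7 : 0 ≤ (φ (a - d)).re := (nonneg_iff.1 (hpos _ hc0)).1
    have h8 : ‖f‖ ^ 2 * (φ 1).re * (φ (a - d)).re ≤ (ε * ‖f‖) ^ 2 := by
      nlinarith [mul_le_mul_of_nonneg_left h5 (sq_nonneg ‖f‖), mul_nonneg (sq_nonneg ‖f‖) h7]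
    refine abs_le_of_sq_le_sq' ?_ (by positivity) |>.2
    calc ‖φ (f * (a - d))‖ ^ 2 ≤ ‖f‖ ^ 2 * (φ 1).re * (φ (a - d)).re :=
          h2.trans (mul_le_mul_of_nonneg_right h4 h7)
      _ ≤ (ε * ‖f‖) ^ 2 := h8) 0
      ⟨zero_mem _, le_rfl, zero_le_one (α := ℬ(K))⟩
  have hm1 : m = 1 := by
    by_contra hne
    obtain ⟨z, ξ, hz0, hz1, hzne, hz⟩ := hdom (1 - m) (sub_nonneg.2 hm.prop.2.2)
      (sub_ne_zero.2 (Ne.symm hne))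
    have h1 : m + z ∈ X :=
      ⟨add_mem hm.prop.1 (hslice z hz0 ξ hz), add_nonneg hm.prop.2.1 hz0,
        le_sub_iff_add_le'.1 (show z.1 ≤ 1 - m.1 from hz1)⟩
    have h2 : m.1 + z ≤ m := hm.le_of_ge h1 (show m.1 ≤ m + z from le_add_of_nonneg_right hz0)
    exact hzne (Subtype.ext (le_antisymm ((add_le_iff_nonpos_right _).1 h2) hz0))
  obtain ⟨ω, hω, h⟩ := hm.prop.1
  refine ⟨ω, hω, fun f => ?_⟩
  rw [← h, hm1, mul_one]

/-! ### Traces -/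

variable (M τ) in
/-- The positive elements of `M` of finite trace. -/
structure FiniteTrace (x : ℬ(K)) : Prop where
  mem : x ∈ M
  nonneg : 0 ≤ x
  lt_top : τ x < ∞

variable (τ) in
/-- `τ(x* x)` as a real number. -/
def traceSq (x : ℬ(K)) : ℝ := (τ (star x * x)).toReal

variable (τ) in
/-- The real part of `τ(x* y)`, by polarization. -/
def traceRe (x y : ℬ(K)) : ℝ := (traceSq τ (x + y) - traceSq τ x - traceSq τ y) / 2

namespace IsNSFTrace

lemma mono (hτ : IsNSFTrace M τ) {x y : ℬ(K)} (hx : x ∈ M) (hy : y ∈ M) (h0 : 0 ≤ x)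
    (hxy : x ≤ y) : τ x ≤ τ y := by
  have h := hτ.add x hx (y - x) (sub_mem hy hx) h0 (sub_nonneg.2 hxy)
  rw [add_sub_cancel] at h
  rw [h]
  exact le_self_add

lemma finiteTrace_of_le (hτ : IsNSFTrace M τ) {x y : ℬ(K)} (hy : FiniteTrace M τ y)
    (hx : x ∈ M) (h0 : 0 ≤ x) (hxy : x ≤ y) : FiniteTrace M τ x :=
  ⟨hx, h0, (hτ.mono hx hy.mem h0 hxy).trans_lt hy.lt_top⟩

lemma finiteTrace_add (hτ : IsNSFTrace M τ) {x y : ℬ(K)} (hx : FiniteTrace M τ x)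
    (hy : FiniteTrace M τ y) : FiniteTrace M τ (x + y) := by
  refine ⟨add_mem hx.mem hy.mem, add_nonneg hx.nonneg hy.nonneg, ?_⟩
  rw [hτ.add x hx.mem y hy.mem hx.nonneg hy.nonneg]
  exact ENNReal.add_lt_top.2 ⟨hx.lt_top, hy.lt_top⟩

lemma toReal_add (hτ : IsNSFTrace M τ) {x y : ℬ(K)} (hx : FiniteTrace M τ x)
    (hy : FiniteTrace M τ y) : (τ (x + y)).toReal = (τ x).toReal + (τ y).toReal := by
  rw [hτ.add x hx.mem y hy.mem hx.nonneg hy.nonneg,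
    ENNReal.toReal_add hx.lt_top.ne hy.lt_top.ne]

lemma finiteTrace_smul (hτ : IsNSFTrace M τ) {x : ℬ(K)} (hx : FiniteTrace M τ x) {c : ℝ}
    (hc : 0 ≤ c) : FiniteTrace M τ ((c : ℂ) • x) := by
  refine ⟨smul_mem_vonNeumann hx.mem _, ?_, ?_⟩
  · refine nonneg_iff_inner.2 fun v => ?_
    rw [smul_apply, inner_smul_right]
    exact mul_nonneg (zero_le_real.2 hc) (nonneg_iff_inner.1 hx.nonneg v)
  · rw [hτ.smul x hx.mem hx.nonneg c hc]
    exact ENNReal.mul_lt_top ENNReal.ofReal_lt_top hx.lt_top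

lemma toReal_smul (hτ : IsNSFTrace M τ) {x : ℬ(K)} (hx : FiniteTrace M τ x) {c : ℝ}
    (hc : 0 ≤ c) : (τ ((c : ℂ) • x)).toReal = c * (τ x).toReal := by
  rw [hτ.smul x hx.mem hx.nonneg c hc, ENNReal.toReal_mul, ENNReal.toReal_ofReal hc]

lemma star_smul_mul_smul (c : ℂ) (x : ℬ(K)) :
    star (c • x) * (c • x) = ((‖c‖ ^ 2 : ℝ) : ℂ) • (star x * x) := by
  rw [star_smul, smul_mul_smul_comm, RCLike.star_def, Complex.conj_mul']
  push_cast; rfl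

lemma trace_zero (hτ : IsNSFTrace M τ) : τ 0 = 0 := by
  simpa using hτ.smul 0 (zero_mem _) le_rfl 0 le_rfl

/-- The square integrable elements `M ∩ L²(M, τ)`. -/
def sqIntegrable (hτ : IsNSFTrace M τ) : Submodule ℂ ℬ(K) where
  carrier := {x | x ∈ M ∧ τ (star x * x) < ∞}
  add_mem' := by
    rintro x y ⟨hx, hx'⟩ ⟨hy, hy'⟩
    have h1 : FiniteTrace M τ (star x * x) :=
      ⟨mul_mem (star_mem hx) hx, star_mul_self_nonneg x, hx'⟩
    have h2 : FiniteTrace M τ (star y * y) :=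
      ⟨mul_mem (star_mem hy) hy, star_mul_self_nonneg y, hy'⟩
    have h3 := hτ.finiteTrace_add (hτ.finiteTrace_add h1 h1) (hτ.finiteTrace_add h2 h2)
    refine ⟨add_mem hx hy, (hτ.finiteTrace_of_le h3 (mul_mem (star_mem (add_mem hx hy))
      (add_mem hx hy)) (star_mul_self_nonneg _) ?_).lt_top⟩
    rw [← sub_nonneg, show star x * x + star x * x + (star y * y + star y * y)
      - star (x + y) * (x + y) = star (x - y) * (x - y) by rw [star_add, star_sub]; noncomm_ring]
    exact star_mul_self_nonneg _
  zero_mem' := ⟨zero_mem _, by simp [hτ.trace_zero]⟩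
  smul_mem' := by
    rintro c x ⟨hx, hx'⟩
    refine ⟨smul_mem_vonNeumann hx c, ?_⟩
    rw [star_smul_mul_smul]
    exact (hτ.finiteTrace_smul ⟨mul_mem (star_mem hx) hx, star_mul_self_nonneg x, hx'⟩
      (by positivity)).lt_top

variable (hτ : IsNSFTrace M τ)
include hτ

lemma finiteTrace_sq {x : ℬ(K)} (hx : x ∈ hτ.sqIntegrable) : FiniteTrace M τ (star x * x) :=
  ⟨mul_mem (star_mem hx.1) hx.1, star_mul_self_nonneg x, hx.2⟩

lemma mul_mem_sqIntegrable {a x : ℬ(K)} (ha : a ∈ M) (hx : x ∈ hτ.sqIntegrable) :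
    a * x ∈ hτ.sqIntegrable := by
  refine ⟨mul_mem ha hx.1, (hτ.finiteTrace_of_le (hτ.finiteTrace_smul (hτ.finiteTrace_sq hx)
    (c := ‖a‖ ^ 2) (by positivity)) ?_ (star_mul_self_nonneg _) ?_).lt_top⟩
  · exact mul_mem (star_mem (mul_mem ha hx.1)) (mul_mem ha hx.1)
  · have h1 := star_left_conjugate_le_conjugate (star_mul_self_le a) x
    rwa [mul_smul_comm, mul_one, smul_mul_assoc, show star x * (star a * a) * x
      = star (a * x) * (a * x) by rw [star_mul]; noncomm_ring] at h1

lemma mul_unitary_mem {x w : ℬ(K)} (hx : x ∈ hτ.sqIntegrable) (hw : w ∈ M)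
    (hwu : w ∈ unitary ℬ(K)) : τ (star (x * w) * (x * w)) = τ (star x * x) := by
  have := hτ.conj (star x * x) (hτ.finiteTrace_sq hx).mem (star_mul_self_nonneg x) (star w)
    (star_mem hw) (Unitary.star_mem hwu)
  rw [star_star] at this
  rw [← this, star_mul]
  noncomm_ring

omit hτ in
lemma exists_sum_unitary {a : ℬ(K)} (ha : a ∈ M) : ∃ (w : Fin 4 → ℬ(K)) (c : Fin 4 → ℂ),
    a = ∑ i, c i • w i ∧ ∀ i, w i ∈ M ∧ w i ∈ unitary ℬ(K) := by
  let inst : CStarAlgebra (Elem M) := {}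
  obtain ⟨w, c, hwc, -⟩ := CStarAlgebra.exists_sum_four_unitary (⟨a, ha⟩ : Elem M)
  refine ⟨fun i => (w i : Elem M), c, ?_, fun i => ⟨(w i : Elem M).2, ?_⟩⟩
  · simpa using congrArg (fun z : Elem M => z.1) hwc
  · have h2 := Unitary.mem_iff.1 (w i).2
    exact Unitary.mem_iff.2 ⟨congrArg Subtype.val h2.1, congrArg Subtype.val h2.2⟩

lemma mul_mem_right {a x : ℬ(K)} (ha : a ∈ M) (hx : x ∈ hτ.sqIntegrable) :
    x * a ∈ hτ.sqIntegrable := by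
  obtain ⟨w, c, rfl, hw⟩ := exists_sum_unitary ha
  rw [Finset.mul_sum]
  refine sum_mem fun i _ => ?_
  rw [mul_smul_comm]
  refine hτ.sqIntegrable.smul_mem _ ⟨mul_mem hx.1 (hw i).1, ?_⟩
  rw [hτ.mul_unitary_mem hx (hw i).1 (hw i).2]
  exact hx.2

lemma sqrt_mem_sqIntegrable {h : ℬ(K)} (hh : FiniteTrace M τ h) :
    CFC.sqrt h ∈ hτ.sqIntegrable := by
  refine ⟨sqrt_mem_vonNeumann hh.mem, ?_⟩
  rw [(IsSelfAdjoint.of_nonneg (CFC.sqrt_nonneg h)).star_eq, CFC.sqrt_mul_sqrt_self _ hh.nonneg]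
  exact hh.lt_top

lemma traceRe_congr {x y x' y' : ℬ(K)} (hx : x ∈ hτ.sqIntegrable)
    (hy : y ∈ hτ.sqIntegrable) (hx' : x' ∈ hτ.sqIntegrable) (hy' : y' ∈ hτ.sqIntegrable)
    (h : star x * y + star y * x = star x' * y' + star y' * x') :
    traceRe τ x y = traceRe τ x' y' := by
  have f := @finiteTrace_sq _ _ _ _ _ _ hτ
  have h1 : star (x + y) * (x + y) + (star x' * x' + star y' * y')
      = star (x' + y') * (x' + y') + (star x * x + star y * y) := by
    have e : ∀ a b : ℬ(K), star (a + b) * (a + b)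
        = star a * a + star b * b + (star a * b + star b * a) := fun a b => by
      rw [star_add]; noncomm_ring
    rw [e, e, h]; abel
  have h2 := congrArg (ENNReal.toReal ∘ τ) h1
  rw [Function.comp_apply, Function.comp_apply] at h2
  rw [hτ.toReal_add (f (add_mem hx hy)) (hτ.finiteTrace_add (f hx') (f hy')),
    hτ.toReal_add (f hx') (f hy'),
    hτ.toReal_add (f (add_mem hx' hy')) (hτ.finiteTrace_add (f hx) (f hy)),
    hτ.toReal_add (f hx) (f hy)] at h2
  simp only [traceRe, traceSq]
  linarith

omit hτ in
lemma traceRe_symm (x y : ℬ(K)) : traceRe τ x y = traceRe τ y x := by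
  simp only [traceRe, add_comm x y]; ring

lemma traceRe_add {x y z : ℬ(K)} (hx : x ∈ hτ.sqIntegrable)
    (hy : y ∈ hτ.sqIntegrable) (hz : z ∈ hτ.sqIntegrable) :
    traceRe τ x (y + z) = traceRe τ x y + traceRe τ x z := by
  have f := @finiteTrace_sq _ _ _ _ _ _ hτ
  have a := @finiteTrace_add _ _ _ _ _ _ hτ
  have h1 : star (x + (y + z)) * (x + (y + z)) + (star x * x + (star y * y + star z * z))
      = star (x + y) * (x + y) + (star (x + z) * (x + z) + star (y + z) * (y + z)) := by
    simp only [star_add]; noncomm_ring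
  have h2 := congrArg (ENNReal.toReal ∘ τ) h1
  rw [Function.comp_apply, Function.comp_apply] at h2
  rw [hτ.toReal_add (f (add_mem hx (add_mem hy hz))) (a (f hx) (a (f hy) (f hz))),
    hτ.toReal_add (f hx) (a (f hy) (f hz)), hτ.toReal_add (f hy) (f hz),
    hτ.toReal_add (f (add_mem hx hy)) (a (f (add_mem hx hz)) (f (add_mem hy hz))),
    hτ.toReal_add (f (add_mem hx hz)) (f (add_mem hy hz))] at h2
  simp only [traceRe, traceSq]
  linarith

lemma traceSq_smul {x : ℬ(K)} (hx : x ∈ hτ.sqIntegrable) (c : ℂ) :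
    traceSq τ (c • x) = ‖c‖ ^ 2 * traceSq τ x := by
  rw [traceSq, star_smul_mul_smul, hτ.toReal_smul (hτ.finiteTrace_sq hx) (by positivity)]
  rfl

lemma traceRe_zero (x : ℬ(K)) : traceRe τ x 0 = 0 := by
  simp [traceRe, traceSq, hτ.trace_zero]

lemma traceRe_neg {x y : ℬ(K)} (hx : x ∈ hτ.sqIntegrable) (hy : y ∈ hτ.sqIntegrable) :
    traceRe τ x (-y) = -traceRe τ x y := by
  have h := hτ.traceRe_add hx hy (neg_mem hy)
  rw [add_neg_cancel, hτ.traceRe_zero] at h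
  linarith

lemma traceRe_smul {x y : ℬ(K)} (hx : x ∈ hτ.sqIntegrable) (hy : y ∈ hτ.sqIntegrable)
    (r : ℝ) : traceRe τ x ((r : ℂ) • y) = r * traceRe τ x y := by
  have hpos : ∀ r : ℝ, 0 ≤ r → traceRe τ x ((r : ℂ) • y) = r * traceRe τ x y := fun r hr => by
    have f := @finiteTrace_sq _ _ _ _ _ _ hτ
    have a := @finiteTrace_add _ _ _ _ _ _ hτ
    have s := @finiteTrace_smul _ _ _ _ _ _ hτ
    have hry := hτ.sqIntegrable.smul_mem (r : ℂ) hy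
    have h1 : star (x + (r : ℂ) • y) * (x + (r : ℂ) • y)
          + ((r : ℂ) • (star x * x) + (r : ℂ) • (star y * y))
        = star x * x + (star ((r : ℂ) • y) * ((r : ℂ) • y)
          + (r : ℂ) • (star (x + y) * (x + y))) := by
      simp only [star_add, star_smul, RCLike.star_def, conj_ofReal, mul_add, add_mul,
        smul_mul_assoc, mul_smul_comm, smul_add]
      abel
    have h2 := congrArg (ENNReal.toReal ∘ τ) h1
    rw [Function.comp_apply, Function.comp_apply] at h2
    rw [hτ.toReal_add (f (add_mem hx hry)) (a (s (f hx) hr) (s (f hy) hr)),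
      hτ.toReal_add (s (f hx) hr) (s (f hy) hr), hτ.toReal_smul (f hx) hr,
      hτ.toReal_smul (f hy) hr, hτ.toReal_add (f hx) (a (f hry) (s (f (add_mem hx hy)) hr)),
      hτ.toReal_add (f hry) (s (f (add_mem hx hy)) hr), hτ.toReal_smul (f (add_mem hx hy)) hr] at h2
    simp only [traceRe, traceSq]
    linarith
  rcases le_total 0 r with h | h
  · exact hpos r h
  · have := hpos (-r) (by linarith)
    rw [Complex.ofReal_neg, neg_smul, hτ.traceRe_neg hx (hτ.sqIntegrable.smul_mem _ hy)] at this
    linarith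

lemma traceRe_I_left {x y : ℬ(K)} (hx : x ∈ hτ.sqIntegrable) (hy : y ∈ hτ.sqIntegrable) :
    traceRe τ (I • x) y = -traceRe τ x (I • y) := by
  rw [← hτ.traceRe_neg hx (hτ.sqIntegrable.smul_mem _ hy)]
  refine hτ.traceRe_congr (hτ.sqIntegrable.smul_mem _ hx) hy hx
    (neg_mem (hτ.sqIntegrable.smul_mem _ hy)) ?_
  simp [star_smul]

lemma traceInner_eq {x y : ℬ(K)} (hx : x ∈ hτ.sqIntegrable) (hy : y ∈ hτ.sqIntegrable) :
    traceInner τ x y = (traceRe τ x y : ℂ) + I * (traceRe τ (I • x) y : ℂ) := by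
  have hix := hτ.sqIntegrable.smul_mem I hx
  have h1 : traceRe τ (-x) y = -traceRe τ x y := by
    rw [traceRe_symm, hτ.traceRe_neg hy hx, traceRe_symm]
  have h2 : traceRe τ (-(I • x)) y = -traceRe τ (I • x) y := by
    rw [traceRe_symm, hτ.traceRe_neg hy hix, traceRe_symm]
  have e : ∀ z ∈ hτ.sqIntegrable, ((τ (star (y + z) * (y + z))).toReal : ℂ)
      = traceSq τ y + traceSq τ z + 2 * (traceRe τ z y : ℂ) := by
    intro z _
    rw [traceRe, add_comm z y]
    change ((traceSq τ (y + z) : ℝ) : ℂ) = _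
    push_cast
    ring
  have hn : traceSq τ (-x) = traceSq τ x := by simp [traceSq]
  have hi : traceSq τ (I • x) = traceSq τ x := by simp [hτ.traceSq_smul hx]
  have hni : traceSq τ (-(I • x)) = traceSq τ x := by rw [← hi]; simp [traceSq]
  simp only [traceInner, Finset.sum_range_succ, Finset.range_zero, Finset.sum_empty, pow_zero,
    one_smul, pow_one, Complex.I_sq, Complex.I_pow_three, neg_smul]
  rw [e x hx, e _ hix, e _ (neg_mem hx), e _ (neg_mem hix), hn, hi, hni, h1, h2]
  push_cast
  ring

lemma traceInner_add {x y z : ℬ(K)} (hx : x ∈ hτ.sqIntegrable)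
    (hy : y ∈ hτ.sqIntegrable) (hz : z ∈ hτ.sqIntegrable) :
    traceInner τ x (y + z) = traceInner τ x y + traceInner τ x z := by
  have hix := hτ.sqIntegrable.smul_mem I hx
  rw [hτ.traceInner_eq hx hy, hτ.traceInner_eq hx hz, hτ.traceInner_eq hx (add_mem hy hz),
    hτ.traceRe_add hx hy hz, hτ.traceRe_add hix hy hz]
  push_cast
  ring

lemma traceInner_smul {x y : ℬ(K)} (hx : x ∈ hτ.sqIntegrable)
    (hy : y ∈ hτ.sqIntegrable) (c : ℂ) : traceInner τ x (c • y) = c * traceInner τ x y := by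
  have hix := hτ.sqIntegrable.smul_mem I hx
  have hiy := hτ.sqIntegrable.smul_mem I hy
  have hreal : ∀ z ∈ hτ.sqIntegrable, ∀ r : ℝ,
      traceInner τ x ((r : ℂ) • z) = r * traceInner τ x z := fun z hz r => by
    rw [hτ.traceInner_eq hx hz, hτ.traceInner_eq hx (hτ.sqIntegrable.smul_mem _ hz),
      hτ.traceRe_smul hx hz, hτ.traceRe_smul hix hz]
    push_cast
    ring
  have hI : traceInner τ x (I • y) = I * traceInner τ x y := by
    rw [hτ.traceInner_eq hx hy, hτ.traceInner_eq hx hiy]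
    have h1 := hτ.traceRe_I_left hx hy
    have h2 := hτ.traceRe_I_left hx hiy
    rw [smul_smul, I_mul_I, neg_one_smul, hτ.traceRe_neg hx hy, neg_neg] at h2
    rw [h1, h2]
    push_cast
    linear_combination (traceRe τ x (I • y) : ℂ) * I_mul_I
  have hc : c • y = (c.re : ℂ) • y + (c.im : ℂ) • (I • y) := by
    rw [smul_smul, ← add_smul, Complex.re_add_im]
  rw [hc, hτ.traceInner_add hx (hτ.sqIntegrable.smul_mem _ hy) (hτ.sqIntegrable.smul_mem _ hiy),
    hreal _ hy, hreal _ hiy, hI]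
  conv_rhs => rw [← Complex.re_add_im c]
  ring

lemma traceInner_conj {x y : ℬ(K)} (hx : x ∈ hτ.sqIntegrable)
    (hy : y ∈ hτ.sqIntegrable) : (starRingEnd ℂ) (traceInner τ y x) = traceInner τ x y := by
  rw [hτ.traceInner_eq hx hy, hτ.traceInner_eq hy hx, hτ.traceRe_I_left hx hy,
    traceRe_symm (I • y), traceRe_symm y]
  simp only [map_add, map_mul, conj_ofReal, Complex.conj_I]
  push_cast
  ring

lemma traceInner_self {x : ℬ(K)} (hx : x ∈ hτ.sqIntegrable) :
    traceInner τ x x = (τ (star x * x)).toReal := by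
  have h1 : traceRe τ (I • x) x = 0 := by
    have := hτ.traceRe_I_left hx hx
    rw [traceRe_symm x] at this
    linarith
  have h2 : traceRe τ x x = (τ (star x * x)).toReal := by
    rw [traceRe, ← two_smul ℂ x, hτ.traceSq_smul hx]
    simp only [traceSq]
    norm_num
    ring
  rw [hτ.traceInner_eq hx hx, h1, h2]
  simp

lemma traceInner_mul_left {a x y : ℬ(K)} (ha : a ∈ M) (hx : x ∈ hτ.sqIntegrable)
    (hy : y ∈ hτ.sqIntegrable) : traceInner τ (a * x) y = traceInner τ x (star a * y) := by
  have hax := hτ.mul_mem_sqIntegrable ha hx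
  have hay := hτ.mul_mem_sqIntegrable (star_mem ha) hy
  have h : ∀ x ∈ hτ.sqIntegrable, traceRe τ (a * x) y = traceRe τ x (star a * y) := fun x hx => by
    refine hτ.traceRe_congr (hτ.mul_mem_sqIntegrable ha hx) hy hx hay ?_
    simp only [star_mul, star_star]; noncomm_ring
  rw [hτ.traceInner_eq hax hy, hτ.traceInner_eq hx hay, h x hx, ← mul_smul_comm,
    h _ (hτ.sqIntegrable.smul_mem _ hx)]

/-- The trace property `τ((x a)* y) = τ(x* y a*)`, from the invariance under unitaries. -/
lemma traceInner_mul_right {a x y : ℬ(K)} (ha : a ∈ M) (hx : x ∈ hτ.sqIntegrable)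
    (hy : y ∈ hτ.sqIntegrable) : traceInner τ (x * a) y = traceInner τ x (y * star a) := by
  have hunit : ∀ w ∈ M, w ∈ unitary ℬ(K) →
      traceInner τ (x * w) y = traceInner τ x (y * star w) := by
    intro w hw hwu
    have h1 : traceInner τ (x * w) (y * star w * w) = traceInner τ x (y * star w) := by
      have hyw := hτ.mul_mem_right (star_mem hw) hy
      simp only [traceInner]
      congr 1
      refine Finset.sum_congr rfl fun k _ => ?_
      rw [← smul_mul_assoc, ← add_mul, hτ.mul_unitary_mem (add_mem hyw
        (hτ.sqIntegrable.smul_mem _ hx)) hw hwu]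
    rwa [mul_assoc, (Unitary.mem_iff.1 hwu).1, mul_one] at h1
  obtain ⟨w, c, rfl, hw⟩ := exists_sum_unitary ha
  let A : ℬ(K) → Prop := fun b => b ∈ M ∧ traceInner τ (x * b) y = traceInner τ x (y * star b)
  have hA : A (∑ i, c i • w i) := by
    refine Finset.sum_induction _ A ?_ ?_ ?_
    · rintro b b' ⟨hb, h⟩ ⟨hb', h'⟩
      refine ⟨add_mem hb hb', ?_⟩
      have m1 := hτ.mul_mem_right hb hx
      have m2 := hτ.mul_mem_right hb' hx
      rw [mul_add, star_add, mul_add, hτ.traceInner_add hx (hτ.mul_mem_right (star_mem hb) hy)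
        (hτ.mul_mem_right (star_mem hb') hy), ← hτ.traceInner_conj (add_mem m1 m2) hy,
        hτ.traceInner_add hy m1 m2, map_add, hτ.traceInner_conj m1 hy, hτ.traceInner_conj m2 hy,
        h, h']
    · refine ⟨zero_mem _, ?_⟩
      have m0 := zero_mem hτ.sqIntegrable
      have h0 : ∀ z ∈ hτ.sqIntegrable, traceInner τ z 0 = 0 := fun z hz => by
        simpa using hτ.traceInner_smul hz m0 0
      rw [mul_zero, star_zero, mul_zero, h0 x hx, ← hτ.traceInner_conj m0 hy, h0 y hy, map_zero]
    · intro i _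
      obtain ⟨hwm, hwu⟩ := hw i
      refine ⟨smul_mem_vonNeumann hwm _, ?_⟩
      have m1 := hτ.mul_mem_right hwm hx
      rw [mul_smul_comm, star_smul, mul_smul_comm, hτ.traceInner_smul hx
        (hτ.mul_mem_right (star_mem hwm) hy), ← hunit _ hwm hwu,
        ← hτ.traceInner_conj (hτ.sqIntegrable.smul_mem _ m1) hy, hτ.traceInner_smul hy m1, map_mul,
        hτ.traceInner_conj m1 hy]
      rfl
  exact hA.2

lemma traceInner_cauchySchwarz {x y : ℬ(K)} (hx : x ∈ hτ.sqIntegrable)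
    (hy : y ∈ hτ.sqIntegrable) :
    ‖traceInner τ x y‖ ^ 2 ≤ (traceInner τ x x).re * (traceInner τ y y).re := by
  let core : PreInnerProductSpace.Core ℂ hτ.sqIntegrable :=
    { inner := fun x y => traceInner τ x y
      conj_inner_symm := fun x y => hτ.traceInner_conj x.2 y.2
      re_inner_nonneg := fun x => by
        show 0 ≤ (traceInner τ x.1 x).re
        rw [hτ.traceInner_self x.2, ofReal_re]
        exact ENNReal.toReal_nonneg
      add_left := fun x y z => by
        show traceInner τ (x.1 + y) z = traceInner τ x.1 z + traceInner τ y.1 z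
        rw [← hτ.traceInner_conj (add_mem x.2 y.2) z.2, hτ.traceInner_add z.2 x.2 y.2, map_add,
          hτ.traceInner_conj x.2 z.2, hτ.traceInner_conj y.2 z.2]
      smul_left := fun x y r => by
        show traceInner τ (r • x.1) y = (starRingEnd ℂ) r * traceInner τ x.1 y
        rw [← hτ.traceInner_conj (hτ.sqIntegrable.smul_mem r x.2) y.2,
          hτ.traceInner_smul y.2 x.2, map_mul, hτ.traceInner_conj x.2 y.2] }
  have h := @InnerProductSpace.Core.inner_mul_inner_self_le ℂ _ _ _ _ core ⟨x, hx⟩ ⟨y, hy⟩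
  change ‖traceInner τ x y‖ * ‖traceInner τ y x‖
    ≤ (traceInner τ x x).re * (traceInner τ y y).re at h
  rwa [← hτ.traceInner_conj hy hx, RCLike.norm_conj, ← pow_two] at h

/-- For square integrable `c = c*`, the positive functional `f ↦ τ(c f c)` on `M` is normal. -/
lemma exists_normal_conj {c : ℬ(K)} (hc : c ∈ hτ.sqIntegrable) (hcs : star c = c) :
    ∃ ω : ℬ(K) →ₗ[ℂ] ℂ, IsNormalFunctional ω ∧ ∀ f ∈ M, traceInner τ c (f * c) = ω f := by
  have hm : ∀ f : Elem M, f.1 * c ∈ hτ.sqIntegrable := fun f => hτ.mul_mem_sqIntegrable f.2 hc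
  let φ : Elem M →ₗ[ℂ] ℂ :=
    { toFun := fun f => traceInner τ c (f.1 * c)
      map_add' := fun f g => by
        show traceInner τ c ((f.1 + g) * c) = _
        rw [add_mul, hτ.traceInner_add hc (hm f) (hm g)]
      map_smul' := fun r f => by
        show traceInner τ c ((r • f.1) * c) = _
        rw [smul_mul_assoc, hτ.traceInner_smul hc (hm f)]; rfl }
  have hφ : ∀ x y : Elem M, φ (star x * y) = traceInner τ (x.1 * c) (y * c) := fun x y => by
    rw [hτ.traceInner_mul_left x.2 hc (hm y), ← mul_assoc]
    rfl
  have hpos : ∀ f : Elem M, 0 ≤ f.1 → φ f = (τ (star c * f.1 * c)).toReal := fun f hf => by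
    let s : Elem M := ⟨CFC.sqrt f.1, sqrt_mem_vonNeumann f.2⟩
    have hsa : star s = s := Subtype.ext (IsSelfAdjoint.of_nonneg (CFC.sqrt_nonneg _))
    have hss : star s * s = f := by
      rw [hsa]; exact Subtype.ext (CFC.sqrt_mul_sqrt_self _ hf)
    have h1 : (star s.1) * s = f := congrArg Subtype.val hss
    rw [← hss, hφ, hτ.traceInner_self (hm s), star_mul, hss, ← h1]
    simp only [mul_assoc]
  obtain ⟨ω, hω, h⟩ := exists_normal_of_chain φ
    (fun f hf => by rw [hpos f hf]; exact zero_le_real.2 ENNReal.toReal_nonneg)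
    (fun x y => by
      rw [hφ, hφ, hφ]
      exact hτ.traceInner_cauchySchwarz (hm x) (hm y))
    (fun D hne hD hD0 U hU x hx ε hε => by
      by_contra! hcon
      let I : D → ℬ(K) := fun d => star c * (d.1.1 * c)
      have hI0 : ∀ d, 0 ≤ I d := fun d => by
        have := star_left_conjugate_nonneg (hD0 d d.2) c
        rwa [mul_assoc] at this
      have hImono : Monotone I := fun a b hab => by
        have := star_left_conjugate_le_conjugate (show a.1.1 ≤ b.1.1 from hab) c
        simpa only [mul_assoc] using this
      have hlub : IsLUB (Set.range I) (star c * (x.1 * c)) :=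
        isLUB_of_tendsto hU hImono (tendsto_sandwich hx (star c) c)
      have hx0 : 0 ≤ x.1 := nonneg_of_tendsto hx (.of_forall fun d => hD0 d d.2)
      have hcM := hc.1
      have hnorm := hτ.normal (Set.range I) ⟨_, ⟨⟨_, hne.some_mem⟩, rfl⟩⟩ (by
          rintro _ ⟨d, rfl⟩
          exact ⟨mul_mem (star_mem hcM) (mul_mem (d : Elem M).2 hcM), hI0 d⟩)
        (by
          rintro _ ⟨a, rfl⟩ _ ⟨b, rfl⟩
          rcases hD.total a.2 b.2 with h | h
          · exact ⟨_, ⟨b, rfl⟩, hImono h, le_rfl⟩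
          · exact ⟨_, ⟨a, rfl⟩, le_rfl, hImono h⟩) _
        (mul_mem (star_mem hcM) (mul_mem x.2 hcM)) hlub
      have hfin : ∀ f : Elem M, 0 ≤ f.1 → τ (star c * (f.1 * c)) < ∞ := by
        intro f hf
        have h1 := star_left_conjugate_le_conjugate
          (IsSelfAdjoint.le_algebraMap_norm_self (a := f.1) (.of_nonneg hf)) c
        have h2 : star c * (algebraMap ℝ ℬ(K) ‖f.1‖) * c = ((‖f‖ : ℝ) : ℂ) • (star c * c) := by
          rw [Algebra.algebraMap_eq_smul_one, mul_smul_comm, mul_one, smul_mul_assoc]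
          rfl
        rw [h2, mul_assoc] at h1
        refine (hτ.finiteTrace_of_le (hτ.finiteTrace_smul (hτ.finiteTrace_sq hc) (norm_nonneg f))
          (mul_mem (star_mem hcM) (mul_mem f.2 hcM)) ?_ h1).lt_top
        have := star_left_conjugate_nonneg hf c
        rwa [mul_assoc] at this
      have hle : τ (star c * (x.1 * c)) ≤ ENNReal.ofReal ((φ x).re - ε) := by
        rw [hnorm]
        refine iSup₂_le ?_
        rintro _ ⟨d, rfl⟩
        rw [← ENNReal.ofReal_toReal (hfin d (hD0 d d.2)).ne]
        refine ENNReal.ofReal_le_ofReal ?_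
        have h1 := hcon d d.2
        rw [hpos d (hD0 d d.2), ofReal_re, mul_assoc] at h1
        linarith
      obtain ⟨d, hd⟩ := hne
      have h2 := hcon d hd
      have h3 : 0 ≤ (φ d).re := by
        rw [hpos d (hD0 d hd), ofReal_re]; exact ENNReal.toReal_nonneg
      have h4 := ENNReal.toReal_mono ENNReal.ofReal_ne_top hle
      rw [ENNReal.toReal_ofReal (by linarith)] at h4
      have h5 : (φ x).re = (τ (star c * (x.1 * c))).toReal := by
        rw [hpos x hx0, ofReal_re, mul_assoc]
      linarith)
  exact ⟨ω, hω, fun f hf => h ⟨f, hf⟩⟩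

end IsNSFTrace

/-! ### Markovian operators -/

section Markov

variable {Φ : Elem M → Elem M}

lemma norm_sq_apply (x : ℬ(K)) (v : K) :
    inner ℂ v ((star x * x) v) = ((‖x v‖ ^ 2 : ℝ) : ℂ) := by
  rw [mul_apply_eq_comp, star_eq_adjoint, adjoint_inner_right, inner_self_eq_norm_sq_to_K]
  push_cast; rfl

namespace IsMarkovOperator

variable (h : IsMarkovOperator M τ Φ)
include h

lemma map_add (x y : Elem M) : Φ (x + y) = Φ x + Φ y := h.linear.map_add x y

lemma map_smul (c : ℂ) (x : Elem M) : Φ (c • x) = c • Φ x := h.linear.map_smul c x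

lemma map_sub (x y : Elem M) : Φ (x - y) = Φ x - Φ y := h.linear.map_sub x y

lemma map_nonneg {x : Elem M} (hx : 0 ≤ x.1) : 0 ≤ (Φ x).1 := by
  refine nonneg_iff_inner.2 fun v => ?_
  simpa using h.completelyPositive 1 (fun _ _ => x) (fun ξ => by
    simpa using nonneg_iff_inner.1 hx (ξ 0)) fun _ => v

lemma map_mono {x y : Elem M} (hxy : x.1 ≤ y) : (Φ x).1 ≤ Φ y := by
  have := h.map_nonneg (x := y - x) (sub_nonneg.2 hxy)
  rw [h.map_sub] at this
  exact sub_nonneg.1 this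

/-- Complete positivity for the positive matrix with rows `(1, x)` and `(x*, x* x)`. -/
lemma matrix_nonneg (x : Elem M) (v w : K) :
    0 ≤ inner ℂ v v + inner ℂ v ((Φ x).1 w) + inner ℂ w ((Φ (star x)).1 v)
      + inner ℂ w ((Φ (star x * x)).1 w) := by
  have := h.completelyPositive 2 ![![1, x], ![star x, star x * x]] (fun ξ => by
    simp only [Fin.sum_univ_two, Matrix.cons_val_zero, Matrix.cons_val_one]
    show 0 ≤ inner ℂ (ξ 0) (ξ 0) + inner ℂ (ξ 0) (x.1 (ξ 1))
      + (inner ℂ (ξ 1) (adjoint x.1 (ξ 0)) + inner ℂ (ξ 1) (adjoint x.1 (x.1 (ξ 1))))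
    rw [adjoint_inner_right, adjoint_inner_right, ← inner_add_right, ← inner_add_right,
      ← inner_add_left, inner_self_eq_norm_sq_to_K]
    exact (zero_le_real.2 (sq_nonneg _)).trans_eq (Complex.ofReal_pow _ _)) ![v, w]
  simp only [Fin.sum_univ_two, Matrix.cons_val_zero, Matrix.cons_val_one, h.unital] at this
  rw [← add_assoc] at this
  exact this

lemma map_star (x : Elem M) : Φ (star x) = star (Φ x) := by
  apply Subtype.ext
  refine eq_of_inner_eq fun w v => ?_
  have key : ∀ v w : K, (inner ℂ v ((Φ x).1 w) + inner ℂ w ((Φ (star x)).1 v)).im = 0 := by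
    intro v w
    have h1 := (nonneg_iff.1 (h.matrix_nonneg x v w)).2
    have h2 := (nonneg_iff.1 (nonneg_iff_inner.1
      (h.map_nonneg (x := star x * x) (star_mul_self_nonneg x.1)) w)).2
    have h3 : (inner ℂ v v : ℂ).im = 0 := by
      rw [inner_self_eq_norm_sq_to_K]; norm_cast
    simp only [Complex.add_im] at h1 ⊢
    linarith
  show _ = inner ℂ w (adjoint (Φ x).1 v)
  rw [adjoint_inner_right, ← inner_conj_symm, ← inner_conj_symm]
  have k1 := key v w
  have k2 := key (I • v) w
  rw [_root_.map_smul, inner_smul_left, inner_smul_right] at k2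
  simp only [Complex.add_im, Complex.mul_im, Complex.conj_I, Complex.neg_re, Complex.I_re,
    Complex.neg_im, Complex.I_im] at k1 k2
  rw [← inner_conj_symm v] at k1 k2
  apply Complex.ext <;> simp only [Complex.conj_re, Complex.conj_im] at k1 k2 ⊢ <;> linarith

lemma coe_map_star (x : Elem M) : (Φ (star x)).1 = adjoint (Φ x).1 := by rw [h.map_star]; rfl

/-- The Kadison–Schwarz inequality `|Φ x|² ≤ Φ |x|²`. -/
lemma kadison_schwarz (x : Elem M) :
    star (Φ x).1 * Φ x ≤ (Φ (star x * x)).1 := by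
  refine sub_nonneg.1 (nonneg_iff_inner.2 fun w => ?_)
  have h1 := h.matrix_nonneg x (-((Φ x).1 w)) w
  rw [h.coe_map_star, adjoint_inner_right, inner_neg_neg, inner_neg_left, inner_neg_right] at h1
  rw [sub_apply, inner_sub_right, star_eq_adjoint, mul_apply_eq_comp, adjoint_inner_right]
  convert h1 using 1
  ring

lemma norm_le (x : Elem M) : ‖Φ x‖ ≤ ‖x‖ := by
  refine opNorm_le_bound _ (norm_nonneg x) fun v => ?_
  have h1 := le_iff_inner.1 (h.kadison_schwarz x) v
  have h2 : (star x * x).1 ≤ (((‖x‖ ^ 2 : ℝ) : ℂ) • 1 : Elem M) :=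
    star_mul_self_le x.1
  have h3 := le_iff_inner.1 (h.map_mono h2) v
  rw [h.map_smul, h.unital] at h3
  change _ ≤ inner ℂ v (((‖x‖ ^ 2 : ℝ) : ℂ) • v) at h3
  rw [inner_smul_right, inner_self_eq_norm_sq_to_K] at h3
  rw [norm_sq_apply] at h1
  have h4 : ‖(Φ x).1 v‖ ^ 2 ≤ ‖x‖ ^ 2 * ‖v‖ ^ 2 :=
    real_le_real.1 (by push_cast; push_cast at h1 h3; exact h1.trans h3)
  rw [← mul_pow] at h4
  exact (pow_le_pow_iff_left₀ (norm_nonneg _) (by positivity) two_ne_zero).1 h4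

/-- The difference form `Φ(x* x) - (Φ x)* x - x* Φ x + x* x` is positive. -/
lemma difference_nonneg (x : Elem M) :
    0 ≤ (Φ (star x * x) - star (Φ x) * x - star x * Φ x + star x * x).1 := by
  refine nonneg_iff_inner.2 fun v => ?_
  have h1 := h.matrix_nonneg x (-(x.1 v)) v
  rw [h.coe_map_star, adjoint_inner_right, inner_neg_neg, inner_neg_left, inner_neg_right] at h1
  show 0 ≤ inner ℂ v ((Φ (star x * x)).1 v - adjoint (Φ x).1 (x.1 v)
    - adjoint x.1 ((Φ x).1 v) + adjoint x.1 (x.1 v))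
  rw [inner_add_right, inner_sub_right, inner_sub_right,
    adjoint_inner_right, adjoint_inner_right, adjoint_inner_right]
  convert h1 using 1
  ring

/-- Markovian operators have preadjoints. -/
lemma exists_normal_comp {ω : ℬ(K) →ₗ[ℂ] ℂ} (hω : IsNormalFunctional ω) :
    ∃ ω' : ℬ(K) →ₗ[ℂ] ℂ, IsNormalFunctional ω' ∧ ∀ f : Elem M, ω (Φ f) = ω' f := by
  let φ : Elem M →ₗ[ℂ] ℂ :=
    { toFun := fun f => ω (Φ f)
      map_add' := fun f g => by rw [h.map_add]; exact _root_.map_add ω _ _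
      map_smul' := fun c f => by rw [h.map_smul]; exact _root_.map_smul ω c _ }
  refine exists_normal_of_continuous φ ?_
  have h1 : @Continuous _ _ (ultraweak K K) _ ω := by
    rw [@continuous_iff_continuousAt _ _ (ultraweak K K)]
    exact fun X => tendsto_ultraweak_iff.1 (@tendsto_id _ (𝓝ᵤ X)) ω hω
  have h2 : @Continuous _ _ (weakStar M) (ultraweak K K) (fun x : Elem M => x.1) :=
    continuous_induced_dom
  exact (@Continuous.comp _ _ _ (weakStar M) (ultraweak K K) _ _ _ h1
    (@Continuous.comp _ _ _ (weakStar M) (weakStar M) (ultraweak K K) _ _ h2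
      h.weakStarContinuous))

lemma tendsto {I : Type*} {l : Filter I} {x : I → Elem M} {y : Elem M}
    (hx : Tendsto (fun i => (x i : ℬ(K))) l (𝓝ᵤ y)) :
    Tendsto (fun i => (Φ (x i)).1) l (𝓝ᵤ (Φ y)) := by
  rw [tendsto_ultraweak_iff] at hx ⊢
  intro ω hω
  obtain ⟨ω', hω', he⟩ := h.exists_normal_comp hω
  simp only [he]
  exact hx ω' hω'

end IsMarkovOperator

end Markov

/-! ### The trace pairing on a test algebra -/

instance : (atTop : Filter (Finset K × ℕ)).NeBot := by classical infer_instance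

namespace IsTestAlgebra

variable (hS : IsTestAlgebra τ T S)
include hS

lemma normal_ext {ω ω' : ℬ(K) →ₗ[ℂ] ℂ} (hω : IsNormalFunctional ω)
    (hω' : IsNormalFunctional ω') (h : ∀ f ∈ S, ω f.1 = ω' f) (f : Elem M) :
    ω f.1 = ω' f := by
  obtain ⟨g, hg, hgf⟩ := exists_bounded_net S hS.dense f
  exact tendsto_nhds_unique (tendsto_ultraweak_iff.1 hgf ω hω)
    ((tendsto_ultraweak_iff.1 hgf ω' hω').congr fun i => (h _ (hg i).1).symm)

lemma mem_sqIntegrable (hτ : IsNSFTrace M τ) {k : Elem M} (hk : k ∈ S) :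
    k.1 ∈ hτ.sqIntegrable := by
  have h1 : FiniteTrace M τ (CFC.abs k.1) :=
    ⟨abs_mem_vonNeumann k.2, CFC.abs_nonneg _, hS.integrable k hk⟩
  have h2 := hτ.mul_mem_sqIntegrable (sqrt_mem_vonNeumann h1.mem) (hτ.sqrt_mem_sqIntegrable h1)
  rw [CFC.sqrt_mul_sqrt_self _ h1.nonneg] at h2
  refine ⟨k.2, ?_⟩
  have h3 := h2.2
  rwa [(IsSelfAdjoint.of_nonneg h1.nonneg).star_eq, CFC.abs_mul_abs] at h3

omit hS in
lemma exists_selfAdjoint_decomp {k : Elem M} (hk : k ∈ S) :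
    ∃ a ∈ S, ∃ b ∈ S, star a = a ∧ star b = b ∧ k = a + I • b := by
  have hstar : star k ∈ S := star_mem hk
  refine ⟨(1 / 2 : ℂ) • (star k + k), SMulMemClass.smul_mem _ (add_mem hstar hk),
    (I / 2 : ℂ) • (star k - k), SMulMemClass.smul_mem _ (sub_mem hstar hk), ?_, ?_, ?_⟩
  · rw [star_smul, star_add, star_star, add_comm k]; simp
  · rw [star_smul, star_sub, star_star, ← neg_sub (star k) k, smul_neg, ← neg_smul]
    simp [neg_div]
  · rw [smul_smul, show I * (I / 2) = -(1 / 2) by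
      linear_combination (1 / 2 : ℂ) * I_mul_I]
    module

lemma exists_pairing (hτ : IsNSFTrace M τ) {k : Elem M} (hk : k ∈ S) :
    ∃ ω : ℬ(K) →ₗ[ℂ] ℂ, IsNormalFunctional ω ∧
      ∀ f ∈ hτ.sqIntegrable, ω f = traceInner τ (star k : Elem M) f := by
  let A : ℬ(K) → Prop := fun k => k ∈ hτ.sqIntegrable ∧
    ∃ ω : ℬ(K) →ₗ[ℂ] ℂ, IsNormalFunctional ω ∧
      ∀ f ∈ hτ.sqIntegrable, ω f = traceInner τ k f
  have hAadd : ∀ x y, A x → A y → A (x + y) := by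
    rintro x y ⟨hx, ω, hω, h⟩ ⟨hy, ω', hω', h'⟩
    refine ⟨add_mem hx hy, ω + ω', hω.add hω', fun f hf => ?_⟩
    rw [← hτ.traceInner_conj (add_mem hx hy) hf, hτ.traceInner_add hf hx hy, map_add,
      hτ.traceInner_conj hx hf, hτ.traceInner_conj hy hf, ← h f hf, ← h' f hf]
    rfl
  have hAsmul : ∀ (c : ℂ) x, A x → A (c • x) := by
    rintro c x ⟨hx, ω, hω, h⟩
    refine ⟨hτ.sqIntegrable.smul_mem c hx, (starRingEnd ℂ) c • ω, hω.smul _, fun f hf => ?_⟩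
    rw [← hτ.traceInner_conj (hτ.sqIntegrable.smul_mem c hx) hf, hτ.traceInner_smul hf hx, map_mul,
      hτ.traceInner_conj hx hf, ← h f hf]
    rfl
  have hApos : ∀ x, FiniteTrace M τ x → A x := fun x hx => by
    have hs := hτ.sqrt_mem_sqIntegrable hx
    have hsa := (IsSelfAdjoint.of_nonneg (CFC.sqrt_nonneg x)).star_eq
    have hss := CFC.sqrt_mul_sqrt_self x hx.nonneg
    have hxm := hτ.mul_mem_sqIntegrable hs.1 hs
    rw [hss] at hxm
    obtain ⟨ω, hω, h⟩ := hτ.exists_normal_conj hs hsa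
    refine ⟨hxm, ω, hω, fun f hf => ?_⟩
    rw [← h f hf.1]
    conv_rhs => rw [← hss, hτ.traceInner_mul_right hs.1 hs hf, hsa]
  have hAsa : ∀ x ∈ S, star x = x → A x.1 := fun x hx hxs => by
    have hxsa : IsSelfAdjoint x.1 := congrArg Subtype.val hxs
    have h1 : FiniteTrace M τ (CFC.abs x.1) :=
      ⟨abs_mem_vonNeumann x.2, CFC.abs_nonneg _, hS.integrable x hx⟩
    have h2 := CFC.posPart_add_negPart x.1 hxsa
    have h3 := CFC.posPart_sub_negPart x.1 hxsa
    have hp : FiniteTrace M τ (x.1⁺) := by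
      refine hτ.finiteTrace_of_le h1 ?_ (CFC.posPart_nonneg _) ?_
      · rw [CFC.posPart_def]; exact cfcₙ_mem_vonNeumann x.2 _
      · rw [← h2]; exact le_add_of_nonneg_right (CFC.negPart_nonneg _)
    have hn : FiniteTrace M τ (x.1⁻) := by
      refine hτ.finiteTrace_of_le h1 ?_ (CFC.negPart_nonneg _) ?_
      · rw [CFC.negPart_def]; exact cfcₙ_mem_vonNeumann x.2 _
      · rw [← h2]; exact le_add_of_nonneg_left (CFC.posPart_nonneg _)
    have h4 := hAadd _ _ (hApos _ hp) (hAsmul (-1) _ (hApos _ hn))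
    rwa [neg_one_smul, ← sub_eq_add_neg, h3] at h4
  obtain ⟨a, ha, b, hb, has, hbs, he⟩ := exists_selfAdjoint_decomp (star_mem hk)
  rw [he]
  exact (hAadd _ _ (hAsa a ha has) (hAsmul I _ (hAsa b hb hbs))).2

end IsTestAlgebra

open Classical in
/-- The normal functional `f ↦ τ(k f)` for `k` in a test algebra. -/
def pairing (hτ : IsNSFTrace M τ) (k : Elem M) : ℬ(K) →ₗ[ℂ] ℂ :=
  if h : ∃ ω : ℬ(K) →ₗ[ℂ] ℂ, IsNormalFunctional ω ∧
    ∀ f ∈ hτ.sqIntegrable, ω f = traceInner τ (star k : Elem M) f then h.choose else 0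

namespace IsTestAlgebra

variable (hS : IsTestAlgebra τ T S) (hτ : IsNSFTrace M τ)
include hS

lemma pairing_normal {k : Elem M} (hk : k ∈ S) : IsNormalFunctional (pairing hτ k) := by
  rw [pairing, dif_pos (hS.exists_pairing hτ hk)]
  exact (hS.exists_pairing hτ hk).choose_spec.1

lemma pairing_apply {k f : Elem M} (hk : k ∈ S) (hf : f ∈ S) :
    pairing hτ k f.1 = traceInner τ (star k : Elem M) f.1 := by
  rw [pairing, dif_pos (hS.exists_pairing hτ hk)]
  exact (hS.exists_pairing hτ hk).choose_spec.2 f (hS.mem_sqIntegrable hτ hf)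

lemma pairing_mul {k l : Elem M} (hk : k ∈ S) (hl : l ∈ S) (f : Elem M) :
    pairing hτ k (l * f).1 = pairing hτ (k * l) f.1 := by
  have hn := (hS.pairing_normal hτ hk).comp_sandwich l.1 (1 : ℬ(K))
  refine hS.normal_ext hn (hS.pairing_normal hτ (mul_mem hk hl)) (fun f hf => ?_) f
  rw [hS.pairing_apply hτ (mul_mem hk hl) hf]
  show pairing hτ k (l * f).1 = _
  rw [hS.pairing_apply hτ hk (mul_mem hl hf), star_mul]
  have := hτ.traceInner_mul_left (star l).2 (hS.mem_sqIntegrable hτ (star_mem hk))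
    (hS.mem_sqIntegrable hτ hf)
  rw [show star (star l).1 = l from star_star l.1] at this
  exact this.symm

lemma pairing_add {k l : Elem M} (hk : k ∈ S) (hl : l ∈ S) (f : Elem M) :
    pairing hτ (k + l) f.1 = pairing hτ k f.1 + pairing hτ l f.1 := by
  refine hS.normal_ext (hS.pairing_normal hτ (add_mem hk hl))
    ((hS.pairing_normal hτ hk).add (hS.pairing_normal hτ hl)) (fun f hf => ?_) f
  rw [LinearMap.add_apply, hS.pairing_apply hτ (add_mem hk hl) hf, hS.pairing_apply hτ hk hf,
    hS.pairing_apply hτ hl hf, star_add]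
  have m1 := hS.mem_sqIntegrable hτ (star_mem hk)
  have m2 := hS.mem_sqIntegrable hτ (star_mem hl)
  have m3 := hS.mem_sqIntegrable hτ hf
  show traceInner τ ((star k).1 + (star l).1) _ = _
  rw [← hτ.traceInner_conj (add_mem m1 m2) m3, hτ.traceInner_add m3 m1 m2, map_add,
    hτ.traceInner_conj m1 m3, hτ.traceInner_conj m2 m3]

lemma pairing_smul {k : Elem M} (hk : k ∈ S) (c : ℂ) (f : Elem M) :
    pairing hτ (c • k) f.1 = c * pairing hτ k f.1 := by
  refine hS.normal_ext (hS.pairing_normal hτ (SMulMemClass.smul_mem c hk))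
    ((hS.pairing_normal hτ hk).smul c) (fun f hf => ?_) f
  rw [LinearMap.smul_apply, smul_eq_mul, hS.pairing_apply hτ (SMulMemClass.smul_mem c hk) hf,
    hS.pairing_apply hτ hk hf, star_smul]
  have m1 := hS.mem_sqIntegrable hτ (star_mem hk)
  have m3 := hS.mem_sqIntegrable hτ hf
  show traceInner τ (star c • (star k).1) _ = _
  rw [← hτ.traceInner_conj (hτ.sqIntegrable.smul_mem _ m1) m3, hτ.traceInner_smul m3 m1, map_mul,
    hτ.traceInner_conj m1 m3]
  simp

lemma pairing_sub {k l : Elem M} (hk : k ∈ S) (hl : l ∈ S) (f : Elem M) :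
    pairing hτ (k - l) f.1 = pairing hτ k f.1 - pairing hτ l f.1 := by
  rw [show k - l = k + (-1 : ℂ) • l by rw [neg_one_smul, sub_eq_add_neg],
    hS.pairing_add hτ hk (SMulMemClass.smul_mem _ hl), hS.pairing_smul hτ hl]
  ring

/-- The symmetry of the semigroup, extended to the whole algebra. -/
lemma pairing_symm (hT : IsMarkovSemigroup M τ T) {t : ℝ} (ht : 0 < t) {k : Elem M} (hk : k ∈ S)
    (f : Elem M) : pairing hτ k (T t f).1 = pairing hτ (T t k) f.1 := by
  have hM := hT.markov t ht.le
  obtain ⟨ω, hω, h⟩ := hM.exists_normal_comp (hS.pairing_normal hτ hk)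
  rw [h]
  refine hS.normal_ext hω (hS.pairing_normal hτ (hS.semigroup_mem t ht k hk)) (fun f hf => ?_) f
  rw [← h, hS.pairing_apply hτ hk (hS.semigroup_mem t ht f hf),
    hS.pairing_apply hτ (hS.semigroup_mem t ht k hk) hf, ← hM.map_star]
  exact hM.symmetric (star k) f (hS.mem_sqIntegrable hτ (star_mem hk)).2
    (hS.mem_sqIntegrable hτ hf).2

/-- The functionals `f ↦ τ(k f)` separate the points of `M`. -/
lemma eq_zero_of_pairing {y : Elem M} (h : ∀ k ∈ S, pairing hτ k y.1 = 0) : y = 0 := by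
  have h1 : ∀ k ∈ S, pairing hτ k (star y * y).1 = 0 := fun k hk => by
    obtain ⟨l, hl, hly⟩ := exists_bounded_net S hS.dense (star y)
    refine tendsto_nhds_unique (tendsto_ultraweak_iff.1 (tendsto_sandwich hly (1 : ℬ(K)) y.1) _
      (hS.pairing_normal hτ hk)) (tendsto_const_nhds.congr fun i => ?_)
    exact ((hS.pairing_mul hτ hk (hl i).1 y).trans (h _ (mul_mem hk (hl i).1))).symm
  have h2 : ∀ c ∈ S, star c = c → y * c = 0 := by
    intro c hc hcs
    have hcm := hS.mem_sqIntegrable hτ hc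
    have hcs' : star c.1 = c := congrArg Subtype.val hcs
    obtain ⟨ω, hω, hωc⟩ := hτ.exists_normal_conj hcm hcs'
    have h3 : pairing hτ (c * c) (star y * y).1 = ω (star y * y).1 := by
      refine hS.normal_ext (hS.pairing_normal hτ (mul_mem hc hc)) hω (fun f hf => ?_) _
      rw [hS.pairing_apply hτ (mul_mem hc hc) hf, star_mul, hcs, ← hωc _ f.2]
      have := hτ.traceInner_mul_right hcm.1 hcm (hS.mem_sqIntegrable hτ hf)
      rwa [hcs'] at this
    rw [h1 _ (mul_mem hc hc), ← hωc _ (star y * y).2] at h3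
    have hym := hτ.mul_mem_sqIntegrable y.2 hcm
    have h4 := hτ.traceInner_mul_left y.2 hcm hym
    rw [show star y.1 * (y.1 * c) = (star y * y).1 * c from (mul_assoc _ _ _).symm,
      ← h3, hτ.traceInner_self hym] at h4
    have h5 : τ (star (y.1 * c) * (y.1 * c)) = 0 :=
      ((ENNReal.toReal_eq_zero_iff _).1 (Complex.ofReal_eq_zero.1 h4)).resolve_right hym.2.ne
    have h6 := hτ.faithful _ (hτ.finiteTrace_sq hym).mem (star_mul_self_nonneg _) h5
    exact Subtype.ext (CStarRing.star_mul_self_eq_zero_iff _ |>.1 h6)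
  have h3 : ∀ k ∈ S, y * k = 0 := by
    intro k hk
    obtain ⟨a, ha, b, hb, has, hbs, rfl⟩ := exists_selfAdjoint_decomp hk
    rw [mul_add, h2 a ha has, mul_smul_comm, h2 b hb hbs, smul_zero, add_zero]
  obtain ⟨l, hl, hl1⟩ := exists_bounded_net S hS.dense 1
  refine Subtype.ext (ultraweak_unique (l := atTop) (X := fun _ : Finset K × ℕ => (0 : ℬ(K)))
    ?_ (tendsto_ultraweak_of_norm tendsto_const_nhds))
  exact (tendsto_sandwich hl1 y.1 (1 : ℬ(K))).congr fun i => congrArg Subtype.val (h3 _ (hl i).1)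

end IsTestAlgebra

/-! ### The Lévy density -/

lemma rpow_neg_three_halves {v : ℝ} (hv : 0 < v) : v ^ (-(3 / 2) : ℝ) = 1 / (v * √v) := by
  rw [Real.rpow_neg hv.le, show (3 / 2 : ℝ) = 1 + 1 / 2 by norm_num, rpow_add hv,
    Real.rpow_one, ← Real.sqrt_eq_rpow, one_div]

lemma subordinator_eq {s v : ℝ} (hv : 0 < v) :
    subordinator s v = s * exp (-(s ^ 2) / (4 * v)) / (2 * √π * (v * √v)) := by
  rw [subordinator, rpow_neg_three_halves hv]
  field_simp

lemma subordinator_nonneg {s v : ℝ} (hs : 0 ≤ s) (hv : 0 < v) : 0 ≤ subordinator s v := by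
  rw [subordinator_eq hv]; positivity

lemma continuousOn_subordinator (s : ℝ) : ContinuousOn (subordinator s) (Ioi 0) := by
  intro v hv
  have hv' : (v : ℝ) ≠ 0 := (mem_Ioi.1 hv).ne'
  have h2 : ContinuousAt (fun v : ℝ => -(s ^ 2) / (4 * v)) v :=
    .div (by fun_prop) (by fun_prop) (by simpa using hv')
  exact (((continuousAt_const.mul (Real.continuous_exp.continuousAt.comp h2)).mul
    (Real.continuousAt_rpow_const _ _ (.inl hv'))).div_const _).continuousWithinAt

/-- `∂_s φ_s(v)`. -/
def subordinatorDeriv (s v : ℝ) : ℝ := (1 / s - s / (2 * v)) * subordinator s v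

/-- `∂_s² φ_s(v) = ∂_v φ_s(v)`. -/
def subordinatorDeriv₂ (s v : ℝ) : ℝ := (s ^ 2 / (4 * v ^ 2) - 3 / (2 * v)) * subordinator s v

lemma hasDerivAt_subordinator {s v : ℝ} (hs : s ≠ 0) (hv : 0 < v) :
    HasDerivAt (fun s => subordinator s v) (subordinatorDeriv s v) s := by
  have h1 : HasDerivAt (fun s : ℝ => -(s ^ 2) / (4 * v)) (-(2 * s) / (4 * v)) s := by
    simpa using ((hasDerivAt_pow 2 s).neg).div_const (4 * v)
  refine ((((hasDerivAt_id s).mul h1.exp).mul_const (v ^ (-(3 / 2) : ℝ))).div_const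
    (2 * √π)).congr_deriv ?_
  simp only [subordinatorDeriv, subordinator, id]
  field_simp
  ring

lemma hasDerivAt_subordinatorDeriv {s v : ℝ} (hs : s ≠ 0) (hv : 0 < v) :
    HasDerivAt (fun s => subordinatorDeriv s v) (subordinatorDeriv₂ s v) s := by
  have h1 : HasDerivAt (fun s : ℝ => 1 / s - s / (2 * v)) (-(s ^ 2)⁻¹ - 1 / (2 * v)) s := by
    have := (hasDerivAt_inv hs).sub ((hasDerivAt_id s).div_const (2 * v))
    exact this.congr_of_eventuallyEq (.of_forall fun x => by simp [one_div])
      |>.congr_deriv (by simp [one_div])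
  refine (h1.mul (hasDerivAt_subordinator hs hv)).congr_deriv ?_
  simp only [subordinatorDeriv, subordinatorDeriv₂]
  field_simp
  ring

/-- The heat equation `∂_v φ_s = ∂_s² φ_s`. -/
lemma hasDerivAt_subordinator_right {s v : ℝ} (hv : 0 < v) :
    HasDerivAt (fun v => subordinator s v) (subordinatorDeriv₂ s v) v := by
  have h1 : HasDerivAt (fun v : ℝ => -(s ^ 2) / (4 * v)) (s ^ 2 / (4 * v ^ 2)) v := by
    refine (((hasDerivAt_inv hv.ne').const_mul (-(s ^ 2) / 4)).congr_deriv
      (by field_simp)).congr_of_eventuallyEq (.of_forall fun x => ?_)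
    simp only [div_eq_mul_inv, mul_inv]; ring
  refine (((h1.exp.const_mul s).mul (Real.hasDerivAt_rpow_const (p := -(3 / 2))
    (.inl hv.ne'))).div_const (2 * √π)).congr_deriv ?_
  simp only [subordinatorDeriv₂, subordinator]
  rw [Real.rpow_sub_one hv.ne']
  field_simp
  ring

lemma moment_aux {c a : ℝ} (hc : 0 < c) (ha : 0 < a) :
    IntegrableOn (fun v : ℝ => v ^ (-a - 1) * exp (-c / v)) (Ioi 0) ∧
    ∫ v in Ioi (0 : ℝ), v ^ (-a - 1) * exp (-c / v) = (1 / c) ^ a * Real.Gamma a := by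
  let g : ℝ → ℝ := fun y => y ^ (a - 1) * exp (-(c * y))
  have e : ∀ v ∈ Ioi (0 : ℝ), v ^ ((-1 : ℝ) - 1) * g (v ^ (-1 : ℝ))
      = v ^ (-a - 1) * exp (-c / v) := fun v (hv : 0 < v) => by
    simp only [g]
    rw [← Real.rpow_mul hv.le, ← mul_assoc, ← rpow_add hv, Real.rpow_neg_one]
    congr 2
    · ring
    · rw [div_eq_mul_inv]; ring
  have hg : IntegrableOn g (Ioi 0) := by
    simpa [g] using integrableOn_rpow_mul_exp_neg_mul_rpow (p := 1) (s := a - 1) (b := c)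
      (by linarith) one_pos hc
  constructor
  · exact ((integrableOn_Ioi_comp_rpow_iff' g (p := -1) (by norm_num)).2 hg).congr_fun e
      measurableSet_Ioi
  · rw [← Real.integral_rpow_mul_exp_neg_mul_Ioi ha hc, ← integral_comp_rpow_Ioi g
      (p := -1) (by norm_num)]
    refine setIntegral_congr_fun measurableSet_Ioi fun v hv => ?_
    rw [← e v hv, smul_eq_mul]
    simp

lemma moment_general {s : ℝ} (hs : 0 < s) (k : ℕ) :
    IntegrableOn (fun v : ℝ => subordinator s v / v ^ k) (Ioi 0) ∧
    ∫ v in Ioi (0 : ℝ), subordinator s v / v ^ k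
      = s / (2 * √π) * ((4 / s ^ 2) ^ (k + 1 / 2 : ℝ) * Real.Gamma (k + 1 / 2)) := by
  have h := moment_aux (c := s ^ 2 / 4) (a := k + 1 / 2) (by positivity) (by positivity)
  have e : ∀ v ∈ Ioi (0 : ℝ), s / (2 * √π) *
      (v ^ (-(k + 1 / 2 : ℝ) - 1) * exp (-(s ^ 2 / 4) / v)) = subordinator s v / v ^ k :=
      fun v (hv : 0 < v) => by
    rw [show (-(k + 1 / 2 : ℝ) - 1) = -(3 / 2) - (k : ℝ) by ring, Real.rpow_sub hv,
      Real.rpow_natCast, show -(s ^ 2 / 4) / v = -(s ^ 2) / (4 * v) by field_simp]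
    simp only [subordinator]
    ring
  constructor
  · exact IntegrableOn.congr_fun (h.1.const_mul (s / (2 * √π))) e measurableSet_Ioi
  · rw [← setIntegral_congr_fun measurableSet_Ioi e, integral_const_mul, h.2]
    congr 3
    rw [one_div_div]

lemma integrableOn_subordinator {s : ℝ} (hs : 0 < s) :
    IntegrableOn (subordinator s) (Ioi 0) := by
  simpa using (moment_general hs 0).1

lemma four_div_sq_rpow {s : ℝ} (hs : 0 < s) (k : ℕ) :
    (4 / s ^ 2) ^ (k + 1 / 2 : ℝ) = (4 / s ^ 2) ^ k * (2 / s) := by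
  rw [rpow_add (by positivity), Real.rpow_natCast, ← Real.sqrt_eq_rpow,
    show (4 / s ^ 2 : ℝ) = (2 / s) ^ 2 by ring, sqrt_sq (by positivity)]

lemma integral_subordinator {s : ℝ} (hs : 0 < s) :
    ∫ v in Ioi (0 : ℝ), subordinator s v = 1 := by
  have h := (moment_general hs 0).2
  rw [four_div_sq_rpow hs] at h
  simp only [pow_zero, div_one, CharP.cast_eq_zero, zero_add, Real.Gamma_one_half_eq] at h
  rw [h]
  have : √π ≠ 0 := by positivity
  field_simp

lemma integrableOn_subordinator_div {s : ℝ} (hs : 0 < s) :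
    IntegrableOn (fun v => subordinator s v / v) (Ioi 0) := by
  simpa using (moment_general hs 1).1

lemma integral_subordinator_div {s : ℝ} (hs : 0 < s) :
    ∫ v in Ioi (0 : ℝ), subordinator s v / v = 2 / s ^ 2 := by
  have h := (moment_general hs 1).2
  rw [four_div_sq_rpow hs] at h
  have hG : Real.Gamma ((1 : ℕ) + 1 / 2) = 1 / 2 * √π := by
    rw [Nat.cast_one, add_comm, Real.Gamma_add_one (by norm_num), Real.Gamma_one_half_eq]
  simp only [pow_one, hG] at h
  rw [h]
  have : √π ≠ 0 := by positivity
  field_simp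
  norm_num

lemma integrableOn_subordinator_div_sq {s : ℝ} (hs : 0 < s) :
    IntegrableOn (fun v => subordinator s v / v ^ 2) (Ioi 0) := (moment_general hs 2).1

lemma integral_subordinator_div_sq {s : ℝ} (hs : 0 < s) :
    ∫ v in Ioi (0 : ℝ), subordinator s v / v ^ 2 = 12 / s ^ 4 := by
  have h := (moment_general hs 2).2
  rw [four_div_sq_rpow hs] at h
  have hG : Real.Gamma ((2 : ℕ) + 1 / 2) = 3 / 4 * √π := by
    rw [show ((2 : ℕ) + 1 / 2 : ℝ) = (1 / 2 + 1) + 1 by norm_num,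
      Real.Gamma_add_one (by norm_num), Real.Gamma_add_one (by norm_num), Real.Gamma_one_half_eq]
    ring
  rw [h, hG]
  have : √π ≠ 0 := by positivity
  field_simp
  norm_num

lemma abs_sub_mul_le {a b c : ℝ} (ha : 0 ≤ a) (hb : 0 ≤ b) (hc : 0 ≤ c) :
    |(a - b) * c| ≤ (a + b) * c := by
  rw [abs_mul, abs_of_nonneg hc]
  exact mul_le_mul_of_nonneg_right (abs_sub_le_iff.2 ⟨by linarith, by linarith⟩) hc

lemma abs_subordinatorDeriv_le {s v : ℝ} (hs : 0 < s) (hv : 0 < v) :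
    |subordinatorDeriv s v| ≤ 1 / s * subordinator s v + s / 2 * (subordinator s v / v) := by
  have h0 := subordinator_nonneg hs.le hv
  exact (abs_sub_mul_le (by positivity) (by positivity) h0).trans_eq (by field_simp)

lemma abs_subordinatorDeriv₂_le {s v : ℝ} (hs : 0 < s) (hv : 0 < v) :
    |subordinatorDeriv₂ s v|
      ≤ s ^ 2 / 4 * (subordinator s v / v ^ 2) + 3 / 2 * (subordinator s v / v) := by
  have h0 := subordinator_nonneg hs.le hv
  exact (abs_sub_mul_le (by positivity) (by positivity) h0).trans_eq (by field_simp)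

lemma continuousOn_subordinatorDeriv (s : ℝ) :
    ContinuousOn (subordinatorDeriv s) (Ioi 0) := by
  refine ContinuousOn.mul (continuousOn_const.sub (ContinuousOn.div continuousOn_const
    (by fun_prop) fun x hx => ?_)) (continuousOn_subordinator s)
  simpa using (mem_Ioi.1 hx).ne'

lemma continuousOn_subordinatorDeriv₂ (s : ℝ) :
    ContinuousOn (subordinatorDeriv₂ s) (Ioi 0) := by
  refine ContinuousOn.mul (ContinuousOn.sub (ContinuousOn.div continuousOn_const
    (by fun_prop) fun x hx => ?_) (ContinuousOn.div continuousOn_const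
    (by fun_prop) fun x hx => ?_)) (continuousOn_subordinator s)
  all_goals simpa using (mem_Ioi.1 hx).ne'

lemma integrableOn_subordinatorDeriv {s : ℝ} (hs : 0 < s) :
    IntegrableOn (subordinatorDeriv s) (Ioi 0) := by
  refine Integrable.mono' (((integrableOn_subordinator hs).const_mul (1 / s)).add
    ((integrableOn_subordinator_div hs).const_mul (s / 2)))
    ((continuousOn_subordinatorDeriv s).aestronglyMeasurable measurableSet_Ioi) ?_
  filter_upwards [ae_restrict_mem measurableSet_Ioi] with v hv using abs_subordinatorDeriv_le hs hv

lemma integrableOn_subordinatorDeriv₂ {s : ℝ} (hs : 0 < s) :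
    IntegrableOn (subordinatorDeriv₂ s) (Ioi 0) := by
  refine Integrable.mono' (((integrableOn_subordinator_div_sq hs).const_mul (s ^ 2 / 4)).add
    ((integrableOn_subordinator_div hs).const_mul (3 / 2)))
    ((continuousOn_subordinatorDeriv₂ s).aestronglyMeasurable measurableSet_Ioi) ?_
  filter_upwards [ae_restrict_mem measurableSet_Ioi] with v hv using abs_subordinatorDeriv₂_le hs hv

lemma integral_abs_subordinatorDeriv_le {s : ℝ} (hs : 0 < s) :
    ∫ v in Ioi (0 : ℝ), |subordinatorDeriv s v| ≤ 2 / s := by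
  have h1 := (integrableOn_subordinator hs).const_mul (1 / s)
  have h2 := (integrableOn_subordinator_div hs).const_mul (s / 2)
  refine (setIntegral_mono_on (integrableOn_subordinatorDeriv hs).abs (h1.add h2)
    measurableSet_Ioi fun v hv => abs_subordinatorDeriv_le hs hv).trans ?_
  simp only [Pi.add_apply]
  rw [integral_add h1 h2, integral_const_mul, integral_const_mul, integral_subordinator hs,
    integral_subordinator_div hs]
  apply le_of_eq
  field_simp
  norm_num

lemma integral_abs_subordinatorDeriv₂_le {s : ℝ} (hs : 0 < s) :
    ∫ v in Ioi (0 : ℝ), |subordinatorDeriv₂ s v| ≤ 6 / s ^ 2 := by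
  have h1 := (integrableOn_subordinator_div_sq hs).const_mul (s ^ 2 / 4)
  have h2 := (integrableOn_subordinator_div hs).const_mul (3 / 2)
  refine (setIntegral_mono_on (integrableOn_subordinatorDeriv₂ hs).abs (h1.add h2)
    measurableSet_Ioi fun v hv => abs_subordinatorDeriv₂_le hs hv).trans ?_
  simp only [Pi.add_apply]
  rw [integral_add h1 h2, integral_const_mul, integral_const_mul, integral_subordinator_div_sq hs,
    integral_subordinator_div hs]
  apply le_of_eq
  field_simp
  norm_num

lemma subordinator_le_of_near {s σ v : ℝ} (hs : 0 < s) (h1 : s / 2 ≤ σ) (h2 : σ ≤ 2 * s)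
    (hv : 0 < v) : subordinator σ v ≤ 4 * subordinator (s / 2) v := by
  rw [subordinator_eq hv, subordinator_eq hv, ← mul_div_assoc]
  have h4 : σ * exp (-(σ ^ 2) / (4 * v)) ≤ (2 * s) * exp (-((s / 2) ^ 2) / (4 * v)) := by
    gcongr
  refine div_le_div_of_nonneg_right ?_ (by positivity)
  linarith

/-- An integrable bound for `∂_σ φ_σ` for `σ` near `s`. -/
lemma subordinatorDeriv_bound {s σ v : ℝ} (hs : 0 < s) (h1 : s / 2 ≤ σ) (h2 : σ ≤ 2 * s)
    (hv : 0 < v) : |subordinatorDeriv σ v|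
      ≤ 8 / s * subordinator (s / 2) v + 4 * s * (subordinator (s / 2) v / v) := by
  have hσ : 0 < σ := by linarith
  have h3 := subordinator_le_of_near hs h1 h2 hv
  have h0 := subordinator_nonneg hσ.le hv
  have h4 : 1 / σ ≤ 2 / s := by
    rw [div_le_div_iff₀ hσ hs]; linarith
  refine (abs_subordinatorDeriv_le hσ hv).trans ?_
  calc 1 / σ * subordinator σ v + σ / 2 * (subordinator σ v / v)
      ≤ 2 / s * (4 * subordinator (s / 2) v) + (2 * s) / 2 * (4 * subordinator (s / 2) v / v) := by
        gcongr
    _ = _ := by ring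

/-- An integrable bound for `∂_σ² φ_σ` for `σ` near `s`. -/
lemma subordinatorDeriv₂_bound {s σ v : ℝ} (hs : 0 < s) (h1 : s / 2 ≤ σ) (h2 : σ ≤ 2 * s)
    (hv : 0 < v) : |subordinatorDeriv₂ σ v|
      ≤ 4 * s ^ 2 * (subordinator (s / 2) v / v ^ 2) + 6 * (subordinator (s / 2) v / v) := by
  have hσ : 0 < σ := by linarith
  have h3 := subordinator_le_of_near hs h1 h2 hv
  have h0 := subordinator_nonneg hσ.le hv
  refine (abs_subordinatorDeriv₂_le hσ hv).trans ?_
  calc σ ^ 2 / 4 * (subordinator σ v / v ^ 2) + 3 / 2 * (subordinator σ v / v)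
      ≤ (2 * s) ^ 2 / 4 * (4 * subordinator (s / 2) v / v ^ 2)
        + 3 / 2 * (4 * subordinator (s / 2) v / v) := by
        gcongr
    _ = _ := by ring

lemma tendsto_subordinator_zero {s : ℝ} (hs : 0 < s) :
    Tendsto (subordinator s) (𝓝[>] 0) (𝓝 0) := by
  have h1 := (tendsto_rpow_mul_exp_neg_mul_atTop_nhds_zero (3 / 2) (s ^ 2 / 4)
    (by positivity)).comp tendsto_inv_nhdsGT_zero
  have h2 := h1.const_mul (s / (2 * √π))
  rw [mul_zero] at h2
  refine h2.congr' ?_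
  filter_upwards [self_mem_nhdsWithin] with v (hv : 0 < v)
  simp only [Function.comp_apply, subordinator]
  rw [Real.inv_rpow hv.le, ← Real.rpow_neg hv.le,
    show -(s ^ 2 / 4) * v⁻¹ = -(s ^ 2) / (4 * v) by field_simp]
  ring

lemma tendsto_subordinator_atTop {s : ℝ} (hs : 0 < s) :
    Tendsto (subordinator s) atTop (𝓝 0) := by
  have h1 := (tendsto_rpow_neg_atTop (y := 3 / 2) (by norm_num)).const_mul (s / (2 * √π))
  rw [mul_zero] at h1
  refine squeeze_zero' ?_ ?_ h1
  · filter_upwards [eventually_gt_atTop 0] with v hv using subordinator_nonneg hs.le hv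
  · filter_upwards [eventually_gt_atTop 0] with v hv
    have h2 : exp (-(s ^ 2) / (4 * v)) ≤ 1 :=
      Real.exp_le_one_iff.2 (neg_div (4 * v) (s ^ 2) ▸ neg_nonpos.2 (by positivity))
    have h3 : 0 ≤ v ^ (-(3 / 2) : ℝ) := rpow_nonneg hv.le _
    rw [subordinator]
    calc s * exp (-(s ^ 2) / (4 * v)) * v ^ (-(3 / 2) : ℝ) / (2 * √π)
        ≤ s * 1 * v ^ (-(3 / 2) : ℝ) / (2 * √π) := by gcongr
      _ = _ := by ring

lemma subordinator_scale {s v : ℝ} (hs : 0 < s) (hv : 0 < v) :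
    s ^ 2 * subordinator s (s ^ 2 * v) = subordinator 1 v := by
  rw [subordinator_eq (by positivity), subordinator_eq hv, sqrt_mul (by positivity),
    sqrt_sq hs.le]
  rw [show -(s ^ 2) / (4 * (s ^ 2 * v)) = -(1 ^ 2) / (4 * v) by field_simp]
  have : √v ≠ 0 := by positivity
  field_simp

/-- The measures `φ_s(v) dv` converge to the Dirac measure at `0` as `s → 0`. -/
lemma tendsto_integral_subordinator {g : ℝ → ℂ} {c : ℝ} (hg : ContinuousOn g (Ici 0))
    (hgc : ∀ v, 0 ≤ v → ‖g v‖ ≤ c) :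
    Tendsto (fun s : ℝ => ∫ v in Ioi (0 : ℝ), (subordinator s v : ℂ) * g v) (𝓝[>] 0)
      (𝓝 (g 0)) := by
  have h1 : ∀ s : ℝ, 0 < s → ∫ v in Ioi (0 : ℝ), (subordinator s v : ℂ) * g v
      = ∫ v in Ioi (0 : ℝ), (subordinator 1 v : ℂ) * g (s ^ 2 * v) := fun s hs => by
    have hs2 : 0 < s ^ 2 := by positivity
    have h := integral_comp_mul_left_Ioi (fun v => (subordinator s v : ℂ) * g v) 0 hs2
    rw [mul_zero] at h
    have h' : ∫ v in Ioi (0 : ℝ), (subordinator s v : ℂ) * g v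
        = s ^ 2 • ∫ v in Ioi (0 : ℝ), (subordinator s (s ^ 2 * v) : ℂ) * g (s ^ 2 * v) := by
      rw [h, smul_smul, mul_inv_cancel₀ hs2.ne', one_smul]
    rw [h', ← integral_smul]
    refine setIntegral_congr_fun measurableSet_Ioi fun v hv => ?_
    rw [← subordinator_scale hs hv, Complex.real_smul]
    push_cast
    ring
  have h2 : g 0 = ∫ v in Ioi (0 : ℝ), (subordinator 1 v : ℂ) * g 0 := by
    rw [integral_mul_const, integral_complex_ofReal, integral_subordinator one_pos]
    simp
  rw [h2]
  refine Tendsto.congr' (f₁ := fun s : ℝ => ∫ v in Ioi (0 : ℝ),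
    (subordinator 1 v : ℂ) * g (s ^ 2 * v)) ?_ ?_
  · filter_upwards [self_mem_nhdsWithin] with s hs using (h1 s hs).symm
  refine tendsto_integral_filter_of_dominated_convergence (fun v => subordinator 1 v * c) ?_ ?_
    ((integrableOn_subordinator one_pos).mul_const c) ?_
  · filter_upwards [self_mem_nhdsWithin] with s hs
    refine ContinuousOn.aestronglyMeasurable ?_ measurableSet_Ioi
    refine (Complex.continuous_ofReal.comp_continuousOn (continuousOn_subordinator 1)).mul
      (hg.comp (by fun_prop) fun v (hv : 0 < v) => mem_Ici.2 (by positivity))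
  · filter_upwards [self_mem_nhdsWithin] with s hs
    filter_upwards [ae_restrict_mem measurableSet_Ioi] with v (hv : 0 < v)
    rw [norm_mul, norm_real, norm_of_nonneg (subordinator_nonneg zero_le_one hv)]
    exact mul_le_mul_of_nonneg_left (hgc _ (by positivity)) (subordinator_nonneg zero_le_one hv)
  · filter_upwards [ae_restrict_mem measurableSet_Ioi] with v (hv : 0 < v)
    refine Tendsto.const_mul _ ?_
    have h3 : Tendsto (fun s : ℝ => s ^ 2 * v) (𝓝[>] 0) (𝓝[Ici 0] 0) := by
      refine tendsto_nhdsWithin_iff.2 ⟨?_, .of_forall fun s => mem_Ici.2 (by positivity)⟩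
      have : Tendsto (fun s : ℝ => s ^ 2 * v) (𝓝 0) (𝓝 (0 ^ 2 * v)) :=
        Continuous.tendsto (by fun_prop) 0
      simpa using this.mono_left nhdsWithin_le_nhds
    exact (hg 0 (mem_Ici.2 le_rfl)).tendsto.comp h3

/-- The pointwise convolution identity `φ_s * φ_r = φ_{s+r}`. With `z = s p - r / p` and
`z' = s p + r / p`, `p = ((w-u)/u)^{1/2}`, the integrand is a combination of the derivatives of
`E(z)` and `E(z')`, where `E` is a primitive of the Gaussian `e^{-z²/4w}`. -/
lemma subordinator_convolution {s r w : ℝ} (hs : 0 < s) (hr : 0 < r) (hw : 0 < w) :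
    ∫ u in Ioo 0 w, subordinator s u * subordinator r (w - u) = subordinator (s + r) w := by
  let e : ℝ → ℝ := fun t => exp (-(1 / (4 * w)) * t ^ 2)
  let E : ℝ → ℝ := fun z => ∫ t in (0 : ℝ)..z, e t
  have hec : Continuous e := by fun_prop
  have hE : ∀ z, HasDerivAt E (e z) z := fun z => hec.integral_hasStrictDerivAt 0 z |>.hasDerivAt
  have hei : Integrable e := integrable_exp_neg_mul_sq (by positivity)
  let c : ℝ := √(π * w)
  have hc : ∫ t in Ioi (0 : ℝ), e t = c := by
    rw [integral_gaussian_Ioi]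
    rw [show π / (1 / (4 * w)) = 2 ^ 2 * (π * w) by field_simp; norm_num,
      sqrt_mul (by positivity), sqrt_sq (by norm_num)]
    simp only [c]; ring
  have hEtop : Tendsto E atTop (𝓝 c) := by
    rw [← hc]
    exact intervalIntegral_tendsto_integral_Ioi 0 hei.integrableOn tendsto_id
  have hEodd : ∀ z, E (-z) = -E z := by
    intro z
    have := intervalIntegral.integral_comp_neg (f := e) (a := 0) (b := z)
    rw [show (fun t => e (-t)) = e by ext t; simp [e], neg_zero] at this
    simp only [E]
    rw [this, intervalIntegral.integral_symm]
  have hEbot : Tendsto E atBot (𝓝 (-c)) :=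
    (hEtop.comp tendsto_neg_atBot_atTop).neg.congr fun z => by simp [hEodd]
  let z₁ : ℝ → ℝ := fun u => s * (√(w - u) / √u) - r * (√u / √(w - u))
  let z₂ : ℝ → ℝ := fun u => s * (√(w - u) / √u) + r * (√u / √(w - u))
  let A : ℝ := 1 / s + 1 / r
  let B : ℝ := (1 / s - 1 / r) * exp (s * r / w)
  let κ : ℝ := s * r / (4 * π * w ^ 2) * exp (-((s + r) ^ 2) / (4 * w))
  let F : ℝ → ℝ := fun u => -κ * (A * E (z₁ u) + B * E (z₂ u))
  have hderiv : ∀ u ∈ Ioo 0 w, HasDerivAt F (subordinator s u * subordinator r (w - u)) u := by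
    rintro u ⟨hu0, huw⟩
    have hwu : 0 < w - u := by linarith
    have ha : 0 < √u := sqrt_pos.2 hu0
    have hb : 0 < √(w - u) := sqrt_pos.2 hwu
    have h1 : HasDerivAt (fun u => √u) (1 / (2 * √u)) u := Real.hasDerivAt_sqrt hu0.ne'
    have h2 : HasDerivAt (fun u => √(w - u)) (-1 / (2 * √(w - u))) u :=
      ((hasDerivAt_id u).const_sub w).sqrt hwu.ne'
    have d1 := h2.div h1 ha.ne'
    have d2 := h1.div h2 hb.ne'
    refine (((((hE (z₁ u)).comp u ((d1.const_mul s).sub (d2.const_mul r))).const_mul A).add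
      (((hE (z₂ u)).comp u ((d1.const_mul s).add (d2.const_mul r))).const_mul B)).const_mul
      (-κ)).congr_deriv ?_
    rw [subordinator_eq hu0, subordinator_eq hwu]
    set a := √u with hadef
    set b := √(w - u) with hbdef
    have hau : u = a ^ 2 := (sq_sqrt hu0.le).symm
    have hbu : w - u = b ^ 2 := (sq_sqrt hwu.le).symm
    have hwab : w = a ^ 2 + b ^ 2 := by linarith
    have hexp2 : exp (s * r / w) * e (z₂ u) = e (z₁ u) := by
      simp only [e, ← Real.exp_add]
      congr 1
      simp only [z₁, z₂]
      rw [← hadef, ← hbdef]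
      field_simp
      ring
    have hexp1 : exp (-((s + r) ^ 2) / (4 * w)) * e (z₁ u)
        = exp (-(s ^ 2) / (4 * u)) * exp (-(r ^ 2) / (4 * (w - u))) := by
      simp only [e, ← Real.exp_add]
      congr 1
      simp only [z₁]
      rw [← hadef, ← hbdef, hau, show w - a ^ 2 = b ^ 2 by linarith, hwab]
      field_simp
      ring
    have hpi : √π ^ 2 = π := sq_sqrt Real.pi_pos.le
    have hpi0 : √π ≠ 0 := by positivity
    have e1 : s * exp (-(s ^ 2) / (4 * u)) / (2 * √π * (u * a))
        * (r * exp (-(r ^ 2) / (4 * (w - u))) / (2 * √π * ((w - u) * b)))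
        = s * r / (4 * π * (u * a) * ((w - u) * b))
          * (exp (-(s ^ 2) / (4 * u)) * exp (-(r ^ 2) / (4 * (w - u)))) := by
      rw [← hpi]; field_simp; norm_num
    rw [e1, ← hexp1]
    have e2 : B * (e (z₂ u) * (s * ((-1 / (2 * b) * a - b * (1 / (2 * a))) / a ^ 2)
          + r * ((1 / (2 * a) * b - a * (-1 / (2 * b))) / b ^ 2)))
        = (1 / s - 1 / r) * (e (z₁ u) * (s * ((-1 / (2 * b) * a - b * (1 / (2 * a))) / a ^ 2)
          + r * ((1 / (2 * a) * b - a * (-1 / (2 * b))) / b ^ 2))) := by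
      rw [← hexp2]; simp only [B]; ring
    rw [e2]
    simp only [A, κ]
    rw [hbu, hau, hwab]
    have hab : a ^ 2 + b ^ 2 ≠ 0 := by positivity
    field_simp
    ring
  have hp0 : Tendsto (fun u : ℝ => √(w - u) / √u) (𝓝[>] 0) atTop := by
    have h1 : Tendsto (fun u : ℝ => √(w - u)) (𝓝[>] 0) (𝓝 √(w - 0)) :=
      (Continuous.tendsto (by fun_prop) 0).mono_left nhdsWithin_le_nhds
    have h2 : Tendsto (fun u : ℝ => √u) (𝓝[>] 0) (𝓝[>] 0) := by
      refine tendsto_nhdsWithin_iff.2 ⟨?_, ?_⟩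
      · have : Tendsto (fun u : ℝ => √u) (𝓝 0) (𝓝 √0) := Continuous.tendsto (by fun_prop) 0
        rw [Real.sqrt_zero] at this
        exact this.mono_left nhdsWithin_le_nhds
      · filter_upwards [self_mem_nhdsWithin] with u hu using sqrt_pos.2 hu
    simp only [div_eq_mul_inv]
    exact h1.pos_mul_atTop (sqrt_pos.2 (by linarith)) (tendsto_inv_nhdsGT_zero.comp h2)
  have hq0 : Tendsto (fun u : ℝ => √u / √(w - u)) (𝓝[>] 0) (𝓝 0) :=
    (tendsto_inv_atTop_zero.comp hp0).congr fun u => by simp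
  have hrefl : Tendsto (fun u : ℝ => w - u) (𝓝[<] w) (𝓝[>] 0) := by
    refine tendsto_nhdsWithin_iff.2 ⟨?_, ?_⟩
    · have : Tendsto (fun u : ℝ => w - u) (𝓝 w) (𝓝 (w - w)) := Continuous.tendsto (by fun_prop) w
      rw [sub_self] at this
      exact this.mono_left nhdsWithin_le_nhds
    · filter_upwards [self_mem_nhdsWithin] with u hu using sub_pos.2 (Set.mem_Iio.1 hu)
  have hpw : Tendsto (fun u : ℝ => √(w - u) / √u) (𝓝[<] w) (𝓝 0) :=
    (hq0.comp hrefl).congr fun u => by simp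
  have hqw : Tendsto (fun u : ℝ => √u / √(w - u)) (𝓝[<] w) atTop :=
    (hp0.comp hrefl).congr fun u => by simp
  have hF0 : Tendsto F (𝓝[>] 0) (𝓝 (-κ * (A * c + B * c))) := by
    have t1 : Tendsto z₁ (𝓝[>] 0) atTop := by
      simp only [z₁, sub_eq_add_neg]
      exact (hp0.const_mul_atTop hs).atTop_add (hq0.const_mul r).neg
    have t2 : Tendsto z₂ (𝓝[>] 0) atTop := (hp0.const_mul_atTop hs).atTop_add (hq0.const_mul r)
    exact (((hEtop.comp t1).const_mul A).add ((hEtop.comp t2).const_mul B)).const_mul (-κ)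
  have hFw : Tendsto F (𝓝[<] w) (𝓝 (-κ * (A * (-c) + B * c))) := by
    have t1 : Tendsto z₁ (𝓝[<] w) atBot := by
      simp only [z₁, sub_eq_add_neg]
      exact (hpw.const_mul s).add_atBot (tendsto_neg_atTop_atBot.comp (hqw.const_mul_atTop hr))
    have t2 : Tendsto z₂ (𝓝[<] w) atTop := (hpw.const_mul s).add_atTop (hqw.const_mul_atTop hr)
    exact (((hEbot.comp t1).const_mul A).add ((hEtop.comp t2).const_mul B)).const_mul (-κ)
  have hcont : ContinuousOn (extendFrom (Ioo 0 w) F) (Icc 0 w) :=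
    continuousOn_Icc_extendFrom_Ioo (fun u hu => (hderiv u hu).continuousAt.continuousWithinAt)
      hF0 hFw
  have hint : IntegrableOn (fun u => subordinator s u * subordinator r (w - u)) (Ioc 0 w) := by
    refine intervalIntegral.integrableOn_deriv_of_nonneg hcont (fun u hu => ?_) fun u hu =>
      mul_nonneg (subordinator_nonneg hs.le hu.1) (subordinator_nonneg hr.le (sub_pos.2 hu.2))
    refine (hderiv u hu).congr_of_eventuallyEq ?_
    filter_upwards [isOpen_Ioo.mem_nhds hu] with x hx
    exact extendFrom_eq (subset_closure hx) ((hderiv x hx).continuousAt.continuousWithinAt)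
  have hfin := intervalIntegral.integral_eq_sub_of_hasDerivAt_of_tendsto hw hderiv
    ((intervalIntegrable_iff_integrableOn_Ioc_of_le hw.le).2 hint) hF0 hFw
  rw [intervalIntegral.integral_of_le hw.le, integral_Ioc_eq_integral_Ioo] at hfin
  rw [hfin, subordinator_eq hw]
  have hcw : c = √π * √w := sqrt_mul Real.pi_pos.le w
  obtain ⟨q, hq, hq0, hqpi⟩ : ∃ q, √π = q ∧ 0 < q ∧ π = q ^ 2 :=
    ⟨_, rfl, sqrt_pos.2 Real.pi_pos, (sq_sqrt Real.pi_pos.le).symm⟩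
  have hw2 : √w ^ 2 = w := sq_sqrt hw.le
  have hw0 : √w ≠ 0 := by positivity
  rw [show -κ * (A * -c + B * c) - -κ * (A * c + B * c) = 2 * κ * A * c by ring, hcw, hq]
  simp only [κ, A]
  rw [hqpi]
  field_simp
  rw [hw2]
  ring

/-- The convolution identity, integrated against a bounded function. -/
lemma integral_subordinator_convolution {s r : ℝ} (hs : 0 < s) (hr : 0 < r) {g : ℝ → ℂ} {c : ℝ}
    (hg : AEStronglyMeasurable g) (hgc : ∀ v, ‖g v‖ ≤ c) :
    ∫ u in Ioi (0 : ℝ), (subordinator s u : ℂ)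
        * ∫ v in Ioi (0 : ℝ), (subordinator r v : ℂ) * g (u + v)
      = ∫ w in Ioi (0 : ℝ), (subordinator (s + r) w : ℂ) * g w := by
  let φ : ℝ → ℝ → ℂ := fun s => (Ioi (0 : ℝ)).indicator fun v => (subordinator s v : ℂ)
  have hφ : ∀ s, 0 < s → Integrable (φ s) := fun s hs =>
    (integrable_indicator_iff measurableSet_Ioi).2 (integrableOn_subordinator hs).ofReal
  have hmul : ∀ (s : ℝ) (h : ℝ → ℂ), ∫ v in Ioi (0 : ℝ), (subordinator s v : ℂ) * h v
      = ∫ v, φ s v * h v := fun s h => by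
    rw [← integral_indicator measurableSet_Ioi]
    congr 1
    ext v
    simp only [φ, Set.indicator_apply]
    split_ifs <;> simp
  rw [hmul, hmul]
  simp only [hmul]
  have h1 : ∀ u, ∫ v, φ r v * g (u + v) = ∫ w, φ r (w - u) * g w := by
    intro u
    rw [← integral_sub_right_eq_self (fun v => φ r v * g (u + v)) u]
    simp
  simp only [h1]
  have h2 : Integrable (Function.uncurry fun u w => φ s u * (φ r (w - u) * g w))
      (volume.prod volume) := by
    have h4 := ((hφ s hs).convolution_integrand (ContinuousLinearMap.mul ℂ ℂ) (hφ r hr)).swap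
    have h5 : AEStronglyMeasurable (fun p : ℝ × ℝ => g p.2) (volume.prod volume) :=
      hg.comp_quasiMeasurePreserving Measure.quasiMeasurePreserving_snd
    refine (h4.bdd_mul h5 (.of_forall fun p => hgc _)).congr (.of_forall fun p => ?_)
    simp only [Function.uncurry, Function.comp_apply, Prod.swap, ContinuousLinearMap.mul_apply']
    ring
  simp only [← integral_const_mul]
  rw [integral_integral_swap h2]
  congr 1
  ext w
  simp only [← mul_assoc]
  rw [integral_mul_const]
  congr 1
  by_cases hw : 0 < w
  · have h5 : ∀ u, φ s u * φ r (w - u) = (Ioo 0 w).indicator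
        (fun u => ((subordinator s u * subordinator r (w - u) : ℝ) : ℂ)) u := by
      intro u
      simp only [φ, Set.indicator_apply, mem_Ioi, Set.mem_Ioo, sub_pos]
      by_cases hu : 0 < u <;> by_cases huw : u < w <;> simp [hu, huw]
    simp only [h5]
    rw [integral_indicator measurableSet_Ioo, integral_complex_ofReal,
      subordinator_convolution hs hr hw]
    simp [φ, hw]
  · have h5 : ∀ u, φ s u * φ r (w - u) = 0 := fun u => by
      simp only [φ, Set.indicator_apply, mem_Ioi, sub_pos]
      by_cases hu : 0 < u
      · have : ¬ u < w := fun h => hw (hu.trans h)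
        simp [this]
      · simp [hu]
    simp only [h5, integral_zero]
    simp [φ, hw]

/-! ### Weak integrals of the semigroup and the Poisson semigroup -/

lemma norm_inner_le_of_norm_le {E F : Type*} [NormedAddCommGroup E] [InnerProductSpace ℂ E]
    [NormedAddCommGroup F] [InnerProductSpace ℂ F] {X : ℬ(E, F)} {c : ℝ} (h : ‖X‖ ≤ c) (w : F)
    (v : E) : ‖inner ℂ w (X v)‖ ≤ c * (‖w‖ * ‖v‖) := by
  rw [mul_left_comm]
  exact (norm_inner_le_norm _ _).trans (mul_le_mul_of_nonneg_left (X.le_of_opNorm_le h v)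
    (norm_nonneg w))

lemma norm_le_of_inner {E F : Type*} [NormedAddCommGroup E] [InnerProductSpace ℂ E]
    [NormedAddCommGroup F] [InnerProductSpace ℂ F] {X : ℬ(E, F)} {c : ℝ} (hc : 0 ≤ c)
    (h : ∀ (w : F) (v : E), ‖inner ℂ w (X v)‖ ≤ c * (‖w‖ * ‖v‖)) : ‖X‖ ≤ c := by
  refine X.opNorm_le_bound hc fun v => ?_
  have h1 := h (X v) v
  rw [inner_self_eq_norm_sq_to_K, norm_pow, RCLike.norm_ofReal, abs_norm] at h1
  rcases eq_or_lt_of_le (norm_nonneg (X v)) with h0 | h0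
  · rw [← h0]; positivity
  · nlinarith

/-- A weak derivative that is continuous in norm is a derivative in norm. -/
lemma hasDerivAt_of_weak {E F : Type*} [NormedAddCommGroup E] [InnerProductSpace ℂ E]
    [NormedAddCommGroup F] [InnerProductSpace ℂ F] {X X' : ℝ → ℬ(E, F)} {s : ℝ}
    (h : ∀ᶠ r in 𝓝 s, ∀ w v, HasDerivAt (fun r => inner ℂ w (X r v)) (inner ℂ w (X' r v)) r)
    (hc : ContinuousAt X' s) : HasDerivAt X (X' s) s := by
  rw [hasDerivAt_iff_isLittleO, Asymptotics.isLittleO_iff]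
  intro ε hε
  have h1 : ∀ᶠ r in 𝓝 s, ‖X' r - X' s‖ ≤ ε := by
    have := (tendsto_iff_norm_sub_tendsto_zero.1 hc.tendsto)
    exact (this.eventually_lt_const hε).mono fun _ => le_of_lt
  obtain ⟨ρ, hρ, hball⟩ := Metric.eventually_nhds_iff_ball.1 (h.and h1)
  filter_upwards [Metric.ball_mem_nhds s hρ] with r hr
  refine norm_le_of_inner (by positivity) fun w v => ?_
  have h2 : ∀ x ∈ Metric.ball s ρ, HasDerivWithinAt
      (fun r : ℝ => inner ℂ w (X r v) - (r : ℂ) * inner ℂ w (X' s v))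
      (inner ℂ w (X' x v) - inner ℂ w (X' s v)) (Metric.ball s ρ) x := by
    intro x hx
    have := ((hball x hx).1 w v).sub ((Complex.ofRealCLM.hasDerivAt (x := x)).mul_const
      (inner ℂ w (X' s v)))
    have h4 := this.hasDerivWithinAt (s := Metric.ball s ρ)
    simp only [Complex.ofRealCLM_apply, Complex.ofReal_one, one_mul] at h4
    exact h4
  have h3 := Convex.norm_image_sub_le_of_norm_hasDerivWithin_le (C := ε * (‖w‖ * ‖v‖)) h2
    (fun x hx => by
      rw [← inner_sub_right, ← sub_apply]
      exact norm_inner_le_of_norm_le (hball x hx).2 w v)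
    (convex_ball s ρ) (Metric.mem_ball_self hρ) hr
  have e : inner ℂ w ((X r - X s - (r - s) • X' s) v)
      = inner ℂ w (X r v) - (r : ℂ) * inner ℂ w (X' s v)
        - (inner ℂ w (X s v) - (s : ℂ) * inner ℂ w (X' s v)) := by
    have : ((X r - X s - (r - s) • X' s) v) = X r v - X s v - ((r - s : ℝ) : ℂ) • X' s v := by
      rw [coe_smul]; rfl
    rw [this, inner_sub_right, inner_sub_right, inner_smul_right]
    push_cast
    ring
  rw [e]
  calc _ ≤ ε * (‖w‖ * ‖v‖) * ‖r - s‖ := h3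
    _ = _ := by ring

/-- A sequence of operators that converges weakly is bounded. -/
lemma bounded_of_weak {E F : Type*} [NormedAddCommGroup E] [InnerProductSpace ℂ E]
    [CompleteSpace E] [NormedAddCommGroup F] [InnerProductSpace ℂ F] [CompleteSpace F]
    {X : ℕ → ℬ(E, F)} {Y : ℬ(E, F)}
    (h : Tendsto X atTop (𝓝ᵤ Y)) : ∃ c, ∀ n, ‖X n‖ ≤ c := by
  refine banach_steinhaus fun v => ?_
  obtain ⟨c, hc⟩ := banach_steinhaus (g := fun n => InnerProductSpace.toDual ℂ F (X n v))
    fun w => by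
      have h1 := (tendsto_ultraweak_iff.1 h _ (isNormalFunctional_vector w v)).norm
      obtain ⟨c, hc⟩ := h1.bddAbove_range
      refine ⟨c, fun n => ?_⟩
      rw [InnerProductSpace.toDual_apply_apply, ← inner_conj_symm, RCLike.norm_conj]
      exact hc ⟨n, rfl⟩
  exact ⟨c, fun n => by simpa using hc n⟩

/-- `y = ∫₀^∞ ψ(v) T_v x dv`, as a weak integral. -/
def IsSmear (T : ℝ → Elem M → Elem M) (ψ : ℝ → ℝ) (x y : Elem M) : Prop :=
  ∀ ξ η : K, inner ℂ ξ (y.1 η) =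
    ∫ v in Ioi (0 : ℝ), (ψ v : ℂ) * inner ℂ ξ ((T v x).1 η)

open Classical in
/-- The weak integral `∫₀^∞ ψ(v) T_v x dv`. -/
def smear (T : ℝ → Elem M → Elem M) (ψ : ℝ → ℝ) (x : Elem M) : Elem M :=
  if h : ∃ y, IsSmear T ψ x y then h.choose else 0

lemma poisson_eq_smear {s : ℝ} (hs : 0 < s) (x : Elem M) :
    poisson T s x = smear T (subordinator s) x := by
  rw [poisson, if_neg (not_le.2 hs)]
  rfl

lemma IsSmear.unique {ψ : ℝ → ℝ} {x y y' : Elem M} (h : IsSmear T ψ x y) (h' : IsSmear T ψ x y') :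
    y = y' :=
  Subtype.ext (eq_of_inner_eq fun w v => by rw [h w v, h' w v])

namespace IsMarkovSemigroup

variable (hT : IsMarkovSemigroup M τ T)
include hT

lemma norm_le {t : ℝ} (ht : 0 ≤ t) (x : Elem M) : ‖T t x‖ ≤ ‖x‖ := (hT.markov t ht).norm_le x

lemma continuousOn_normal {ω : ℬ(K) →ₗ[ℂ] ℂ} (hω : IsNormalFunctional ω) (x : Elem M) :
    ContinuousOn (fun t => ω (T t x).1) (Ici 0) := by
  intro t ht
  have h1 := hT.weakStarContinuous x t ht
  exact tendsto_ultraweak_iff.1 (tendsto_weakStar_iff.1 h1) ω hω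

/-- The orbit `v ↦ ω(T_v x)`, extended continuously to all real `v`. -/
lemma continuous_orbit {ω : ℬ(K) →ₗ[ℂ] ℂ} (hω : IsNormalFunctional ω) (x : Elem M) :
    Continuous fun t => ω (T (max 0 t) x).1 :=
  (hT.continuousOn_normal hω x).comp_continuous (by fun_prop) fun t => mem_Ici.2 (le_max_left _ _)

lemma norm_inner_le {t : ℝ} (ht : 0 ≤ t) (x : Elem M) (w v : K) :
    ‖inner ℂ w ((T t x).1 v)‖ ≤ ‖x‖ * (‖w‖ * ‖v‖) :=
  norm_inner_le_of_norm_le (hT.norm_le ht x) w v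

lemma aestronglyMeasurable_normal {ω : ℬ(K) →ₗ[ℂ] ℂ} (hω : IsNormalFunctional ω) (x : Elem M) :
    AEStronglyMeasurable (fun v => ω (T v x).1) (volume.restrict (Ioi (0 : ℝ))) :=
  ((hT.continuousOn_normal hω x).mono Ioi_subset_Ici_self).aestronglyMeasurable measurableSet_Ioi

lemma integrableOn_normal {ψ : ℝ → ℝ} (hψ : IntegrableOn ψ (Ioi 0))
    {ω : ℬ(K) →ₗ[ℂ] ℂ} (hω : IsNormalFunctional ω) (x : Elem M) :
    IntegrableOn (fun v => (ψ v : ℂ) * ω (T v x).1) (Ioi 0) := by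
  obtain ⟨c, hc0, hc⟩ := hω.exists_bound
  refine (Integrable.bdd_mul (c := c * ‖x‖) hψ.ofReal (hT.aestronglyMeasurable_normal hω x)
    ?_).congr (.of_forall fun v => mul_comm _ _)
  filter_upwards [ae_restrict_mem measurableSet_Ioi] with v hv
  refine (hc _).trans ?_
  gcongr
  exact hT.norm_le hv.out.le x

lemma exists_smear {ψ : ℝ → ℝ} (hψ : IntegrableOn ψ (Ioi 0)) (x : Elem M) :
    ∃ y, IsSmear T ψ x y := by
  have hint : ∀ ξ η : K, IntegrableOn
      (fun v => (ψ v : ℂ) * inner ℂ ξ ((T v x).1 η)) (Ioi 0) := fun ξ η =>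
    hT.integrableOn_normal hψ (isNormalFunctional_vector ξ η) x
  obtain ⟨Y, -, hY⟩ := exists_operator_of_form
    (fun ξ η : K => ∫ v in Ioi (0 : ℝ), (ψ v : ℂ) * inner ℂ ξ ((T v x).1 η))
    (c := (∫ v in Ioi (0 : ℝ), |ψ v|) * ‖x‖) (by
      have : 0 ≤ ∫ v in Ioi (0 : ℝ), |ψ v| := integral_nonneg fun v => abs_nonneg _
      positivity)
    (fun w v v' => by
      rw [← integral_add (hint _ _) (hint _ _)]
      refine integral_congr_ae (.of_forall fun r => ?_)
      simp only [map_add, inner_add_right]; ring)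
    (fun w a v => by
      rw [← integral_const_mul]
      refine integral_congr_ae (.of_forall fun r => ?_)
      simp only [map_smul, inner_smul_right]; ring)
    (fun w w' v => by
      rw [← integral_add (hint _ _) (hint _ _)]
      refine integral_congr_ae (.of_forall fun r => ?_)
      simp only [inner_add_left]; ring)
    (fun a w v => by
      rw [← integral_const_mul]
      refine integral_congr_ae (.of_forall fun r => ?_)
      simp only [inner_smul_left]; ring)
    (fun w v => by
      refine (norm_integral_le_integral_norm _).trans ?_
      rw [mul_assoc, ← integral_mul_const]
      refine setIntegral_mono_on (hint w v).norm (hψ.abs.mul_const _) measurableSet_Ioi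
        fun r hr => ?_
      rw [norm_mul, norm_real, norm_eq_abs]
      gcongr
      exact hT.norm_inner_le hr.out.le x w v)
  refine ⟨⟨Y, mem_of_commute fun z hz => eq_of_inner_eq fun w v => ?_⟩, hY⟩
  rw [mul_apply_eq_comp, mul_apply_eq_comp, ← adjoint_inner_left, hY, hY]
  refine setIntegral_congr_fun measurableSet_Ioi fun r _ => ?_
  rw [adjoint_inner_left]
  have := congrArg (fun A : ℬ(K) => inner ℂ w (A v)) (commute_of_mem (T r x).2 hz)
  simp only [mul_apply_eq_comp] at this
  rw [this]

lemma isSmear_smear {ψ : ℝ → ℝ} (hψ : IntegrableOn ψ (Ioi 0)) (x : Elem M) :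
    IsSmear T ψ x (smear T ψ x) := by
  rw [smear, dif_pos (hT.exists_smear hψ x)]
  exact (hT.exists_smear hψ x).choose_spec

lemma norm_smear_le {ψ : ℝ → ℝ} (hψ : IntegrableOn ψ (Ioi 0)) (x : Elem M) :
    ‖smear T ψ x‖ ≤ (∫ v in Ioi (0 : ℝ), |ψ v|) * ‖x‖ := by
  have h0 : 0 ≤ ∫ v in Ioi (0 : ℝ), |ψ v| := integral_nonneg fun v => abs_nonneg _
  refine norm_le_of_inner (X := (smear T ψ x).1) (by positivity) fun w v => ?_
  rw [hT.isSmear_smear hψ x w v]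
  refine (norm_integral_le_integral_norm _).trans ?_
  rw [mul_assoc, ← integral_mul_const]
  refine setIntegral_mono_on
    (hT.integrableOn_normal hψ (isNormalFunctional_vector w v) x).norm
    (hψ.abs.mul_const _) measurableSet_Ioi fun r hr => ?_
  rw [norm_mul, norm_real, norm_eq_abs]
  gcongr
  exact hT.norm_inner_le hr.out.le x w v

/-- Normal functionals commute with the weak integral. -/
lemma normal_smear {ψ : ℝ → ℝ} (hψ : IntegrableOn ψ (Ioi 0)) (x : Elem M)
    {ω : ℬ(K) →ₗ[ℂ] ℂ} (hω : IsNormalFunctional ω) :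
    ω (smear T ψ x).1
      = ∫ v in Ioi (0 : ℝ), (ψ v : ℂ) * ω (T v x).1 := by
  obtain ⟨ξ, η, hξ, hη, h⟩ := hω
  have hint : ∀ n, IntegrableOn
      (fun v => (ψ v : ℂ) * inner ℂ (η n) ((T v x).1 (ξ n))) (Ioi 0) := fun n =>
    hT.integrableOn_normal hψ (isNormalFunctional_vector (η n) (ξ n)) x
  have h1 := hasSum_integral_of_summable_integral_norm hint (by
    refine Summable.of_nonneg_of_le (fun n => integral_nonneg fun v => norm_nonneg _) (fun n => ?_)
      ((hξ.add hη).mul_left ((∫ v in Ioi (0 : ℝ), |ψ v|) * ‖x‖))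
    rw [mul_assoc, ← integral_mul_const]
    refine setIntegral_mono_on (hint n).norm (hψ.abs.mul_const _) measurableSet_Ioi fun r hr => ?_
    rw [norm_mul, norm_real, norm_eq_abs]
    gcongr
    refine (norm_inner_apply_le _ _ _).trans ?_
    gcongr
    exact hT.norm_le hr.out.le x)
  have h2 : ∀ n, ∫ v in Ioi (0 : ℝ), (ψ v : ℂ) * inner ℂ (η n) ((T v x).1 (ξ n))
      = inner ℂ (η n) ((smear T ψ x).1 (ξ n)) := fun n =>
    (hT.isSmear_smear hψ x (η n) (ξ n)).symm
  simp only [h2] at h1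
  rw [(h _).unique h1]
  refine setIntegral_congr_fun measurableSet_Ioi fun r _ => ?_
  exact ((h (T r x)).mul_left (ψ r : ℂ)).tsum_eq

lemma smear_add {ψ : ℝ → ℝ} (hψ : IntegrableOn ψ (Ioi 0)) (x y : Elem M) :
    smear T ψ (x + y) = smear T ψ x + smear T ψ y := by
  refine (hT.isSmear_smear hψ (x + y)).unique fun w v => ?_
  have h1 : IntegrableOn (fun r => (ψ r : ℂ) * inner ℂ w ((T r x).1 v)) (Ioi 0) :=
    hT.integrableOn_normal hψ (isNormalFunctional_vector w v) x
  have h2 : IntegrableOn (fun r => (ψ r : ℂ) * inner ℂ w ((T r y).1 v)) (Ioi 0) :=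
    hT.integrableOn_normal hψ (isNormalFunctional_vector w v) y
  have e : inner ℂ w ((smear T ψ x + smear T ψ y).1 v)
      = inner ℂ w ((smear T ψ x).1 v) + inner ℂ w ((smear T ψ y).1 v) := by
    rw [← inner_add_right]; rfl
  rw [e, hT.isSmear_smear hψ x w v, hT.isSmear_smear hψ y w v, ← integral_add h1 h2]
  refine setIntegral_congr_fun measurableSet_Ioi fun r hr => ?_
  rw [(hT.markov r hr.out.le).map_add, ← mul_add, ← inner_add_right]
  rfl

lemma smear_smul {ψ : ℝ → ℝ} (hψ : IntegrableOn ψ (Ioi 0)) (c : ℂ) (x : Elem M) :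
    smear T ψ (c • x) = c • smear T ψ x := by
  refine (hT.isSmear_smear hψ (c • x)).unique fun w v => ?_
  have e : inner ℂ w ((c • smear T ψ x).1 v)
      = c * inner ℂ w ((smear T ψ x).1 v) := by
    rw [← inner_smul_right]; rfl
  rw [e, hT.isSmear_smear hψ x w v, ← integral_const_mul]
  refine setIntegral_congr_fun measurableSet_Ioi fun r hr => ?_
  rw [(hT.markov r hr.out.le).map_smul, ← mul_assoc, mul_comm c, mul_assoc,
    ← inner_smul_right]
  rfl

/-- The operator `x ↦ ∫₀^∞ ψ(v) T_v x dv`. -/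
def smearCLM {ψ : ℝ → ℝ} (hψ : IntegrableOn ψ (Ioi 0)) : Elem M →L[ℂ] Elem M :=
  LinearMap.mkContinuous
    { toFun := smear T ψ
      map_add' := hT.smear_add hψ
      map_smul' := hT.smear_smul hψ } (∫ v in Ioi (0 : ℝ), |ψ v|) (hT.norm_smear_le hψ)

lemma smearCLM_apply {ψ : ℝ → ℝ} (hψ : IntegrableOn ψ (Ioi 0)) (x : Elem M) :
    hT.smearCLM hψ x = smear T ψ x := rfl

/-- The operator `T_t`, as a contraction. -/
def semigroupCLM {t : ℝ} (ht : 0 ≤ t) : Elem M →L[ℂ] Elem M :=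
  LinearMap.mkContinuous ((hT.markov t ht).linear.mk' (T t)) 1 (fun x => by
    rw [one_mul]; exact hT.norm_le ht x)

lemma semigroupCLM_apply {t : ℝ} (ht : 0 ≤ t) (x : Elem M) : hT.semigroupCLM ht x = T t x := rfl

lemma semigroup_semigroup {t s : ℝ} (ht : 0 ≤ t) (hs : 0 ≤ s) (x : Elem M) :
    T t (T s x) = T (s + t) x := by
  rw [hT.add t s ht hs]; rfl

lemma semigroup_comm {t s : ℝ} (ht : 0 ≤ t) (hs : 0 ≤ s) (x : Elem M) :
    T t (T s x) = T s (T t x) := by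
  rw [hT.semigroup_semigroup ht hs, hT.semigroup_semigroup hs ht, add_comm]

lemma semigroup_zero (x : Elem M) : T 0 x = x := by rw [hT.zero]; rfl

lemma semigroup_smear {ψ : ℝ → ℝ} (hψ : IntegrableOn ψ (Ioi 0)) {t : ℝ} (ht : 0 ≤ t)
    (x : Elem M) : T t (smear T ψ x) = smear T ψ (T t x) := by
  refine ((hT.isSmear_smear hψ (T t x)).unique fun w v => ?_).symm
  obtain ⟨ω, hω, h⟩ := (hT.markov t ht).exists_normal_comp (isNormalFunctional_vector w v)
  have h1 := h (smear T ψ x)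
  rw [vectorFunctional_apply, hT.normal_smear hψ x hω] at h1
  rw [h1]
  refine setIntegral_congr_fun measurableSet_Ioi fun r hr => ?_
  rw [← h, vectorFunctional_apply, hT.semigroup_comm ht hr.out.le]

lemma smear_nonneg {ψ : ℝ → ℝ} (hψ : IntegrableOn ψ (Ioi 0)) (hψ0 : ∀ v, 0 < v → 0 ≤ ψ v)
    {x : Elem M} (hx : 0 ≤ x.1) : 0 ≤ (smear T ψ x).1 := by
  refine nonneg_iff_inner.2 fun v => ?_
  rw [hT.isSmear_smear hψ x v v]
  have h1 : ∀ r ∈ Ioi (0 : ℝ), (ψ r : ℂ) * inner ℂ v ((T r x).1 v)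
      = ((ψ r * (inner ℂ v ((T r x).1 v)).re : ℝ) : ℂ) := by
    intro r hr
    have := nonneg_iff.1
      (nonneg_iff_inner.1 ((hT.markov r hr.out.le).map_nonneg hx) v)
    push_cast
    congr 1
    exact Complex.ext rfl this.2.symm
  rw [setIntegral_congr_fun measurableSet_Ioi h1, integral_complex_ofReal]
  refine zero_le_real.2 (setIntegral_nonneg measurableSet_Ioi fun r hr => ?_)
  exact mul_nonneg (hψ0 r hr) (nonneg_iff.1
    (nonneg_iff_inner.1 ((hT.markov r hr.out.le).map_nonneg hx) v)).1

lemma smear_star {ψ : ℝ → ℝ} (hψ : IntegrableOn ψ (Ioi 0)) (x : Elem M) :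
    smear T ψ (star x) = star (smear T ψ x) := by
  refine (hT.isSmear_smear hψ (star x)).unique fun w v => ?_
  have e : ∀ y : Elem M, inner ℂ w ((star y).1 v)
      = (starRingEnd ℂ) (inner ℂ v (y.1 w)) := by
    intro y
    have : (star y).1 = adjoint y.1 := rfl
    rw [this, adjoint_inner_right, inner_conj_symm]
  rw [e, hT.isSmear_smear hψ x v w, ← integral_conj]
  refine setIntegral_congr_fun measurableSet_Ioi fun r hr => ?_
  rw [(hT.markov r hr.out.le).map_star, e, map_mul, conj_ofReal]

/-! #### The Poisson semigroup -/

lemma norm_poisson_le {s : ℝ} (hs : 0 < s) (x : Elem M) : ‖poisson T s x‖ ≤ ‖x‖ := by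
  rw [poisson_eq_smear hs]
  refine (hT.norm_smear_le (integrableOn_subordinator hs) x).trans (le_of_eq ?_)
  have : ∫ v in Ioi (0 : ℝ), |subordinator s v| = 1 := by
    rw [← integral_subordinator hs]
    refine setIntegral_congr_fun measurableSet_Ioi fun v hv => ?_
    exact abs_of_nonneg (subordinator_nonneg hs.le hv)
  rw [this, one_mul]

lemma normal_poisson {s : ℝ} (hs : 0 < s) (x : Elem M) {ω : ℬ(K) →ₗ[ℂ] ℂ}
    (hω : IsNormalFunctional ω) : ω (poisson T s x).1
      = ∫ v in Ioi (0 : ℝ), (subordinator s v : ℂ) * ω (T v x).1 := by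
  rw [poisson_eq_smear hs, hT.normal_smear (integrableOn_subordinator hs) x hω]

lemma poisson_nonneg {s : ℝ} (hs : 0 < s) {x : Elem M} (hx : 0 ≤ x.1) :
    0 ≤ (poisson T s x).1 := by
  rw [poisson_eq_smear hs]
  exact hT.smear_nonneg (integrableOn_subordinator hs) (fun v hv => subordinator_nonneg hs.le hv) hx

lemma poisson_add {s : ℝ} (hs : 0 < s) (x y : Elem M) :
    poisson T s (x + y) = poisson T s x + poisson T s y := by
  simp only [poisson_eq_smear hs]
  exact hT.smear_add (integrableOn_subordinator hs) x y

lemma poisson_smul {s : ℝ} (hs : 0 < s) (c : ℂ) (x : Elem M) :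
    poisson T s (c • x) = c • poisson T s x := by
  simp only [poisson_eq_smear hs]
  exact hT.smear_smul (integrableOn_subordinator hs) c x

lemma poisson_sub {s : ℝ} (hs : 0 < s) (x y : Elem M) :
    poisson T s (x - y) = poisson T s x - poisson T s y := by
  rw [sub_eq_add_neg, ← neg_one_smul ℂ, hT.poisson_add hs, hT.poisson_smul hs, neg_one_smul,
    sub_eq_add_neg]

lemma poisson_star {s : ℝ} (hs : 0 < s) (x : Elem M) :
    poisson T s (star x) = star (poisson T s x) := by
  rw [poisson_eq_smear hs, poisson_eq_smear hs, hT.smear_star (integrableOn_subordinator hs)]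

lemma semigroup_poisson {s t : ℝ} (hs : 0 < s) (ht : 0 ≤ t) (x : Elem M) :
    T t (poisson T s x) = poisson T s (T t x) := by
  rw [poisson_eq_smear hs, poisson_eq_smear hs,
    hT.semigroup_smear (integrableOn_subordinator hs) ht]

/-- The semigroup property of the Poisson semigroup. -/
lemma poisson_poisson {s r : ℝ} (hs : 0 < s) (hr : 0 < r) (x : Elem M) :
    poisson T s (poisson T r x) = poisson T (s + r) x := by
  have h : IsSmear T (subordinator (s + r)) x (poisson T s (poisson T r x)) := by
    intro w v
    let g : ℝ → ℂ := fun t => inner ℂ w ((T (max 0 t) x).1 v)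
    have hg : Continuous g := hT.continuous_orbit (isNormalFunctional_vector w v) x
    have hgt : ∀ t, 0 ≤ t → g t = inner ℂ w ((T t x).1 v) := fun t ht => by
      simp only [g, max_eq_right ht]
    have h1 := integral_subordinator_convolution hs hr hg.aestronglyMeasurable fun t =>
      hT.norm_inner_le (le_max_left 0 t) x w v
    have h2 := hT.normal_poisson hs (poisson T r x) (isNormalFunctional_vector w v)
    rw [vectorFunctional_apply] at h2
    rw [h2]
    refine Eq.trans (setIntegral_congr_fun measurableSet_Ioi fun u (hu : 0 < u) => ?_) (h1.trans
      (setIntegral_congr_fun measurableSet_Ioi fun u (hu : 0 < u) => ?_))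
    · congr 1
      rw [hT.semigroup_poisson hr hu.le, hT.normal_poisson hr _ (isNormalFunctional_vector w v)]
      refine setIntegral_congr_fun measurableSet_Ioi fun t (ht : 0 < t) => ?_
      rw [hgt _ (by positivity), hT.semigroup_semigroup ht.le hu.le]
      rfl
    · rw [hgt u hu.le]
  rw [poisson_eq_smear (add_pos hs hr)]
  exact h.unique (hT.isSmear_smear (integrableOn_subordinator (add_pos hs hr)) x)

/-- Differentiation of the weak integral `∫₀^∞ φ_s(v) T_v x dv` in the parameter `s`. -/
lemma hasDerivAt_normal_smear {φ φ' : ℝ → ℝ → ℝ} {b : ℝ → ℝ} {s : ℝ} (hs : 0 < s)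
    (hφ : ∀ {r}, 0 < r → IntegrableOn (φ r) (Ioi 0)) (hφ' : IntegrableOn (φ' s) (Ioi 0))
    (hb : IntegrableOn b (Ioi 0))
    (hle : ∀ {r v}, s / 2 ≤ r → r ≤ 2 * s → 0 < v → |φ' r v| ≤ b v)
    (hd : ∀ {r v}, r ≠ 0 → 0 < v → HasDerivAt (fun r => φ r v) (φ' r v) r) (x : Elem M)
    {ω : ℬ(K) →ₗ[ℂ] ℂ} (hω : IsNormalFunctional ω) :
    HasDerivAt (fun r => ω (smear T (φ r) x).1) (ω (smear T (φ' s) x).1) s := by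
  obtain ⟨c, hc0, hc⟩ := hω.exists_bound
  have hmeas := hT.aestronglyMeasurable_normal hω x
  have h := hasDerivAt_integral_of_dominated_loc_of_deriv_le (μ := volume.restrict (Ioi (0 : ℝ)))
    (F := fun r v => (φ r v : ℂ) * ω (T v x).1) (F' := fun r v => (φ' r v : ℂ) * ω (T v x).1)
    (x₀ := s) (bound := fun v => b v * (c * ‖x‖))
    (Icc_mem_nhds (half_lt_self hs) (by linarith : s < 2 * s))
    (by
      filter_upwards [eventually_gt_nhds hs] with r hr
      exact ((hφ hr).ofReal.aestronglyMeasurable).mul hmeas)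
    (hT.integrableOn_normal (hφ hs) hω x) (hφ'.ofReal.aestronglyMeasurable.mul hmeas)
    (by
      filter_upwards [ae_restrict_mem measurableSet_Ioi] with v hv r hr
      rw [norm_mul, norm_real, norm_eq_abs]
      refine mul_le_mul (hle hr.1 hr.2 hv) ?_ (norm_nonneg _)
        ((abs_nonneg _).trans (hle hr.1 hr.2 hv))
      exact (hc _).trans (mul_le_mul_of_nonneg_left (hT.norm_le hv.out.le x) hc0))
    (hb.mul_const _)
    (by
      filter_upwards [ae_restrict_mem measurableSet_Ioi] with v hv r hr
      exact (hd ((half_pos hs).trans_le hr.1).ne' hv).ofReal_comp.mul_const _)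
  rw [hT.normal_smear hφ' x hω]
  refine h.2.congr_of_eventuallyEq ?_
  filter_upwards [eventually_gt_nhds hs] with r hr
  exact hT.normal_smear (hφ hr) x hω

/-- The weak derivative of `s ↦ P_s x`. -/
lemma hasDerivAt_normal_poisson {s : ℝ} (hs : 0 < s) (x : Elem M) {ω : ℬ(K) →ₗ[ℂ] ℂ}
    (hω : IsNormalFunctional ω) : HasDerivAt (fun r => ω (poisson T r x).1)
      (ω (smear T (subordinatorDeriv s) x).1) s := by
  refine (hT.hasDerivAt_normal_smear hs integrableOn_subordinator
    (integrableOn_subordinatorDeriv hs)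
    (((integrableOn_subordinator (half_pos hs)).const_mul (8 / s)).add
    ((integrableOn_subordinator_div (half_pos hs)).const_mul (4 * s)))
    (subordinatorDeriv_bound hs) hasDerivAt_subordinator x hω).congr_of_eventuallyEq ?_
  filter_upwards [eventually_gt_nhds hs] with r hr
  rw [poisson_eq_smear hr]

lemma hasDerivAt_normal_smear_deriv {s : ℝ} (hs : 0 < s) (x : Elem M) {ω : ℬ(K) →ₗ[ℂ] ℂ}
    (hω : IsNormalFunctional ω) :
    HasDerivAt (fun r => ω (smear T (subordinatorDeriv r) x).1)
      (ω (smear T (subordinatorDeriv₂ s) x).1) s :=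
  hT.hasDerivAt_normal_smear hs integrableOn_subordinatorDeriv (integrableOn_subordinatorDeriv₂ hs)
    (((integrableOn_subordinator_div_sq (half_pos hs)).const_mul (4 * s ^ 2)).add
    ((integrableOn_subordinator_div (half_pos hs)).const_mul 6))
    (subordinatorDeriv₂_bound hs) hasDerivAt_subordinatorDeriv x hω

lemma norm_smear_deriv_le {s : ℝ} (hs : 0 < s) (x : Elem M) :
    ‖smear T (subordinatorDeriv s) x‖ ≤ 2 / s * ‖x‖ :=
  (hT.norm_smear_le (integrableOn_subordinatorDeriv hs) x).trans
    (mul_le_mul_of_nonneg_right (integral_abs_subordinatorDeriv_le hs) (norm_nonneg x))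

lemma norm_smear_deriv₂_le {s : ℝ} (hs : 0 < s) (x : Elem M) :
    ‖smear T (subordinatorDeriv₂ s) x‖ ≤ 6 / s ^ 2 * ‖x‖ :=
  (hT.norm_smear_le (integrableOn_subordinatorDeriv₂ hs) x).trans
    (mul_le_mul_of_nonneg_right (integral_abs_subordinatorDeriv₂_le hs) (norm_nonneg x))

lemma continuousAt_smear_deriv {s : ℝ} (hs : 0 < s) (x : Elem M) :
    ContinuousAt (fun r => (smear T (subordinatorDeriv r) x).1) s := by
  have hlip : ∀ r ∈ Ioi (s / 2), ‖(smear T (subordinatorDeriv r) x).1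
      - smear T (subordinatorDeriv s) x‖ ≤ 6 / (s / 2) ^ 2 * ‖x‖ * ‖r - s‖ := by
    intro r hr
    refine norm_le_of_inner (by positivity) fun w v => ?_
    have h1 : ∀ q ∈ Ioi (s / 2), HasDerivWithinAt
        (fun r => inner ℂ w ((smear T (subordinatorDeriv r) x).1 v))
        (inner ℂ w ((smear T (subordinatorDeriv₂ q) x).1 v)) (Ioi (s / 2)) q :=
      fun q hq => (hT.hasDerivAt_normal_smear_deriv ((half_pos hs).trans hq) x
        (isNormalFunctional_vector w v)).hasDerivWithinAt
    have h2 := Convex.norm_image_sub_le_of_norm_hasDerivWithin_le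
      (C := 6 / (s / 2) ^ 2 * ‖x‖ * (‖w‖ * ‖v‖)) h1 (fun q hq => by
        have hq' : s / 2 < q := hq
        refine norm_inner_le_of_norm_le ?_ w v
        refine (hT.norm_smear_deriv₂_le ((half_pos hs).trans hq) x).trans ?_
        gcongr)
      (convex_Ioi _) (half_lt_self hs : s / 2 < s) hr
    rw [sub_apply, inner_sub_right]
    calc _ ≤ 6 / (s / 2) ^ 2 * ‖x‖ * (‖w‖ * ‖v‖) * ‖r - s‖ := h2
      _ = _ := by ring
  refine tendsto_iff_norm_sub_tendsto_zero.2 ?_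
  refine squeeze_zero' (.of_forall fun r => norm_nonneg _) ?_
    (g := fun r => 6 / (s / 2) ^ 2 * ‖x‖ * ‖r - s‖) ?_
  · filter_upwards [Ioi_mem_nhds (half_lt_self hs)] with r hr using hlip r hr
  · have : Tendsto (fun r : ℝ => 6 / (s / 2) ^ 2 * ‖x‖ * ‖r - s‖) (𝓝 s)
        (𝓝 (6 / (s / 2) ^ 2 * ‖x‖ * ‖s - s‖)) := Continuous.tendsto (by fun_prop) s
    simpa using this

/-- On `s > 0`, the function `s ↦ P_s x` is differentiable in norm. -/
lemma hasDerivAt_poisson {s : ℝ} (hs : 0 < s) (x : Elem M) :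
    HasDerivAt (fun r => (poisson T r x).1)
      (smear T (subordinatorDeriv s) x).1 s := by
  refine hasDerivAt_of_weak (X' := fun r => (smear T (subordinatorDeriv r) x).1) ?_
    (hT.continuousAt_smear_deriv hs x)
  filter_upwards [eventually_gt_nhds hs] with r hr w v
  exact hT.hasDerivAt_normal_poisson hr x (isNormalFunctional_vector w v)

lemma poissonDeriv_eq {s : ℝ} (hs : 0 < s) (x : Elem M) :
    poissonDeriv T s x = (smear T (subordinatorDeriv s) x).1 :=
  (hT.hasDerivAt_poisson hs x).deriv

lemma hasDerivAt_poisson' {s : ℝ} (hs : 0 < s) (x : Elem M) :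
    HasDerivAt (fun r => (poisson T r x).1) (poissonDeriv T s x) s := by
  rw [hT.poissonDeriv_eq hs]; exact hT.hasDerivAt_poisson hs x

lemma norm_poissonDeriv_le {s : ℝ} (hs : 0 < s) (x : Elem M) :
    ‖poissonDeriv T s x‖ ≤ 2 / s * ‖x‖ := by
  rw [hT.poissonDeriv_eq hs]; exact hT.norm_smear_deriv_le hs x

lemma continuousOn_poissonDeriv (x : Elem M) :
    ContinuousOn (fun s => poissonDeriv T s x) (Ioi 0) := by
  intro s hs
  refine ((hT.continuousAt_smear_deriv hs x).congr ?_).continuousWithinAt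
  filter_upwards [eventually_gt_nhds (mem_Ioi.1 hs)] with r hr
  exact (hT.poissonDeriv_eq hr x).symm

lemma poissonDeriv_add {s : ℝ} (hs : 0 < s) (x y : Elem M) :
    poissonDeriv T s (x + y) = poissonDeriv T s x + poissonDeriv T s y := by
  simp only [hT.poissonDeriv_eq hs]
  rw [hT.smear_add (integrableOn_subordinatorDeriv hs)]; rfl

lemma poissonDeriv_smul {s : ℝ} (hs : 0 < s) (c : ℂ) (x : Elem M) :
    poissonDeriv T s (c • x) = c • poissonDeriv T s x := by
  simp only [hT.poissonDeriv_eq hs]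
  rw [hT.smear_smul (integrableOn_subordinatorDeriv hs)]; rfl

/-- `P_s x → x` in the weak-* topology as `s → 0`. -/
lemma tendsto_poisson_zero (x : Elem M) : Tendsto (fun s => (poisson T s x).1) (𝓝[>] 0)
    (𝓝ᵤ x) := by
  rw [tendsto_ultraweak_iff]
  intro ω hω
  obtain ⟨c, hc0, hc⟩ := hω.exists_bound
  have h := tendsto_integral_subordinator (hT.continuousOn_normal hω x) (c := c * ‖x‖)
    fun v hv => (hc _).trans (mul_le_mul_of_nonneg_left (hT.norm_le hv x) hc0)
  rw [hT.semigroup_zero] at h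
  refine h.congr' ?_
  filter_upwards [self_mem_nhdsWithin] with s hs
  exact (hT.normal_poisson hs x hω).symm

/-- Poisson operators preserve the convergence of bounded sequences in the weak-* topology. -/
lemma tendsto_poisson_of_bounded {s c : ℝ} (hs : 0 < s) {I : Type*} {l : Filter I}
    [l.IsCountablyGenerated] {x : I → Elem M} {y : Elem M} (hc : ∀ᶠ i in l, ‖x i‖ ≤ c)
    (hx : Tendsto (fun i => (x i : ℬ(K))) l (𝓝ᵤ y)) :
    Tendsto (fun i => (poisson T s (x i)).1) l
      (𝓝ᵤ (poisson T s y)) := by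
  rw [tendsto_ultraweak_iff]
  intro ω hω
  obtain ⟨d, hd0, hd⟩ := hω.exists_bound
  simp only [hT.normal_poisson hs _ hω]
  refine tendsto_integral_filter_of_dominated_convergence (fun v => subordinator s v * (d * c))
    (.of_forall fun i => (hT.integrableOn_normal
      (integrableOn_subordinator hs) hω (x i)).aestronglyMeasurable) ?_
    ((integrableOn_subordinator hs).mul_const _) ?_
  · filter_upwards [hc] with i hi
    filter_upwards [ae_restrict_mem measurableSet_Ioi] with v hv
    rw [norm_mul, norm_real, norm_of_nonneg (subordinator_nonneg hs.le hv)]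
    refine mul_le_mul_of_nonneg_left ?_ (subordinator_nonneg hs.le hv)
    exact (hd _).trans (mul_le_mul_of_nonneg_left
      ((hT.norm_le hv.out.le _).trans hi) hd0)
  · filter_upwards [ae_restrict_mem measurableSet_Ioi] with v hv
    refine Tendsto.const_mul _ ?_
    exact tendsto_ultraweak_iff.1 ((hT.markov v hv.out.le).tendsto hx) ω hω

end IsMarkovSemigroup

/-! ### The generator on the test algebra -/

/-- Integrated heat equation: `∫₀ᵗ ∫ ∂_vφ_s(v) g(u + v) dv du = -∫ φ_s(v) (g(t + v) - g(v)) dv`. -/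
lemma integral_subordinatorDeriv₂_translate {s t c : ℝ} (hs : 0 < s) (ht : 0 ≤ t) {g : ℝ → ℂ}
    (hg : Continuous g) (hgc : ∀ v, ‖g v‖ ≤ c) :
    ∫ u in (0 : ℝ)..t, ∫ v in Ioi (0 : ℝ), (subordinatorDeriv₂ s v : ℂ) * g (u + v)
      = -∫ v in Ioi (0 : ℝ), (subordinator s v : ℂ) * (g (t + v) - g v) := by
  have hφ := (integrableOn_subordinator hs).ofReal (𝕜 := ℂ)
  have hφ₂ := (integrableOn_subordinatorDeriv₂ hs).ofReal (𝕜 := ℂ)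
  let W : ℝ → ℂ := fun v => ∫ u in (0 : ℝ)..t, g (u + v)
  have hW : ∀ v, HasDerivAt W (g (t + v) - g v) v := by
    intro v
    have h1 : ∀ x, HasDerivAt (fun y => ∫ u in (0 : ℝ)..y, g u) (g x) x := fun x =>
      intervalIntegral.integral_hasDerivAt_right (hg.intervalIntegrable _ _)
        hg.stronglyMeasurable.stronglyMeasurableAtFilter hg.continuousAt
    have h2 := ((h1 (t + v)).scomp v ((hasDerivAt_id v).const_add t)).sub (h1 v)
    refine (h2.congr_deriv (by simp)).congr_of_eventuallyEq (.of_forall fun x => ?_)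
    have h3 : W x = ∫ u in x..(t + x), g u := by
      simp only [W]
      rw [intervalIntegral.integral_comp_add_right (f := g), zero_add]
    rw [h3, ← intervalIntegral.integral_interval_sub_left (hg.intervalIntegrable _ _)
      (hg.intervalIntegrable 0 x)]
    rfl
  have hWc : ∀ v, ‖W v‖ ≤ c * t := by
    intro v
    have := intervalIntegral.norm_integral_le_of_norm_le_const (a := 0) (b := t) (C := c)
      (f := fun u => g (u + v)) fun x _ => hgc _
    rwa [sub_zero, abs_of_nonneg ht] at this
  have hWcont : Continuous W := continuous_iff_continuousAt.2 fun v => (hW v).continuousAt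
  have hint : Integrable (Function.uncurry fun u v => (subordinatorDeriv₂ s v : ℂ) * g (u + v))
      ((volume.restrict (Set.uIoc 0 t)).prod (volume.restrict (Ioi 0))) := by
    have h1 : Integrable (fun _ : ℝ => c) (volume.restrict (Set.uIoc 0 t)) := by
      refine (intervalIntegrable_iff.1 ?_ : IntegrableOn (fun _ : ℝ => c) (Set.uIoc 0 t) volume)
      exact intervalIntegrable_const
    refine (h1.mul_prod (integrableOn_subordinatorDeriv₂ hs).abs).mono' ?_ ?_
    · exact (hφ₂.aestronglyMeasurable.comp_snd).mul
        (hg.comp (continuous_fst.add continuous_snd)).aestronglyMeasurable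
    · refine Eventually.of_forall fun z => ?_
      simp only [Function.uncurry]
      rw [norm_mul, norm_real, norm_eq_abs, mul_comm]
      exact mul_le_mul_of_nonneg_right (hgc _) (abs_nonneg _)
  rw [intervalIntegral_integral_swap hint]
  have h1 : ∀ v, ∫ u in (0 : ℝ)..t, (subordinatorDeriv₂ s v : ℂ) * g (u + v)
      = W v * (subordinatorDeriv₂ s v : ℂ) := fun v => by
    rw [intervalIntegral.integral_const_mul, mul_comm]
  simp only [h1]
  have h0 : ∀ {l : Filter ℝ}, Tendsto (subordinator s) l (𝓝 0) →
      Tendsto (W * fun v => (subordinator s v : ℂ)) l (𝓝 0) := by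
    intro l hl
    rw [tendsto_zero_iff_norm_tendsto_zero]
    refine squeeze_zero (fun _ => norm_nonneg _) (g := fun v => c * t * |subordinator s v|)
      (fun v => ?_) ?_
    · rw [Pi.mul_apply, norm_mul, norm_real, norm_eq_abs]
      exact mul_le_mul_of_nonneg_right (hWc v) (abs_nonneg _)
    · simpa using (hl.abs.const_mul (c * t))
  have h2 := integral_Ioi_mul_deriv_eq_deriv_mul (a := 0) (u := W)
    (u' := fun v => g (t + v) - g v) (v := fun v => (subordinator s v : ℂ))
    (v' := fun v => (subordinatorDeriv₂ s v : ℂ)) (fun v _ => hW v)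
    (fun v hv => (hasDerivAt_subordinator_right (mem_Ioi.1 hv)).ofReal_comp)
    (hφ₂.bdd_mul (c := c * t) hWcont.aestronglyMeasurable (.of_forall hWc))
    (hφ.bdd_mul (c := c + c) (Continuous.aestronglyMeasurable (by fun_prop))
      (.of_forall fun v => (norm_sub_le _ _).trans (add_le_add (hgc _) (hgc _))))
    (h0 (tendsto_subordinator_zero hs)) (h0 (tendsto_subordinator_atTop hs))
  rw [h2, sub_zero, zero_sub]
  congr 1
  exact integral_congr_ae (.of_forall fun v => mul_comm _ _)

lemma IsGeneratorAt.unique {f y y' : Elem M} (h : IsGeneratorAt T f y) (h' : IsGeneratorAt T f y') :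
    y = y' :=
  Subtype.ext (ultraweak_unique (tendsto_weakStar_iff.1 h) (tendsto_weakStar_iff.1 h'))

lemma IsGeneratorAt.generator_eq {f y : Elem M} (h : IsGeneratorAt T f y) : generator T f = y := by
  have h1 : ∃ y, IsGeneratorAt T f y := ⟨y, h⟩
  rw [generator, dif_pos h1]
  exact h1.choose_spec.unique h

lemma isGeneratorAt_of_norm {f y : Elem M}
    (h : Tendsto (fun t : ℝ => ((t⁻¹ : ℝ) : ℂ) • (f - T t f)) (𝓝[>] 0) (𝓝 y)) :
    IsGeneratorAt T f y :=
  tendsto_weakStar_iff.2 (tendsto_ultraweak_of_norm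
    ((continuous_subtype_val.tendsto y).comp h))

namespace IsMarkovSemigroup

variable (hT : IsMarkovSemigroup M τ T)
include hT

/-- `∂_s P_s f = -P_s A^{1/2} f` on the domain of `A^{1/2}`. -/
lemma poissonDeriv_of_isGeneratorAt {f y : Elem M} (h : IsGeneratorAt (poisson T) f y) {s : ℝ}
    (hs : 0 < s) : poissonDeriv T s f = -(poisson T s y : ℬ(K)) := by
  obtain ⟨r, hpos, hlim⟩ : ∃ r : ℕ → ℝ, (∀ n, 0 < r n) ∧ Tendsto r atTop (𝓝[>] 0) :=
    ⟨fun n => 1 / ((n : ℝ) + 1), fun n => by positivity,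
      tendsto_nhdsWithin_iff.2 ⟨tendsto_one_div_add_atTop_nhds_zero_nat,
        Eventually.of_forall fun n => mem_Ioi.2 (by positivity)⟩⟩
  obtain ⟨D, hDe⟩ : ∃ D : ℕ → Elem M, ∀ n, D n = (((r n)⁻¹ : ℝ) : ℂ) • (f - poisson T (r n) f) :=
    ⟨_, fun n => rfl⟩
  have hD : Tendsto (fun n => (D n : ℬ(K))) atTop (𝓝ᵤ y) := by
    simp only [hDe]
    exact (tendsto_weakStar_iff.1 h).comp hlim
  obtain ⟨c, hc⟩ := bounded_of_weak hD
  have hc' : ∀ᶠ n in atTop, ‖D n‖ ≤ c := Eventually.of_forall hc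
  have h1 := hT.tendsto_poisson_of_bounded hs hc' hD
  have h2 : Tendsto (fun n => (poisson T s (D n)).1) atTop
      (𝓝 (-poissonDeriv T s f)) := by
    have h3 := (hT.hasDerivAt_poisson' hs f).tendsto_slope_zero_right
    refine (h3.comp hlim).neg.congr fun n => ?_
    have e : ∀ (c : ℝ) (x y : Elem M), ((c : ℂ) • (x - y)).1
        = -(c • (y.1 - x)) := fun c x y => by
      rw [← smul_neg, neg_sub, ← coe_smul]; rfl
    rw [hDe, hT.poisson_smul hs, hT.poisson_sub hs, hT.poisson_poisson hs (hpos n), e]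
    rfl
  have h4 := ultraweak_unique h1 (tendsto_ultraweak_of_norm h2)
  rw [h4, neg_neg]

lemma smear_deriv_of_isGeneratorAt {f y : Elem M} (h : IsGeneratorAt (poisson T) f y) {s : ℝ}
    (hs : 0 < s) : (smear T (subordinatorDeriv s) f).1 = -(poisson T s y : ℬ(K)) := by
  rw [← hT.poissonDeriv_eq hs, hT.poissonDeriv_of_isGeneratorAt h hs]

/-- `∂_s² P_s f = P_s A f`. -/
lemma smear_deriv₂_of_isGeneratorAt {f y z : Elem M} (h : IsGeneratorAt (poisson T) f y)
    (h' : IsGeneratorAt (poisson T) y z) {s : ℝ} (hs : 0 < s) :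
    smear T (subordinatorDeriv₂ s) f = poisson T s z := by
  refine Subtype.ext (eq_of_inner_eq fun w v => ?_)
  have h1 := hT.hasDerivAt_normal_smear_deriv hs f (isNormalFunctional_vector w v)
  have h2 := (hT.hasDerivAt_normal_poisson hs y (isNormalFunctional_vector w v)).neg
  rw [hT.smear_deriv_of_isGeneratorAt h' hs] at h2
  have h3 := h1.unique (h2.congr_of_eventuallyEq (by
    filter_upwards [eventually_gt_nhds hs] with r hr
    rw [hT.smear_deriv_of_isGeneratorAt h hr]
    exact map_neg _ _))
  simpa using h3

/-- The orbits of `f` in the domain of `A` are integrals: `T_t f = f - ∫₀ᵗ T_u A f du`. -/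
lemma normal_orbit {f y z : Elem M} (h : IsGeneratorAt (poisson T) f y)
    (h' : IsGeneratorAt (poisson T) y z) {t : ℝ} (ht : 0 ≤ t) {ω : ℬ(K) →ₗ[ℂ] ℂ}
    (hω : IsNormalFunctional ω) : ω (T t f).1
      = ω f.1 - ∫ u in (0 : ℝ)..t, ω (T (max 0 u) z).1 := by
  obtain ⟨c, hc0, hc⟩ := hω.exists_bound
  let g : ℝ → ℂ := fun v => ω (T (max 0 v) f).1
  have hg : Continuous g := hT.continuous_orbit hω f
  have hgc : ∀ v, ‖g v‖ ≤ c * ‖f‖ := fun v =>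
    (hc _).trans (mul_le_mul_of_nonneg_left (hT.norm_le (le_max_left _ _) f) hc0)
  have key : ∀ s : ℝ, 0 < s → ∫ u in (0 : ℝ)..t, ω (poisson T s (T (max 0 u) z)).1
      = ω (poisson T s f).1 - ω (poisson T s (T t f)).1 := by
    intro s hs
    have h1 := integral_subordinatorDeriv₂_translate hs ht hg hgc
    have h2 : ∀ u ∈ uIcc 0 t,
        ∫ v in Ioi (0 : ℝ), (subordinatorDeriv₂ s v : ℂ) * g (u + v)
          = ω (poisson T s (T (max 0 u) z)).1 := by
      intro u hu
      rw [uIcc_of_le ht] at hu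
      rw [max_eq_right hu.1, ← hT.semigroup_poisson hs hu.1,
        ← hT.smear_deriv₂_of_isGeneratorAt h h' hs,
        hT.semigroup_smear (integrableOn_subordinatorDeriv₂ hs) hu.1,
        hT.normal_smear (integrableOn_subordinatorDeriv₂ hs) _ hω]
      refine setIntegral_congr_fun measurableSet_Ioi fun v hv => ?_
      have hv' : (0 : ℝ) < v := hv
      have hu' := hu.1
      simp only [g]
      rw [max_eq_right (by positivity), hT.semigroup_semigroup hv'.le hu.1]
    rw [intervalIntegral.integral_congr h2] at h1
    rw [h1, hT.normal_poisson hs _ hω, hT.normal_poisson hs _ hω,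
      ← integral_sub (hT.integrableOn_normal (integrableOn_subordinator hs) hω f)
        (hT.integrableOn_normal (integrableOn_subordinator hs) hω (T t f)), ← integral_neg]
    refine setIntegral_congr_fun measurableSet_Ioi fun v hv => ?_
    have hv' : (0 : ℝ) < v := hv
    simp only [g]
    rw [max_eq_right (by positivity), max_eq_right hv'.le, hT.semigroup_semigroup hv'.le ht]
    ring
  have hl : Tendsto (fun s : ℝ => ∫ u in (0 : ℝ)..t, ω (poisson T s (T (max 0 u) z)).1)
      (𝓝[>] 0) (𝓝 (∫ u in (0 : ℝ)..t, ω (T (max 0 u) z).1)) := by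
    refine intervalIntegral.tendsto_integral_filter_of_dominated_convergence
      (fun _ => c * ‖z‖) ?_ ?_ intervalIntegrable_const ?_
    · filter_upwards [self_mem_nhdsWithin] with s hs
      have : ∀ u, ω (poisson T s (T (max 0 u) z)).1
          = ω (T (max 0 u) (poisson T s z)).1 := fun u => by
        rw [hT.semigroup_poisson hs (le_max_left _ _)]
      simp only [this]
      exact (hT.continuous_orbit hω _).aestronglyMeasurable
    · filter_upwards [self_mem_nhdsWithin] with s hs
      refine Eventually.of_forall fun u _ => (hc _).trans (mul_le_mul_of_nonneg_left ?_ hc0)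
      exact (hT.norm_poisson_le hs _).trans (hT.norm_le (le_max_left _ _) z)
    · exact Eventually.of_forall fun u _ =>
        tendsto_ultraweak_iff.1 (hT.tendsto_poisson_zero (T (max 0 u) z)) ω hω
  have hr := (tendsto_ultraweak_iff.1 (hT.tendsto_poisson_zero f) ω hω).sub
    (tendsto_ultraweak_iff.1 (hT.tendsto_poisson_zero (T t f)) ω hω)
  have := tendsto_nhds_unique hl (hr.congr' (by
    filter_upwards [self_mem_nhdsWithin] with s hs using (key s hs).symm))
  rw [this]; ring

lemma isGeneratorAt_of_sqrt {f y z : Elem M} (h : IsGeneratorAt (poisson T) f y)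
    (h' : IsGeneratorAt (poisson T) y z) : IsGeneratorAt T f z := by
  refine tendsto_weakStar_iff.2 (tendsto_ultraweak_iff.2 fun ω hω => ?_)
  have hg := hT.continuous_orbit hω z
  have h1 : HasDerivAt (fun t => ∫ u in (0 : ℝ)..t, ω (T (max 0 u) z).1)
      (ω (T (max 0 0) z).1) 0 :=
    intervalIntegral.integral_hasDerivAt_right (hg.intervalIntegrable _ _)
      hg.stronglyMeasurable.stronglyMeasurableAtFilter hg.continuousAt
  rw [max_self, hT.semigroup_zero] at h1
  refine h1.tendsto_slope_zero_right.congr' ?_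
  filter_upwards [self_mem_nhdsWithin] with t ht
  have e : (((t⁻¹ : ℝ) : ℂ) • (f - T t f)).1
      = ((t⁻¹ : ℝ) : ℂ) • (f.1 - (T t f).1) := rfl
  rw [e, map_smul, map_sub, hT.normal_orbit h h' (mem_Ioi.1 ht).le hω, zero_add,
    intervalIntegral.integral_same, ← coe_smul]
  congr 1
  ring

end IsMarkovSemigroup

/-! #### Generators on the test algebra -/

namespace IsTestAlgebra

variable (hS : IsTestAlgebra τ T S)
include hS

lemma sqrt_mem {f : Elem M} (hf : f ∈ S) : sqrtGenerator T f ∈ S := by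
  obtain ⟨y, hy, h⟩ := hS.sqrtGenerator_mem f hf
  rwa [sqrtGenerator, h.generator_eq]

lemma isGeneratorAt_sqrt {f : Elem M} (hf : f ∈ S) :
    IsGeneratorAt (poisson T) f (sqrtGenerator T f) := by
  obtain ⟨y, hy, h⟩ := hS.sqrtGenerator_mem f hf
  rwa [sqrtGenerator, h.generator_eq]

variable (hT : IsMarkovSemigroup M τ T)
include hT

lemma isGeneratorAt {f : Elem M} (hf : f ∈ S) : IsGeneratorAt T f (generator T f) := by
  have h := hT.isGeneratorAt_of_sqrt (hS.isGeneratorAt_sqrt hf)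
    (hS.isGeneratorAt_sqrt (hS.sqrt_mem hf))
  rwa [h.generator_eq]

lemma generator_eq_sqrt {f : Elem M} (hf : f ∈ S) :
    generator T f = sqrtGenerator T (sqrtGenerator T f) :=
  (hT.isGeneratorAt_of_sqrt (hS.isGeneratorAt_sqrt hf)
    (hS.isGeneratorAt_sqrt (hS.sqrt_mem hf))).generator_eq

lemma generator_mem {f : Elem M} (hf : f ∈ S) : generator T f ∈ S := by
  rw [hS.generator_eq_sqrt hT hf]; exact hS.sqrt_mem (hS.sqrt_mem hf)

lemma normal_orbit {f : Elem M} (hf : f ∈ S) {t : ℝ} (ht : 0 ≤ t) {ω : ℬ(K) →ₗ[ℂ] ℂ}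
    (hω : IsNormalFunctional ω) : ω (T t f).1
      = ω f.1 - ∫ u in (0 : ℝ)..t, ω (T (max 0 u) (generator T f)).1 := by
  rw [hS.generator_eq_sqrt hT hf]
  exact hT.normal_orbit (hS.isGeneratorAt_sqrt hf) (hS.isGeneratorAt_sqrt (hS.sqrt_mem hf)) ht hω

lemma semigroup_mem' {f : Elem M} (hf : f ∈ S) {t : ℝ} (ht : 0 ≤ t) : T t f ∈ S := by
  rcases ht.eq_or_lt with rfl | ht
  · rwa [hT.semigroup_zero]
  · exact hS.semigroup_mem t ht f hf

lemma norm_sub_le {f : Elem M} (hf : f ∈ S) {t : ℝ} (ht : 0 ≤ t) :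
    ‖f - T t f‖ ≤ t * ‖generator T f‖ := by
  refine norm_le_of_inner (X := (f - T t f).1) (by positivity)
    fun w v => ?_
  have h1 := hS.normal_orbit hT hf ht (isNormalFunctional_vector w v)
  have e : inner ℂ w ((f - T t f).1 v)
      = inner ℂ w (f.1 v) - inner ℂ w ((T t f).1 v) := by
    rw [← inner_sub_right]; rfl
  simp only [vectorFunctional_apply] at h1
  rw [e, h1, sub_sub_cancel]
  have h2 := intervalIntegral.norm_integral_le_of_norm_le_const (a := 0) (b := t)
    (C := ‖generator T f‖ * (‖w‖ * ‖v‖))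
    (f := fun u => inner ℂ w ((T (max 0 u) (generator T f)).1 v)) fun u _ => by
      refine (norm_inner_le_norm _ _).trans ?_
      have := ((T (max 0 u) (generator T f)).1.le_opNorm v).trans
        (mul_le_mul_of_nonneg_right (hT.norm_le (le_max_left 0 u) (generator T f)) (norm_nonneg v))
      calc ‖w‖ * ‖(T (max 0 u) (generator T f)).1 v‖
          ≤ ‖w‖ * (‖generator T f‖ * ‖v‖) := by gcongr
        _ = _ := by ring
  rw [sub_zero, abs_of_nonneg ht] at h2
  linarith

lemma norm_sub_sub_le {f : Elem M} (hf : f ∈ S) {t : ℝ} (ht : 0 ≤ t) :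
    ‖f - T t f - (t : ℂ) • generator T f‖ ≤ t ^ 2 * ‖generator T (generator T f)‖ := by
  refine norm_le_of_inner
    (X := (f - T t f - (t : ℂ) • generator T f).1) (by positivity)
    fun w v => ?_
  have h1 := hS.normal_orbit hT hf ht (isNormalFunctional_vector w v)
  have e : inner ℂ w ((f - T t f - (t : ℂ) • generator T f).1 v)
      = inner ℂ w (f.1 v) - inner ℂ w ((T t f).1 v)
        - t * inner ℂ w ((generator T f).1 v) := by
    rw [← inner_sub_right, ← inner_smul_right, ← inner_sub_right]; rfl
  simp only [vectorFunctional_apply] at h1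
  have hi : IntervalIntegrable
      (fun u => inner ℂ w ((T (max 0 u) (generator T f)).1 v)) volume 0 t :=
    (hT.continuous_orbit (isNormalFunctional_vector w v) _).intervalIntegrable _ _
  have e2 : (t : ℂ) * inner ℂ w ((generator T f).1 v)
      = ∫ _u in (0 : ℝ)..t, inner ℂ w ((generator T f).1 v) := by
    rw [intervalIntegral.integral_const, sub_zero, ← coe_smul, smul_eq_mul]
  rw [e, h1, sub_sub_cancel, e2, ← intervalIntegral.integral_sub hi intervalIntegrable_const]
  have h2 := intervalIntegral.norm_integral_le_of_norm_le_const (a := 0) (b := t)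
    (C := t * ‖generator T (generator T f)‖ * (‖w‖ * ‖v‖))
    (f := fun u => inner ℂ w ((T (max 0 u) (generator T f)).1 v)
      - inner ℂ w ((generator T f).1 v)) fun u hu => by
      rw [Set.uIoc_of_le ht] at hu
      rw [max_eq_right hu.1.le, ← inner_sub_right, ← sub_apply]
      refine (norm_inner_le_norm _ _).trans ?_
      have h3 : ‖(T u (generator T f)).1 - generator T f‖
          ≤ t * ‖generator T (generator T f)‖ := by
        rw [norm_sub_rev]
        refine (hS.norm_sub_le hT (hS.generator_mem hT hf) hu.1.le).trans ?_
        gcongr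
        exact hu.2
      have := ((T u (generator T f) - generator T f : ℬ(K)).le_opNorm v).trans
        (mul_le_mul_of_nonneg_right h3 (norm_nonneg v))
      calc ‖w‖ * ‖((T u (generator T f)).1 - generator T f) v‖
          ≤ ‖w‖ * (t * ‖generator T (generator T f)‖ * ‖v‖) := by gcongr
        _ = _ := by ring
  rw [sub_zero, abs_of_nonneg ht] at h2
  refine h2.trans (le_of_eq ?_)
  ring

/-- On the test algebra, the generator is a limit in norm. -/
lemma tendsto_generator {f : Elem M} (hf : f ∈ S) :
    Tendsto (fun t : ℝ => ((t⁻¹ : ℝ) : ℂ) • (f - T t f)) (𝓝[>] 0) (𝓝 (generator T f)) := by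
  rw [tendsto_iff_norm_sub_tendsto_zero]
  refine squeeze_zero' (.of_forall fun _ => norm_nonneg _)
    (g := fun t => t * ‖generator T (generator T f)‖) ?_ ?_
  · filter_upwards [self_mem_nhdsWithin] with t ht
    have ht' : (0 : ℝ) < t := ht
    have htc : (t : ℂ) ≠ 0 := by exact_mod_cast ht'.ne'
    have e : ((t⁻¹ : ℝ) : ℂ) • (f - T t f) - generator T f
        = ((t⁻¹ : ℝ) : ℂ) • (f - T t f - (t : ℂ) • generator T f) := by
      rw [smul_sub _ (f - T t f), smul_smul, Complex.ofReal_inv, inv_mul_cancel₀ htc, one_smul]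
    rw [e, norm_smul, norm_real, norm_inv, norm_of_nonneg ht'.le]
    calc t⁻¹ * ‖f - T t f - (t : ℂ) • generator T f‖
        ≤ t⁻¹ * (t ^ 2 * ‖generator T (generator T f)‖) := by
          gcongr; exact hS.norm_sub_sub_le hT hf ht'.le
      _ = _ := by field_simp
  · have : Tendsto (fun t : ℝ => t * ‖generator T (generator T f)‖) (𝓝 0)
        (𝓝 (0 * ‖generator T (generator T f)‖)) := Continuous.tendsto (by fun_prop) 0
    rw [zero_mul] at this
    exact this.mono_left nhdsWithin_le_nhds

lemma generator_add {f g : Elem M} (hf : f ∈ S) (hg : g ∈ S) :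
    generator T (f + g) = generator T f + generator T g := by
  refine (isGeneratorAt_of_norm (((hS.tendsto_generator hT hf).add
    (hS.tendsto_generator hT hg)).congr' ?_)).generator_eq
  filter_upwards [self_mem_nhdsWithin] with t ht
  rw [(hT.markov t (mem_Ioi.1 ht).le).map_add]
  module

lemma generator_smul {f : Elem M} (hf : f ∈ S) (c : ℂ) :
    generator T (c • f) = c • generator T f := by
  refine (isGeneratorAt_of_norm
    (((hS.tendsto_generator hT hf).const_smul c).congr' ?_)).generator_eq
  filter_upwards [self_mem_nhdsWithin] with t ht
  rw [(hT.markov t (mem_Ioi.1 ht).le).map_smul]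
  module

lemma generator_star {f : Elem M} (hf : f ∈ S) :
    generator T (star f) = star (generator T f) := by
  refine (isGeneratorAt_of_norm (((hS.tendsto_generator hT hf).star).congr' ?_)).generator_eq
  filter_upwards [self_mem_nhdsWithin] with t ht
  rw [(hT.markov t (mem_Ioi.1 ht).le).map_star, star_smul, star_sub]
  congr 1
  exact conj_ofReal _

lemma generator_semigroup {f : Elem M} (hf : f ∈ S) {t : ℝ} (ht : 0 ≤ t) :
    generator T (T t f) = T t (generator T f) := by
  refine (isGeneratorAt_of_norm ((((hT.semigroupCLM ht).continuous.tendsto _).comp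
    (hS.tendsto_generator hT hf)).congr' ?_)).generator_eq
  filter_upwards [self_mem_nhdsWithin] with r hr
  simp only [Function.comp, hT.semigroupCLM_apply ht]
  rw [(hT.markov t ht).map_smul, (hT.markov t ht).map_sub, hT.semigroup_comm ht (mem_Ioi.1 hr).le]

lemma generator_poisson {f : Elem M} (hf : f ∈ S) {s : ℝ} (hs : 0 < s) :
    generator T (poisson T s f) = poisson T s (generator T f) := by
  have hs' := integrableOn_subordinator hs
  have e : ∀ x, hT.smearCLM hs' x = poisson T s x := fun x => by
    rw [hT.smearCLM_apply, poisson_eq_smear hs]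
  rw [← e (generator T f)]
  refine (isGeneratorAt_of_norm ((((hT.smearCLM hs').continuous.tendsto _).comp
    (hS.tendsto_generator hT hf)).congr' ?_)).generator_eq
  filter_upwards [self_mem_nhdsWithin] with r hr
  rw [Function.comp, map_smul, map_sub, e, e, hT.semigroup_poisson hs (mem_Ioi.1 hr).le]

lemma poissonDeriv_eq {f : Elem M} (hf : f ∈ S) {s : ℝ} (hs : 0 < s) :
    poissonDeriv T s f = -(poisson T s (sqrtGenerator T f) : ℬ(K)) :=
  hT.poissonDeriv_of_isGeneratorAt (hS.isGeneratorAt_sqrt hf) hs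

lemma smear_deriv₂_eq {f : Elem M} (hf : f ∈ S) {s : ℝ} (hs : 0 < s) :
    smear T (subordinatorDeriv₂ s) f = poisson T s (generator T f) := by
  rw [hS.generator_eq_sqrt hT hf]
  exact hT.smear_deriv₂_of_isGeneratorAt (hS.isGeneratorAt_sqrt hf)
    (hS.isGeneratorAt_sqrt (hS.sqrt_mem hf)) hs

lemma norm_semigroup_sub_le {f : Elem M} (hf : f ∈ S) {t u : ℝ} (ht : 0 ≤ t) (hu : 0 ≤ u) :
    ‖T t f - T u f‖ ≤ |t - u| * ‖generator T f‖ := by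
  wlog h : u ≤ t generalizing t u
  · rw [norm_sub_rev, abs_sub_comm]; exact this hu ht (not_le.1 h).le
  have e : T t f - T u f = -T u (f - T (t - u) f) := by
    rw [(hT.markov u hu).map_sub, hT.semigroup_semigroup hu (sub_nonneg.2 h), sub_add_cancel,
      neg_sub]
  rw [e, norm_neg, abs_of_nonneg (sub_nonneg.2 h)]
  exact (hT.norm_le hu _).trans (hS.norm_sub_le hT hf (sub_nonneg.2 h))

lemma continuousOn_semigroup {f : Elem M} (hf : f ∈ S) :
    ContinuousOn (fun t => T t f) (Ici 0) := by
  refine LipschitzOnWith.continuousOn (K := ‖generator T f‖₊) ?_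
  refine LipschitzOnWith.of_dist_le_mul fun t ht u hu => ?_
  rw [dist_eq_norm, Real.dist_eq, mul_comm]
  exact hS.norm_semigroup_sub_le hT hf ht hu

/-- On the test algebra, `∂_t T_t f = -T_t A f` in norm. -/
lemma hasDerivAt_semigroup {f : Elem M} (hf : f ∈ S) {t : ℝ} (ht : 0 < t) :
    HasDerivAt (fun r => (T r f).1) (-(T t (generator T f)).1) t := by
  refine hasDerivAt_of_weak (X' := fun r => -(T r (generator T f)).1) ?_ ?_
  · filter_upwards [eventually_gt_nhds ht] with r hr w v
    have hg := hT.continuous_orbit (isNormalFunctional_vector w v) (generator T f)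
    have h1 := (intervalIntegral.integral_hasDerivAt_right (a := 0) (b := r)
      (hg.intervalIntegrable _ _)
      hg.stronglyMeasurable.stronglyMeasurableAtFilter hg.continuousAt).const_sub
        (vectorFunctional w v f.1)
    rw [max_eq_right hr.le] at h1
    refine (h1.congr_deriv ?_).congr_of_eventuallyEq ?_
    · rw [vectorFunctional_apply, neg_apply, inner_neg_right]
    · filter_upwards [eventually_gt_nhds hr] with q hq
      exact hS.normal_orbit hT hf hq.le (isNormalFunctional_vector w v)
  · refine ContinuousAt.neg (continuous_subtype_val.continuousAt.comp ?_)
    exact (hS.continuousOn_semigroup hT (hS.generator_mem hT hf)).continuousAt (Ici_mem_nhds ht)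

end IsTestAlgebra

/-! ### The curvature condition -/

/-- The functional `x ↦ Re ⟨v, x v⟩`. -/
def vectorState (v : K) : Elem M →L[ℝ] ℝ := Complex.reCLM ∘L
  ((innerSL ℂ v ∘L (ContinuousLinearMap.apply ℂ K v)).restrictScalars ℝ) ∘L
    (M.toStarSubalgebra.toSubalgebra.toSubmodule.subtypeL.restrictScalars ℝ)

lemma vectorState_smul (v : K) (c : ℝ) (x : Elem M) :
    vectorState v ((c : ℂ) • x) = c * vectorState v x := by
  rw [coe_smul, map_smul, smul_eq_mul]

lemma vectorState_star (v : K) (x : Elem M) : vectorState v (star x) = vectorState v x := by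
  show (inner ℂ v (adjoint x.1 v)).re = (inner ℂ v (x.1 v)).re
  rw [adjoint_inner_right, ← inner_conj_symm, Complex.conj_re]

lemma vectorState_nonneg {x : Elem M} (hx : 0 ≤ x.1) (v : K) : 0 ≤ vectorState v x :=
  (nonneg_iff.1 (nonneg_iff_inner.1 hx v)).1

lemma vectorState_mono {x y : Elem M} (h : x.1 ≤ y.1) (v : K) :
    vectorState v x ≤ vectorState v y :=
  (Complex.le_def.1 (le_iff_inner.1 h v)).1

lemma vectorState_le_norm (x : Elem M) (v : K) : vectorState v x ≤ ‖x‖ * ‖v‖ ^ 2 := by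
  rw [sq]
  exact (Complex.re_le_norm _).trans (norm_inner_le_of_norm_le le_rfl v v)

lemma nonneg_of_vectorState {x : Elem M} (hx : star x = x) (h : ∀ v : K, 0 ≤ vectorState v x) :
    0 ≤ x.1 := by
  refine nonneg_iff_inner.2 fun v => nonneg_iff.2 ⟨h v, (Complex.conj_eq_iff_im.1 ?_).symm⟩
  conv_rhs => rw [← hx]; change inner ℂ v (adjoint x.1 v); rw [adjoint_inner_right]
  rw [inner_conj_symm]

lemma norm_le_of_vectorState {x : Elem M} (hx : 0 ≤ x.1) {c : ℝ} (hc : 0 ≤ c)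
    (h : ∀ v, vectorState v x ≤ c * ‖v‖ ^ 2) : ‖x‖ ≤ c := by
  have h1 : x.1 ≤ ((c : ℝ) : ℂ) • (1 : ℬ(K)) := by
    refine le_iff_inner.2 fun v => ?_
    have h2 : inner ℂ v ((((c : ℝ) : ℂ) • (1 : ℬ(K))) v) = ((c * ‖v‖ ^ 2 : ℝ) : ℂ) := by
      rw [smul_apply, inner_smul_right, one_apply_eq_self, inner_self_eq_norm_sq_to_K]
      push_cast; rfl
    rw [h2]
    refine Complex.le_def.2 ⟨by rw [ofReal_re]; exact h v, ?_⟩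
    rw [Complex.ofReal_im]
    exact (nonneg_iff.1 (nonneg_iff_inner.1 hx v)).2.symm
  refine (CStarAlgebra.norm_le_norm_of_nonneg_of_le hx h1).trans ?_
  rw [norm_smul, norm_real, norm_of_nonneg hc]
  exact mul_le_of_le_one_right hc norm_id_le

lemma hasDerivAt_elem {x : ℝ → Elem M} {x' : Elem M} {s : ℝ}
    (h : HasDerivAt (fun r => (x r : ℬ(K))) x'.1 s) : HasDerivAt x x' s := by
  rw [hasDerivAt_iff_isLittleO, ← Asymptotics.isLittleO_norm_left] at h ⊢
  exact h

lemma HasDerivAt.comp_clm {E F : Type*} [NormedAddCommGroup E] [NormedSpace ℂ E]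
    [NormedAddCommGroup F] [NormedSpace ℂ F] (Q : ℬ(E, F)) {x : ℝ → E} {x' : E} {s : ℝ}
    (h : HasDerivAt x x' s) : HasDerivAt (fun r => Q (x r)) (Q x') s :=
  (Q.restrictScalars ℝ).hasFDerivAt.comp_hasDerivAt s h

lemma gradientForm_eq (f g : Elem M) : gradientForm T f g
    = (1 / 2 : ℂ) • (star (generator T f) * g + star f * generator T g
      - generator T (star f * g)) :=
  rfl

namespace IsTestAlgebra

variable (hS : IsTestAlgebra τ T S) (hT : IsMarkovSemigroup M τ T)
include hS hT

lemma gradientForm_mem {f g : Elem M} (hf : f ∈ S) (hg : g ∈ S) : gradientForm T f g ∈ S := by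
  have h1 := hS.generator_mem hT hf
  have h2 := hS.generator_mem hT hg
  exact SMulMemClass.smul_mem _ (sub_mem (add_mem (mul_mem (star_mem h1) hg)
    (mul_mem (star_mem hf) h2)) (hS.generator_mem hT (mul_mem (star_mem hf) hg)))

lemma gradientForm_star {f g : Elem M} (hf : f ∈ S) (hg : g ∈ S) :
    star (gradientForm T f g) = gradientForm T g f := by
  rw [gradientForm_eq, gradientForm_eq, star_smul, star_sub, star_add, star_mul, star_mul,
    star_star, star_star, ← hS.generator_star hT (mul_mem (star_mem hf) hg), star_mul, star_star,
    add_comm]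
  congr 1
  simp

lemma gradientForm_add_right {f g g' : Elem M} (hf : f ∈ S) (hg : g ∈ S) (hg' : g' ∈ S) :
    gradientForm T f (g + g') = gradientForm T f g + gradientForm T f g' := by
  simp only [gradientForm_eq]
  rw [hS.generator_add hT hg hg', mul_add (star f) g g',
    hS.generator_add hT (mul_mem (star_mem hf) hg) (mul_mem (star_mem hf) hg'), mul_add, mul_add,
    ← smul_add]
  congr 1
  abel

lemma gradientForm_smul_right {f g : Elem M} (hf : f ∈ S) (hg : g ∈ S) (c : ℂ) :
    gradientForm T f (c • g) = c • gradientForm T f g := by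
  simp only [gradientForm_eq]
  rw [hS.generator_smul hT hg, mul_smul_comm c (star f) g,
    hS.generator_smul hT (mul_mem (star_mem hf) hg), mul_smul_comm, mul_smul_comm]
  module

lemma gradientForm_add_left {f f' g : Elem M} (hf : f ∈ S) (hf' : f' ∈ S) (hg : g ∈ S) :
    gradientForm T (f + f') g = gradientForm T f g + gradientForm T f' g := by
  rw [← hS.gradientForm_star hT hg (add_mem hf hf'), hS.gradientForm_add_right hT hg hf hf',
    star_add, hS.gradientForm_star hT hg hf, hS.gradientForm_star hT hg hf']

lemma gradientForm_smul_left {f g : Elem M} (hf : f ∈ S) (hg : g ∈ S) (c : ℂ) :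
    gradientForm T (c • f) g = (starRingEnd ℂ c) • gradientForm T f g := by
  rw [← hS.gradientForm_star hT hg (SMulMemClass.smul_mem c hf),
    hS.gradientForm_smul_right hT hg hf, star_smul, hS.gradientForm_star hT hg hf]
  rfl

/-- The gradient form is the limit of the forms
`(T_t(f* f) - (T_t f)* f - f* T_t f + f* f) / 2t`. -/
lemma tendsto_gradientForm {f : Elem M} (hf : f ∈ S) :
    Tendsto (fun t : ℝ => (((2 * t)⁻¹ : ℝ) : ℂ) • (T t (star f * f) - star (T t f) * f
      - star f * T t f + star f * f)) (𝓝[>] 0) (𝓝 (gradientForm T f f)) := by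
  have h1 := hS.tendsto_generator hT hf
  have h2 := hS.tendsto_generator hT (mul_mem (star_mem hf) hf)
  have h3 := (((h1.star.mul_const f).add (h1.const_mul (star f))).sub h2).const_smul (1 / 2 : ℂ)
  refine h3.congr fun t => ?_
  have e : star (((t⁻¹ : ℝ) : ℂ) • (f - T t f)) = ((t⁻¹ : ℝ) : ℂ) • (star f - star (T t f)) := by
    rw [star_smul, star_sub]
    congr 1
    exact conj_ofReal _
  rw [e, smul_mul_assoc, mul_smul_comm, sub_mul, mul_sub]
  push_cast
  rw [mul_inv]
  module

lemma gradientForm_nonneg {f : Elem M} (hf : f ∈ S) : 0 ≤ (gradientForm T f f).1 := by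
  refine nonneg_of_tendsto (tendsto_ultraweak_of_norm
    ((continuous_subtype_val.tendsto _).comp (hS.tendsto_gradientForm hT hf))) ?_
  filter_upwards [self_mem_nhdsWithin] with t ht
  have h1 := (hT.markov t ht.out.le).difference_nonneg f
  have h2 : (0 : ℝ) ≤ (2 * t)⁻¹ := by have := ht.out; positivity
  rw [nonneg_iff_inner] at h1 ⊢
  intro v
  have := mul_nonneg (zero_le_real.2 h2) (h1 v)
  rwa [← inner_smul_right] at this

lemma hasDerivAt_orbit {f : Elem M} (hf : f ∈ S) {t : ℝ} (ht : 0 < t) :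
    HasDerivAt (fun r => T r f) (-T t (generator T f)) t :=
  hasDerivAt_elem (hS.hasDerivAt_semigroup hT hf ht)

/-- The mean value theorem for `u ↦ T_{t-u} L(u)`. -/
lemma exists_mean_value {t : ℝ} (ht : 0 < t) {L L' : ℝ → Elem M}
    (hL : ∀ u, 0 ≤ u → L u ∈ S) (hL' : ∀ u, 0 < u → L' u ∈ S)
    (hc : ContinuousOn L (Ici 0)) (hd : ∀ u, 0 < u → HasDerivAt L (L' u) u) (v : K) :
    ∃ u ∈ Ioo 0 t, vectorState v (T t (L 0) - L t)
      = -t * vectorState v (T (t - u) (generator T (L u) + L' u)) := by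
  let G : ℝ → Elem M := fun u => T (t - u) (L u)
  have hlip : ∀ u ∈ Icc 0 t, ∀ q ∈ Icc 0 t, ‖G q - T (t - q) (L u)‖ ≤ ‖L q - L u‖ := by
    intro u hu q hq
    rw [← (hT.markov (t - q) (sub_nonneg.2 hq.2)).map_sub (L q) (L u)]
    exact hT.norm_le (sub_nonneg.2 hq.2) _
  have hGc : ContinuousOn G (Icc 0 t) := by
    intro u hu
    have h1 : Tendsto (fun q => T (t - q) (L u)) (𝓝[Icc 0 t] u) (𝓝 (T (t - u) (L u))) := by
      have h2 := (hS.continuousOn_semigroup hT (hL u hu.1)) (t - u) (sub_nonneg.2 hu.2)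
      refine h2.tendsto.comp (tendsto_nhdsWithin_iff.2 ⟨?_, ?_⟩)
      · exact (Continuous.tendsto (by fun_prop : Continuous fun q : ℝ => t - q) u).mono_left
          nhdsWithin_le_nhds
      · filter_upwards [self_mem_nhdsWithin] with q hq using sub_nonneg.2 hq.2
    have h3 : Tendsto (fun q => ‖L q - L u‖) (𝓝[Icc 0 t] u) (𝓝 0) := by
      exact tendsto_iff_norm_sub_tendsto_zero.1 ((hc u hu.1).mono Set.Icc_subset_Ici_self)
    have h4 : Tendsto (fun q => G q - T (t - q) (L u)) (𝓝[Icc 0 t] u) (𝓝 0) := by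
      rw [tendsto_zero_iff_norm_tendsto_zero]
      refine squeeze_zero' (.of_forall fun _ => norm_nonneg _) ?_ h3
      filter_upwards [self_mem_nhdsWithin] with q hq using hlip u hu q hq
    have h5 := h4.add h1
    simp only [sub_add_cancel, zero_add] at h5
    exact h5
  have hGd : ∀ u ∈ Ioo 0 t, HasDerivAt G (T (t - u) (generator T (L u) + L' u)) u := by
    intro u hu
    have hu0 : 0 < t - u := sub_pos.2 hu.2
    have h1 : HasDerivAt (fun q => T (t - q) (L u)) (T (t - u) (generator T (L u))) u := by
      have h2 := (hS.hasDerivAt_orbit hT (hL u hu.1.le) hu0).scomp u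
        ((hasDerivAt_id u).const_sub t)
      exact h2.congr_deriv (by rw [neg_one_smul, neg_neg])
    have h2 : HasDerivAt (fun q => G q - T (t - q) (L u)) (T (t - u) (L' u)) u := by
      rw [hasDerivAt_iff_tendsto_slope]
      have h3 : Tendsto (fun q => T (t - q) (L' u)) (𝓝[≠] u) (𝓝 (T (t - u) (L' u))) := by
        have h4 := ((hS.continuousOn_semigroup hT (hL' u hu.1)).continuousAt (Ici_mem_nhds hu0))
        exact h4.tendsto.comp ((Continuous.tendsto
          (by fun_prop : Continuous fun q : ℝ => t - q) u).mono_left nhdsWithin_le_nhds)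
      have h5 := tendsto_iff_norm_sub_tendsto_zero.1 (hasDerivAt_iff_tendsto_slope.1 (hd u hu.1))
      have h6 : Tendsto (fun q => slope (fun q => G q - T (t - q) (L u)) u q - T (t - q) (L' u))
          (𝓝[≠] u) (𝓝 0) := by
        rw [tendsto_zero_iff_norm_tendsto_zero]
        refine squeeze_zero' (.of_forall fun _ => norm_nonneg _) ?_ h5
        filter_upwards [mem_nhdsWithin_of_mem_nhds (Iio_mem_nhds hu.2)] with q hq
        have hq' : 0 ≤ t - q := (sub_pos.2 hq).le
        have e : slope (fun q => G q - T (t - q) (L u)) u q - T (t - q) (L' u)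
            = T (t - q) (slope L u q - L' u) := by
          simp only [slope_def_module, G]
          rw [sub_self (T (t - u) (L u)), sub_zero, (hT.markov _ hq').map_sub,
            ← coe_smul, ← coe_smul, (hT.markov _ hq').map_smul,
            (hT.markov _ hq').map_sub]
        rw [e]
        exact hT.norm_le hq' _
      have h7 := h6.add h3
      simp only [sub_add_cancel, zero_add] at h7
      exact h7
    have h3 := h2.add h1
    rw [(hT.markov _ hu0.le).map_add, add_comm]
    refine h3.congr_of_eventuallyEq (.of_forall fun q => ?_)
    simp
  obtain ⟨u, hu, h⟩ := exists_hasDerivAt_eq_slope (fun u => vectorState v (G u))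
    (fun u => vectorState v (T (t - u) (generator T (L u) + L' u))) ht
    ((vectorState v).continuous.comp_continuousOn hGc)
    (fun u hu => (vectorState v).hasFDerivAt.comp_hasDerivAt u (hGd u hu))
  refine ⟨u, hu, ?_⟩
  rw [sub_zero, eq_div_iff ht.ne', show G 0 = T t (L 0) by simp only [G, sub_zero],
    show G t = L t by simp only [G, sub_self, hT.semigroup_zero]] at h
  rw [map_sub]
  linarith

/-- Bakry-Émery: `Γ(T_t f) ≤ T_t Γ(f)` when `Γ² ≥ 0`. -/
lemma gradientForm_semigroup_le (hΓ : GradientForm₂Nonneg T S) {f : Elem M} (hf : f ∈ S) {t : ℝ}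
    (ht : 0 ≤ t) : (gradientForm T (T t f) (T t f)).1 ≤ T t (gradientForm T f f) := by
  rcases ht.eq_or_lt with rfl | ht
  · simp only [hT.semigroup_zero, le_refl]
  have hm : ∀ {u : ℝ}, 0 ≤ u → ∀ {g}, g ∈ S → T u g ∈ S := fun hu _ hg => hS.semigroup_mem' hT hg hu
  have ha := hS.generator_mem hT hf
  have hb := hS.generator_mem hT ha
  -- regularize by `P_ε`, for which `x ↦ P_ε A x` is bounded
  have key : ∀ ε : ℝ, 0 < ε → 0 ≤ ((poisson T ε (T t (gradientForm T f f))
      - poisson T ε (gradientForm T (T t f) (T t f)) : Elem M) : ℬ(K)) := by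
    intro ε hε
    obtain ⟨P, hP⟩ : ∃ P : Elem M →L[ℂ] Elem M, ∀ x, P x = poisson T ε x :=
      ⟨hT.smearCLM (integrableOn_subordinator hε), fun x => by
        rw [hT.smearCLM_apply, poisson_eq_smear hε]⟩
    obtain ⟨Q, hQ⟩ : ∃ Q : Elem M →L[ℂ] Elem M, ∀ x ∈ S, Q x = P (generator T x) :=
      ⟨hT.smearCLM (integrableOn_subordinatorDeriv₂ hε), fun x hx => by
        rw [hT.smearCLM_apply, hP, hS.smear_deriv₂_eq hT hx hε]⟩
    have hPS : ∀ x ∈ S, P x ∈ S := fun x hx => by rw [hP]; exact hS.poisson_mem ε hε x hx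
    have hPG : ∀ x ∈ S, ∀ y ∈ S, P (gradientForm T x y)
        = (1 / 2 : ℂ) • (P (star (generator T x) * y + star x * generator T y)
          - Q (star x * y)) := by
      intro x hx y hy
      rw [gradientForm_eq, map_smul, map_sub, hQ _ (mul_mem (star_mem hx) hy)]
    let L : ℝ → Elem M := fun u => (1 / 2 : ℂ) • (P (star (T u (generator T f)) * T u f
      + star (T u f) * T u (generator T f)) - Q (star (T u f) * T u f))
    let L' : ℝ → Elem M := fun u => -P (gradientForm T (T u (generator T f)) (T u f)
      + gradientForm T (T u f) (T u (generator T f)))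
    have hLe : ∀ u, 0 ≤ u → L u = P (gradientForm T (T u f) (T u f)) := by
      intro u hu
      rw [hPG _ (hm hu hf) _ (hm hu hf), hS.generator_semigroup hT hf hu]
    have hd : ∀ u, 0 < u → HasDerivAt L (L' u) u := by
      intro u hu
      have d1 := hS.hasDerivAt_orbit hT hf hu
      have d2 := hS.hasDerivAt_orbit hT ha hu
      have d3 := ((HasDerivAt.comp_clm P ((d2.star.mul d1).add (d1.star.mul d2))).sub
        (HasDerivAt.comp_clm Q (d1.star.mul d1))).const_smul (1 / 2 : ℂ)
      refine d3.congr_deriv ?_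
      simp only [L']
      rw [map_add P (gradientForm T _ (T u f)) _, hPG _ (hm hu.le ha) _ (hm hu.le hf),
        hPG _ (hm hu.le hf) _ (hm hu.le ha),
        hS.generator_semigroup hT hf hu.le, hS.generator_semigroup hT ha hu.le]
      simp only [star_neg, neg_mul, mul_neg, map_add, map_neg]
      module
    have hc : ContinuousOn L (Ici 0) := by
      have c1 := hS.continuousOn_semigroup hT hf
      have c2 := hS.continuousOn_semigroup hT ha
      exact ((P.continuous.comp_continuousOn ((c2.star.mul c1).add (c1.star.mul c2))).sub
        (Q.continuous.comp_continuousOn (c1.star.mul c1))).const_smul (1 / 2 : ℂ)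
    have hLS : ∀ u, 0 ≤ u → L u ∈ S := fun u hu => by
      rw [hLe u hu]; exact hPS _ (hS.gradientForm_mem hT (hm hu hf) (hm hu hf))
    have hLS' : ∀ u, 0 < u → L' u ∈ S := fun u hu =>
      neg_mem (hPS _ (add_mem (hS.gradientForm_mem hT (hm hu.le ha) (hm hu.le hf))
        (hS.gradientForm_mem hT (hm hu.le hf) (hm hu.le ha))))
    have hsa : ∀ x ∈ S, star (gradientForm T x x) = gradientForm T x x := fun x hx =>
      hS.gradientForm_star hT hx hx
    refine nonneg_of_vectorState ?_ fun v => ?_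
    · rw [star_sub, ← hT.poisson_star hε, ← hT.poisson_star hε, ← (hT.markov t ht.le).map_star,
        hsa f hf, hsa _ (hm ht.le hf)]
    · obtain ⟨u, hu, h⟩ := hS.exists_mean_value hT ht hLS hLS' hc hd v
      have hgu := hm hu.1.le hf
      have e1 : generator T (L u) + L' u
          = ((-2 : ℝ) : ℂ) • P (gradientForm₂ T (T u f) (T u f)) := by
        have e2 : gradientForm₂ T (T u f) (T u f) = (1 / 2 : ℂ) •
            (gradientForm T (T u (generator T f)) (T u f)
              + gradientForm T (T u f) (T u (generator T f))
              - generator T (gradientForm T (T u f) (T u f))) := by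
          rw [← hS.generator_semigroup hT hf hu.1.le]; rfl
        rw [hLe u hu.1.le, hP, hS.generator_poisson hT (hS.gradientForm_mem hT hgu hgu) hε, e2,
          map_smul, map_sub, hP (generator T _)]
        simp only [L']
        push_cast
        module
      have e0 : T t (L 0) = poisson T ε (T t (gradientForm T f f)) := by
        rw [hLe 0 le_rfl, hP, hT.semigroup_poisson hε ht.le, hT.semigroup_zero]
      have e3 : L t = poisson T ε (gradientForm T (T t f) (T t f)) := by
        rw [hLe t ht.le, hP]
      rw [e0, e3, e1, (hT.markov _ (sub_pos.2 hu.2).le).map_smul, vectorState_smul, hP] at h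
      have h3 := vectorState_nonneg ((hT.markov _ (sub_pos.2 hu.2).le).map_nonneg
        (hT.poisson_nonneg hε (hΓ _ hgu))) v
      rw [h]
      nlinarith [mul_nonneg ht.le h3]
  have h1 := (hT.tendsto_poisson_zero (T t (gradientForm T f f)
    - gradientForm T (T t f) (T t f)))
  refine sub_nonneg.1 (nonneg_of_tendsto h1 ?_)
  filter_upwards [self_mem_nhdsWithin] with ε hε
  rw [hT.poisson_sub hε]
  exact key ε hε

lemma difference_mean_value {f : Elem M} (hf : f ∈ S) {t : ℝ} (ht : 0 < t) (v : K) :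
    ∃ u ∈ Ioo 0 t, vectorState v (T t (star f * f) - star (T t f) * T t f)
      = 2 * t * vectorState v (T (t - u) (gradientForm T (T u f) (T u f))) := by
  have hm : ∀ {u : ℝ}, 0 ≤ u → ∀ {g}, g ∈ S → T u g ∈ S := fun hu _ hg => hS.semigroup_mem' hT hg hu
  have ha := hS.generator_mem hT hf
  have c1 := hS.continuousOn_semigroup hT hf
  obtain ⟨u, hu, h⟩ := hS.exists_mean_value hT ht (L := fun u => star (T u f) * T u f)
    (L' := fun u => star (-T u (generator T f)) * T u f + star (T u f) * (-T u (generator T f)))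
    (fun u hu => mul_mem (star_mem (hm hu hf)) (hm hu hf))
    (fun u hu => add_mem (mul_mem (star_mem (neg_mem (hm hu.le ha))) (hm hu.le hf))
      (mul_mem (star_mem (hm hu.le hf)) (neg_mem (hm hu.le ha))))
    (c1.star.mul c1)
    (fun u hu => (hS.hasDerivAt_orbit hT hf hu).star.mul (hS.hasDerivAt_orbit hT hf hu)) v
  refine ⟨u, hu, ?_⟩
  have e : generator T (star (T u f) * T u f)
      + (star (-T u (generator T f)) * T u f + star (T u f) * (-T u (generator T f)))
      = ((-2 : ℝ) : ℂ) • gradientForm T (T u f) (T u f) := by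
    rw [gradientForm_eq, hS.generator_semigroup hT hf hu.1.le, star_neg, neg_mul, mul_neg]
    push_cast
    module
  rw [e, (hT.markov _ (sub_pos.2 hu.2).le).map_smul, hT.semigroup_zero, vectorState_smul] at h
  exact h.trans (by ring)

variable (hΓ : GradientForm₂Nonneg T S)
include hΓ

/-- `2t Γ(T_t f) ≤ T_t |f|² - |T_t f|² ≤ |f|²`. -/
lemma norm_gradientForm_semigroup_le {f : Elem M} (hf : f ∈ S) {t : ℝ} (ht : 0 < t) :
    ‖gradientForm T (T t f) (T t f)‖ ≤ ‖f‖ ^ 2 / (2 * t) := by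
  have hft := hS.semigroup_mem' hT hf ht.le
  refine norm_le_of_vectorState (hS.gradientForm_nonneg hT hft) (by positivity) fun v => ?_
  obtain ⟨u, hu, h⟩ := hS.difference_mean_value hT hf ht v
  have h1 := vectorState_mono (hS.gradientForm_semigroup_le hT hΓ
    (hS.semigroup_mem' hT hf hu.1.le) (sub_pos.2 hu.2).le) v
  rw [hT.semigroup_semigroup (sub_pos.2 hu.2).le hu.1.le, add_sub_cancel] at h1
  rw [map_sub] at h
  have h2 : 0 ≤ vectorState v (star (T t f) * T t f) :=
    vectorState_nonneg (star_mul_self_nonneg (T t f).1) v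
  have h3 : vectorState v (T t (star f * f)) ≤ ‖f‖ ^ 2 * ‖v‖ ^ 2 := by
    refine (vectorState_le_norm _ v).trans (mul_le_mul_of_nonneg_right ?_ (by positivity))
    refine (hT.norm_le ht.le _).trans ((norm_mul_le (star f) f).trans ?_)
    rw [norm_star, sq]
  rw [div_mul_eq_mul_div, le_div_iff₀ (by positivity)]
  nlinarith

lemma norm_gradientForm_semigroup_le' {f : Elem M} (hf : f ∈ S) {t : ℝ} (ht : 0 ≤ t) :
    ‖gradientForm T (T t f) (T t f)‖ ≤ ‖gradientForm T f f‖ := by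
  refine (CStarAlgebra.norm_le_norm_of_nonneg_of_le
    (hS.gradientForm_nonneg hT (hS.semigroup_mem' hT hf ht))
    (hS.gradientForm_semigroup_le hT hΓ hf ht)).trans (hT.norm_le ht _)

/-- `T_t |f|² - (T_t f)* f - f* T_t f + |f|² ≤ 2t T_t Γ(f) + |f - T_t f|²`. -/
lemma re_difference_le {f : Elem M} (hf : f ∈ S) {t : ℝ} (ht : 0 < t) (v : K) :
    vectorState v (T t (star f * f) - star (T t f) * f - star f * T t f + star f * f)
      ≤ (2 * t * ‖gradientForm T f f‖ + t ^ 2 * ‖generator T f‖ ^ 2) * ‖v‖ ^ 2 := by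
  obtain ⟨u, hu, h⟩ := hS.difference_mean_value hT hf ht v
  have h1 : vectorState v (T (t - u) (gradientForm T (T u f) (T u f)))
      ≤ ‖gradientForm T f f‖ * ‖v‖ ^ 2 := by
    refine (vectorState_le_norm _ v).trans (mul_le_mul_of_nonneg_right ?_ (by positivity))
    exact (hT.norm_le (sub_pos.2 hu.2).le _).trans
      (hS.norm_gradientForm_semigroup_le' hT hΓ hf hu.1.le)
  have e : T t (star f * f) - star (T t f) * f - star f * T t f + star f * f
      = (T t (star f * f) - star (T t f) * T t f) + star (f - T t f) * (f - T t f) := by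
    rw [star_sub]; noncomm_ring
  have h2 : vectorState v (star (f - T t f) * (f - T t f))
      ≤ t ^ 2 * ‖generator T f‖ ^ 2 * ‖v‖ ^ 2 := by
    refine (vectorState_le_norm _ v).trans (mul_le_mul_of_nonneg_right ?_ (by positivity))
    refine (norm_mul_le (star (f - T t f)) (f - T t f)).trans ?_
    rw [norm_star, ← mul_pow, ← sq]
    exact pow_le_pow_left₀ (norm_nonneg _) (hS.norm_sub_le hT hf ht.le) 2
  rw [e, map_add, h]
  nlinarith

/-- A Jensen inequality for the subordinated semigroup. -/
lemma norm_gradientForm_poisson_le {f : Elem M} (hf : f ∈ S) {s : ℝ} (hs : 0 < s) {b : ℝ → ℝ}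
    (hb : ∀ v, 0 < v → ‖gradientForm T (T v f) (T v f)‖ ≤ b v)
    (hbi : IntegrableOn (fun v => subordinator s v * b v) (Ioi 0)) :
    ‖gradientForm T (poisson T s f) (poisson T s f)‖
      ≤ ∫ v in Ioi (0 : ℝ), subordinator s v * b v := by
  set x := poisson T s f with hx
  have hxS : x ∈ S := hS.poisson_mem s hs f hf
  have hI0 : 0 ≤ ∫ v in Ioi (0 : ℝ), subordinator s v * b v :=
    setIntegral_nonneg measurableSet_Ioi fun v hv => mul_nonneg
      (subordinator_nonneg hs.le hv) ((norm_nonneg _).trans (hb v hv))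
  -- the bound for the difference forms
  have key : ∀ t : ℝ, 0 < t → ∀ w : K,
      vectorState w (T t (star x * x) - star (T t x) * x - star x * T t x + star x * x)
      ≤ (2 * t * (∫ v in Ioi (0 : ℝ), subordinator s v * b v)
        + t ^ 2 * ‖generator T f‖ ^ 2) * ‖w‖ ^ 2 := by
    intro t ht w
    let D : Elem M → Elem M → Elem M := fun y z =>
      T t (star y * z) - star (T t y) * z - star y * T t z + star y * z
    obtain ⟨ω, hω, hωD⟩ : ∃ ω : ℬ(K) →ₗ[ℂ] ℂ, IsNormalFunctional ω ∧
        ∀ z : Elem M, ω z = inner ℂ w ((D x z : ℬ(K)) w) := by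
      have hv := isNormalFunctional_vector (E := K) w w
      obtain ⟨ω₁, hω₁, h₁⟩ := (hT.markov t ht.le).exists_normal_comp hv
      obtain ⟨ω₂, hω₂, h₂⟩ := (hT.markov t ht.le).exists_normal_comp
        (hv.comp_sandwich (star x.1) (1 : ℬ(K)))
      refine ⟨_, (((hω₁.comp_sandwich (star x.1) (1 : ℬ(K))).sub
        (hv.comp_sandwich (star (T t x).1) (1 : ℬ(K)))).sub hω₂).add
        (hv.comp_sandwich (star x.1) (1 : ℬ(K))), fun z => ?_⟩
      have h3 := h₁ (star x * z)
      have e : inner ℂ w ((D x z : ℬ(K)) w)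
          = inner ℂ w ((T t (star x * z)).1 w)
            - inner ℂ w ((star (T t x).1 * z) w)
            - inner ℂ w ((star x.1 * T t z) w)
            + inner ℂ w ((star x.1 * z) w) := by
        rw [← inner_sub_right, ← inner_sub_right, ← inner_add_right]; rfl
      rw [e, LinearMap.add_apply, LinearMap.sub_apply, LinearMap.sub_apply, ← h₂ z]
      rw [vectorFunctional_apply] at h3
      rw [h3]
      rfl
    have hQ : inner ℂ w ((D x x : ℬ(K)) w)
        = ∫ v in Ioi (0 : ℝ), (subordinator s v : ℂ)
          * inner ℂ w ((D x (T v f) : ℬ(K)) w) := by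
      rw [← hωD, hx, hT.normal_poisson hs f hω, ← hx]
      simp only [hωD]
    have hQi : IntegrableOn (fun v => (subordinator s v : ℂ)
        * inner ℂ w ((D x (T v f) : ℬ(K)) w)) (Ioi 0) := by
      have := hT.integrableOn_normal (integrableOn_subordinator hs) hω f
      simpa only [hωD] using this
    have hre : vectorState w (D x x)
        = ∫ v in Ioi (0 : ℝ), subordinator s v * vectorState w (D x (T v f)) := by
      have := integral_re hQi
      simp only [RCLike.re_eq_complex_re, re_ofReal_mul] at this
      exact (congrArg Complex.re hQ).trans this.symm
    have hrei : IntegrableOn (fun v => subordinator s v * vectorState w (D x (T v f)))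
        (Ioi 0) := by
      have := hQi.re
      simp only [RCLike.re_eq_complex_re, re_ofReal_mul] at this
      exact this
    obtain ⟨q, hq⟩ : ∃ q, q = vectorState w (D x x) := ⟨_, rfl⟩
    have hbound : ∀ v, 0 < v → vectorState w (D x (T v f))
        ≤ q / 2 + (t * b v + t ^ 2 * ‖generator T f‖ ^ 2 / 2) * ‖w‖ ^ 2 := by
      intro v hv
      have hvS := hS.semigroup_mem' hT hf hv.le
      have h1 := hS.re_difference_le hT hΓ hvS ht w
      have h2 : ‖generator T (T v f)‖ ≤ ‖generator T f‖ := by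
        rw [hS.generator_semigroup hT hf hv.le]; exact hT.norm_le hv.le _
      have h3 : vectorState w (D (T v f) (T v f))
          ≤ (2 * t * b v + t ^ 2 * ‖generator T f‖ ^ 2) * ‖w‖ ^ 2 := by
        refine h1.trans ?_
        gcongr
        exact hb v hv
      have h4 := vectorState_nonneg ((hT.markov t ht.le).difference_nonneg (x - T v f)) w
      have e : T t (star (x - T v f) * (x - T v f)) - star (T t (x - T v f)) * (x - T v f)
          - star (x - T v f) * T t (x - T v f) + star (x - T v f) * (x - T v f)
          = D x x + D (T v f) (T v f) - D x (T v f) - star (D x (T v f)) := by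
        simp only [D]
        have hM := hT.markov t ht.le
        simp only [star_sub, star_add, star_mul, star_star, ← hM.map_star, mul_sub, sub_mul,
          hM.map_sub]
        abel
      rw [e, map_sub, map_sub, map_add, vectorState_star, ← hq] at h4
      linarith
    have hφ := integrableOn_subordinator hs
    have hI : q ≤ ∫ v in Ioi (0 : ℝ), ((q / 2 + t ^ 2 * ‖generator T f‖ ^ 2 / 2 * ‖w‖ ^ 2)
        * subordinator s v + t * ‖w‖ ^ 2 * (subordinator s v * b v)) := by
      refine (hq.trans hre).trans_le ?_
      refine setIntegral_mono_on hrei ((hφ.const_mul _).add (hbi.const_mul _)) measurableSet_Ioi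
        fun v hv => ?_
      have := mul_le_mul_of_nonneg_left (hbound v hv) (subordinator_nonneg hs.le hv)
      linarith
    rw [integral_add (hφ.const_mul _) (hbi.const_mul _), integral_const_mul, integral_const_mul,
      integral_subordinator hs] at hI
    refine le_of_eq_of_le hq.symm ?_
    linarith
  refine norm_le_of_vectorState (hS.gradientForm_nonneg hT hxS) hI0 fun w => ?_
  have h2 := ((vectorState w).continuous.tendsto _).comp (hS.tendsto_gradientForm hT hxS)
  have h3 : Tendsto (fun t : ℝ => ((∫ v in Ioi (0 : ℝ), subordinator s v * b v)
      + t * ‖generator T f‖ ^ 2 / 2) * ‖w‖ ^ 2) (𝓝[>] 0)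
      (𝓝 (((∫ v in Ioi (0 : ℝ), subordinator s v * b v)
      + 0 * ‖generator T f‖ ^ 2 / 2) * ‖w‖ ^ 2)) :=
    (Continuous.tendsto (by fun_prop) 0).mono_left nhdsWithin_le_nhds
  rw [zero_mul, zero_div, add_zero] at h3
  refine le_of_tendsto_of_tendsto h2 h3 ?_
  filter_upwards [self_mem_nhdsWithin] with t ht
  have ht' : (0 : ℝ) < t := ht
  rw [Function.comp_apply, vectorState_smul, inv_mul_le_iff₀ (by positivity)]
  exact (key t ht' w).trans_eq (by ring)

lemma norm_gradientForm_poisson_le_sq {f : Elem M} (hf : f ∈ S) {s : ℝ} (hs : 0 < s) :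
    ‖gradientForm T (poisson T s f) (poisson T s f)‖ ≤ ‖f‖ ^ 2 / s ^ 2 := by
  have hi := (integrableOn_subordinator_div hs).const_mul (‖f‖ ^ 2 / 2)
  have e : (fun v => ‖f‖ ^ 2 / 2 * (subordinator s v / v))
      = fun v => subordinator s v * (‖f‖ ^ 2 / (2 * v)) := by
    funext v
    rw [div_mul_div_comm, mul_div_assoc']
    ring
  refine (hS.norm_gradientForm_poisson_le hT hΓ hf hs (b := fun v => ‖f‖ ^ 2 / (2 * v))
    (fun v hv => hS.norm_gradientForm_semigroup_le hT hΓ hf hv) (e ▸ hi)).trans (le_of_eq ?_)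
  simp only [← e]
  rw [integral_const_mul, integral_subordinator_div hs]
  ring

lemma norm_gradientForm_poisson_le' {f : Elem M} (hf : f ∈ S) {s : ℝ} (hs : 0 < s) :
    ‖gradientForm T (poisson T s f) (poisson T s f)‖ ≤ ‖gradientForm T f f‖ := by
  refine (hS.norm_gradientForm_poisson_le hT hΓ hf hs (b := fun v => ‖gradientForm T f f‖)
    (fun v hv => hS.norm_gradientForm_semigroup_le' hT hΓ hf hv.le)
    ((integrableOn_subordinator hs).mul_const _)).trans (le_of_eq ?_)
  rw [integral_mul_const, integral_subordinator hs, one_mul]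

end IsTestAlgebra

/-! ### Duality on the test algebra -/

lemma Submodule.setIntegral_mem {B : Type*} [NormedAddCommGroup B] [NormedSpace ℂ B]
    [CompleteSpace B] {N : Submodule ℂ B} (hN : IsClosed (N : Set B)) {f : ℝ → B} {s : Set ℝ}
    (hs : MeasurableSet s) (hf : ∀ v ∈ s, f v ∈ N) (hint : IntegrableOn f s) :
    ∫ v in s, f v ∈ N := by
  by_contra hx
  obtain ⟨φ, c, hφ, hc⟩ := geometric_hahn_banach_closed_point
    (N.restrictScalars ℝ).convex hN hx
  have h0 : ∀ a ∈ N, φ a = 0 := by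
    intro a ha
    by_contra h
    have h1 := hφ ((c / φ a) • a) ((N.restrictScalars ℝ).smul_mem _ ha)
    rw [map_smul, smul_eq_mul, div_mul_cancel₀ _ h] at h1
    exact lt_irrefl _ h1
  have h2 := hφ 0 N.zero_mem
  rw [map_zero] at h2
  rw [← φ.integral_comp_comm hint, setIntegral_congr_fun hs fun v hv => h0 _ (hf v hv),
    integral_zero] at hc
  exact lt_asymm h2 hc

lemma integrableOn_smul_of_continuousOn {B : Type*} [NormedAddCommGroup B] [NormedSpace ℂ B]
    {φ : ℝ → ℝ} (hφ : IntegrableOn φ (Ioi 0)) {V : ℝ → B} (hV : ContinuousOn V (Ioi 0))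
    {b : ℝ → ℝ} (hb : ∀ v, 0 < v → ‖V v‖ ≤ b v) (hφb : IntegrableOn (fun v => φ v * b v) (Ioi 0)) :
    IntegrableOn (fun v => (φ v : ℂ) • V v) (Ioi 0) := by
  refine Integrable.mono' hφb.norm
    (hφ.ofReal.aestronglyMeasurable.smul (hV.aestronglyMeasurable measurableSet_Ioi)) ?_
  filter_upwards [ae_restrict_mem measurableSet_Ioi] with v hv
  have h1 := hb v hv
  rw [norm_smul, norm_real, norm_mul, norm_of_nonneg ((norm_nonneg _).trans h1)]
  exact mul_le_mul_of_nonneg_left h1 (norm_nonneg _)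

variable (M) in
/-- The restrictions to `M` of the normal functionals, as a subspace of the dual of `M`. -/
def normalDual : Submodule ℂ (Elem M →L[ℂ] ℂ) where
  carrier := {φ | ∃ ω : ℬ(K) →ₗ[ℂ] ℂ, IsNormalFunctional ω ∧ ∀ x : Elem M, φ x = ω x}
  add_mem' := by
    rintro φ ψ ⟨ω, hω, h⟩ ⟨ω', hω', h'⟩
    exact ⟨_, hω.add hω', fun x => by rw [add_apply, h, h']; rfl⟩
  zero_mem' := ⟨0, isNormalFunctional_zero, fun x => rfl⟩
  smul_mem' := by
    rintro c φ ⟨ω, hω, h⟩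
    exact ⟨_, hω.smul c, fun x => by rw [smul_apply, h]; rfl⟩

lemma isClosed_normalDual : IsClosed (normalDual M : Set (Elem M →L[ℂ] ℂ)) := by
  refine isClosed_of_closure_subset fun φ hφ => ?_
  obtain ⟨ω, hω, h⟩ := exists_normal_of_approx (M := M) (φ : Elem M →ₗ[ℂ] ℂ) (fun ε hε => by
    obtain ⟨ψ, ⟨ω, hω, h⟩, hd⟩ := Metric.mem_closure_iff.1 hφ ε hε
    refine ⟨ω, hω, fun f => ?_⟩
    rw [← h]
    rw [dist_eq_norm] at hd
    exact ((φ - ψ).le_opNorm f).trans (mul_le_mul_of_nonneg_right hd.le (norm_nonneg f)))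
  exact ⟨ω, hω, h⟩

namespace IsTestAlgebra

variable (hS : IsTestAlgebra τ T S) (hτ : IsNSFTrace M τ)
include hS

/-- The pairing is hermitian on the test algebra. -/
lemma pairing_conj {k f : Elem M} (hk : k ∈ S) (hf : f ∈ S) : pairing hτ k f.1
    = (starRingEnd ℂ) (pairing hτ (star f) (star k).1) := by
  rw [hS.pairing_apply hτ hk hf, hS.pairing_apply hτ (star_mem hf) (star_mem hk), star_star,
    hτ.traceInner_conj (hS.mem_sqIntegrable hτ (star_mem hk)) (hS.mem_sqIntegrable hτ hf)]

variable (hT : IsMarkovSemigroup M τ T)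
include hT

lemma pairing_generator {k f : Elem M} (hk : k ∈ S) (hf : f ∈ S) :
    pairing hτ k (generator T f).1
      = pairing hτ (generator T k) f.1 := by
  have hl : ∀ {k f : Elem M}, k ∈ S → f ∈ S → Tendsto (fun t : ℝ => pairing hτ k
      (((t⁻¹ : ℝ) : ℂ) • (f - T t f)).1) (𝓝[>] 0)
      (𝓝 (pairing hτ k (generator T f).1)) := fun hk hf =>
    tendsto_ultraweak_iff.1 (tendsto_weakStar_iff.1 (hS.isGeneratorAt hT hf)) _
      (hS.pairing_normal hτ hk)
  have h1 := hl hk hf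
  have h2 := (Complex.continuous_conj.tendsto _).comp (hl (star_mem hf) (star_mem hk))
  rw [hS.generator_star hT hk, ← hS.pairing_conj hτ (hS.generator_mem hT hk) hf] at h2
  refine tendsto_nhds_unique h1 (h2.congr' ?_)
  filter_upwards [self_mem_nhdsWithin] with t ht
  have ht' : (0 : ℝ) < t := ht
  have hm := hS.semigroup_mem t ht' k hk
  have e : ((t⁻¹ : ℝ) : ℂ) • (star k - T t (star k)) = star (((t⁻¹ : ℝ) : ℂ) • (k - T t k)) := by
    rw [(hT.markov t ht'.le).map_star, star_smul, star_sub]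
    congr 1
    exact (conj_ofReal _).symm
  simp only [Function.comp]
  rw [e, ← hS.pairing_conj hτ (SMulMemClass.smul_mem _ (sub_mem hk hm)) hf,
    hS.pairing_smul hτ (sub_mem hk hm), hS.pairing_sub hτ hk hm, ← hS.pairing_symm hτ hT ht' hk]
  rw [← map_sub, ← smul_eq_mul, ← map_smul]
  rfl

/-- The functionals `x ↦ τ(k T_t x)` depend on `t` in a Lipschitz way. -/
lemma exists_pairing_lipschitz {k : Elem M} (hk : k ∈ S) : ∃ c : ℝ, 0 ≤ c ∧ ∀ u t : ℝ, 0 ≤ u →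
    0 ≤ t → ∀ x : Elem M, ‖pairing hτ k (T t x).1 - pairing hτ k (T u x).1‖
      ≤ c * |t - u| * ‖x‖ := by
  obtain ⟨c, hc0, hc⟩ := (hS.pairing_normal hτ (hS.generator_mem hT hk)).exists_bound
  have h1 : ∀ t : ℝ, 0 ≤ t → ∀ x ∈ S, ‖pairing hτ k x.1
      - pairing hτ k (T t x).1‖ ≤ c * t * ‖x‖ := by
    intro t ht x hx
    rw [hS.normal_orbit hT hx ht (hS.pairing_normal hτ hk), sub_sub_cancel]
    have h2 := intervalIntegral.norm_integral_le_of_norm_le_const (a := 0) (b := t) (C := c * ‖x‖)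
      (f := fun u => pairing hτ k (T (max 0 u) (generator T x)).1) fun u _ => by
        rw [← hS.generator_semigroup hT hx (le_max_left 0 u),
          hS.pairing_generator hτ hT hk (hS.semigroup_mem' hT hx (le_max_left 0 u))]
        exact (hc _).trans (mul_le_mul_of_nonneg_left (hT.norm_le (le_max_left 0 u) x) hc0)
    rw [sub_zero, abs_of_nonneg ht] at h2
    linarith
  have h3 : ∀ t : ℝ, 0 ≤ t → ∀ x : Elem M, ‖pairing hτ k x.1
      - pairing hτ k (T t x).1‖ ≤ 4 * c * t * ‖x‖ := by
    intro t ht x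
    obtain ⟨g, hg, hgx⟩ := exists_bounded_net S hS.dense x
    have hn := hS.pairing_normal hτ hk
    have h4 := ((tendsto_ultraweak_iff.1 hgx _ hn).sub
      (tendsto_ultraweak_iff.1 ((hT.markov t ht).tendsto hgx) _ hn)).norm
    refine le_of_tendsto h4 (.of_forall fun i => ?_)
    refine (h1 t ht _ (hg i).1).trans ?_
    calc c * t * ‖g i‖ ≤ c * t * (4 * ‖x‖) := by gcongr; exact (hg i).2
      _ = _ := by ring
  refine ⟨4 * c, by positivity, fun u t hu ht x => ?_⟩
  wlog h : u ≤ t generalizing u t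
  · rw [norm_sub_rev, abs_sub_comm]; exact this t u ht hu (not_le.1 h).le
  have h5 := h3 (t - u) (sub_nonneg.2 h) (T u x)
  rw [hT.semigroup_semigroup (sub_nonneg.2 h) hu, add_sub_cancel] at h5
  rw [norm_sub_rev, abs_of_nonneg (sub_nonneg.2 h)]
  refine h5.trans (mul_le_mul_of_nonneg_left (hT.norm_le hu x) ?_)
  have := sub_nonneg.2 h
  positivity

/-- The functional `x ↦ τ(k ∫ ψ(v) T_v x dv)` is normal. -/
lemma exists_normal_pairing_smear {k : Elem M} (hk : k ∈ S) {ψ : ℝ → ℝ}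
    (hψ : IntegrableOn ψ (Ioi 0)) :
    ∃ ω : ℬ(K) →ₗ[ℂ] ℂ, IsNormalFunctional ω ∧
      ∀ x : Elem M, pairing hτ k (smear T ψ x).1 = ω x := by
  have hn := hS.pairing_normal hτ hk
  obtain ⟨c, hc0, hc⟩ := hn.exists_bound
  obtain ⟨d, hd0, hd⟩ := hS.exists_pairing_lipschitz hτ hT hk
  let N : Elem M →L[ℂ] ℂ := LinearMap.mkContinuous
    ((pairing hτ k) ∘ₗ M.toStarSubalgebra.toSubalgebra.toSubmodule.subtype) c fun x => hc _
  have hN : ∀ x, N x = pairing hτ k x.1 := fun x => rfl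
  let V : ℝ → Elem M →L[ℂ] ℂ := fun v => N ∘L hT.semigroupCLM (le_max_left 0 v)
  have hVN : ∀ v, V v ∈ normalDual M := by
    intro v
    obtain ⟨ω, hω, h⟩ := (hT.markov (max 0 v) (le_max_left 0 v)).exists_normal_comp hn
    exact ⟨ω, hω, fun x => h x⟩
  have hV : ∀ v, 0 ≤ v → ∀ x, V v x = pairing hτ k (T v x).1 := by
    intro v hv x
    have : V v x = pairing hτ k (T (max 0 v) x).1 := rfl
    rw [this, max_eq_right hv]
  have hVc : ContinuousOn V (Ici 0) := by
    refine LipschitzOnWith.continuousOn (K := d.toNNReal) (LipschitzOnWith.of_dist_le_mul ?_)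
    intro t ht u hu
    rw [dist_eq_norm, Real.dist_eq, Real.coe_toNNReal d hd0]
    refine opNorm_le_bound (V t - V u)
      (mul_nonneg hd0 (abs_nonneg _)) fun x => ?_
    rw [sub_apply, hV t ht, hV u hu]
    exact hd u t hu ht x
  have hVb : ∀ v, ‖V v‖ ≤ c := by
    intro v
    refine opNorm_le_bound _ hc0 fun x => ?_
    exact (hc _).trans (mul_le_mul_of_nonneg_left (hT.norm_le (le_max_left 0 v) x) hc0)
  have hint : IntegrableOn (fun v => (ψ v : ℂ) • V v) (Ioi 0) :=
    integrableOn_smul_of_continuousOn hψ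
      (hVc.mono Ioi_subset_Ici_self) (fun v _ => hVb v)
      (hψ.mul_const c)
  obtain ⟨ω, hω, h⟩ := Submodule.setIntegral_mem isClosed_normalDual measurableSet_Ioi
    (fun v _ => (normalDual M).smul_mem _ (hVN v)) hint
  refine ⟨ω, hω, fun x => ?_⟩
  rw [← h]
  have h1 := (ContinuousLinearMap.apply ℂ ℂ x).integral_comp_comm hint
  refine Eq.trans ?_ h1
  rw [hT.normal_smear hψ x hn]
  refine setIntegral_congr_fun measurableSet_Ioi fun v hv => ?_
  have hv' : (0 : ℝ) < v := hv
  rw [← hV v hv'.le]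
  rfl

include hτ in
/-- The graph of `x ↦ ∫ ψ(v) T_v x dv` is closed for the weak-* topology. -/
lemma smear_eq_of_tendsto {ψ : ℝ → ℝ} (hψ : IntegrableOn ψ (Ioi 0)) {I : Type*} {l : Filter I}
    [l.NeBot] {x : I → Elem M} {y z : Elem M}
    (hx : Tendsto (fun i => (x i : ℬ(K))) l (𝓝ᵤ y))
    (hz : Tendsto (fun i => (smear T ψ (x i)).1) l (𝓝ᵤ z)) :
    smear T ψ y = z := by
  refine sub_eq_zero.1 (hS.eq_zero_of_pairing hτ fun k hk => ?_)
  obtain ⟨ω, hω, h⟩ := hS.exists_normal_pairing_smear hτ hT hk hψ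
  have h2 := tendsto_ultraweak_iff.1 hz _ (hS.pairing_normal hτ hk)
  simp only [h] at h2
  have h3 := tendsto_nhds_unique (tendsto_ultraweak_iff.1 hx _ hω) h2
  rw [← h] at h3
  have e : (smear T ψ y - z).1 = (smear T ψ y).1 - z := rfl
  rw [e, map_sub, h3, sub_self]

include hτ in
/-- The graph of `P_s` is closed for the weak-* topology. -/
lemma poisson_eq_of_tendsto {s : ℝ} (hs : 0 < s) {I : Type*} {l : Filter I} [l.NeBot]
    {x : I → Elem M} {y z : Elem M}
    (hx : Tendsto (fun i => (x i : ℬ(K))) l (𝓝ᵤ y))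
    (hz : Tendsto (fun i => (poisson T s (x i)).1) l (𝓝ᵤ z)) :
    poisson T s y = z := by
  simp only [poisson_eq_smear hs] at hz ⊢
  exact hS.smear_eq_of_tendsto hτ hT (integrableOn_subordinator hs) hx hz

lemma pairing_gradientForm {h g f : Elem M} (hh : h ∈ S) (hg : g ∈ S) (hf : f ∈ S) :
    2 * pairing hτ h (gradientForm T g f).1
      = pairing hτ (h * star (generator T g) + generator T (h * star g)
          - generator T h * star g) f.1 := by
  have hAg := hS.generator_mem hT hg
  have hAh := hS.generator_mem hT hh
  have hAf := hS.generator_mem hT hf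
  have hhg := mul_mem hh (star_mem hg)
  rw [hS.pairing_sub hτ (add_mem (mul_mem hh (star_mem hAg)) (hS.generator_mem hT hhg))
    (mul_mem hAh (star_mem hg)), hS.pairing_add hτ (mul_mem hh (star_mem hAg))
    (hS.generator_mem hT hhg), ← hS.pairing_generator hτ hT hhg hf,
    ← hS.pairing_mul hτ hh (star_mem hAg), ← hS.pairing_mul hτ hh (star_mem hg),
    ← hS.pairing_mul hτ hAh (star_mem hg),
    ← hS.pairing_generator hτ hT hh (mul_mem (star_mem hg) hf), ← map_add, ← map_sub,
    ← smul_eq_mul, ← map_smul]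
  congr 1
  have e : (2 : ℂ) • gradientForm T g f = star (generator T g) * f + star g * generator T f
      - generator T (star g * f) := by
    rw [gradientForm_eq]; module
  exact congrArg Subtype.val e

end IsTestAlgebra

/-! ### The closure of the derivation -/

section Closure

variable {ι : Type v} {δ : S →ₗ[ℂ] columnModule M ι}

lemma mem_closedGraph (f : S) :
    ((f : Elem M).1, (δ f : ℬ(K, Ampl K ι))) ∈ closedGraph δ :=
  @subset_closure _ (@instTopologicalSpaceProd _ _ (ultraweak K K) (ultraweak K (Ampl K ι))) _ _
    ⟨f, rfl, rfl⟩

variable (δ) in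
lemma exists_closedGraph_submodule :
    ∃ W : Submodule ℂ (ℬ(K) × ℬ(K, Ampl K ι)), (W : Set _) = closedGraph δ := by
  refine ultraweakPairClosure_linear
    { carrier := {p | ∃ f : S, p.1 = (f : Elem M).1 ∧
        p.2 = (δ f : ℬ(K, Ampl K ι))}
      add_mem' := ?_
      zero_mem' := ⟨0, rfl, by rw [map_zero]; rfl⟩
      smul_mem' := ?_ } rfl
  · rintro p q ⟨f, h1, h2⟩ ⟨g, h3, h4⟩
    exact ⟨f + g, by rw [Prod.fst_add, h1, h3]; rfl, by rw [Prod.snd_add, h2, h4, map_add]; rfl⟩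
  · rintro c p ⟨f, h1, h2⟩
    let cf : S := ⟨c • (f : Elem M), SMulMemClass.smul_mem c f.2⟩
    have e : δ cf = c • δ f := δ.map_smul c f
    exact ⟨cf, by rw [Prod.smul_fst, h1]; rfl, by rw [Prod.smul_snd, h2, e]; rfl⟩

lemma closedGraph_add {x y : ℬ(K)} {X Y : ℬ(K, Ampl K ι)} (hx : (x, X) ∈ closedGraph δ)
    (hy : (y, Y) ∈ closedGraph δ) : (x + y, X + Y) ∈ closedGraph δ := by
  obtain ⟨W, hW⟩ := exists_closedGraph_submodule δ
  rw [← hW] at hx hy ⊢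
  exact W.add_mem hx hy

lemma closedGraph_sub {x y : ℬ(K)} {X Y : ℬ(K, Ampl K ι)} (hx : (x, X) ∈ closedGraph δ)
    (hy : (y, Y) ∈ closedGraph δ) : (x - y, X - Y) ∈ closedGraph δ := by
  obtain ⟨W, hW⟩ := exists_closedGraph_submodule δ
  rw [← hW] at hx hy ⊢
  exact W.sub_mem hx hy

lemma closedGraph_of_tendsto {I : Type*} {l : Filter I} [l.NeBot] {x : I → ℬ(K)}
    {X : I → ℬ(K, Ampl K ι)} {y : ℬ(K)} {Y : ℬ(K, Ampl K ι)}
    (h : ∀ᶠ i in l, (x i, X i) ∈ closedGraph δ)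
    (hx : Tendsto x l (𝓝ᵤ y))
    (hX : Tendsto X l (𝓝ᵤ Y)) : (y, Y) ∈ closedGraph δ :=
  mem_ultraweakPairClosure_of_tendsto h hx hX

lemma Factorizes.norm_sq (hδ : Factorizes T δ) (f : S) :
    ‖(δ f : ℬ(K, Ampl K ι))‖ ^ 2 = ‖gradientForm T (f : Elem M) f‖ := by
  have h := hδ f f
  have h1 : ‖gradientForm T (f : Elem M) f‖ = ‖(gradientForm T f f).1‖ := rfl
  rw [h1, h, norm_adjoint_comp_self, sq]

/-- The derivation is closable for the weak-* topologies. -/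
lemma eq_zero_of_mem_closedGraph (hτ : IsNSFTrace M τ) (hT : IsMarkovSemigroup M τ T)
    (hS : IsTestAlgebra τ T S) (hδ : Factorizes T δ) {X : ℬ(K, Ampl K ι)}
    (h : (0, X) ∈ closedGraph δ) : X = 0 := by
  obtain ⟨U, hU, h1, h2⟩ := mem_ultraweakPairClosure_iff.1 h
  simp only at h1 h2
  -- `⟨δ g, X⟩ = 0`
  have key : ∀ g : S, adjoint (δ g : ℬ(K, Ampl K ι)) ∘L X = 0 := by
    intro g
    have h3 := tendsto_sandwich h2 (adjoint (δ g : ℬ(K, Ampl K ι)))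
      (ContinuousLinearMap.id ℂ K)
    simp only [comp_id] at h3
    have hmem : adjoint (δ g : ℬ(K, Ampl K ι)) ∘L X ∈ M := by
      refine mem_of_tendsto_ultraweak ?_ h3
      filter_upwards [hU] with p hp
      obtain ⟨f, -, hf⟩ := hp
      rw [hf, ← hδ]
      exact (gradientForm T (g : Elem M) f).2
    have h4 : (⟨_, hmem⟩ : Elem M) = 0 := by
      refine hS.eq_zero_of_pairing hτ fun k hk => ?_
      have hAg := hS.generator_mem hT g.2
      have hq := sub_mem (add_mem (mul_mem hk (star_mem hAg))
        (hS.generator_mem hT (mul_mem hk (star_mem g.2))))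
        (mul_mem (hS.generator_mem hT hk) (star_mem g.2))
      have h5 := (tendsto_ultraweak_iff.1 h3 _ (hS.pairing_normal hτ hk)).const_mul 2
      have h6 := tendsto_ultraweak_iff.1 h1 _ (hS.pairing_normal hτ hq)
      rw [map_zero] at h6
      have h7 := tendsto_nhds_unique h5 (h6.congr' (by
        filter_upwards [hU] with p hp
        obtain ⟨f, hf1, hf⟩ := hp
        rw [hf, ← hδ, hf1, hS.pairing_gradientForm hτ hT hk g.2 f.2]))
      simpa using h7
    exact congrArg Subtype.val h4
  have h3 := tendsto_sandwich h2 (adjoint X) (ContinuousLinearMap.id ℂ K)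
  simp only [comp_id] at h3
  have h4 : adjoint X ∘L X = 0 := by
    refine ultraweak_unique (h3.congr' (f₂ := fun _ => 0) ?_)
      (tendsto_ultraweak_of_norm tendsto_const_nhds)
    filter_upwards [hU] with p hp
    obtain ⟨f, -, hf⟩ := hp
    have := congrArg adjoint (key f)
    rw [ContinuousLinearMap.adjoint_comp, ContinuousLinearMap.adjoint_adjoint, map_zero] at this
    rw [hf, this]
  have h5 := norm_adjoint_comp_self X
  rw [h4, norm_zero] at h5
  exact norm_eq_zero.1 (mul_self_eq_zero.1 h5.symm)

lemma closedGraph_unique (hτ : IsNSFTrace M τ) (hT : IsMarkovSemigroup M τ T)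
    (hS : IsTestAlgebra τ T S) (hδ : Factorizes T δ) {x : ℬ(K)} {X Y : ℬ(K, Ampl K ι)}
    (hX : (x, X) ∈ closedGraph δ) (hY : (x, Y) ∈ closedGraph δ) : X = Y := by
  have h := closedGraph_sub hX hY
  rw [sub_self] at h
  exact sub_eq_zero.1 (eq_zero_of_mem_closedGraph hτ hT hS hδ h)

/-- The range of `P_r` is in the domain of the closure of `δ`. -/
lemma exists_closedGraph_poisson (hτ : IsNSFTrace M τ) (hT : IsMarkovSemigroup M τ T)
    (hS : IsTestAlgebra τ T S) (hΓ : GradientForm₂Nonneg T S) (hδ : Factorizes T δ) {r : ℝ}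
    (hr : 0 < r) (m : Elem M) : ∃ X : ℬ(K, Ampl K ι),
      ((poisson T r m).1, X) ∈ closedGraph δ ∧ ‖X‖ ≤ 4 / r * ‖m‖ := by
  obtain ⟨g, hg, hgm⟩ := exists_bounded_net S hS.dense m
  let U : Ultrafilter (Finset K × ℕ) := Ultrafilter.of atTop
  have hgU := hgm.mono_left (Ultrafilter.of_le atTop)
  let k : Finset K × ℕ → S := fun i => ⟨poisson T r (g i), hS.poisson_mem r hr _ (hg i).1⟩
  have hX : ∀ i, ‖(δ (k i) : ℬ(K, Ampl K ι))‖ ≤ 4 / r * ‖m‖ := by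
    intro i
    refine abs_le_of_sq_le_sq' ?_ (by positivity) |>.2
    rw [hδ.norm_sq]
    refine (hS.norm_gradientForm_poisson_le_sq hT hΓ (hg i).1 hr).trans ?_
    rw [mul_pow, div_pow, div_mul_eq_mul_div, ← mul_pow]
    gcongr
    exact (hg i).2
  have hP : ∀ i, ‖(poisson T r (g i)).1‖ ≤ 4 * ‖m‖ := fun i =>
    (hT.norm_poisson_le hr (g i)).trans (hg i).2
  obtain ⟨X, hXn, hXl⟩ := exists_ultraweak_limit U (fun i => (δ (k i) : ℬ(K, Ampl K ι)))
    (by positivity) (.of_forall hX)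
  obtain ⟨Y, hYn, hYl⟩ := exists_ultraweak_limit U (fun i => (poisson T r (g i)).1)
    (by positivity) (.of_forall hP)
  have hYM : Y ∈ M := mem_of_tendsto_ultraweak
    (.of_forall fun i => (poisson T r (g i)).2) hYl
  have e := hS.poisson_eq_of_tendsto hτ hT hr (z := ⟨Y, hYM⟩) hgU hYl
  refine ⟨X, ?_, hXn⟩
  rw [e]
  exact closedGraph_of_tendsto (.of_forall fun i => mem_closedGraph (k i)) hYl hXl

end Closure

/-! ### Dyadic summation and the two-sided bounds -/

section Dyadic

variable {α : ℝ}

lemma dyadic_ratio_lt_one (hα : α < 1) : (2 : ℝ) ^ (α - 1) < 1 :=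
  Real.rpow_lt_one_of_one_lt_of_neg one_lt_two (by linarith)

lemma dyadic_ratio_pos : 0 < (2 : ℝ) ^ (α - 1) := Real.rpow_pos_of_pos two_pos _

/-- Dyadic summation: an increment `N s^{α-1}` from `2s` to `s`, for a function that vanishes at
infinity, gives the bound `N s^{α-1} ∑ₙ 2^{n(α-1)}`. -/
lemma dyadic_bound {v : ℝ → ℝ} {u : ℕ → ℝ} {N s : ℝ} (hα : α < 1) (hN : 0 ≤ N) (hs : 0 < s)
    (h : ∀ r, s ≤ r → v r ≤ v (2 * r) + N * r ^ (α - 1))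
    (h0 : ∀ n, v (2 ^ n * s) ≤ u n) (hu : Tendsto u atTop (𝓝 0)) :
    v s ≤ N * s ^ (α - 1) / (1 - 2 ^ (α - 1)) := by
  set ρ : ℝ := 2 ^ (α - 1) with hρ
  have hρ0 : 0 < ρ := dyadic_ratio_pos
  have hρ1 : ρ < 1 := dyadic_ratio_lt_one hα
  have hs' : 0 ≤ N * s ^ (α - 1) := mul_nonneg hN (rpow_nonneg hs.le _)
  have h1 : ∀ n : ℕ, v s ≤ v (2 ^ n * s)
      + N * s ^ (α - 1) * ∑ j ∈ Finset.range n, ρ ^ j := by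
    intro n
    induction n with
    | zero => simp
    | succ n ih =>
      have h2 := h (2 ^ n * s) (le_mul_of_one_le_left hs.le (one_le_pow₀ one_le_two))
      have e : (2 ^ n * s) ^ (α - 1) = ρ ^ n * s ^ (α - 1) := by
        rw [Real.mul_rpow (by positivity) hs.le, ← Real.rpow_natCast, ← Real.rpow_mul two_pos.le,
          mul_comm (n : ℝ), Real.rpow_mul two_pos.le, Real.rpow_natCast]
      rw [e, ← mul_assoc, ← pow_succ'] at h2
      rw [Finset.sum_range_succ]
      nlinarith
  have h4 : ∀ n : ℕ, ∑ j ∈ Finset.range n, ρ ^ j ≤ (1 - ρ)⁻¹ := fun n => by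
    rw [← tsum_geometric_of_lt_one hρ0.le hρ1]
    exact (summable_geometric_of_lt_one hρ0.le hρ1).sum_le_tsum _ fun j _ => by positivity
  have h3 := hu.add_const (N * s ^ (α - 1) / (1 - ρ))
  rw [zero_add] at h3
  refine ge_of_tendsto' h3 fun n => (h1 n).trans (add_le_add (h0 n) ?_)
  rw [div_eq_mul_inv (N * s ^ (α - 1))]
  exact mul_le_mul_of_nonneg_left (h4 n) hs'

lemma weightedSup_le {C : ℝ} (hC : 0 < C) {f g : ℝ → ℝ}
    (h : ∀ N, 0 ≤ N → (∀ s, 0 < s → s ^ (1 - α) * g s ≤ N) →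
      ∀ s, 0 < s → s ^ (1 - α) * f s ≤ C * N) :
    weightedSup α f ≤ ENNReal.ofReal C * weightedSup α g := by
  by_cases htop : weightedSup α g = ∞
  · rw [htop, ENNReal.mul_top (by simpa using hC)]; exact le_top
  refine iSup₂_le fun s hs => ?_
  have h1 := h (weightedSup α g).toReal ENNReal.toReal_nonneg (fun r hr => by
    rw [← ENNReal.ofReal_le_iff_le_toReal htop]
    exact le_iSup₂ (f := fun (r : ℝ) (_ : 0 < r) => ENNReal.ofReal (r ^ (1 - α) * g r)) r hr) s hs
  calc ENNReal.ofReal (s ^ (1 - α) * f s) ≤ ENNReal.ofReal (C * (weightedSup α g).toReal) :=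
        ENNReal.ofReal_le_ofReal h1
    _ = _ := by rw [ENNReal.ofReal_mul hC.le, ENNReal.ofReal_toReal htop]

/-- The constant in the two-sided bounds. -/
def holderConst (α : ℝ) : ℝ := 1 + 64 / (1 - 2 ^ (α - 1))

lemma holderConst_pos (hα : α < 1) : 0 < holderConst α := by
  have := dyadic_ratio_lt_one hα
  have : 0 < 1 - (2 : ℝ) ^ (α - 1) := by linarith
  unfold holderConst
  positivity

lemma one_le_holderConst (hα : α < 1) : 1 ≤ holderConst α := by
  have := dyadic_ratio_lt_one hα
  have : 0 < 1 - (2 : ℝ) ^ (α - 1) := by linarith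
  unfold holderConst
  have : 0 < 64 / (1 - (2 : ℝ) ^ (α - 1)) := by positivity
  linarith

/-- The two-sided bound, for `d = ‖∂_s P_s f‖`, `v = ‖Γ(P_s f)‖^{1/2}` and
`w = ‖Γ(P_s f) + |∂_s P_s f|²‖^{1/2}`. -/
lemma weightedSup_equiv (hα : α < 1) {v d w : ℝ → ℝ} {c : ℝ} (hdw : ∀ s, 0 < s → d s ≤ w s)
    (hwv : ∀ s, 0 < s → w s ≤ v s + d s)
    (hv : ∀ N, 0 ≤ N → (∀ s, 0 < s → d s ≤ N * s ^ (α - 1)) →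
      ∀ s, 0 < s → v s ≤ v (2 * s) + 16 * N * s ^ (α - 1))
    (hc : ∀ s, 0 < s → v s ≤ c / s) :
    weightedSup α w ≤ ENNReal.ofReal (holderConst α) * weightedSup α d ∧
      weightedSup α d ≤ ENNReal.ofReal (holderConst α) * weightedSup α w := by
  have hpow : ∀ s : ℝ, 0 < s → s ^ (1 - α) * s ^ (α - 1) = 1 := fun s hs => by
    rw [← rpow_add hs]; simp
  constructor
  · refine weightedSup_le (holderConst_pos hα) fun N hN h s hs => ?_
    have hd : ∀ s, 0 < s → d s ≤ N * s ^ (α - 1) := by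
      intro s hs
      have h1 := mul_le_mul_of_nonneg_right (h s hs) (rpow_nonneg hs.le (α - 1))
      calc d s = s ^ (1 - α) * s ^ (α - 1) * d s := by rw [hpow s hs, one_mul]
        _ ≤ _ := by linarith
    have hu : Tendsto (fun n : ℕ => c / s * (1 / 2) ^ n) atTop (𝓝 0) := by
      simpa using (tendsto_pow_atTop_nhds_zero_of_lt_one (r := (1 / 2 : ℝ)) (by norm_num)
        (by norm_num)).const_mul (c / s)
    have h1 := dyadic_bound hα (by positivity) hs (fun r hr => hv N hN hd r (hs.trans_le hr))
      (fun n => (hc (2 ^ n * s) (by positivity)).trans (le_of_eq (by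
        rw [div_pow, one_pow]; field_simp))) hu
    have h2 := (hwv s hs).trans (add_le_add h1 (hd s hs))
    have h3 := mul_le_mul_of_nonneg_left h2 (rpow_nonneg hs.le (1 - α))
    have hρ := sub_pos.2 (dyadic_ratio_lt_one hα)
    refine h3.trans ?_
    calc s ^ (1 - α) * (16 * N * s ^ (α - 1) / (1 - 2 ^ (α - 1)) + N * s ^ (α - 1))
        = (s ^ (1 - α) * s ^ (α - 1)) * (16 * N / (1 - 2 ^ (α - 1)) + N) := by ring
      _ ≤ _ := by
        rw [hpow s hs, one_mul, holderConst, add_mul, one_mul, add_comm, div_mul_eq_mul_div]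
        gcongr
        norm_num
  · refine weightedSup_le (holderConst_pos hα) fun N hN h s hs => ?_
    have h1 := mul_le_mul_of_nonneg_left (hdw s hs) (rpow_nonneg hs.le (1 - α))
    exact h1.trans ((h s hs).trans (le_mul_of_one_le_left hN (one_le_holderConst hα)))

end Dyadic

section TwoSided

variable {α : ℝ}

lemma IsMarkovSemigroup.norm_poisson_sub_le (hT : IsMarkovSemigroup M τ T) (hα₀ : 0 < α)
    (hα : α < 1) {f : Elem M} {N : ℝ} (hN : 0 ≤ N)
    (h : ∀ s, 0 < s → ‖poissonDeriv T s f‖ ≤ N * s ^ (α - 1)) {s : ℝ} (hs : 0 < s) :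
    ‖poisson T (s / 2) f - poisson T (s / 2 + s) f‖ ≤ s * (2 * N * s ^ (α - 1)) := by
  have h1 : ∀ r ∈ Ici (s / 2), HasDerivWithinAt (fun r => (poisson T r f).1)
      (poissonDeriv T r f) (Ici (s / 2)) r := fun r hr =>
    (hT.hasDerivAt_poisson' (lt_of_lt_of_le (half_pos hs) hr) f).hasDerivWithinAt
  have h2 := Convex.norm_image_sub_le_of_norm_hasDerivWithin_le (C := 2 * N * s ^ (α - 1)) h1
    (fun r hr => by
      have hr' : s / 2 ≤ r := hr
      refine (h r (lt_of_lt_of_le (half_pos hs) hr')).trans ?_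
      have h3 : r ^ (α - 1) ≤ (s / 2) ^ (α - 1) :=
        Real.rpow_le_rpow_of_nonpos (half_pos hs) hr' (by linarith)
      have h4 : (s / 2) ^ (α - 1) ≤ 2 * s ^ (α - 1) := by
        rw [Real.div_rpow hs.le two_pos.le, div_le_iff₀ dyadic_ratio_pos]
        have h5 : (2 : ℝ)⁻¹ ≤ 2 ^ (α - 1) := by
          rw [← Real.rpow_neg_one]
          exact Real.rpow_le_rpow_of_exponent_le one_le_two (by linarith)
        have h6 := rpow_nonneg hs.le (α - 1)
        nlinarith
      calc N * r ^ (α - 1) ≤ N * (2 * s ^ (α - 1)) := by gcongr; exact h3.trans h4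
        _ = _ := by ring)
    (convex_Ici _) (mem_Ici.2 (by linarith : s / 2 ≤ s / 2 + s)) (mem_Ici.2 le_rfl)
  refine h2.trans (le_of_eq ?_)
  rw [show s / 2 - (s / 2 + s) = -s by ring, norm_neg, norm_of_nonneg hs.le]
  ring

lemma IsMarkovSemigroup.poisson_sub_poisson_two (hT : IsMarkovSemigroup M τ T) {s : ℝ} (hs : 0 < s)
    (f : Elem M) : poisson T s f - poisson T (2 * s) f
      = poisson T (s / 2) (poisson T (s / 2) f - poisson T (s / 2 + s) f) := by
  rw [hT.poisson_sub (half_pos hs), hT.poisson_poisson (half_pos hs) (half_pos hs),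
    hT.poisson_poisson (half_pos hs) (by positivity), add_halves, ← add_assoc, add_halves, two_mul]

namespace IsTestAlgebra

variable (hS : IsTestAlgebra τ T S) (hT : IsMarkovSemigroup M τ T)
include hS hT

/-- `Γ(x + y) ≤ (1 + t) Γ(x) + (1 + t⁻¹) Γ(y)`. -/
lemma norm_gradientForm_add_le {x y : Elem M} (hx : x ∈ S) (hy : y ∈ S) {t : ℝ} (ht : 0 < t) :
    ‖gradientForm T (x + y) (x + y)‖
      ≤ (1 + t) * ‖gradientForm T x x‖ + (1 + t⁻¹) * ‖gradientForm T y y‖ := by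
  refine norm_le_of_vectorState (hS.gradientForm_nonneg hT (add_mem hx hy))
    (by positivity) fun v => ?_
  have hty : ((t⁻¹ : ℝ) : ℂ) • y ∈ S := SMulMemClass.smul_mem _ hy
  have hny : (-((t⁻¹ : ℝ) : ℂ)) • y ∈ S := SMulMemClass.smul_mem _ hy
  have h0 := hS.gradientForm_nonneg hT (add_mem hx hny)
  have h1 := mul_nonneg ht.le (vectorState_nonneg h0 v)
  have htc : (t : ℂ) ≠ 0 := by exact_mod_cast ht.ne'
  have e : ((t : ℝ) : ℂ) • gradientForm T (x + (-((t⁻¹ : ℝ) : ℂ)) • y) (x + (-((t⁻¹ : ℝ) : ℂ)) • y)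
      = ((1 + t : ℝ) : ℂ) • gradientForm T x x + ((1 + t⁻¹ : ℝ) : ℂ) • gradientForm T y y
        - gradientForm T (x + y) (x + y) := by
    rw [hS.gradientForm_add_right hT (add_mem hx hny) hx hny,
      hS.gradientForm_add_left hT hx hny hx, hS.gradientForm_add_left hT hx hny hny,
      hS.gradientForm_smul_left hT hy hx, hS.gradientForm_smul_right hT hx hy,
      hS.gradientForm_smul_left hT hy hny, hS.gradientForm_smul_right hT hy hy,
      hS.gradientForm_add_right hT (add_mem hx hy) hx hy,
      hS.gradientForm_add_left hT hx hy hx, hS.gradientForm_add_left hT hx hy hy]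
    rw [map_neg, conj_ofReal]
    push_cast
    simp only [smul_add, smul_smul, mul_neg, neg_mul, neg_neg, mul_inv_cancel₀ htc]
    rw [← mul_assoc, mul_inv_cancel₀ htc]
    module
  rw [← vectorState_smul, e, map_sub, map_add, vectorState_smul, vectorState_smul] at h1
  have h2 := mul_le_mul_of_nonneg_left (vectorState_le_norm (gradientForm T x x) v)
    (by positivity : (0 : ℝ) ≤ 1 + t)
  have h3 := mul_le_mul_of_nonneg_left (vectorState_le_norm (gradientForm T y y) v)
    (by positivity : (0 : ℝ) ≤ 1 + t⁻¹)
  linarith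

/-- `‖Γ(·)‖^{1/2}` is a seminorm. -/
lemma sqrt_norm_gradientForm_add_le {x y : Elem M} (hx : x ∈ S) (hy : y ∈ S) :
    √‖gradientForm T (x + y) (x + y)‖ ≤ √‖gradientForm T x x‖ + √‖gradientForm T y y‖ := by
  refine le_of_forall_pos_le_add fun ε hε => ?_
  set a := √‖gradientForm T x x‖ + ε / 2 with ha
  set b := √‖gradientForm T y y‖ + ε / 2 with hb
  have ha0 : 0 < a := by positivity
  have hb0 : 0 < b := by positivity
  have h := hS.norm_gradientForm_add_le hT hx hy (t := b / a) (by positivity)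
  have hxa : ‖gradientForm T x x‖ ≤ a ^ 2 := by
    rw [← sqrt_le_left ha0.le]; linarith
  have hyb : ‖gradientForm T y y‖ ≤ b ^ 2 := by
    rw [← sqrt_le_left hb0.le]; linarith
  have h2 : ‖gradientForm T (x + y) (x + y)‖ ≤ (a + b) ^ 2 := by
    calc _ ≤ (1 + b / a) * a ^ 2 + (1 + (b / a)⁻¹) * b ^ 2 := h.trans (by gcongr)
      _ = _ := by field_simp; ring
  calc _ ≤ a + b := (sqrt_le_left (by positivity)).2 h2
    _ = _ := by rw [ha, hb]; ring

/-- `Γ̂[P_s f] = Γ(P_s f, P_s f) + |∂_s P_s f|²`. -/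
lemma spaceTimeGradient_poisson {f : Elem M} (hf : f ∈ S) {s : ℝ} (hs : 0 < s) :
    spaceTimeGradient T (fun r => poisson T r f) (fun r => poisson T r f) s
      = (gradientForm T (poisson T s f) (poisson T s f)).1
        + star (poissonDeriv T s f) * poissonDeriv T s f := by
  let F : ℝ → ℬ(K) := fun r => (poisson T r f).1
  let B : ℝ → ℬ(K) := fun r => (poisson T r (sqrtGenerator T f)).1
  have hd : ∀ r, 0 < r → HasDerivAt F (-B r) r := fun r hr => by
    rw [← hS.poissonDeriv_eq hT hf hr]; exact hT.hasDerivAt_poisson' hr f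
  have hd2 : ∀ r, 0 < r → HasDerivAt B (-(poisson T r (generator T f) : ℬ(K))) r :=
    fun r hr => by
      rw [hS.generator_eq_sqrt hT hf, ← hS.poissonDeriv_eq hT (hS.sqrt_mem hf) hr]
      exact hT.hasDerivAt_poisson' hr _
  have hev : ∀ᶠ r in 𝓝 s, 0 < r := eventually_gt_nhds hs
  have h2 : iteratedDeriv 2 F s = (poisson T s (generator T f)).1 := by
    rw [iteratedDeriv_succ, iteratedDeriv_one]
    have h1 : HasDerivAt (fun r => -B r) (poisson T s (generator T f)).1 s := by
      have := (hd2 s hs).neg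
      rw [neg_neg] at this
      exact this
    exact (h1.congr_of_eventuallyEq (hev.mono fun r hr => (hd r hr).deriv)).deriv
  have h3 : iteratedDeriv 2 (fun r => star (F r) * F r) s
      = star (poisson T s (generator T f)).1 * F s + (2 : ℂ) • (star (B s) * B s)
        + star (F s) * (poisson T s (generator T f)).1 := by
    rw [iteratedDeriv_succ, iteratedDeriv_one]
    have h4 : HasDerivAt (fun r => star (-B r) * F r + star (F r) * (-B r))
        (star (poisson T s (generator T f)).1 * F s + (2 : ℂ) • (star (B s) * B s)
        + star (F s) * (poisson T s (generator T f)).1) s := by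
      have h1 := ((((hd2 s hs).neg).star.mul (hd s hs)).add ((hd s hs).star.mul (hd2 s hs).neg))
      refine (h1.congr_deriv ?_).congr_of_eventuallyEq (.of_forall fun r => rfl)
      simp only [neg_neg, star_neg, Pi.neg_apply]
      rw [two_smul]
      noncomm_ring
    exact (h4.congr_of_eventuallyEq
      (hev.mono fun r hr => ((hd r hr).star.mul (hd r hr)).deriv)).deriv
  have g1 : spaceTimeGenerator T (fun r => poisson T r f) s = 0 := by
    rw [spaceTimeGenerator, hS.generator_poisson hT hf hs]
    exact sub_eq_zero.2 h2.symm
  have g2 : spaceTimeGenerator T (fun r => star (poisson T r f) * poisson T r f) s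
      = (generator T (star (poisson T s f) * poisson T s f) : ℬ(K))
        - (star (poisson T s (generator T f)).1 * F s + (2 : ℂ) • (star (B s) * B s)
        + star (F s) * (poisson T s (generator T f)).1) := by
    rw [spaceTimeGenerator, ← h3]; rfl
  have g3 : (gradientForm T (poisson T s f) (poisson T s f)).1
      = (1 / 2 : ℂ) • (star (poisson T s (generator T f)).1 * F s
        + star (F s) * (poisson T s (generator T f)).1
        - (generator T (star (poisson T s f) * poisson T s f) : ℬ(K))) := by
    rw [gradientForm_eq, hS.generator_poisson hT hf hs]; rfl
  rw [spaceTimeGradient, g1, g2, g3, hS.poissonDeriv_eq hT hf hs, star_zero, zero_mul, mul_zero,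
    add_zero, zero_sub, star_neg, neg_mul_neg]
  simp only [B, F]
  module

/-- The two-sided bound on the test algebra. -/
lemma weightedSup_spaceTimeGradient (hΓ : GradientForm₂Nonneg T S) (hα₀ : 0 < α) (hα : α < 1)
    {f : Elem M} (hf : f ∈ S) :
    weightedSup α (fun s => √‖spaceTimeGradient T
        (fun r => poisson T r f) (fun r => poisson T r f) s‖)
      ≤ ENNReal.ofReal (holderConst α) * weightedSup α (fun s => ‖poissonDeriv T s f‖) ∧
    weightedSup α (fun s => ‖poissonDeriv T s f‖)
      ≤ ENNReal.ofReal (holderConst α) * weightedSup α (fun s => √‖spaceTimeGradient T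
        (fun r => poisson T r f) (fun r => poisson T r f) s‖) := by
  have hP : ∀ s, 0 < s → poisson T s f ∈ S := fun s hs => hS.poisson_mem s hs f hf
  have hbound : ∀ g ∈ S, ∀ s, 0 < s →
      √‖gradientForm T (poisson T s g) (poisson T s g)‖ ≤ ‖g‖ / s := by
    intro g hg s hs
    rw [sqrt_le_left (by positivity), div_pow]
    exact hS.norm_gradientForm_poisson_le_sq hT hΓ hg hs
  refine weightedSup_equiv hα (v := fun s => √‖gradientForm T (poisson T s f) (poisson T s f)‖)
    (c := ‖f‖) (fun s hs => ?_) (fun s hs => ?_) (fun N hN h s hs => ?_) (hbound f hf)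
  · rw [hS.spaceTimeGradient_poisson hT hf hs]
    refine Real.le_sqrt_of_sq_le ?_
    rw [sq, ← CStarRing.norm_star_mul_self]
    exact CStarAlgebra.norm_le_norm_of_nonneg_of_le (star_mul_self_nonneg _)
      (le_add_of_nonneg_left (hS.gradientForm_nonneg hT (hP s hs)))
  · rw [hS.spaceTimeGradient_poisson hT hf hs, sqrt_le_left (by positivity)]
    refine (norm_add_le _ _).trans ?_
    rw [CStarRing.norm_star_mul_self, add_sq, sq_sqrt (norm_nonneg _)]
    have : 0 ≤ 2 * √‖gradientForm T (poisson T s f) (poisson T s f)‖ * ‖poissonDeriv T s f‖ := by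
      positivity
    have e : ‖(gradientForm T (poisson T s f) (poisson T s f)).1‖
      = ‖gradientForm T (poisson T s f) (poisson T s f)‖ := rfl
    rw [e]
    nlinarith
  · have hg := sub_mem (hP (s / 2) (half_pos hs)) (hP (s / 2 + s) (by positivity))
    have h1 := hS.sqrt_norm_gradientForm_add_le hT (hP (2 * s) (by positivity))
      (hS.poisson_mem (s / 2) (half_pos hs) _ hg)
    rw [← hT.poisson_sub_poisson_two hs, add_sub_cancel, hT.poisson_sub_poisson_two hs] at h1
    refine h1.trans (add_le_add_right ?_ _)
    refine (hbound _ hg _ (half_pos hs)).trans ?_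
    have h2 := hT.norm_poisson_sub_le hα₀ hα hN h hs
    rw [div_le_iff₀ (half_pos hs)]
    have := mul_nonneg (mul_nonneg hN (rpow_nonneg hs.le (α - 1))) hs.le
    nlinarith

end IsTestAlgebra

/-- The two-sided bound on all of `M`, through the closure of the derivation. -/
lemma exists_closure_bound {ι : Type v} {δ : S →ₗ[ℂ] columnModule M ι} (hτ : IsNSFTrace M τ)
    (hT : IsMarkovSemigroup M τ T) (hS : IsTestAlgebra τ T S) (hΓ : GradientForm₂Nonneg T S)
    (hδ : Factorizes T δ) (hα₀ : 0 < α) (hα : α < 1) (f : Elem M) :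
    ∃ η : ℝ → ℬ(K, Ampl K ι),
      (∀ s : ℝ, 0 < s → ∀ X : ℬ(K, Ampl K ι),
        ((poisson T s f).1, X) ∈ closedGraph δ ↔ X = η s) ∧
      weightedSup α (fun s => √‖adjoint (η s) ∘L η s
          + star (poissonDeriv T s f) * poissonDeriv T s f‖)
        ≤ ENNReal.ofReal (holderConst α) * weightedSup α (fun s => ‖poissonDeriv T s f‖) ∧
      weightedSup α (fun s => ‖poissonDeriv T s f‖)
        ≤ ENNReal.ofReal (holderConst α) *
          weightedSup α (fun s => √‖adjoint (η s) ∘L η s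
            + star (poissonDeriv T s f) * poissonDeriv T s f‖) := by
  have h1 : ∀ s : ℝ, ∃ X : ℬ(K, Ampl K ι), 0 < s →
      ((poisson T s f).1, X) ∈ closedGraph δ ∧ ‖X‖ ≤ 4 / s * ‖f‖ := by
    intro s
    by_cases hs : 0 < s
    · obtain ⟨X, hX⟩ := exists_closedGraph_poisson hτ hT hS hΓ hδ hs f
      exact ⟨X, fun _ => hX⟩
    · exact ⟨0, fun h => absurd h hs⟩
  choose η hη using h1
  refine ⟨η, fun s hs X => ⟨fun hX => closedGraph_unique hτ hT hS hδ hX (hη s hs).1,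
    fun hX => hX ▸ (hη s hs).1⟩, ?_⟩
  have hpos : ∀ s, 0 ≤ adjoint (η s) ∘L η s := fun s => by
    rw [nonneg_iff_inner]
    intro v
    rw [ContinuousLinearMap.comp_apply, adjoint_inner_right,
      inner_self_eq_norm_sq_to_K]
    have := zero_le_real.2 (sq_nonneg ‖η s v‖)
    push_cast at this
    exact this
  refine weightedSup_equiv hα (v := fun s => ‖η s‖) (c := 4 * ‖f‖) (fun s hs => ?_)
    (fun s hs => ?_) (fun N hN h s hs => ?_) (fun s hs => ?_)
  · refine Real.le_sqrt_of_sq_le ?_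
    rw [sq, ← CStarRing.norm_star_mul_self]
    exact CStarAlgebra.norm_le_norm_of_nonneg_of_le (star_mul_self_nonneg _)
      (le_add_of_nonneg_left (hpos s))
  · rw [sqrt_le_left (by positivity)]
    refine (norm_add_le _ _).trans ?_
    rw [CStarRing.norm_star_mul_self, norm_adjoint_comp_self]
    nlinarith [norm_nonneg (η s), norm_nonneg (poissonDeriv T s f)]
  · obtain ⟨X, hX, hXn⟩ := exists_closedGraph_poisson hτ hT hS hΓ hδ (half_pos hs)
      (poisson T (s / 2) f - poisson T (s / 2 + s) f)
    rw [← hT.poisson_sub_poisson_two hs] at hX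
    have h2 := closedGraph_add (hη (2 * s) (by positivity)).1 hX
    have e : (poisson T (2 * s) f : ℬ(K)) + ((poisson T s f - poisson T (2 * s) f : Elem M)
        : ℬ(K)) = poisson T s f := add_sub_cancel _ (poisson T s f).1
    rw [e] at h2
    have h3 := closedGraph_unique hτ hT hS hδ (hη s hs).1 h2
    have h4 := hT.norm_poisson_sub_le hα₀ hα hN h hs
    rw [h3]
    have h5 : 4 / (s / 2) * ‖poisson T (s / 2) f - poisson T (s / 2 + s) f‖
        ≤ 16 * N * s ^ (α - 1) := by
      calc _ ≤ 4 / (s / 2) * (s * (2 * N * s ^ (α - 1))) := by gcongr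
        _ = _ := by field_simp; ring
    have h6 := norm_add_le (η (2 * s)) X
    linarith
  · have := (hη s hs).2
    rwa [div_mul_eq_mul_div] at this

end TwoSided

/-! ### Operators of multiplication on `L²(ℝ₊; E)` and their weighted slices -/

section Slices

variable {E : Type u} {F : Type v} [NormedAddCommGroup E] [InnerProductSpace ℂ E]
  [NormedAddCommGroup F] [InnerProductSpace ℂ F]

/-- Lebesgue measure on `ℝ₊`. -/
abbrev posVol : Measure ℝ := volume.restrict (Ioi 0)

lemma exists_isMultiplication {G : ℝ → ℬ(E, F)} {c : ℝ} (hG : ContinuousOn G (Ioi 0))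
    (hc : ∀ s, 0 < s → ‖G s‖ ≤ c) : ∃ Θ : ℬ(L2Pos E, L2Pos F), IsMultiplication G Θ := by
  have hm : MemLp G ∞ posVol := memLp_top_of_bound (hG.aestronglyMeasurable measurableSet_Ioi) c
    ((ae_restrict_iff' measurableSet_Ioi).2 (.of_forall fun s hs => hc s hs))
  refine ⟨(ContinuousLinearMap.id ℂ ℬ(E, F)).holderL posVol ∞ 2 2 hm.toLp, fun h => ?_⟩
  filter_upwards [(ContinuousLinearMap.id ℂ ℬ(E, F)).coeFn_holder (r := 2) hm.toLp h,
    hm.coeFn_toLp] with s h1 h2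
  refine h1.trans ?_
  rw [h2]
  rfl

lemma IsMultiplication.norm_le {G : ℝ → ℬ(E, F)} {Θ : ℬ(L2Pos E, L2Pos F)}
    (hG : IsMultiplication G Θ) {c : ℝ} (hc0 : 0 ≤ c) (hc : ∀ s, 0 < s → ‖G s‖ ≤ c) : ‖Θ‖ ≤ c := by
  refine Θ.opNorm_le_bound hc0 fun h => Lp.norm_le_mul_norm_of_ae_le_mul ?_
  filter_upwards [hG h, ae_restrict_mem measurableSet_Ioi] with s h1 h2
  rw [h1]
  exact (G s).le_of_opNorm_le (hc s h2) _

/-- `0 ≤ w ≤ c`, and `w` vanishes outside of the interval `(a, b]`, where `a > 0`. -/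
structure IsWeight (a b c : ℝ) (w : ℝ → ℝ) : Prop where
  pos : 0 < a
  measurable : Measurable w
  nonneg : ∀ ρ, 0 ≤ w ρ
  le : ∀ ρ, w ρ ≤ c
  support : ∀ ρ, ρ ∉ Ioc a b → w ρ = 0

variable {a b c α : ℝ} {w : ℝ → ℝ}

/-- The density `ρ^{α-1} w(ρ)` that undoes the factor `ρ^{1-α}` of Hölder symbols. -/
def density (α : ℝ) (w : ℝ → ℝ) (ρ : ℝ) : ℝ := ρ ^ (α - 1) * w ρ

/-- The function `√(ρ^{α-1} w(ρ))`. -/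
def weightFun (α : ℝ) (w : ℝ → ℝ) (ρ : ℝ) : ℂ := (√(density α w ρ) : ℝ)

namespace IsWeight

lemma density_nonneg (hw : IsWeight a b c w) (ρ : ℝ) : 0 ≤ density α w ρ := by
  by_cases h : ρ ∈ Ioc a b
  · exact mul_nonneg (rpow_nonneg (hw.pos.trans h.1).le _) (hw.nonneg ρ)
  · rw [density, hw.support ρ h, mul_zero]

lemma density_le (hw : IsWeight a b c w) (hα : α < 1) (ρ : ℝ) :
    density α w ρ ≤ (Ioc a b).indicator (fun _ => a ^ (α - 1) * c) ρ := by
  by_cases h : ρ ∈ Ioc a b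
  · rw [Set.indicator_of_mem h]
    have := rpow_nonneg hw.pos.le (α - 1)
    exact mul_le_mul (Real.rpow_le_rpow_of_nonpos hw.pos h.1.le (by linarith)) (hw.le ρ)
      (hw.nonneg ρ) this
  · rw [Set.indicator_of_notMem h, density, hw.support ρ h, mul_zero]

lemma measurable_density (hw : IsWeight a b c w) : Measurable (density α w) :=
  (measurable_id.pow_const (α - 1)).mul hw.measurable

lemma integrable_indicator (hw : IsWeight a b c w) :
    Integrable ((Ioc a b).indicator fun _ => a ^ (α - 1) * c) posVol :=
  ((integrable_indicator_iff measurableSet_Ioc).2 (integrableOn_const (by simp))).integrableOn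

lemma integrable_density (hw : IsWeight a b c w) (hα : α < 1) : Integrable (density α w) posVol :=
  hw.integrable_indicator.mono' hw.measurable_density.aestronglyMeasurable
    (.of_forall fun ρ => by
      rw [norm_of_nonneg (hw.density_nonneg ρ)]; exact hw.density_le hα ρ)

lemma integral_density_le (hw : IsWeight a b c w) (hα : α < 1) (hab : a ≤ b) :
    ∫ ρ in Ioi 0, density α w ρ ≤ a ^ (α - 1) * c * (b - a) := by
  have h1 : Ioc a b ⊆ Ioi 0 := fun ρ h => hw.pos.trans h.1
  refine (integral_mono (hw.integrable_density hα) hw.integrable_indicator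
    fun ρ => hw.density_le hα ρ).trans (le_of_eq ?_)
  rw [setIntegral_indicator measurableSet_Ioc, Set.inter_eq_right.2 h1]
  simp [hab, mul_comm]

lemma memLp (hw : IsWeight a b c w) (hα : α < 1) : MemLp (weightFun α w) 2 posVol := by
  have h1 : MemLp ((Ioc a b).indicator fun _ => √(a ^ (α - 1) * c)) 2 posVol :=
    memLp_indicator_const 2 measurableSet_Ioc _ (Or.inr (by
      refine ((Measure.restrict_apply_le _ _).trans_lt ?_).ne
      simp))
  have hm : Measurable (weightFun α w) := Complex.measurable_ofReal.comp hw.measurable_density.sqrt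
  refine h1.mono hm.aestronglyMeasurable (.of_forall fun ρ => ?_)
  rw [weightFun, norm_real, norm_of_nonneg (sqrt_nonneg _)]
  refine le_trans (Real.sqrt_le_sqrt (hw.density_le hα ρ)) (le_trans (le_of_eq ?_) (le_abs_self _))
  by_cases h : ρ ∈ Ioc a b <;> simp [h]

end IsWeight

open Classical in
/-- The vector `√(ρ^{α-1} w(ρ))` of `L²(ℝ₊)`. -/
def weightLp (α : ℝ) (w : ℝ → ℝ) : Lp ℂ 2 posVol :=
  if h : MemLp (weightFun α w) 2 posVol then h.toLp else 0

/-- The operator `v ↦ √(ρ^{α-1} w(ρ)) ⊗ v` from `E` to `L²(ℝ₊; E)`. -/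
def weightEmbed (α : ℝ) (w : ℝ → ℝ) : ℬ(E, L2Pos E) :=
  (ContinuousLinearMap.compLpL₂ 2 posVol (ContinuousLinearMap.lsmul ℂ ℂ).flip).flip (weightLp α w)

lemma weightEmbed_ae (hw : IsWeight a b c w) (hα : α < 1) (v : E) :
    weightEmbed α w v =ᵐ[posVol] fun ρ => weightFun α w ρ • v := by
  have h : weightLp α w = (hw.memLp hα).toLp := dif_pos _
  filter_upwards [((ContinuousLinearMap.lsmul ℂ ℂ).flip v).coeFn_compLp (weightLp α w),
    (hw.memLp hα).coeFn_toLp] with ρ h1 h2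
  refine h1.trans ?_
  rw [h, h2]
  rfl

lemma inner_weightEmbed {a' b' c' : ℝ} {w' : ℝ → ℝ} {G : ℝ → ℬ(E, F)}
    {Θ : ℬ(L2Pos E, L2Pos F)} (hG : IsMultiplication G Θ) (hw : IsWeight a b c w)
    (hw' : IsWeight a' b' c' w') (hα : α < 1) (x : F) (y : E) :
    inner ℂ (weightEmbed α w x) (Θ (weightEmbed α w' y)) = ∫ ρ in Ioi 0,
      ((√(density α w ρ) * √(density α w' ρ) : ℝ) : ℂ) * inner ℂ x (G ρ y) := by
  rw [L2.inner_def]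
  refine integral_congr_ae ?_
  filter_upwards [weightEmbed_ae hw hα x, weightEmbed_ae hw' hα y, hG (weightEmbed α w' y)]
    with ρ h1 h2 h3
  rw [h1, h3, h2, map_smul, inner_smul_left, inner_smul_right, weightFun, weightFun,
    conj_ofReal, ofReal_mul, mul_assoc]

lemma isMultiplication_id : IsMultiplication (fun _ => ContinuousLinearMap.id ℂ E)
    (ContinuousLinearMap.id ℂ (L2Pos E)) := fun _ => Eventually.of_forall fun _ => rfl

lemma inner_weightEmbed_self {G : ℝ → ℬ(E, F)}
    {Θ : ℬ(L2Pos E, L2Pos F)} (hG : IsMultiplication G Θ) (hw : IsWeight a b c w) (hα : α < 1)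
    (x : F) (y : E) : inner ℂ (weightEmbed α w x) (Θ (weightEmbed α w y))
      = ∫ ρ in Ioi 0, (density α w ρ : ℂ) * inner ℂ x (G ρ y) := by
  rw [inner_weightEmbed hG hw hw hα]
  simp only [mul_self_sqrt (hw.density_nonneg _)]

lemma norm_weightEmbed_sq (hw : IsWeight a b c w) (hα : α < 1) (y : E) :
    ‖(weightEmbed α w y : L2Pos E)‖ ^ 2 = (∫ ρ in Ioi 0, density α w ρ) * ‖y‖ ^ 2 := by
  have h := inner_weightEmbed_self isMultiplication_id hw hα y y
  simp only [ContinuousLinearMap.id_apply, inner_self_eq_norm_sq_to_K, integral_mul_const] at h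
  refine Complex.ofReal_injective ?_
  rw [ofReal_mul, Complex.ofReal_pow, Complex.ofReal_pow,
    ← integral_complex_ofReal]
  exact h

lemma norm_weightEmbed (hw : IsWeight a b c w) (hα : α < 1) (y : E) :
    ‖(weightEmbed α w y : L2Pos E)‖ = √(∫ ρ in Ioi 0, density α w ρ) * ‖y‖ := by
  rw [← sqrt_sq (norm_nonneg (weightEmbed α w y)), norm_weightEmbed_sq hw hα,
    Real.sqrt_mul' _ (sq_nonneg _), sqrt_sq (norm_nonneg y)]

lemma norm_weightEmbed_le (hw : IsWeight a b c w) (hα : α < 1) (hab : a ≤ b) :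
    ‖(weightEmbed α w : ℬ(E, L2Pos E))‖ ≤ √(a ^ (α - 1) * c * (b - a)) := by
  refine opNorm_le_bound _ (sqrt_nonneg _) fun y => ?_
  rw [norm_weightEmbed hw hα]
  exact mul_le_mul_of_nonneg_right (Real.sqrt_le_sqrt (hw.integral_density_le hα hab))
    (norm_nonneg y)

variable [CompleteSpace E] [CompleteSpace F]

/-- The slice `∫ ρ^{α-1} w(ρ) Θ(ρ) dρ` of an operator from `L²(ℝ₊; E)` to `L²(ℝ₊; F)`. -/
def slice (α : ℝ) (w : ℝ → ℝ) (Θ : ℬ(L2Pos E, L2Pos F)) : ℬ(E, F) :=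
  adjoint (weightEmbed α w : ℬ(F, L2Pos F)) ∘L Θ ∘L weightEmbed α w

lemma inner_slice (α : ℝ) (w : ℝ → ℝ) (Θ : ℬ(L2Pos E, L2Pos F)) (x : F) (y : E) :
    inner ℂ x (slice α w Θ y) = inner ℂ (weightEmbed α w x) (Θ (weightEmbed α w y)) := by
  rw [slice, ContinuousLinearMap.comp_apply, adjoint_inner_right]
  rfl

lemma norm_slice_le (hw : IsWeight a b c w) (hα : α < 1) (hab : a ≤ b)
    (Θ : ℬ(L2Pos E, L2Pos F)) : ‖slice α w Θ‖ ≤ a ^ (α - 1) * c * (b - a) * ‖Θ‖ := by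
  have h0 : 0 ≤ a ^ (α - 1) * c * (b - a) := mul_nonneg (mul_nonneg
    (rpow_nonneg hw.pos.le _) ((hw.nonneg 0).trans (hw.le 0))) (sub_nonneg.2 hab)
  refine (ContinuousLinearMap.opNorm_comp_le _ _).trans ?_
  refine (mul_le_mul_of_nonneg_left (ContinuousLinearMap.opNorm_comp_le _ _)
    (norm_nonneg _)).trans ?_
  rw [LinearIsometryEquiv.norm_map]
  have h1 := norm_weightEmbed_le (E := E) hw hα hab
  have h2 := norm_weightEmbed_le (E := F) hw hα hab
  have h3 := mul_le_mul h2 h1 (opNorm_nonneg _) (sqrt_nonneg _)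
  rw [mul_self_sqrt h0] at h3
  calc _ = ‖(weightEmbed α w : ℬ(F, L2Pos F))‖ * ‖(weightEmbed α w : ℬ(E, L2Pos E))‖ * ‖Θ‖ := by
        ring
    _ ≤ _ := mul_le_mul_of_nonneg_right h3 (opNorm_nonneg Θ)

lemma slice_sub (w : ℝ → ℝ) (Θ Θ' : ℬ(L2Pos E, L2Pos F)) :
    slice α w (Θ - Θ') = slice α w Θ - slice α w Θ' := by
  simp [slice]

lemma tendsto_slice {I : Type*} {l : Filter I} {X : I → ℬ(L2Pos E, L2Pos F)}
    {Y : ℬ(L2Pos E, L2Pos F)} (h : Tendsto X l (𝓝ᵤ Y)) (w : ℝ → ℝ) :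
    Tendsto (fun i => slice α w (X i)) l (𝓝ᵤ (slice α w Y)) :=
  tendsto_sandwich h _ _

end Slices

section Intervals

/-- The indicator function of `(a, b]`. -/
def intervalWeight (a b : ℝ) : ℝ → ℝ := (Ioc a b).indicator 1

/-- The length of `{x ∈ [0, h] : a + x < ρ ≤ b + x}`, as a second difference of ramps. -/
def trapezoidWeight (a b h ρ : ℝ) : ℝ :=
  max (ρ - a) 0 - max (ρ - b) 0 - max (ρ - (a + h)) 0 + max (ρ - (b + h)) 0

variable {a b h α : ℝ}

lemma isWeight_interval (ha : 0 < a) : IsWeight a b 1 (intervalWeight a b) where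
  pos := ha
  measurable := measurable_one.indicator measurableSet_Ioc
  nonneg ρ := Set.indicator_nonneg (fun _ _ => zero_le_one) ρ
  le ρ := Set.indicator_apply_le' (fun _ => le_rfl) fun _ => zero_le_one
  support _ h := Set.indicator_of_notMem h _

lemma isWeight_trapezoid (ha : 0 < a) (hab : a ≤ b) (hh : 0 ≤ h) :
    IsWeight a (b + h) (b - a) (trapezoidWeight a b h) where
  pos := ha
  measurable := by unfold trapezoidWeight; fun_prop
  nonneg ρ := by unfold trapezoidWeight; grind
  le ρ := by unfold trapezoidWeight; grind
  support ρ hρ := by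
    simp only [Set.mem_Ioc, not_and_or, not_lt, not_le] at hρ
    unfold trapezoidWeight; grind

lemma integral_intervalWeight (ha : 0 < a) (hab : a ≤ b) {p q : ℝ → ℂ}
    (hp : ∀ ρ, 0 < ρ → HasDerivAt p (q ρ) ρ) (hq : ContinuousOn q (Ioi 0)) :
    ∫ ρ in Ioi 0, (intervalWeight a b ρ : ℂ) * q ρ = p b - p a := by
  have hs : uIcc a b ⊆ Ioi 0 := by
    rw [uIcc_of_le hab]; exact fun ρ h => ha.trans_le h.1
  rw [← intervalIntegral.integral_eq_sub_of_hasDerivAt (fun ρ h => hp ρ (hs h))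
    (hq.mono hs).intervalIntegrable, intervalIntegral.integral_of_le hab]
  have h1 : Ioc a b ⊆ Ioi 0 := fun ρ h => ha.trans h.1
  rw [← Set.inter_eq_right.2 h1, ← setIntegral_indicator measurableSet_Ioc]
  refine integral_congr_ae (.of_forall fun ρ => ?_)
  by_cases hρ : ρ ∈ Ioc a b <;> simp [intervalWeight, hρ]

lemma integral_ramp {c N : ℝ} (hc : 0 < c) (hN : c ≤ N) {p q r : ℝ → ℂ}
    (hp : ∀ ρ, 0 < ρ → HasDerivAt p (q ρ) ρ) (hq : ∀ ρ, 0 < ρ → HasDerivAt q (r ρ) ρ)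
    (hr : ContinuousOn r (Ioi 0)) :
    IntegrableOn (fun ρ => ((max (ρ - c) 0 : ℝ) : ℂ) * r ρ) (Ioc 0 N) ∧
    ∫ ρ in Ioc 0 N, ((max (ρ - c) 0 : ℝ) : ℂ) * r ρ = (N - c) * q N - (p N - p c) := by
  have hs : uIcc c N ⊆ Ioi 0 := by
    rw [uIcc_of_le hN]; exact fun ρ h => hc.trans_le h.1
  have hd : ∀ ρ ∈ uIcc c N, HasDerivAt (fun ρ : ℝ => ((ρ : ℂ) - c) * q ρ - p ρ)
      (((max (ρ - c) 0 : ℝ) : ℂ) * r ρ) ρ := fun ρ h => by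
    have hρ : c ≤ ρ := by rw [uIcc_of_le hN] at h; exact h.1
    have h1 : HasDerivAt (fun ρ : ℝ => (ρ : ℂ) - c) 1 ρ :=
      (Complex.ofRealCLM.hasDerivAt).sub_const _
    refine ((h1.mul (hq ρ (hs h))).sub (hp ρ (hs h))).congr_deriv ?_
    rw [max_eq_left (sub_nonneg.2 hρ)]; push_cast; ring
  have hi : IntervalIntegrable (fun ρ => ((max (ρ - c) 0 : ℝ) : ℂ) * r ρ) volume c N :=
    (ContinuousOn.mul (by fun_prop) (hr.mono hs)).intervalIntegrable
  have hI : Ioc 0 N = Ioc 0 c ∪ Ioc c N := (Set.Ioc_union_Ioc_eq_Ioc hc.le hN).symm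
  have h0 : Set.EqOn (fun ρ => ((max (ρ - c) 0 : ℝ) : ℂ) * r ρ) 0 (Ioc 0 c) := fun ρ h => by
    simp [max_eq_right (sub_nonpos.2 h.2)]
  have hi0 : IntegrableOn (fun ρ => ((max (ρ - c) 0 : ℝ) : ℂ) * r ρ) (Ioc 0 c) :=
    (integrableOn_congr_fun h0 measurableSet_Ioc).2 integrableOn_zero
  have hi1 := (intervalIntegrable_iff_integrableOn_Ioc_of_le hN).1 hi
  refine ⟨hI ▸ hi0.union hi1, ?_⟩
  rw [hI, setIntegral_union (Set.Ioc_disjoint_Ioc_of_le le_rfl) measurableSet_Ioc hi0 hi1,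
    setIntegral_congr_fun measurableSet_Ioc h0, ← intervalIntegral.integral_of_le hN,
    intervalIntegral.integral_eq_sub_of_hasDerivAt hd hi]
  simp; ring

lemma integral_trapezoidWeight (ha : 0 < a) (hab : a ≤ b) (hh : 0 ≤ h) {p q r : ℝ → ℂ}
    (hp : ∀ ρ, 0 < ρ → HasDerivAt p (q ρ) ρ) (hq : ∀ ρ, 0 < ρ → HasDerivAt q (r ρ) ρ)
    (hr : ContinuousOn r (Ioi 0)) :
    ∫ ρ in Ioi 0, (trapezoidWeight a b h ρ : ℂ) * r ρ
      = p (b + h) - p b - p (a + h) + p a := by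
  obtain ⟨i1, e1⟩ := integral_ramp (N := b + h) ha (by linarith) hp hq hr
  obtain ⟨i2, e2⟩ := integral_ramp (c := b) (N := b + h) (by linarith) (by linarith) hp hq hr
  obtain ⟨i3, e3⟩ := integral_ramp (c := a + h) (N := b + h) (by linarith) (by linarith) hp hq hr
  obtain ⟨i4, e4⟩ := integral_ramp (c := b + h) (N := b + h) (by linarith) le_rfl hp hq hr
  have hs : ∀ ρ ∈ Ioi 0 \ Ioc 0 (b + h), (trapezoidWeight a b h ρ : ℂ) * r ρ = 0 :=
    fun ρ hρ => by
    rw [(isWeight_trapezoid ha hab hh).support ρ fun h => hρ.2 ⟨hρ.1, h.2⟩]; simp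
  rw [setIntegral_eq_of_subset_of_forall_sdiff_eq_zero measurableSet_Ioi
    (fun ρ h => h.1) hs]
  have e : ∀ ρ, (trapezoidWeight a b h ρ : ℂ) * r ρ = ((max (ρ - a) 0 : ℝ) : ℂ) * r ρ
      - ((max (ρ - b) 0 : ℝ) : ℂ) * r ρ - ((max (ρ - (a + h)) 0 : ℝ) : ℂ) * r ρ
      + ((max (ρ - (b + h)) 0 : ℝ) : ℂ) * r ρ := fun ρ => by
    rw [trapezoidWeight]; push_cast; ring
  simp only [e]
  refine (integral_add ((i1.sub i2).sub i3) i4).trans ?_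
  refine (congrArg₂ (· + ·) ((integral_sub (i1.sub i2) i3).trans (congrArg₂ (· - ·)
    ((integral_sub i1 i2).trans (congrArg₂ (· - ·) e1 e2)) e3)) e4).trans ?_
  push_cast
  ring

variable {E : Type u} {F : Type v} [NormedAddCommGroup E] [InnerProductSpace ℂ E]
  [NormedAddCommGroup F] [InnerProductSpace ℂ F]

/-- The slices of `Θ` off the diagonal vanish, as they do for multiplication operators. -/
def IsDecomposable (α : ℝ) (Θ : ℬ(L2Pos E, L2Pos F)) : Prop :=
  ∀ a b c d : ℝ, 0 < a → 0 < c → b ≤ c → ∀ x y,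
    inner ℂ (weightEmbed α (intervalWeight a b) x) (Θ (weightEmbed α (intervalWeight c d) y)) = 0 ∧
    inner ℂ (weightEmbed α (intervalWeight c d) x) (Θ (weightEmbed α (intervalWeight a b) y)) = 0

lemma IsMultiplication.isDecomposable {G : ℝ → ℬ(E, F)} {Θ : ℬ(L2Pos E, L2Pos F)}
    (hG : IsMultiplication G Θ) (hα : α < 1) : IsDecomposable α Θ := by
  intro a b c d ha hc hbc x y
  have h : ∀ ρ, √(density α (intervalWeight a b) ρ) * √(density α (intervalWeight c d) ρ) = 0 := by
    intro ρ
    by_cases h1 : ρ ∈ Ioc a b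
    · have h2 : ρ ∉ Ioc c d := fun h2 => not_lt.2 (h1.2.trans hbc) h2.1
      simp [density, intervalWeight, h2]
    · simp [density, intervalWeight, h1]
  rw [inner_weightEmbed hG (isWeight_interval ha) (isWeight_interval hc) hα,
    inner_weightEmbed hG (isWeight_interval hc) (isWeight_interval ha) hα]
  simp [h, mul_comm (√(density α (intervalWeight c d) _))]

lemma IsDecomposable.sub {Θ Θ' : ℬ(L2Pos E, L2Pos F)} (h : IsDecomposable α Θ)
    (h' : IsDecomposable α Θ') : IsDecomposable α (Θ - Θ') := fun a b c d ha hc hbc x y => by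
  simp only [sub_apply, inner_sub_right, (h a b c d ha hc hbc x y).1, (h a b c d ha hc hbc x y).2,
    (h' a b c d ha hc hbc x y).1, (h' a b c d ha hc hbc x y).2, sub_zero, and_self]

lemma isDecomposable_of_tendsto {I : Type*} {l : Filter I} [l.NeBot]
    {X : I → ℬ(L2Pos E, L2Pos F)} {Y : ℬ(L2Pos E, L2Pos F)}
    (h : Tendsto X l (𝓝ᵤ Y)) (hX : ∀ᶠ i in l, IsDecomposable α (X i)) :
    IsDecomposable α Y := fun a b c d ha hc hbc x y => by
  have h1 := fun w v => tendsto_ultraweak_iff.1 h _ (isNormalFunctional_vector w v)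
  exact ⟨tendsto_nhds_unique_of_eventuallyEq (h1 _ _) tendsto_const_nhds
      (hX.mono fun i hi => (hi a b c d ha hc hbc x y).1),
    tendsto_nhds_unique_of_eventuallyEq (h1 _ _) tendsto_const_nhds
      (hX.mono fun i hi => (hi a b c d ha hc hbc x y).2)⟩

lemma weightEmbed_split {c : ℝ} (ha : 0 < a) (hab : a ≤ b) (hbc : b ≤ c) (hα : α < 1) (x : E) :
    (weightEmbed α (intervalWeight a c) x : L2Pos E)
      = weightEmbed α (intervalWeight a b) x + weightEmbed α (intervalWeight b c) x := by
  refine Lp.ext ?_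
  filter_upwards [weightEmbed_ae (isWeight_interval ha) hα x,
    weightEmbed_ae (isWeight_interval ha) hα x,
    weightEmbed_ae (isWeight_interval (ha.trans_le hab)) hα x, Lp.coeFn_add
      (weightEmbed α (intervalWeight a b) x) (weightEmbed α (intervalWeight b c) x)]
    with ρ h1 h2 h3 h4
  rw [h4, Pi.add_apply, h1, h2, h3, ← add_smul]
  congr 1
  simp only [weightFun, density, intervalWeight, Set.indicator_apply, Set.mem_Ioc]
  grind [Real.sqrt_zero, Complex.ofReal_zero]

/-- The dyadic interval `((k+1)/2ⁿ, (k+2)/2ⁿ]`. -/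
def dyadicWeight (n k : ℕ) : ℝ → ℝ := intervalWeight ((k + 1) / 2 ^ n) ((k + 2) / 2 ^ n)

/-- The step function `∑ₖ √(ρ^{α-1}) 1_{((k+1)/2ⁿ, (k+2)/2ⁿ]} ⊗ vₖ`. -/
def dyadicStep (E : Type*) [NormedAddCommGroup E] [InnerProductSpace ℂ E] (α : ℝ) (n : ℕ) :
    (ℕ →₀ E) →ₗ[ℂ] L2Pos E :=
  Finsupp.lsum ℂ fun k => (weightEmbed α (dyadicWeight n k) : ℬ(E, L2Pos E)).toLinearMap

lemma dyadicStep_apply (n : ℕ) {v : ℕ →₀ E} {s : Finset ℕ} (hs : v.support ⊆ s) :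
    dyadicStep E α n v = ∑ k ∈ s, weightEmbed α (dyadicWeight n k) (v k) :=
  Finsupp.sum_of_support_subset v hs _ (by simp)

lemma weightEmbed_mem_range (n k : ℕ) (x : E) :
    weightEmbed α (dyadicWeight n k) x ∈ LinearMap.range (dyadicStep E α n) :=
  ⟨Finsupp.single k x, by simp [dyadicStep]⟩

lemma monotone_range_dyadicStep (hα : α < 1) :
    Monotone fun n => LinearMap.range (dyadicStep E α n) := by
  refine monotone_nat_of_le_succ fun n => ?_
  rintro _ ⟨v, rfl⟩
  rw [dyadicStep_apply n subset_rfl]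
  refine Submodule.sum_mem _ fun k _ => ?_
  have h := weightEmbed_split (a := (k + 1 : ℝ) / 2 ^ n) (b := (2 * k + 3) / 2 ^ (n + 1))
    (c := (k + 2) / 2 ^ n) (by positivity)
    (by rw [div_le_div_iff₀ (by positivity) (by positivity), pow_succ]
        nlinarith [pow_pos (two_pos : (0 : ℝ) < 2) n])
    (by rw [div_le_div_iff₀ (by positivity) (by positivity), pow_succ]
        nlinarith [pow_pos (two_pos : (0 : ℝ) < 2) n]) hα (v k)
  have h1 := weightEmbed_mem_range (α := α) (n + 1) (2 * k + 1) (v k)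
  have h2 := weightEmbed_mem_range (α := α) (n + 1) (2 * k + 2) (v k)
  have e1 : ((((2 * k + 1 : ℕ) : ℝ) + 1) / 2 ^ (n + 1)) = (k + 1) / 2 ^ n := by
    rw [pow_succ]; push_cast; field_simp; ring
  have e2 : ((((2 * k + 1 : ℕ) : ℝ) + 2) / 2 ^ (n + 1)) = (2 * k + 3) / 2 ^ (n + 1) := by
    push_cast; ring
  have e3 : ((((2 * k + 2 : ℕ) : ℝ) + 1) / 2 ^ (n + 1)) = (2 * k + 3) / 2 ^ (n + 1) := by
    push_cast; ring
  have e4 : ((((2 * k + 2 : ℕ) : ℝ) + 2) / 2 ^ (n + 1)) = (k + 2) / 2 ^ n := by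
    rw [pow_succ]; push_cast; field_simp; ring
  rw [dyadicWeight, e1, e2] at h1
  rw [dyadicWeight, e3, e4] at h2
  rw [dyadicWeight, h]
  exact add_mem h1 h2

/-- Dyadic step functions are dense: the primitive of a function that is orthogonal to them vanishes
at all dyadic numbers. -/
lemma dense_dyadicStep [CompleteSpace E] (hα : α < 1) :
    (⨆ n, LinearMap.range (dyadicStep E α n)).topologicalClosure = ⊤ := by
  rw [Submodule.topologicalClosure_eq_top_iff, Submodule.eq_bot_iff]
  intro q hq
  have hu : ∀ a b : ℝ, 0 < a → Integrable (fun ρ => weightFun α (intervalWeight a b) ρ • q ρ)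
      posVol := fun a b ha => memLp_one_iff_integrable.1
    ((Lp.memLp q).smul ((isWeight_interval ha).memLp hα))
  have hI : ∀ n k : ℕ, ∫ ρ in Ioi 0, weightFun α (dyadicWeight n k) ρ • q ρ = 0 := by
    intro n k
    refine ext_inner_left ℂ fun x => ?_
    have h0 : Integrable (fun ρ => weightFun α (dyadicWeight n k) ρ • q ρ) posVol :=
      hu _ _ (by positivity)
    rw [inner_zero_right, ← integral_inner h0]
    have h1 := hq _ (Submodule.mem_iSup_of_mem n (weightEmbed_mem_range n k x))
    rw [L2.inner_def] at h1
    refine Eq.trans (integral_congr_ae ?_) h1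
    filter_upwards [weightEmbed_ae (w := dyadicWeight n k)
      (isWeight_interval (by positivity : (0 : ℝ) < (k + 1) / 2 ^ n)) hα x] with ρ h2
    rw [h2, inner_smul_left, inner_smul_right, weightFun, conj_ofReal]
  obtain ⟨u, hu'⟩ : ∃ u : ℝ → E, ∀ ρ, u ρ = ((√(ρ ^ (α - 1)) : ℝ) : ℂ) • q ρ := ⟨_, fun _ => rfl⟩
  have hwu : ∀ a b ρ, weightFun α (intervalWeight a b) ρ • q ρ = (Ioc a b).indicator u ρ := by
    intro a b ρ
    by_cases h : ρ ∈ Ioc a b <;> simp [weightFun, density, intervalWeight, h, hu']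
  simp only [dyadicWeight, hwu] at hI hu
  have hsub : ∀ a b : ℝ, 0 < a → Ioc a b ⊆ Ioi 0 := fun a b ha ρ h => ha.trans h.1
  have hii : ∀ a b : ℝ, 0 < a → 0 < b → IntervalIntegrable u volume a b := by
    have : ∀ a b : ℝ, 0 < a → IntegrableOn u (Ioc a b) := fun a b ha => by
      have h := (integrable_indicator_iff measurableSet_Ioc).1 (hu a b ha)
      rwa [IntegrableOn, Measure.restrict_restrict measurableSet_Ioc,
        Set.inter_eq_left.2 (hsub a b ha)] at h
    exact fun a b ha hb => ⟨this a b ha, this b a hb⟩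
  have hQ : ∀ n k : ℕ, ∫ ρ in (1 / 2 ^ n : ℝ)..((k + 1) / 2 ^ n), u ρ = 0 := by
    intro n k
    induction k with
    | zero => simp
    | succ k ih =>
      rw [← intervalIntegral.integral_add_adjacent_intervals
        (hii _ ((k + 1) / 2 ^ n) (by positivity) (by positivity))
        (hii _ _ (by positivity) (by positivity)), ih, zero_add]
      have h := hI n k
      rw [setIntegral_indicator measurableSet_Ioc, Set.inter_eq_right.2 (hsub _ _ (by positivity)),
        ← intervalIntegral.integral_of_le (by gcongr; norm_num)] at h
      push_cast
      rw [show (k : ℝ) + 1 + 1 = k + 2 by ring, h]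
  have hQ1 : ∀ n k : ℕ, ∫ ρ in (1 : ℝ)..((k + 1) / 2 ^ n), u ρ = 0 := by
    intro n k
    have h1 := hQ n (2 ^ n - 1)
    have e : (((2 ^ n - 1 : ℕ) : ℝ) + 1) / 2 ^ n = 1 := by
      rw [Nat.cast_sub Nat.one_le_two_pow]; push_cast; field_simp; ring
    rw [e] at h1
    have h2 := intervalIntegral.integral_add_adjacent_intervals
      (hii (1 / 2 ^ n) 1 (by positivity) one_pos)
      (hii 1 ((k + 1) / 2 ^ n) one_pos (by positivity))
    rwa [h1, hQ n k, zero_add] at h2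
  have hd : ∀ᵐ x : ℝ, ∀ m : ℕ, x ∈ uIcc (1 / (m + 1) : ℝ) (m + 1) →
      ∀ c ∈ uIcc (1 / (m + 1) : ℝ) (m + 1), HasDerivAt (fun y => ∫ t in c..y, u t) (u x) x :=
    ae_all_iff.2 fun m => (hii _ _ (by positivity) (by positivity)).ae_hasDerivAt_integral
  refine Lp.ext ?_
  filter_upwards [ae_restrict_of_ae hd, ae_restrict_mem measurableSet_Ioi,
    Lp.coeFn_zero E 2 posVol] with x hx hx0 hz
  rw [hz]
  have hx0' : (0 : ℝ) < x := hx0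
  obtain ⟨m, hm⟩ := exists_nat_ge (max x (1 / x))
  have hm1 : (1 / (m + 1) : ℝ) ≤ m + 1 := by
    rw [div_le_iff₀ (by positivity)]; nlinarith [(Nat.cast_nonneg m : (0 : ℝ) ≤ m)]
  have hD := hx m (by
    rw [uIcc_of_le hm1]
    have h1 := (le_max_right _ _).trans hm
    rw [div_le_iff₀ hx0'] at h1
    refine ⟨?_, ((le_max_left _ _).trans hm).trans (by linarith)⟩
    rw [div_le_iff₀ (by positivity)]; nlinarith) 1 (by
    rw [uIcc_of_le hm1]
    exact ⟨by rw [div_le_one (by positivity)]; linarith [(Nat.cast_nonneg m : (0 : ℝ) ≤ m)],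
      by linarith [(Nat.cast_nonneg m : (0 : ℝ) ≤ m)]⟩)
  obtain ⟨y, hy⟩ : ∃ y : ℕ → ℝ, ∀ n, y n = (⌊x * 2 ^ n⌋₊ + 1) / 2 ^ n := ⟨_, fun _ => rfl⟩
  have hy1 : ∀ n, x < y n := fun n => by
    rw [hy, lt_div_iff₀ (by positivity)]; exact Nat.lt_floor_add_one _
  have hy2 : ∀ n, y n ≤ x + (1 / 2) ^ n := fun n => by
    rw [hy, div_le_iff₀ (by positivity), add_mul, ← mul_pow]
    norm_num
    exact Nat.floor_le (by positivity)
  have hy3 : Tendsto y atTop (𝓝 x) := by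
    refine tendsto_of_tendsto_of_tendsto_of_le_of_le tendsto_const_nhds ?_ (fun n => (hy1 n).le) hy2
    simpa using (tendsto_pow_atTop_nhds_zero_of_lt_one (r := (1 / 2 : ℝ)) (by norm_num)
      (by norm_num)).const_add x
  have hQy : ∀ n, ∫ t in (1 : ℝ)..(y n), u t = 0 := fun n => by rw [hy]; exact hQ1 n _
  have hQx : ∫ t in (1 : ℝ)..x, u t = 0 := by
    refine tendsto_nhds_unique (hD.continuousAt.tendsto.comp hy3) ?_
    simp only [Function.comp_def, hQy, tendsto_const_nhds]
  have hux : u x = 0 := by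
    refine tendsto_nhds_unique ((hasDerivAt_iff_tendsto_slope.1 hD).comp
      (tendsto_nhdsWithin_iff.2 ⟨hy3, Eventually.of_forall fun n => (hy1 n).ne'⟩)) ?_
    simp only [Function.comp_def, slope_def_module, hQy, hQx, sub_self, smul_zero,
      tendsto_const_nhds]
  rw [hu', smul_eq_zero, Complex.ofReal_eq_zero] at hux
  exact hux.resolve_left (sqrt_pos.2 (Real.rpow_pos_of_pos hx0' _)).ne'

lemma inner_dyadicWeight_of_ne {Θ : ℬ(L2Pos E, L2Pos F)} (hΘ : IsDecomposable α Θ) {n k l : ℕ}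
    (hkl : k ≠ l) (x : F) (y : E) :
    inner ℂ (weightEmbed α (dyadicWeight n k) x) (Θ (weightEmbed α (dyadicWeight n l) y)) = 0 := by
  have h : ∀ {i j : ℕ}, i < j → ((i : ℝ) + 2) / 2 ^ n ≤ (j + 1) / 2 ^ n := fun {i j} hij => by
    have : (i : ℝ) + 1 ≤ j := by exact_mod_cast hij
    exact div_le_div_of_nonneg_right (by linarith) (by positivity)
  rcases lt_or_gt_of_ne hkl with h1 | h1
  · exact (hΘ _ _ _ _ (by positivity) (by positivity) (h h1) x y).1
  · exact (hΘ _ _ _ _ (by positivity) (by positivity) (h h1) x y).2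

lemma inner_dyadicStep {Θ : ℬ(L2Pos E, L2Pos F)} (hΘ : IsDecomposable α Θ) (n : ℕ)
    {v : ℕ →₀ F} {w : ℕ →₀ E} {s : Finset ℕ} (hv : v.support ⊆ s) (hw : w.support ⊆ s) :
    inner ℂ (dyadicStep F α n v) (Θ (dyadicStep E α n w)) = ∑ k ∈ s, inner ℂ
      (weightEmbed α (dyadicWeight n k) (v k)) (Θ (weightEmbed α (dyadicWeight n k) (w k))) := by
  rw [dyadicStep_apply n hv, dyadicStep_apply n hw, map_sum, sum_inner]
  refine Finset.sum_congr rfl fun k hk => ?_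
  rw [inner_sum]
  exact Finset.sum_eq_single_of_mem k hk fun l _ hl => inner_dyadicWeight_of_ne hΘ hl.symm _ _

lemma norm_dyadicStep_sq (hα : α < 1) (n : ℕ) {v : ℕ →₀ E} {s : Finset ℕ} (hv : v.support ⊆ s) :
    ‖dyadicStep E α n v‖ ^ 2
      = ∑ k ∈ s, ‖(weightEmbed α (dyadicWeight n k) (v k) : L2Pos E)‖ ^ 2 := by
  have h := inner_dyadicStep (isMultiplication_id.isDecomposable hα) n hv hv
  simp only [ContinuousLinearMap.id_apply, inner_self_eq_norm_sq_to_K] at h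
  refine Complex.ofReal_injective ?_
  push_cast
  exact h

lemma le_integral_density {l : ℝ} (hα₀ : 0 < α) (hα : α < 1) (hl : 0 < l) (hla : l ≤ a) :
    l * a ^ (α - 1) ≤ 2 * ∫ ρ in Ioi 0, density α (intervalWeight a (a + l)) ρ := by
  have ha := hl.trans_le hla
  have hw := isWeight_interval (b := a + l) ha
  have h1 : Ioc a (a + l) ⊆ Ioi 0 := fun ρ h => ha.trans h.1
  have h2 : ∀ ρ, (Ioc a (a + l)).indicator (fun _ => a ^ (α - 1) / 2) ρ
      ≤ density α (intervalWeight a (a + l)) ρ := fun ρ => by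
    by_cases h : ρ ∈ Ioc a (a + l)
    · rw [density, intervalWeight, Set.indicator_of_mem h, Set.indicator_of_mem h, Pi.one_apply,
        mul_one]
      refine le_trans ?_ (Real.rpow_le_rpow_of_nonpos (y := 2 * a) (ha.trans h.1)
        (h.2.trans (by linarith)) (by linarith))
      rw [Real.mul_rpow two_pos.le ha.le, div_eq_inv_mul, ← Real.rpow_neg_one 2]
      exact mul_le_mul_of_nonneg_right (Real.rpow_le_rpow_of_exponent_le one_le_two (by linarith))
        (rpow_nonneg ha.le _)
    · rw [Set.indicator_of_notMem h]; exact hw.density_nonneg ρ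
  have h0 : Integrable ((Ioc a (a + l)).indicator fun _ => a ^ (α - 1) / 2) posVol :=
    ((integrable_indicator_iff measurableSet_Ioc).2 (integrableOn_const (by simp))).integrableOn
  have h3 := integral_mono h0 (hw.integrable_density hα) h2
  rw [setIntegral_indicator measurableSet_Ioc, Set.inter_eq_right.2 h1] at h3
  simp [hl.le] at h3
  linarith

variable [CompleteSpace E] [CompleteSpace F]

/-- A decomposable operator is bounded through its slices over short intervals. -/
lemma norm_le_of_slices (hα₀ : 0 < α) (hα : α < 1) {Θ : ℬ(L2Pos E, L2Pos F)}
    (hΘ : IsDecomposable α Θ) {c : ℝ} (hc0 : 0 ≤ c) (hc : ∀ a l : ℝ, 0 < l → l ≤ a →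
      ‖slice α (intervalWeight a (a + l)) Θ‖ ≤ c * (l * a ^ (α - 1))) : ‖Θ‖ ≤ 2 * c := by
  have hstep : ∀ n k (x : F) (y : E), ‖inner ℂ (weightEmbed α (dyadicWeight n k) x)
      (Θ (weightEmbed α (dyadicWeight n k) y))‖ ≤ 2 * c * (‖(weightEmbed α (dyadicWeight n k) x :
        L2Pos F)‖ * ‖(weightEmbed α (dyadicWeight n k) y : L2Pos E)‖) := by
    intro n k x y
    have hla : (1 / 2 ^ n : ℝ) ≤ (k + 1) / 2 ^ n :=
      div_le_div_of_nonneg_right (by simp) (by positivity)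
    have hl : (0 : ℝ) < 1 / 2 ^ n := by positivity
    have e : ((k : ℝ) + 2) / 2 ^ n = (k + 1) / 2 ^ n + 1 / 2 ^ n := by ring
    have hw := isWeight_interval (b := (k + 1) / 2 ^ n + 1 / 2 ^ n) (hl.trans_le hla)
    rw [dyadicWeight, e, norm_weightEmbed hw hα, norm_weightEmbed hw hα, ← inner_slice]
    have hI := le_integral_density hα₀ hα hl hla
    obtain ⟨I, hI'⟩ : ∃ I, I = ∫ ρ in Ioi 0,
      density α (intervalWeight ((k + 1) / 2 ^ n) ((k + 1) / 2 ^ n + 1 / 2 ^ n)) ρ := ⟨_, rfl⟩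
    rw [← hI'] at hI ⊢
    have hI0 : 0 ≤ I := hI' ▸ integral_nonneg fun ρ => hw.density_nonneg ρ
    refine (norm_inner_le_norm _ _).trans ?_
    have h1 := ContinuousLinearMap.le_of_opNorm_le _ ((hc _ _ hl hla).trans
      (mul_le_mul_of_nonneg_left hI hc0)) y
    calc _ ≤ ‖x‖ * (c * (2 * I) * ‖y‖) := mul_le_mul_of_nonneg_left h1 (norm_nonneg x)
      _ = 2 * c * (√I * √I * (‖x‖ * ‖y‖)) := by rw [mul_self_sqrt hI0]; ring
      _ = _ := by ring
  have hV : ∀ x ∈ ⨆ n, LinearMap.range (dyadicStep F α n), ∀ y ∈ ⨆ n, LinearMap.range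
      (dyadicStep E α n), ‖inner ℂ x (Θ y)‖ ≤ 2 * c * (‖x‖ * ‖y‖) := by
    intro x hx y hy
    rw [Submodule.mem_iSup_of_directed _ (monotone_range_dyadicStep hα).directed_le] at hx hy
    obtain ⟨m, hx⟩ := hx
    obtain ⟨m', hy⟩ := hy
    obtain ⟨v, rfl⟩ := monotone_range_dyadicStep hα (le_max_left m m') hx
    obtain ⟨w, rfl⟩ := monotone_range_dyadicStep hα (le_max_right m m') hy
    have hv := Finset.subset_union_left (s₁ := v.support) (s₂ := w.support)
    have hw := Finset.subset_union_right (s₁ := v.support) (s₂ := w.support)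
    rw [inner_dyadicStep hΘ _ hv hw, ← sqrt_sq (norm_nonneg (dyadicStep F α _ v)),
      ← sqrt_sq (norm_nonneg (dyadicStep E α _ w)), norm_dyadicStep_sq hα _ hv,
      norm_dyadicStep_sq hα _ hw]
    refine (norm_sum_le _ _).trans ((Finset.sum_le_sum fun k _ => hstep _ k _ _).trans ?_)
    rw [← Finset.mul_sum]
    exact mul_le_mul_of_nonneg_left (Real.sum_mul_le_sqrt_mul_sqrt _ _ _) (by positivity)
  have hE := Submodule.dense_iff_topologicalClosure_eq_top.2 (dense_dyadicStep (E := E) hα)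
  have hF := Submodule.dense_iff_topologicalClosure_eq_top.2 (dense_dyadicStep (E := F) hα)
  have h1 : ∀ y ∈ ⨆ n, LinearMap.range (dyadicStep E α n), ∀ x : L2Pos F,
      ‖inner ℂ x (Θ y)‖ ≤ 2 * c * (‖x‖ * ‖y‖) := fun y hy x =>
    (isClosed_le (f := fun x => ‖inner ℂ x (Θ y)‖) (g := fun x => 2 * c * (‖x‖ * ‖y‖))
      (by fun_prop) (by fun_prop)).closure_subset_iff.2 (fun x hx => hV x hx y hy)
      (hF x)
  refine norm_le_of_inner (by positivity) fun x y => ?_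
  exact (isClosed_le (f := fun y => ‖inner ℂ x (Θ y)‖) (g := fun y => 2 * c * (‖x‖ * ‖y‖))
    (by fun_prop) (by fun_prop)).closure_subset_iff.2 (fun y hy => h1 y hy x) (hE y)

end Intervals

/-! ### Slices of Hölder symbols -/

section WeakIntegral

variable {F : Type v} [NormedAddCommGroup F] [InnerProductSpace ℂ F] [CompleteSpace F]

lemma continuousAt_of_norm_sub_le {X : ℝ → ℬ(K, F)} {s : ℝ} {u : ℝ → ℝ}
    (h : ∀ᶠ r in 𝓝 s, ‖X r - X s‖ ≤ u r) (hu : Tendsto u (𝓝 s) (𝓝 0)) : ContinuousAt X s := by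
  rw [ContinuousAt, tendsto_iff_norm_sub_tendsto_zero]
  exact squeeze_zero' (.of_forall fun _ => norm_nonneg _) h hu

/-- Weak-* closed subspaces are stable under Bochner integrals. -/
lemma exists_integral_mem_closure {W : Submodule ℂ (ℬ(K) × ℬ(K, F))}
    {G : Set (ℬ(K) × ℬ(K, F))} (hW : (W : Set _) = ultraweakPairClosure G) {φ : ℝ → ℝ}
    (hφ : IntegrableOn φ (Ioi 0)) {x : ℝ → ℬ(K)} {X : ℝ → ℬ(K, F)}
    (hx : ContinuousOn x (Ioi 0)) (hX : ContinuousOn X (Ioi 0)) {c d : ℝ}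
    (hc : ∀ r, 0 < r → ‖x r‖ ≤ c) (hd : ∀ r, 0 < r → ‖X r‖ ≤ d)
    (h : ∀ r, 0 < r → (x r, X r) ∈ ultraweakPairClosure G) :
    ∃ (z : ℬ(K)) (Z : ℬ(K, F)), (z, Z) ∈ ultraweakPairClosure G ∧
      (∀ w v, inner ℂ w (z v) = ∫ r in Ioi (0 : ℝ), (φ r : ℂ) * inner ℂ w (x r v)) ∧
      ∀ w v, inner ℂ w (Z v) = ∫ r in Ioi (0 : ℝ), (φ r : ℂ) * inner ℂ w (X r v) := by
  have hcl : IsClosed (W : Set (ℬ(K) × ℬ(K, F))) := by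
    refine isClosed_of_closure_subset fun p hp => ?_
    have := mem_closure_iff_nhdsWithin_neBot.1 hp
    have h1 : Tendsto (fun q => q) (𝓝[(W : Set _)] p) (𝓝 p) :=
      tendsto_id.mono_left nhdsWithin_le_nhds
    rw [hW]
    refine mem_ultraweakPairClosure_of_tendsto (l := 𝓝[(W : Set _)] p) (X := Prod.fst)
      (Y := Prod.snd) ?_ (tendsto_ultraweak_of_norm ((continuous_fst.tendsto p).comp h1))
      (tendsto_ultraweak_of_norm ((continuous_snd.tendsto p).comp h1))
    filter_upwards [self_mem_nhdsWithin] with q hq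
    rw [← hW]; exact hq
  have hint := integrableOn_smul_of_continuousOn hφ (hx.prodMk hX) (b := fun _ => max c d)
    (fun r hr => max_le_max (hc r hr) (hd r hr)) (hφ.mul_const _)
  have hmem := Submodule.setIntegral_mem hcl measurableSet_Ioi
    (fun r hr => W.smul_mem (φ r : ℂ) (hW.ge (h r hr))) hint
  refine ⟨_, _, hW.le hmem, fun w v => ?_, fun w v => ?_⟩
  · refine ((((innerSL ℂ w).comp (ContinuousLinearMap.apply ℂ K v)).comp (ContinuousLinearMap.fst ℂ
      ℬ(K) ℬ(K, F))).integral_comp_comm hint).symm.trans ?_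
    exact integral_congr_ae (.of_forall fun r => inner_smul_right _ _ _)
  · refine ((((innerSL ℂ w).comp (ContinuousLinearMap.apply ℂ F v)).comp (ContinuousLinearMap.snd ℂ
      ℬ(K) ℬ(K, F))).integral_comp_comm hint).symm.trans ?_
    exact integral_congr_ae (.of_forall fun r => inner_smul_right _ _ _)

lemma continuousOn_neg_smul_rpow {X : ℝ → ℬ(K, F)} (hX : ContinuousOn X (Ioi 0)) (α : ℝ) :
    ContinuousOn (fun s => -(((s ^ (1 - α) : ℝ) : ℂ) • X s)) (Ioi 0) := by
  refine ContinuousOn.neg (ContinuousOn.smul (f := fun s : ℝ => ((s ^ (1 - α) : ℝ) : ℂ)) ?_ hX)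
  exact Complex.continuous_ofReal.comp_continuousOn
    (continuousOn_id.rpow_const fun s hs => Or.inl (ne_of_gt hs))

lemma norm_neg_smul_rpow {s : ℝ} (hs : 0 ≤ s) (α : ℝ) (X : ℬ(K, F)) :
    ‖-(((s ^ (1 - α) : ℝ) : ℂ) • X)‖ = s ^ (1 - α) * ‖X‖ := by
  rw [norm_neg, norm_smul, norm_real, norm_of_nonneg (rpow_nonneg hs _)]

lemma rpow_mul_le {α s y A B : ℝ} (hα₀ : 0 < α) (hα : α < 1) (hs : 0 < s) (hy : 0 ≤ y) (hA : y ≤ A)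
    (hB : y ≤ B / s) : s ^ (1 - α) * y ≤ A + B := by
  have hB0 : 0 ≤ B := by
    have := mul_le_mul_of_nonneg_right hB hs.le
    rw [div_mul_cancel₀ _ hs.ne'] at this
    exact (mul_nonneg hy hs.le).trans this
  rcases le_total s 1 with h | h
  · have h1 := Real.rpow_le_one hs.le h (by linarith : 0 ≤ 1 - α)
    nlinarith
  · have h1 := Real.rpow_le_rpow_of_exponent_le h (by linarith : 1 - α ≤ 1)
    rw [Real.rpow_one] at h1
    rw [le_div_iff₀ hs] at hB
    nlinarith

end WeakIntegral

section HolderSlices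

variable {α a b c : ℝ}

/-- The factor `ρ^{1-α}` of a symbol cancels in the slices. -/
lemma inner_slice_symbol {F : Type v} [NormedAddCommGroup F] [InnerProductSpace ℂ F]
    [CompleteSpace F] {w : ℝ → ℝ} {G : ℝ → ℬ(K, F)} {Θ : ℬ(L2Pos K, L2Pos F)} {x : F} {y : K}
    {q : ℝ → ℂ} (hG : IsMultiplication G Θ) (hw : IsWeight a b c w) (hα : α < 1)
    (hq : ∀ ρ, 0 < ρ → inner ℂ x (G ρ y) = ((ρ ^ (1 - α) : ℝ) : ℂ) * q ρ) :
    inner ℂ x (slice α w Θ y) = ∫ ρ in Ioi 0, (w ρ : ℂ) * q ρ := by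
  rw [inner_slice, inner_weightEmbed_self hG hw hα]
  refine setIntegral_congr_fun measurableSet_Ioi fun ρ hρ => ?_
  have hρ' : 0 < ρ := hρ
  rw [hq ρ hρ', density, ← mul_assoc, ← ofReal_mul, mul_right_comm, ← rpow_add hρ']
  simp

lemma inner_holderSymbol (f : Elem M) (x y : K) (ρ : ℝ) : inner ℂ x (holderSymbol T α f ρ y)
    = ((ρ ^ (1 - α) : ℝ) : ℂ) * inner ℂ x (poissonDeriv T ρ f y) := by
  rw [holderSymbol, smul_apply, inner_smul_right]

lemma IsMarkovSemigroup.hasDerivAt_inner_poisson (hT : IsMarkovSemigroup M τ T) (f : Elem M)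
    (x y : K) (ρ : ℝ) (hρ : 0 < ρ) : HasDerivAt (fun r => inner ℂ x ((poisson T r f).1 y))
      (inner ℂ x (poissonDeriv T ρ f y)) ρ :=
  (((innerSL ℂ x).restrictScalars ℝ).comp
    ((ContinuousLinearMap.apply ℂ K y).restrictScalars ℝ)).hasFDerivAt.comp_hasDerivAt ρ
      (hT.hasDerivAt_poisson' hρ f)

lemma IsMarkovSemigroup.continuousOn_inner_poissonDeriv (hT : IsMarkovSemigroup M τ T) (f : Elem M)
    (x y : K) : ContinuousOn (fun r => inner ℂ x (poissonDeriv T r f y)) (Ioi 0) :=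
  (innerSL ℂ x).continuous.comp_continuousOn
    ((hT.continuousOn_poissonDeriv f).clm_apply continuousOn_const)

lemma exists_isMultiplication_holderSymbol (hT : IsMarkovSemigroup M τ T) {f : Elem M}
    (hf : ∀ s, 0 < s → ‖holderSymbol T α f s‖ ≤ c) :
    ∃ Θ : ℬ(L2Pos K), IsMultiplication (holderSymbol T α f) Θ := by
  refine exists_isMultiplication (ContinuousOn.smul
    (f := fun s : ℝ => ((s ^ (1 - α) : ℝ) : ℂ)) ?_ (hT.continuousOn_poissonDeriv f)) hf
  exact Complex.continuous_ofReal.comp_continuousOn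
    (continuousOn_id.rpow_const fun s hs => Or.inl (ne_of_gt hs))

lemma norm_holderSymbol (f : Elem M) {s : ℝ} (hs : 0 < s) :
    ‖holderSymbol T α f s‖ = s ^ (1 - α) * ‖poissonDeriv T s f‖ := by
  rw [holderSymbol, norm_smul, norm_real, norm_of_nonneg (rpow_nonneg hs.le _)]

lemma slice_holderSymbol (hT : IsMarkovSemigroup M τ T) (hα : α < 1) (ha : 0 < a) (hab : a ≤ b)
    {f : Elem M} {Θ : ℬ(L2Pos K)} (hΘ : IsMultiplication (holderSymbol T α f) Θ) :
    slice α (intervalWeight a b) Θ = (poisson T b f).1 - poisson T a f := by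
  refine eq_of_inner_eq fun x y => ?_
  rw [inner_slice_symbol hΘ (isWeight_interval ha) hα fun ρ _ => inner_holderSymbol f x y ρ,
    integral_intervalWeight ha hab (hT.hasDerivAt_inner_poisson f x y)
      (hT.continuousOn_inner_poissonDeriv f x y), sub_apply, inner_sub_right]

/-- The slices of `Λ_α°(T; H^c)`-symbols are computed entrywise. -/
lemma entry_slice_holderColumnSymbol {ι : Type v} (hT : IsMarkovSemigroup M τ T) (hα : α < 1)
    (ha : 0 < a) (hab : a ≤ b) {X : columnModule M ι} {G : ℝ → ℬ(K, Ampl K ι)}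
    (hX : IsHolderColumnSymbol T α X G) {Θ : ℬ(L2Pos K, L2Pos (Ampl K ι))}
    (hΘ : IsMultiplication G Θ) (i : ι) : entry i (slice α (intervalWeight a b) Θ)
      = (poisson T b (coord X i)).1 - poisson T a (coord X i) := by
  classical
  refine eq_of_inner_eq fun x y => ?_
  have e : ∀ Y : ℬ(K, Ampl K ι),
      inner ℂ x (entry i Y y) = inner ℂ (lp.single 2 i x : Ampl K ι) (Y y) := fun Y =>
    (lp.inner_single_left i x (Y y)).symm
  rw [e, inner_slice_symbol hΘ (isWeight_interval ha) hα fun ρ hρ => by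
      rw [← e, hX ρ hρ i, inner_holderSymbol],
    integral_intervalWeight ha hab (hT.hasDerivAt_inner_poisson _ x y)
      (hT.continuousOn_inner_poissonDeriv _ x y), sub_apply, inner_sub_right]

lemma norm_entry_le {ι : Type v} (i : ι) (X : ℬ(K, Ampl K ι)) : ‖entry i X‖ ≤ ‖X‖ :=
  opNorm_le_bound _ (opNorm_nonneg _) fun y =>
    (lp.norm_apply_le_norm two_ne_zero (X y) i).trans (X.le_opNorm y)

lemma column_ext {ι : Type v} {X Y : ℬ(K, Ampl K ι)} (h : ∀ i, entry i X = entry i Y) : X = Y := by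
  refine ContinuousLinearMap.ext fun y => lp.ext (funext fun i => ?_)
  exact congrArg (fun Z : ℬ(K) => Z y) (h i)

/-- Two symbols of the same column agree. -/
lemma IsHolderColumnSymbol.eq {ι : Type v} {X : columnModule M ι} {G G' : ℝ → ℬ(K, Ampl K ι)}
    (h : IsHolderColumnSymbol T α X G) (h' : IsHolderColumnSymbol T α X G') {s : ℝ} (hs : 0 < s) :
    G s = G' s := column_ext fun i => (h s hs i).trans (h' s hs i).symm

namespace IsTestAlgebra

variable (hS : IsTestAlgebra τ T S) (hT : IsMarkovSemigroup M τ T)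

/-- `A^{1/2}` on the test algebra. -/
def sqrt (f : S) : S := ⟨sqrtGenerator T f, hS.sqrt_mem f.2⟩

/-- `P_s` on the test algebra, for `s > 0`. -/
def smooth (s : ℝ) (f : S) : S :=
  if hs : 0 < s then ⟨poisson T s f, hS.poisson_mem s hs f f.2⟩ else f

lemma coe_smooth {s : ℝ} (hs : 0 < s) (f : S) : (hS.smooth s f : Elem M) = poisson T s f := by
  rw [smooth, dif_pos hs]

include hT

lemma exists_smooth_difference {s r : ℝ} (hs : 0 < s) (hr : s / 2 < r) (f : S) (c : ℂ)
    {V : Type*} [AddCommGroup V] [Module ℂ V] (Q : S →ₗ[ℂ] V) :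
    ∃ k : S, (k : Elem M) = poisson T (r - s / 2) f - poisson T (s / 2) f
        + c • poisson T (s / 2) (hS.sqrt f) ∧ Q (hS.smooth (s / 2) k)
      = Q (hS.smooth r f) - Q (hS.smooth s f) + c • Q (hS.smooth s (hS.sqrt f)) := by
  have hs2 := half_pos hs
  have hr2 := sub_pos.2 hr
  have hm : ∀ u, 0 < u → ∀ g : S, poisson T u g ∈ S := fun u hu g => hS.poisson_mem u hu g g.2
  refine ⟨⟨_, add_mem (sub_mem (hm _ hr2 f) (hm _ hs2 f))
    (SMulMemClass.smul_mem c (hm _ hs2 (hS.sqrt f)))⟩, rfl, ?_⟩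
  obtain ⟨z, hz⟩ : ∃ z, z = hS.smooth s (hS.sqrt f) := ⟨_, rfl⟩
  rw [← hz, ← Q.map_smul c z, ← map_sub, ← map_add]
  refine congrArg Q (Subtype.ext ?_)
  rw [hS.coe_smooth hs2, hT.poisson_add hs2, hT.poisson_sub hs2, hT.poisson_smul hs2,
    hT.poisson_poisson hs2 hr2, hT.poisson_poisson hs2 hs2, hT.poisson_poisson hs2 hs2, add_halves,
    add_sub_cancel, ← hS.coe_smooth (hs2.trans hr), ← hS.coe_smooth hs, ← hS.coe_smooth hs, ← hz]
  rfl

lemma slice_trapezoid {h : ℝ} (hα : α < 1) (ha : 0 < a) (hab : a ≤ b) (hh : 0 ≤ h) (g : S)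
    {Θ : ℬ(L2Pos K)} (hΘ : IsMultiplication (holderSymbol T α (hS.sqrt g)) Θ) :
    slice α (trapezoidWeight a b h) Θ = (poisson T b g - poisson T a g).1
      - (poisson T (b + h) g - poisson T (a + h) g).1 := by
  refine eq_of_inner_eq fun x y => ?_
  have hp : ∀ ρ, 0 < ρ → HasDerivAt (fun r => -inner ℂ x ((poisson T r g).1 y))
      (inner ℂ x ((poisson T ρ (hS.sqrt g : Elem M) : ℬ(K)) y)) ρ := fun ρ hρ => by
    refine (hT.hasDerivAt_inner_poisson g x y ρ hρ).neg.congr_deriv ?_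
    rw [hS.poissonDeriv_eq hT g.2 hρ, neg_apply, inner_neg_right, neg_neg]
    rfl
  rw [inner_slice_symbol hΘ (isWeight_trapezoid ha hab hh) hα fun ρ _ =>
      inner_holderSymbol (hS.sqrt g : Elem M) x y ρ, integral_trapezoidWeight ha hab hh hp
      (hT.hasDerivAt_inner_poisson _ x y) (hT.continuousOn_inner_poissonDeriv _ x y)]
  have e : ∀ u v : Elem M, (u - v).1 = u.1 - v := fun _ _ => rfl
  simp only [e, sub_apply, inner_sub_right]
  ring

lemma norm_holderSymbol_sqrt_le (hα₀ : 0 < α) (hα : α < 1) (g : S) {s : ℝ} (hs : 0 < s) :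
    ‖holderSymbol T α (hS.sqrt g : Elem M) s‖
      ≤ ‖(hS.sqrt (hS.sqrt g) : Elem M)‖ + 2 * ‖(hS.sqrt g : Elem M)‖ := by
  rw [norm_holderSymbol _ hs]
  refine rpow_mul_le hα₀ hα hs (norm_nonneg _) ?_ ?_
  · rw [hS.poissonDeriv_eq hT (hS.sqrt g).2 hs, norm_neg]
    exact hT.norm_poisson_le hs _
  · rw [mul_div_right_comm]
    exact hT.norm_poissonDeriv_le hs _

end IsTestAlgebra

end HolderSlices

section Intertwining

variable {ι : Type v} {δ : S →ₗ[ℂ] columnModule M ι} {α s : ℝ}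
  (hτ : IsNSFTrace M τ) (hS : IsTestAlgebra τ T S) (hT : IsMarkovSemigroup M τ T)
  (hΓ : GradientForm₂Nonneg T S) (hδ : Factorizes T δ)

include hS hT hΓ hδ

lemma norm_derivation_poisson_le (hs : 0 < s) (f : S) :
    ‖(δ (hS.smooth s f) : ℬ(K, Ampl K ι))‖ ≤ ‖(f : Elem M)‖ / s := by
  refine (abs_le_of_sq_le_sq' ?_ (by positivity)).2
  rw [hδ.norm_sq, hS.coe_smooth hs, div_pow]
  exact hS.norm_gradientForm_poisson_le_sq hT hΓ f.2 hs

lemma norm_derivation_poisson_le' (hs : 0 < s) (f : S) :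
    ‖(δ (hS.smooth s f) : ℬ(K, Ampl K ι))‖ ≤ ‖(δ f : ℬ(K, Ampl K ι))‖ := by
  refine (abs_le_of_sq_le_sq' ?_ (opNorm_nonneg _)).2
  rw [hδ.norm_sq, hδ.norm_sq, hS.coe_smooth hs]
  exact hS.norm_gradientForm_poisson_le' hT hΓ f.2 hs

lemma continuousOn_derivation_poisson (f : S) :
    ContinuousOn (fun r => (δ (hS.smooth r f) : ℬ(K, Ampl K ι))) (Ioi 0) := by
  intro s hs
  have hs : 0 < s := hs
  have hs2 := half_pos hs
  refine ContinuousAt.continuousWithinAt ?_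
  have h1 : ContinuousAt (fun r => (poisson T (r - s / 2) f : ℬ(K))) s := by
    refine ContinuousAt.comp (g := fun r => (poisson T r f).1) ?_ (by fun_prop)
    rw [sub_half]
    exact (hT.hasDerivAt_poisson hs2 f).continuousAt
  rw [ContinuousAt, tendsto_iff_norm_sub_tendsto_zero] at h1
  refine continuousAt_of_norm_sub_le ?_ (by simpa using h1.const_mul (s / 2)⁻¹)
  filter_upwards [eventually_gt_nhds (half_lt_self hs)] with r hr
  have hr2 := sub_pos.2 hr
  have hr0 := hs2.trans hr
  have e : hS.smooth r f - hS.smooth s f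
      = hS.smooth (s / 2) (hS.smooth (r - s / 2) f - hS.smooth (s / 2) f) := by
    refine Subtype.ext ?_
    rw [hS.coe_smooth hs2]
    refine Eq.trans ?_ (hT.poisson_sub hs2 _ _).symm
    rw [hS.coe_smooth hr2, hS.coe_smooth hs2, hT.poisson_poisson hs2 hr2,
      hT.poisson_poisson hs2 hs2, add_halves, add_sub_cancel, ← hS.coe_smooth hr0,
      ← hS.coe_smooth hs]
    rfl
  have h2 := norm_derivation_poisson_le hS hT hΓ hδ hs2
    (hS.smooth (r - s / 2) f - hS.smooth (s / 2) f)
  rw [← e, map_sub] at h2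
  refine h2.trans (le_of_eq ?_)
  rw [div_eq_inv_mul, inv_div, sub_half, ← hS.coe_smooth hr2, ← hS.coe_smooth hs2]
  rfl

variable (hI : Intertwines T δ)
include hτ hI

/-- The intertwining identity passes to the Poisson semigroup. -/
lemma isAmplification_poisson (hs : 0 < s) (f : S) :
    IsAmplification (fun x => (poisson T s x).1) (δ f)
      (δ (hS.smooth s f) : ℬ(K, Ampl K ι)) := by
  obtain ⟨t, ht⟩ : ∃ t : ℝ → S, ∀ v, t v = ⟨T (max v 0) f, hS.semigroup_mem' hT f.2
    (le_max_right _ _)⟩ := ⟨_, fun _ => rfl⟩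
  have ht' : ∀ v, 0 ≤ v → (t v : Elem M) = T v f := fun v hv => by
    rw [ht]; simp only [max_eq_left hv]
  have hc1 : ContinuousOn (fun v => (t v).1.1) (Ioi 0) := by
    refine ContinuousOn.congr (continuous_subtype_val.comp_continuousOn
      ((hS.continuousOn_semigroup hT f.2).mono Ioi_subset_Ici_self)) fun v hv => ?_
    rw [ht' v (le_of_lt hv)]; rfl
  have hc2 : ContinuousOn (fun v => (δ (t v) : ℬ(K, Ampl K ι))) (Ioi 0) := by
    intro v hv
    have hv : 0 < v := hv
    have hv2 := half_pos hv
    refine ContinuousAt.continuousWithinAt ?_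
    have h1 : Tendsto (fun r => |r - v| * ‖generator T (f : Elem M)‖ / √v) (𝓝 v) (𝓝 0) := by
      have : ContinuousAt (fun r => |r - v| * ‖generator T (f : Elem M)‖ / √v) v := by fun_prop
      simpa [ContinuousAt] using this
    refine continuousAt_of_norm_sub_le ?_ h1
    filter_upwards [eventually_gt_nhds (half_lt_self hv)] with r hr
    have hr2 := sub_pos.2 hr
    have hr0 := hv2.trans hr
    have h2 := hS.norm_gradientForm_semigroup_le hT hΓ (t (r - v / 2) - t (v / 2)).2 hv2
    have e : (T (v / 2) (t (r - v / 2) - t (v / 2) : S) : Elem M) = (t r - t v : S) := by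
      refine ((hT.markov _ hv2.le).map_sub _ _).trans ?_
      rw [ht' _ hr2.le, ht' _ hv2.le, hT.semigroup_semigroup hv2.le hr2.le,
        hT.semigroup_semigroup hv2.le hv2.le, add_halves, sub_add_cancel,
        ← ht' _ hr0.le,
        ← ht' _ hv.le]
      rfl
    have h3 := hS.norm_semigroup_sub_le hT f.2 hr2.le hv2.le
    rw [← ht' _ hr2.le, ← ht' _ hv2.le, sub_sub, add_halves] at h3
    rw [e, ← hδ.norm_sq, map_sub, mul_div_cancel₀ v two_ne_zero] at h2
    refine (abs_le_of_sq_le_sq' (h2.trans ?_) (by positivity)).2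
    rw [div_pow, sq_sqrt hv.le]
    gcongr
    exact h3
  have hb1 : ∀ v, 0 < v → ‖(t v).1.1‖ ≤ ‖(f : Elem M)‖ := fun v hv => by
    rw [ht' v hv.le]; exact hT.norm_le hv.le (f : Elem M)
  have hb2 : ∀ v, 0 < v → ‖(δ (t v) : ℬ(K, Ampl K ι))‖ ≤ ‖(δ f : ℬ(K, Ampl K ι))‖ := by
    intro v hv
    refine (abs_le_of_sq_le_sq' ?_ (opNorm_nonneg _)).2
    rw [hδ.norm_sq, hδ.norm_sq, ht' v hv.le]
    exact hS.norm_gradientForm_semigroup_le' hT hΓ f.2 hv.le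
  obtain ⟨W, hW⟩ := exists_closedGraph_submodule δ
  obtain ⟨z, Z, hmem, h1, h2⟩ := exists_integral_mem_closure hW (integrableOn_subordinator hs) hc1
    hc2 hb1 hb2 fun r _ => mem_closedGraph (t r)
  have e1 : z = (hS.smooth s f).1 := by
    refine eq_of_inner_eq fun w v => ?_
    rw [h1, hS.coe_smooth hs]
    refine Eq.trans ?_ (hT.normal_poisson hs (f : Elem M) (isNormalFunctional_vector w v)).symm
    refine setIntegral_congr_fun measurableSet_Ioi fun r hr => ?_
    rw [ht' r (le_of_lt hr)]; rfl
  have e2 : Z = (δ (hS.smooth s f) : ℬ(K, Ampl K ι)) := by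
    refine closedGraph_unique hτ hT hS hδ ?_ (mem_closedGraph _)
    rw [← e1]; exact hmem
  classical
  intro i
  rw [← e2]
  refine eq_of_inner_eq fun w v => ?_
  refine ((lp.inner_single_left i w (Z v)).symm.trans (h2 _ _)).trans ?_
  refine Eq.trans ?_ (hT.normal_poisson hs (coord (δ f) i) (isNormalFunctional_vector w v)).symm
  refine setIntegral_congr_fun measurableSet_Ioi fun r hr => ?_
  have h := hI r hr f (t r) (ht' r (le_of_lt hr)) i
  rw [lp.inner_single_left]
  exact congrArg (fun Y : ℬ(K) => (subordinator s r : ℂ) * inner ℂ w (Y v)) h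

/-- The symbol of the Riesz transform of `A^{1/2} f`. -/
lemma isHolderColumnSymbol_derivation (f : S) : IsHolderColumnSymbol T α (δ f) fun s =>
    -(((s ^ (1 - α) : ℝ) : ℂ) • (δ (hS.smooth s (hS.sqrt f)) : ℬ(K, Ampl K ι))) := by
  intro s hs i
  have hs2 : 0 < s / 2 := half_pos hs
  obtain ⟨Q, hQ⟩ : ∃ Q : S →ₗ[ℂ] ℬ(K), ∀ g, Q g = entry i (δ g : ℬ(K, Ampl K ι)) :=
    ⟨{ toFun := fun g => entry i (δ g : ℬ(K, Ampl K ι))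
       map_add' := fun x y => by rw [map_add]; simp [entry]
       map_smul' := fun c x => by rw [δ.map_smul]; simp [entry] }, fun _ => rfl⟩
  have hQn : ∀ g, ‖Q (hS.smooth (s / 2) g)‖ ≤ (s / 2)⁻¹ * ‖(g : Elem M)‖ := fun g => by
    rw [hQ, ← div_eq_inv_mul]
    exact (norm_entry_le _ _).trans (norm_derivation_poisson_le hS hT hΓ hδ hs2 g)
  have hQP : ∀ r, 0 < r → ∀ g, Q (hS.smooth r g) = poisson T r (coord (δ g) i) := fun r hr g => by
    rw [hQ]; exact isAmplification_poisson hτ hS hT hΓ hδ hI hr g i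
  have h1 : HasDerivAt (fun r => (poisson T (r - s / 2) f : ℬ(K))) (poissonDeriv T (s / 2) f)
      s := HasDerivAt.comp_sub_const s (s / 2) (by
    rw [sub_half]; exact hT.hasDerivAt_poisson' hs2 (f : Elem M))
  have h2 : HasDerivAt (fun r => (poisson T r (coord (δ f) i)).1)
      (-(poisson T s (coord (δ (hS.sqrt f)) i) : ℬ(K))) s := by
    rw [hasDerivAt_iff_isLittleO] at h1 ⊢
    refine Asymptotics.IsBigO.trans_isLittleO (Asymptotics.IsBigO.of_bound (s / 2)⁻¹ ?_) h1
    filter_upwards [eventually_gt_nhds (half_lt_self hs)] with r hr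
    have hr2 := sub_pos.2 hr
    have hr0 := hs2.trans hr
    obtain ⟨c, hc⟩ : ∃ c : ℂ, c = ((r - s : ℝ) : ℂ) := ⟨_, rfl⟩
    obtain ⟨k, hk, hQk⟩ := hS.exists_smooth_difference hT hs hr f c Q
    have h3 := hQn k
    rw [hQk, hQP r hr0, hQP s hs, hQP s hs, hk] at h3
    have e : (poisson T (r - s / 2) f : ℬ(K)) - poisson T (s - s / 2) f
        - (r - s) • poissonDeriv T (s / 2) f = ((poisson T (r - s / 2) f - poisson T (s / 2) f
          + c • poisson T (s / 2) (hS.sqrt f) : Elem M) : ℬ(K)) := by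
      rw [hS.poissonDeriv_eq hT f.2 hs2, smul_neg, sub_neg_eq_add, ← coe_smul, ← hc,
        sub_half]
      rfl
    rw [e, smul_neg, sub_neg_eq_add, ← coe_smul, ← hc]
    exact h3
  have h3 := h2.deriv
  refine Eq.trans ?_ (congrArg (fun Y => ((s ^ (1 - α) : ℝ) : ℂ) • Y) h3).symm
  rw [← hQP s hs, hQ]
  simp only [entry, ContinuousLinearMap.comp_neg, ContinuousLinearMap.comp_smul, smul_neg]

lemma norm_derivation_symbol_le (hα₀ : 0 < α) (hα : α < 1) (hs : 0 < s) (f : S) :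
    ‖-(((s ^ (1 - α) : ℝ) : ℂ) • (δ (hS.smooth s (hS.sqrt f)) : ℬ(K, Ampl K ι)))‖
      ≤ ‖(δ (hS.sqrt f) : ℬ(K, Ampl K ι))‖ + ‖(hS.sqrt f : Elem M)‖ := by
  rw [norm_neg_smul_rpow hs.le]
  exact rpow_mul_le hα₀ hα hs (opNorm_nonneg _)
    (norm_derivation_poisson_le' hS hT hΓ hδ hs _) (norm_derivation_poisson_le hS hT hΓ hδ hs _)

lemma exists_riesz_symbol (hα₀ : 0 < α) (hα : α < 1) (f : S) :
    ∃ (G : ℝ → ℬ(K, Ampl K ι)) (Y : ℬ(L2Pos K, L2Pos (Ampl K ι))),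
      IsHolderColumnSymbol T α (δ f) G ∧ IsMultiplication G Y := by
  obtain ⟨Y, hY⟩ := exists_isMultiplication
    (continuousOn_neg_smul_rpow (continuousOn_derivation_poisson hS hT hΓ hδ (hS.sqrt f)) α)
    fun s hs => norm_derivation_symbol_le hτ hS hT hΓ hδ hI hα₀ hα hs f
  exact ⟨_, Y, isHolderColumnSymbol_derivation hτ hS hT hΓ hδ hI f, hY⟩

end Intertwining

/-! ### The Riesz transform -/

section Riesz

variable {α : ℝ}

lemma mem_ultraweakClosure_of_tendsto {E F : Type*} [NormedAddCommGroup E] [InnerProductSpace ℂ E]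
    [NormedAddCommGroup F] [InnerProductSpace ℂ F] {W : Submodule ℂ ℬ(E, F)} {I : Type*}
    {l : Filter I} [l.NeBot] {X : I → ℬ(E, F)} {Y : ℬ(E, F)} (h : ∀ᶠ i in l, X i ∈ W)
    (hX : Tendsto X l (𝓝ᵤ Y)) : Y ∈ ultraweakClosure W :=
  mem_ultraweakClosure_iff.2 (by
    let := ultraweak E F
    exact mem_closure_of_tendsto hX h)

lemma tendsto_ultraweak_sub {E F : Type*} [NormedAddCommGroup E] [InnerProductSpace ℂ E]
    [NormedAddCommGroup F] [InnerProductSpace ℂ F] {I : Type*} {l : Filter I}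
    {X X' : I → ℬ(E, F)} {Y Y' : ℬ(E, F)} (h : Tendsto X l (𝓝ᵤ Y))
    (h' : Tendsto X' l (𝓝ᵤ Y')) :
    Tendsto (fun i => X i - X' i) l (𝓝ᵤ (Y - Y')) :=
  tendsto_ultraweak_iff.2 fun ω hω => by
    simpa only [map_sub] using
      (tendsto_ultraweak_iff.1 h ω hω).sub (tendsto_ultraweak_iff.1 h' ω hω)

lemma IsMultiplication.smul_add {E : Type u} {F : Type v} [NormedAddCommGroup E]
    [InnerProductSpace ℂ E] [NormedAddCommGroup F] [InnerProductSpace ℂ F] {G G' G'' : ℝ → ℬ(E, F)}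
    {Θ Θ' : ℬ(L2Pos E, L2Pos F)} (hG : IsMultiplication G Θ) (hG' : IsMultiplication G' Θ') (c : ℂ)
    (h : ∀ s, 0 < s → G'' s = c • G s + G' s) : IsMultiplication G'' (c • Θ + Θ') := by
  intro f
  rw [add_apply, smul_apply]
  filter_upwards [hG f, hG' f, Lp.coeFn_add (c • Θ f) (Θ' f), Lp.coeFn_smul c (Θ f),
    ae_restrict_mem measurableSet_Ioi] with s h1 h2 h3 h4 hs
  rw [h3, Pi.add_apply, h4, Pi.smul_apply, h1, h2, h s hs, add_apply, smul_apply]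

namespace IsMarkovSemigroup

variable (hT : IsMarkovSemigroup M τ T)
include hT

lemma poissonDeriv_poisson {s r : ℝ} (hs : 0 < s) (hr : 0 < r) (f : Elem M) :
    poissonDeriv T s (poisson T r f) = poissonDeriv T (s + r) f := by
  have h := (hT.hasDerivAt_poisson' (add_pos hs hr) f).comp_add_const s r
  refine (h.congr_of_eventuallyEq ?_).deriv
  filter_upwards [eventually_gt_nhds hs] with t ht
  rw [hT.poisson_poisson ht hr]

/-- `P_{2ε} f - P_{ε+R} f = A^{1/2} P_ε m` for `m = ∫_ε^R P_r f dr`. -/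
lemma exists_primitive {ε R : ℝ} (hε : 0 < ε) (hR : ε ≤ R) (f : Elem M) : ∃ m : Elem M,
    smear T (subordinatorDeriv ε) m = poisson T (ε + R) f - poisson T (ε + ε) f := by
  have : CompleteSpace (Elem M) := (isClosed_vonNeumann (M := M)).completeSpace_coe
  have hs : ∀ r ∈ uIcc ε R, 0 < r := fun r hr => by
    rw [uIcc_of_le hR] at hr; exact hε.trans_le hr.1
  have hd : ∀ r, 0 < r → HasDerivAt (fun r => poisson T r f) (smear T (subordinatorDeriv r) f) r :=
    fun r hr => hasDerivAt_elem (hT.hasDerivAt_poisson hr f)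
  have hc : ContinuousOn (fun r => poisson T r f) (uIcc ε R) := fun r hr =>
    (hd r (hs r hr)).continuousAt.continuousWithinAt
  refine ⟨∫ r in ε..R, poisson T r f, ?_⟩
  have h1 := (hT.smearCLM (integrableOn_subordinatorDeriv hε)).intervalIntegral_comp_comm
    (hc.intervalIntegrable (μ := volume))
  rw [hT.smearCLM_apply] at h1
  rw [← h1]
  have h2 : ∀ r ∈ uIcc ε R, HasDerivAt (fun r => poisson T (ε + r) f)
      (smear T (subordinatorDeriv (ε + r)) f) r := fun r hr =>
    (hd (ε + r) (add_pos hε (hs r hr))).comp_const_add ε r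
  have e : ∀ r ∈ uIcc ε R, hT.smearCLM (integrableOn_subordinatorDeriv hε) (poisson T r f)
      = smear T (subordinatorDeriv (ε + r)) f := fun r hr => by
    refine Subtype.ext ?_
    rw [hT.smearCLM_apply, ← hT.poissonDeriv_eq hε, hT.poissonDeriv_poisson hε (hs r hr),
      hT.poissonDeriv_eq (add_pos hε (hs r hr))]
  rw [intervalIntegral.integral_congr e]
  refine intervalIntegral.integral_eq_sub_of_hasDerivAt h2 (ContinuousOn.intervalIntegrable ?_)
  refine continuousOn_iff_continuous_domRestrict.2 (Continuous.subtype_mk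
    (f := fun r : uIcc ε R => (smear T (subordinatorDeriv (ε + r)) f : ℬ(K))) ?_ _)
  refine continuousOn_iff_continuous_domRestrict.1 (ContinuousOn.congr
    (f := fun r => poissonDeriv T (ε + r) f) ?_
    fun r hr => (hT.poissonDeriv_eq (add_pos hε (hs r hr)) f).symm)
  exact (hT.continuousOn_poissonDeriv f).comp (by fun_prop) fun r hr => add_pos hε (hs r hr)

end IsMarkovSemigroup

namespace IsTestAlgebra

variable (hS : IsTestAlgebra τ T S) (hτ : IsNSFTrace M τ) (hT : IsMarkovSemigroup M τ T)

include hS hT hτ in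
lemma tendsto_smear_of_bounded {I : Type*} {U : Ultrafilter I} {x : I → Elem M} {y : Elem M}
    {ψ : ℝ → ℝ} (hψ : IntegrableOn ψ (Ioi 0)) {c : ℝ} (hc0 : 0 ≤ c) (hc : ∀ i, ‖x i‖ ≤ c)
    (hx : Tendsto (fun i => (x i : ℬ(K))) U (𝓝ᵤ y)) :
    Tendsto (fun i => (smear T ψ (x i)).1) U
      (𝓝ᵤ (smear T ψ y)) := by
  have h0 : 0 ≤ ∫ v in Ioi (0 : ℝ), |ψ v| := integral_nonneg fun v => abs_nonneg _
  obtain ⟨z, -, hz⟩ := exists_ultraweak_limit U (fun i => (smear T ψ (x i)).1)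
    (mul_nonneg h0 hc0) (.of_forall fun i => (hT.norm_smear_le hψ (x i)).trans
      (mul_le_mul_of_nonneg_left (hc i) h0))
  have hzM : z ∈ M := mem_of_tendsto_ultraweak (.of_forall fun i => (smear T ψ (x i)).2) hz
  rw [hS.smear_eq_of_tendsto hτ hT hψ (z := ⟨z, hzM⟩) hx hz]
  exact hz

include hT

/-- `A^{1/2} P_ε g = -∂_ε P_ε g`. -/
lemma sqrt_smooth {ε : ℝ} (hε : 0 < ε) (g : S) :
    (hS.sqrt (hS.smooth ε g) : Elem M) = -smear T (subordinatorDeriv ε) g := by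
  have h := (hasDerivAt_elem (hT.hasDerivAt_poisson hε (g : Elem M))).tendsto_slope_zero_right.neg
  refine (isGeneratorAt_of_norm (T := poisson T) (h.congr' ?_)).generator_eq
  filter_upwards [self_mem_nhdsWithin] with t ht
  rw [hS.coe_smooth hε, hT.poisson_poisson ht hε, ← smul_neg, neg_sub, add_comm t ε,
    coe_smul]

lemma holderSymbol_sqrt {s : ℝ} (hs : 0 < s) (g : S) : holderSymbol T α (hS.sqrt g : Elem M) s
    = -(((s ^ (1 - α) : ℝ) : ℂ) • (poisson T s (generator T g)).1) := by
  rw [holderSymbol, hS.poissonDeriv_eq hT (hS.sqrt g).2 hs, hS.generator_eq_sqrt hT g.2, smul_neg]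
  rfl

end IsTestAlgebra

variable {ι : Type v} {δ : S →ₗ[ℂ] columnModule M ι}

/-- Pairs in the initial graph of the Riesz transform. -/
def rieszBase (T : ℝ → Elem M → Elem M) (α : ℝ) (δ : S →ₗ[ℂ] columnModule M ι) :
    Set (ℬ(L2Pos K) × ℬ(L2Pos K, L2Pos (Ampl K ι))) :=
  {p | ∃ (g : S) (G : ℝ → ℬ(K, Ampl K ι)), IsHolderColumnSymbol T α (δ g) G ∧
      IsMultiplication (holderSymbol T α (sqrtGenerator T g)) p.1 ∧ IsMultiplication G p.2}

variable (hτ : IsNSFTrace M τ) (hS : IsTestAlgebra τ T S) (hT : IsMarkovSemigroup M τ T)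
  (hΓ : GradientForm₂Nonneg T S) (hδ : Factorizes T δ) (hI : Intertwines T δ)
  (hα₀ : 0 < α) (hα : α < 1)

include hS hT in
lemma exists_rieszGraph_submodule (h0 : (rieszBase T α δ).Nonempty) :
    ∃ W : Submodule ℂ (ℬ(L2Pos K) × ℬ(L2Pos K, L2Pos (Ampl K ι))),
      (W : Set _) = rieszGraph T α δ := by
  have key : ∀ (c : ℂ) (p q : ℬ(L2Pos K) × ℬ(L2Pos K, L2Pos (Ampl K ι))),
      p ∈ rieszBase T α δ → q ∈ rieszBase T α δ → c • p + q ∈ rieszBase T α δ := by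
    rintro c p q ⟨f, G, h1, h2, h3⟩ ⟨f', G', h1', h2', h3'⟩
    let cf : S := ⟨c • (f : Elem M), SMulMemClass.smul_mem c f.2⟩
    have e : δ cf = c • δ f := δ.map_smul c f
    refine ⟨cf + f', fun s => c • G s + G' s, fun s hs i => ?_,
      h2.smul_add h2' c fun s hs => ?_, h3.smul_add h3' c fun s _ => rfl⟩
    · have e1 : coord (δ (cf + f')) i = c • coord (δ f) i + coord (δ f') i := by
        rw [map_add, e]; refine Subtype.ext ?_; simp [coord, entry]
      have e2 : entry i (c • G s + G' s) = c • entry i (G s) + entry i (G' s) := by simp [entry]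
      rw [e1, e2, h1 s hs i, h1' s hs i]
      simp only [holderSymbol, hT.poissonDeriv_add hs, hT.poissonDeriv_smul hs]
      module
    · have e3 : generator T (cf + f' : S) = c • generator T f + generator T f' :=
        (hS.generator_add hT cf.2 f'.2).trans (by rw [← hS.generator_smul hT f.2])
      refine (hS.holderSymbol_sqrt hT hs (cf + f')).trans ?_
      rw [e3, hT.poisson_add hs, hT.poisson_smul hs]
      refine Eq.trans ?_ (congrArg₂ (fun X Y => c • X + Y) (hS.holderSymbol_sqrt hT hs f)
        (hS.holderSymbol_sqrt hT hs f')).symm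
      have e4 : ∀ x y : Elem M, (c • x + y).1 = c • x.1 + y :=
        fun _ _ => rfl
      rw [e4]
      module
  obtain ⟨p, hp⟩ := h0
  have hz : (0 : ℬ(L2Pos K) × ℬ(L2Pos K, L2Pos (Ampl K ι))) ∈ rieszBase T α δ := by
    simpa using key (-1) p p hp hp
  exact ultraweakPairClosure_linear
    { carrier := rieszBase T α δ
      add_mem' := fun {p q} hp hq => by simpa using key 1 p q hp hq
      zero_mem' := hz
      smul_mem' := fun c p hp => by simpa using key c p 0 hp hz } rfl

include hτ hS hT hΓ hδ hI hα₀ hα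

lemma rieszBase_mem {p : ℬ(L2Pos K) × ℬ(L2Pos K, L2Pos (Ampl K ι))}
    (hp : p ∈ rieszBase T α δ) :
    IsDecomposable α p.1 ∧ IsDecomposable α p.2 ∧
    p.1 ∈ Submodule.span ℂ {Θ : ℬ(L2Pos K) | ∃ f : Elem M,
      (∃ c : ℝ, ∀ s : ℝ, 0 < s → ‖holderSymbol T α f s‖ ≤ c) ∧
        IsMultiplication (holderSymbol T α f) Θ} ∧
    p.2 ∈ Submodule.span ℂ {Θ : ℬ(L2Pos K, L2Pos (Ampl K ι)) | ∃ (X : columnModule M ι)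
      (G : ℝ → ℬ(K, Ampl K ι)), IsHolderColumnSymbol T α X G ∧
      (∃ c : ℝ, ∀ s : ℝ, 0 < s → ‖G s‖ ≤ c) ∧ IsMultiplication G Θ} ∧
    ∀ a b h, 0 < a → a ≤ b → 0 ≤ h → (slice α (trapezoidWeight a b h) p.1,
        slice α (intervalWeight a b) p.2 - slice α (intervalWeight (a + h) (b + h)) p.2)
          ∈ closedGraph δ ∧
      ∃ x : Elem M, x.1 = slice α (trapezoidWeight a b h) p.1 ∧ ∀ r, 0 < r →
        (poisson T r x).1 = slice α (trapezoidWeight (r + a) (r + b) h) p.1 := by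
  obtain ⟨g, G, hG, h1, h2⟩ := hp
  have hb : ∀ s, 0 < s → ‖G s‖ ≤ ‖(δ (hS.sqrt g) : ℬ(K, Ampl K ι))‖ + ‖(hS.sqrt g : Elem M)‖ :=
    fun s hs => by
    rw [hG.eq (isHolderColumnSymbol_derivation hτ hS hT hΓ hδ hI g) hs]
    exact norm_derivation_symbol_le hτ hS hT hΓ hδ hI hα₀ hα hs g
  refine ⟨h1.isDecomposable hα, h2.isDecomposable hα,
    Submodule.subset_span ⟨_, ⟨_, fun s hs => hS.norm_holderSymbol_sqrt_le hT hα₀ hα g hs⟩, h1⟩,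
    Submodule.subset_span ⟨δ g, G, hG, ⟨_, hb⟩, h2⟩, fun a b h ha hab hh => ⟨?_, ?_⟩⟩
  · have hsl : ∀ a b, 0 < a → a ≤ b → slice α (intervalWeight a b) p.2
        = (δ (hS.smooth b g) : ℬ(K, Ampl K ι)) - δ (hS.smooth a g) := fun a b ha hab =>
      column_ext fun i => by
        rw [entry_slice_holderColumnSymbol hT hα ha hab hG h2,
          ← show _ = (poisson T a (coord (δ g) i)).1 from
            isAmplification_poisson hτ hS hT hΓ hδ hI ha g i,
          ← show _ = (poisson T b (coord (δ g) i)).1 from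
            isAmplification_poisson hτ hS hT hΓ hδ hI (ha.trans_le hab) g i]
        simp [entry]
    rw [hS.slice_trapezoid hT hα ha hab hh g h1, hsl a b ha hab,
      hsl _ _ (by linarith) (by linarith)]
    have e := mem_closedGraph (δ := δ) ((hS.smooth b g - hS.smooth a g)
      - (hS.smooth (b + h) g - hS.smooth (a + h) g))
    rw [map_sub, map_sub, map_sub] at e
    rw [← hS.coe_smooth ha, ← hS.coe_smooth (ha.trans_le hab), ← hS.coe_smooth (by linarith),
      ← hS.coe_smooth (by linarith : 0 < a + h)]
    exact e
  · refine ⟨(poisson T b g - poisson T a g) - (poisson T (b + h) g - poisson T (a + h) g),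
      (hS.slice_trapezoid hT hα ha hab hh g h1).symm, fun r hr => ?_⟩
    rw [hS.slice_trapezoid hT hα (by linarith) (by linarith) hh g h1, hT.poisson_sub hr,
      hT.poisson_sub hr, hT.poisson_sub hr, hT.poisson_poisson hr ha,
      hT.poisson_poisson hr (ha.trans_le hab), hT.poisson_poisson hr (by linarith),
      hT.poisson_poisson hr (by linarith), add_assoc, add_assoc]
    rfl

/-- Properties of the pairs in the closed graph: the first relation comes from `δ P_s = P_s δ`, the
second one from the semigroup law. -/
lemma rieszGraph_slices {p : ℬ(L2Pos K) × ℬ(L2Pos K, L2Pos (Ampl K ι))}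
    (hp : p ∈ rieszGraph T α δ) :
    (IsDecomposable α p.1 ∧ IsDecomposable α p.2 ∧ p.1 ∈ holderClass T α ∧
      p.2 ∈ holderColumnClass T α ι) ∧
    ∀ a b h, 0 < a → a ≤ b → 0 ≤ h → (slice α (trapezoidWeight a b h) p.1,
        slice α (intervalWeight a b) p.2 - slice α (intervalWeight (a + h) (b + h)) p.2)
          ∈ closedGraph δ ∧
      ∃ x : Elem M, x.1 = slice α (trapezoidWeight a b h) p.1 ∧ ∀ r, 0 < r →
        (poisson T r x).1 = slice α (trapezoidWeight (r + a) (r + b) h) p.1 := by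
  obtain ⟨U, hU, h1, h2⟩ := mem_ultraweakPairClosure_iff.1 hp
  have hB := fun q hq => rieszBase_mem hτ hS hT hΓ hδ hI hα₀ hα (p := q) hq
  have hB' : ∀ᶠ q in (U : Filter _), q ∈ rieszBase T α δ := hU
  refine ⟨⟨isDecomposable_of_tendsto h1 (hB'.mono fun q hq => (hB q hq).1),
    isDecomposable_of_tendsto h2 (hB'.mono fun q hq => (hB q hq).2.1),
    mem_ultraweakClosure_of_tendsto (hB'.mono fun q hq => (hB q hq).2.2.1) h1,
    mem_ultraweakClosure_of_tendsto (hB'.mono fun q hq => (hB q hq).2.2.2.1) h2⟩,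
    fun a b h ha hab hh => ⟨closedGraph_of_tendsto
      (hB'.mono fun q hq => ((hB q hq).2.2.2.2 a b h ha hab hh).1) (tendsto_slice h1 _) ?_, ?_⟩⟩
  · exact tendsto_ultraweak_sub (tendsto_slice h2 _) (tendsto_slice h2 _)
  · have h3 : ∀ q : ℬ(L2Pos K) × ℬ(L2Pos K, L2Pos (Ampl K ι)), ∃ x : Elem M,
        q ∈ rieszBase T α δ → x.1 = slice α (trapezoidWeight a b h) q.1 ∧ ∀ r, 0 < r →
          (poisson T r x).1 = slice α (trapezoidWeight (r + a) (r + b) h) q.1 := fun q => by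
      by_cases hq : q ∈ rieszBase T α δ
      · obtain ⟨x, hx⟩ := ((hB q hq).2.2.2.2 a b h ha hab hh).2
        exact ⟨x, fun _ => hx⟩
      · exact ⟨0, fun h => absurd h hq⟩
    choose x hx using h3
    have h4 := (tendsto_slice h1 (trapezoidWeight a b h)).congr'
      (hB'.mono fun q hq => ((hx q hq).1).symm)
    have hM := mem_of_tendsto_ultraweak (.of_forall fun q => (x q).2) h4
    refine ⟨⟨_, hM⟩, rfl, fun r hr => ?_⟩
    have h5 := (tendsto_slice h1 (trapezoidWeight (r + a) (r + b) h)).congr'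
      (hB'.mono fun q hq => ((hx q hq).2 r hr).symm)
    have hM' := mem_of_tendsto_ultraweak (.of_forall fun q => (poisson T r (x q)).2) h5
    exact congrArg Subtype.val (hS.poisson_eq_of_tendsto hτ hT hr (y := ⟨_, hM⟩) (z := ⟨_, hM'⟩)
      h4 h5)

/-- The Riesz transform is bounded on its graph. -/
lemma norm_le_of_mem_rieszGraph {p : ℬ(L2Pos K) × ℬ(L2Pos K, L2Pos (Ampl K ι))}
    (hp : p ∈ rieszGraph T α δ) : ‖p.2‖ ≤ 64 / (1 - 2 ^ (α - 1)) * ‖p.1‖ := by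
  obtain ⟨⟨-, hd, -, -⟩, hs⟩ := rieszGraph_slices hτ hS hT hΓ hδ hI hα₀ hα hp
  have hρ : 0 < 1 - (2 : ℝ) ^ (α - 1) := sub_pos.2 (dyadic_ratio_lt_one hα)
  refine (norm_le_of_slices hα₀ hα hd (c := 32 * ‖p.1‖ / (1 - 2 ^ (α - 1))) (by positivity)
    fun a l hl hla => ?_).trans (le_of_eq (by ring))
  have ha := hl.trans_le hla
  refine (dyadic_bound (v := fun r => ‖slice α (intervalWeight r (r + l)) p.2‖)
    (u := fun n => (2 ^ n * a) ^ (α - 1) * (l * ‖p.2‖)) (N := 32 * l * ‖p.1‖) hα (by positivity) ha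
    (fun r hr => ?_) (fun n => ?_) ?_).trans (le_of_eq (by ring))
  · have hr0 := ha.trans_le hr
    have h1 := (hs r (r + l) r hr0 (by linarith) hr0.le).1
    obtain ⟨x, hx, hxr⟩ := (hs (r / 2) (r / 2 + l) r (by positivity) (by linarith) hr0.le).2
    obtain ⟨X, hX, hXn⟩ := exists_closedGraph_poisson hτ hT hS hΓ hδ (half_pos hr0) x
    rw [hxr _ (half_pos hr0), ← add_assoc, add_halves] at hX
    have h2 := closedGraph_unique hτ hT hS hδ h1 hX
    have h3 := norm_slice_le (isWeight_trapezoid (half_pos hr0)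
      (by linarith : r / 2 ≤ r / 2 + l) hr0.le) hα (by linarith) p.1
    rw [← hx, add_sub_cancel_left, add_assoc, add_sub_cancel_left] at h3
    have h4 : (r / 2) ^ (α - 1) ≤ 2 * r ^ (α - 1) := by
      rw [div_eq_mul_inv, Real.mul_rpow hr0.le (by norm_num), mul_comm, ← Real.rpow_neg_one,
        ← Real.rpow_mul two_pos.le]
      refine mul_le_mul_of_nonneg_right ?_ (by positivity)
      exact (Real.rpow_le_rpow_of_exponent_le one_le_two (by linarith)).trans_eq (Real.rpow_one 2)
    have h5 : ‖x.1‖ ≤ 2 * r ^ (α - 1) * l * (r + r) * ‖p.1‖ := by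
      refine h3.trans ?_
      gcongr
      linarith
    have h6 : 4 / (r / 2) * ‖x‖ ≤ 32 * l * ‖p.1‖ * r ^ (α - 1) := by
      calc _ ≤ 4 / (r / 2) * (2 * r ^ (α - 1) * l * (r + r) * ‖p.1‖) :=
            mul_le_mul_of_nonneg_left h5 (by positivity)
        _ = _ := by field_simp; ring
    have h7 := norm_add_le (slice α (intervalWeight (r + r) (r + l + r)) p.2) X
    have e : slice α (intervalWeight (r + r) (r + l + r)) p.2 + X
        = slice α (intervalWeight r (r + l)) p.2 := by rw [← h2, add_sub_cancel]
    rw [e, add_right_comm r l r, ← two_mul] at h7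
    exact h7.trans (add_le_add_right (hXn.trans h6) _)
  · refine (norm_slice_le (isWeight_interval (by positivity)) hα (by linarith) p.2).trans_eq ?_
    rw [add_sub_cancel_left]; ring
  · have h1 : Tendsto (fun n : ℕ => (2 : ℝ) ^ n * a) atTop atTop :=
      (tendsto_pow_atTop_atTop_of_one_lt one_lt_two).atTop_mul_const ha
    have h2 := (tendsto_rpow_neg_atTop (by linarith : 0 < 1 - α)).comp h1
    simpa using h2.mul_const (l * ‖p.2‖)

lemma exists_mem_rieszBase (g : S) : ∃ Θ Y, (Θ, Y) ∈ rieszBase T α δ ∧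
    IsMultiplication (holderSymbol T α (hS.sqrt g : Elem M)) Θ := by
  obtain ⟨Θ, hΘ⟩ := exists_isMultiplication_holderSymbol hT
    fun s hs => hS.norm_holderSymbol_sqrt_le hT hα₀ hα g hs
  obtain ⟨G, Y, hG, hY⟩ := exists_riesz_symbol hτ hS hT hΓ hδ hI hα₀ hα g
  exact ⟨Θ, Y, ⟨g, G, hG, hΘ, hY⟩, hΘ⟩

lemma exists_rieszGraph_eq :
    ∃ W : Submodule ℂ (ℬ(L2Pos K) × ℬ(L2Pos K, L2Pos (Ampl K ι))),
      ∀ p, p ∈ W ↔ p ∈ rieszGraph T α δ := by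
  obtain ⟨Θ, Y, h, -⟩ := exists_mem_rieszBase hτ hS hT hΓ hδ hI hα₀ hα 0
  obtain ⟨W, hW⟩ := exists_rieszGraph_submodule (α := α) (δ := δ) hS hT ⟨_, h⟩
  exact ⟨W, fun p => Set.ext_iff.1 hW p⟩

lemma rieszGraph_unique {Θ : ℬ(L2Pos K)} {Y Y' : ℬ(L2Pos K, L2Pos (Ampl K ι))}
    (h : (Θ, Y) ∈ rieszGraph T α δ) (h' : (Θ, Y') ∈ rieszGraph T α δ) : Y = Y' := by
  obtain ⟨W, hW⟩ := exists_rieszGraph_eq hτ hS hT hΓ hδ hI hα₀ hα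
  have h1 := norm_le_of_mem_rieszGraph hτ hS hT hΓ hδ hI hα₀ hα
    ((hW _).1 (W.sub_mem ((hW _).2 h) ((hW _).2 h')))
  simp only [Prod.mk_sub_mk, sub_self, norm_zero, mul_zero] at h1
  exact sub_eq_zero.1 (norm_le_zero_iff.1 h1)

/-- Thanks to the bound, the domain of the Riesz transform is stable under bounded limits. -/
lemma exists_rieszGraph_of_tendsto {I : Type*} {U : Ultrafilter I} {X : I → ℬ(L2Pos K)}
    {Θ : ℬ(L2Pos K)} {c : ℝ}
    (h : ∀ᶠ i in (U : Filter I), (∃ Y, (X i, Y) ∈ rieszGraph T α δ) ∧ ‖X i‖ ≤ c)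
    (hX : Tendsto X U (𝓝ᵤ Θ)) : ∃ Y, (Θ, Y) ∈ rieszGraph T α δ := by
  have hρ : 0 < 1 - (2 : ℝ) ^ (α - 1) := sub_pos.2 (dyadic_ratio_lt_one hα)
  have h1 : ∀ i, ∃ Y, (∃ Y, (X i, Y) ∈ rieszGraph T α δ) → (X i, Y) ∈ rieszGraph T α δ :=
      fun i => by
    by_cases hi : ∃ Y, (X i, Y) ∈ rieszGraph T α δ
    · exact ⟨hi.choose, fun _ => hi.choose_spec⟩
    · exact ⟨0, fun h => absurd h hi⟩
  choose Y hY using h1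
  obtain ⟨Z, -, hZ⟩ := exists_ultraweak_limit U Y (c := 64 / (1 - 2 ^ (α - 1)) * max c 0)
    (by positivity) (h.mono fun i hi =>
      (norm_le_of_mem_rieszGraph hτ hS hT hΓ hδ hI hα₀ hα (hY i hi.1)).trans
        (mul_le_mul_of_nonneg_left (hi.2.trans (le_max_left _ _)) (by positivity)))
  exact ⟨Z, mem_ultraweakPairClosure_of_tendsto (h.mono fun i hi => hY i hi.1) hX hZ⟩

/-- A symbol belongs to the domain of the Riesz transform once its slices are limits of the slices
of a bounded family of symbols in the domain. -/
lemma exists_rieszGraph_of_slices {I : Type*} {U : Ultrafilter I} {x : I → Elem M} {f : Elem M}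
    {Θ : ℬ(L2Pos K)} {c : ℝ} (hc0 : 0 ≤ c)
    (hc : ∀ i s, 0 < s → ‖holderSymbol T α (x i) s‖ ≤ c)
    (hx : ∀ i X, IsMultiplication (holderSymbol T α (x i)) X → ∃ Y, (X, Y) ∈ rieszGraph T α δ)
    (hlim : ∀ a b, 0 < a → a ≤ b → Tendsto
      (fun i => (poisson T b (x i)).1 - poisson T a (x i)) U
      (𝓝ᵤ ((poisson T b f).1 - poisson T a f)))
    (hΘ : IsMultiplication (holderSymbol T α f) Θ) : ∃ Y, (Θ, Y) ∈ rieszGraph T α δ := by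
  choose X hX using fun i => exists_isMultiplication_holderSymbol hT (hc i)
  have hXc : ∀ i, ‖X i‖ ≤ c := fun i => (hX i).norm_le hc0 (hc i)
  obtain ⟨F, -, hF⟩ := exists_ultraweak_limit U X hc0 (.of_forall hXc)
  obtain ⟨Y, hY⟩ := exists_rieszGraph_of_tendsto hτ hS hT hΓ hδ hI hα₀ hα
    (.of_forall fun i => ⟨hx i _ (hX i), hXc i⟩) hF
  have hd := (isDecomposable_of_tendsto hF
    (.of_forall fun i => (hX i).isDecomposable hα)).sub (hΘ.isDecomposable hα)
  have h0 := norm_le_of_slices hα₀ hα hd le_rfl fun a l hl hla => by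
    have ha := hl.trans_le hla
    have h1 := tendsto_slice (α := α) hF (intervalWeight a (a + l))
    have h2 := ultraweak_unique h1 ((hlim a (a + l) ha (by linarith)).congr fun i =>
      (slice_holderSymbol hT hα ha (by linarith) (hX i)).symm)
    rw [slice_sub, h2, slice_holderSymbol hT hα ha (by linarith) hΘ, sub_self, norm_zero, zero_mul]
  rw [mul_zero] at h0
  rw [← sub_eq_zero.1 (norm_le_zero_iff.1 h0)]
  exact ⟨Y, hY⟩

/-- The symbol of `A^{1/2} P_ε m` belongs to the domain: approximate `m` from the test algebra. -/
lemma exists_rieszGraph_smear {ε : ℝ} (hε : 0 < ε) (m : Elem M) {Θ : ℬ(L2Pos K)}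
    (hΘ : IsMultiplication (holderSymbol T α (-smear T (subordinatorDeriv ε) m)) Θ) :
    ∃ Y, (Θ, Y) ∈ rieszGraph T α δ := by
  obtain ⟨g, hg, hgm⟩ := exists_bounded_net S hS.dense m
  obtain ⟨k, hk⟩ : ∃ k : Finset K × ℕ → S, ∀ i, k i = hS.smooth ε ⟨g i, (hg i).1⟩ :=
    ⟨_, fun _ => rfl⟩
  have hk1 : ∀ i, (hS.sqrt (k i) : Elem M) = -smear T (subordinatorDeriv ε) (g i) := fun i => by
    rw [hk, hS.sqrt_smooth hT hε]
  have hn1 : ∀ i, ‖(hS.sqrt (k i) : Elem M)‖ ≤ 2 / ε * (4 * ‖m‖) := fun i => by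
    rw [hk1, norm_neg]
    exact (hT.norm_smear_deriv_le hε _).trans
      (mul_le_mul_of_nonneg_left (hg i).2 (by positivity))
  have hn2 : ∀ i, ‖(hS.sqrt (hS.sqrt (k i)) : Elem M)‖ ≤ 6 / ε ^ 2 * (4 * ‖m‖) := fun i => by
    have e : (hS.sqrt (hS.sqrt (k i)) : Elem M) = smear T (subordinatorDeriv₂ ε) (g i) := by
      refine (hS.generator_eq_sqrt hT (k i).2).symm.trans ?_
      rw [hk, hS.coe_smooth hε, hS.generator_poisson hT (hg i).1 hε,
        hS.smear_deriv₂_eq hT (hg i).1 hε]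
    rw [e]
    exact (hT.norm_smear_deriv₂_le hε _).trans
      (mul_le_mul_of_nonneg_left (hg i).2 (by positivity))
  let U : Ultrafilter (Finset K × ℕ) := Ultrafilter.of atTop
  have hlim := hS.tendsto_smear_of_bounded (U := U) hτ hT
    (integrableOn_subordinatorDeriv hε) (by positivity) (fun i => (hg i).2)
    (hgm.mono_left (Ultrafilter.of_le atTop))
  have hlim' : Tendsto (fun i => (hS.sqrt (k i)).1.1) (U : Filter _)
      (𝓝ᵤ (-smear T (subordinatorDeriv ε) m).1) := by
    refine tendsto_ultraweak_iff.2 fun ω hω => ?_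
    have e : ∀ y : Elem M, ω (-y).1 = -ω y.1 := fun y =>
      map_neg ω y.1
    simp only [hk1, e]
    exact (tendsto_ultraweak_iff.1 hlim ω hω).neg
  have hP : ∀ b, 0 < b → Tendsto
      (fun i => (poisson T b (hS.sqrt (k i) : Elem M) : ℬ(K))) (U : Filter _)
      (𝓝ᵤ (poisson T b (-smear T (subordinatorDeriv ε) m) : ℬ(K))) :=
    fun b hb => by
    simp only [poisson_eq_smear hb]
    exact hS.tendsto_smear_of_bounded hτ hT (integrableOn_subordinator hb) (by positivity) hn1 hlim'
  refine exists_rieszGraph_of_slices hτ hS hT hΓ hδ hI hα₀ hα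
    (c := 6 / ε ^ 2 * (4 * ‖m‖) + 2 * (2 / ε * (4 * ‖m‖))) (by positivity)
    (fun i s hs => (hS.norm_holderSymbol_sqrt_le hT hα₀ hα (k i) hs).trans
      (add_le_add (hn2 i) (mul_le_mul_of_nonneg_left (hn1 i) two_pos.le)))
    (fun i X hX => ?_) (fun a b ha hab =>
      tendsto_ultraweak_sub (hP b (ha.trans_le hab)) (hP a ha)) hΘ
  obtain ⟨G, Y, hG, hY⟩ := exists_riesz_symbol hτ hS hT hΓ hδ hI hα₀ hα (k i)
  exact ⟨Y, @subset_closure _ (_) _ _ ⟨k i, G, hG, hX, hY⟩⟩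

/-- Every Hölder symbol belongs to the domain: approximate `f` by `P_{2ε} f - P_{ε+R} f`, which is
`-∂_ε P_ε m` for some `m`. -/
lemma exists_rieszGraph_symbol {f : Elem M} {c : ℝ}
    (hc : ∀ s : ℝ, 0 < s → ‖holderSymbol T α f s‖ ≤ c) {Θ : ℬ(L2Pos K)}
    (hΘ : IsMultiplication (holderSymbol T α f) Θ) : ∃ Y, (Θ, Y) ∈ rieszGraph T α δ := by
  have hc0 : 0 ≤ c := (norm_nonneg _).trans (hc 1 one_pos)
  obtain ⟨ε, hε⟩ : ∃ ε : ℕ → ℝ, ∀ n, ε n = 1 / ((n : ℝ) + 1) := ⟨_, fun _ => rfl⟩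
  obtain ⟨R, hR⟩ : ∃ R : ℕ → ℝ, ∀ n, R n = (n : ℝ) + 1 := ⟨_, fun _ => rfl⟩
  have hε0 : ∀ n, 0 < ε n := fun n => by rw [hε]; positivity
  have hR0 : ∀ n, 0 < R n := fun n => by rw [hR]; positivity
  have hεR : ∀ n, ε n ≤ R n := fun n => by
    rw [hε, hR, div_le_iff₀ (by positivity)]; nlinarith [(Nat.cast_nonneg n : (0 : ℝ) ≤ n)]
  have hεlim : Tendsto ε atTop (𝓝 0) := by
    rw [funext hε]; exact tendsto_one_div_add_atTop_nhds_zero_nat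
  have hRlim : Tendsto R atTop atTop := by
    rw [funext hR]; exact tendsto_atTop_add_const_right _ _ tendsto_natCast_atTop_atTop
  choose m hm using fun n => hT.exists_primitive (hε0 n) (hεR n) f
  have hx : ∀ n, -smear T (subordinatorDeriv (ε n)) (m n)
      = poisson T (ε n + ε n) f - poisson T (ε n + R n) f := fun n => by rw [hm, neg_sub]
  have hpos : ∀ n, 0 < ε n + ε n ∧ 0 < ε n + R n := fun n =>
    ⟨add_pos (hε0 n) (hε0 n), add_pos (hε0 n) (hR0 n)⟩
  have hbound : ∀ r s, 0 < r → 0 < s → ‖holderSymbol T α (poisson T r f) s‖ ≤ c :=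
      fun r s hr hs => by
    rw [norm_holderSymbol _ hs, hT.poissonDeriv_poisson hs hr]
    refine le_trans ?_ (hc (s + r) (by positivity))
    rw [norm_holderSymbol _ (by positivity)]
    refine mul_le_mul_of_nonneg_right ?_ (norm_nonneg _)
    exact Real.rpow_le_rpow hs.le (by linarith) (by linarith)
  have hP : ∀ n b, 0 < b → poisson T b (-smear T (subordinatorDeriv (ε n)) (m n))
      = poisson T (b + (ε n + ε n)) f - poisson T (b + (ε n + R n)) f := fun n b hb => by
    rw [hx, hT.poisson_sub hb, hT.poisson_poisson hb (hpos n).1, hT.poisson_poisson hb (hpos n).2]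
  refine exists_rieszGraph_of_slices (U := Ultrafilter.of atTop) hτ hS hT hΓ hδ hI hα₀ hα
    (x := fun n => -smear T (subordinatorDeriv (ε n)) (m n)) (c := c + c) (by positivity)
    (fun n s hs => ?_) (fun n X hX => exists_rieszGraph_smear hτ hS hT hΓ hδ hI hα₀ hα (hε0 n) _ hX)
    (fun a b ha hab => ?_) hΘ
  · have e : holderSymbol T α (-smear T (subordinatorDeriv (ε n)) (m n)) s
        = holderSymbol T α (poisson T (ε n + ε n) f) s
          - holderSymbol T α (poisson T (ε n + R n) f) s := by
      rw [hx, sub_eq_add_neg, ← neg_one_smul ℂ (poisson T (ε n + R n) f)]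
      simp only [holderSymbol, hT.poissonDeriv_add hs, hT.poissonDeriv_smul hs]
      module
    rw [e]
    exact (norm_sub_le _ _).trans (add_le_add (hbound _ _ (hpos n).1 hs) (hbound _ _ (hpos n).2 hs))
  · have hb := ha.trans_le hab
    refine tendsto_ultraweak_of_norm (Tendsto.mono_left ?_ (Ultrafilter.of_le atTop))
    have hl : ∀ b, 0 < b → Tendsto (fun n => (poisson T (b + (ε n + ε n)) f : ℬ(K))) atTop
        (𝓝 (poisson T b f).1) := fun b hb => by
      refine (hT.hasDerivAt_poisson hb f).continuousAt.tendsto.comp ?_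
      simpa using (hεlim.add hεlim).const_add b
    have hr : Tendsto (fun n => (poisson T (b + (ε n + R n)) f : ℬ(K))
        - poisson T (a + (ε n + R n)) f) atTop (𝓝 0) := by
      have h2 : Tendsto (fun n => 2 / R n * ‖f‖ * (b - a)) atTop (𝓝 0) := by
        simpa using ((hRlim.const_div_atTop 2).mul_const ‖f‖).mul_const (b - a)
      refine squeeze_zero_norm (fun n => ?_) h2
      have h3 := Convex.norm_image_sub_le_of_norm_hasDerivWithin_le (s := Ici (R n))
        (f := fun r => (poisson T r f).1) (f' := fun r => poissonDeriv T r f)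
        (C := 2 / R n * ‖f‖) (x := a + (ε n + R n)) (y := b + (ε n + R n))
        (fun r hr => (hT.hasDerivAt_poisson' ((hR0 n).trans_le hr) f).hasDerivWithinAt)
        (fun r hr => (hT.norm_poissonDeriv_le ((hR0 n).trans_le hr) f).trans (by
          have := hR0 n
          have hr' : R n ≤ r := hr
          gcongr)) (convex_Ici _)
        (mem_Ici.2 (by linarith [hε0 n])) (mem_Ici.2 (by linarith [hε0 n]))
      rwa [add_sub_add_right_eq_sub, norm_of_nonneg (sub_nonneg.2 hab)] at h3
    have h := ((hl b hb).sub (hl a ha)).sub hr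
    rw [sub_zero] at h
    refine h.congr fun n => ?_
    rw [hP n b hb, hP n a ha]
    have e : ∀ u v : Elem M, (u - v).1 = u.1 - v := fun _ _ => rfl
    rw [e, e]
    abel

lemma exists_rieszGraph_holderClass {F : ℬ(L2Pos K)} (hF : F ∈ holderClass T α) :
    ∃ Y, (F, Y) ∈ rieszGraph T α δ := by
  obtain ⟨W, hW⟩ := exists_rieszGraph_eq hτ hS hT hΓ hδ hI hα₀ hα
  let D := W.map (LinearMap.fst ℂ ℬ(L2Pos K) ℬ(L2Pos K, L2Pos (Ampl K ι)))
  have hD : ∀ X, X ∈ D ↔ ∃ Y, (X, Y) ∈ rieszGraph T α δ := fun X =>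
    ⟨fun ⟨p, hp, e⟩ => ⟨p.2, by rw [← e]; exact (hW _).1 hp⟩, fun ⟨Y, hY⟩ => ⟨_, (hW _).2 hY, rfl⟩⟩
  have h1 : ultraweakClosure D ≤ D := kreinSmulian D fun c U Y h hY =>
    (hD Y).2 (exists_rieszGraph_of_tendsto hτ hS hT hΓ hδ hI hα₀ hα
      (h.mono fun X hX => ⟨(hD X).1 hX.1, hX.2⟩) hY)
  refine (hD F).1 (h1 (mem_ultraweakClosure_iff.2 ?_))
  refine @closure_mono _ (ultraweak _ _) _ _ (Submodule.span_le.2 ?_) _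
      (mem_ultraweakClosure_iff.1 hF)
  rintro X ⟨f, ⟨c, hc⟩, hX⟩
  exact (hD X).2 (exists_rieszGraph_symbol hτ hS hT hΓ hδ hI hα₀ hα hc hX)

/-- The Riesz transform is everywhere defined and bounded. -/
theorem exists_rieszTransform : ∃ R : holderClass T α →ₗ[ℂ] holderColumnClass T α ι,
    (∀ F : holderClass T α, ‖(R F : ℬ(L2Pos K, L2Pos (Ampl K ι)))‖
      ≤ holderConst α * ‖(F : ℬ(L2Pos K))‖) ∧
    ∀ p : ℬ(L2Pos K) × ℬ(L2Pos K, L2Pos (Ampl K ι)),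
      p ∈ rieszGraph T α δ ↔ ∃ F : holderClass T α,
        p = ((F : ℬ(L2Pos K)), (R F : ℬ(L2Pos K, L2Pos (Ampl K ι)))) := by
  obtain ⟨W, hW⟩ := exists_rieszGraph_eq hτ hS hT hΓ hδ hI hα₀ hα
  have hu := fun F Y Y' => rieszGraph_unique hτ hS hT hΓ hδ hI hα₀ hα (Θ := F) (Y := Y) (Y' := Y')
  choose R hR using fun F : holderClass T α =>
    exists_rieszGraph_holderClass hτ hS hT hΓ hδ hI hα₀ hα F.2
  have hadd : ∀ F F' : holderClass T α, R (F + F') = R F + R F' := fun F F' => by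
    have h := W.add_mem ((hW _).2 (hR F)) ((hW _).2 (hR F'))
    exact hu _ _ _ (hR (F + F')) ((hW _).1 h)
  have hsmul : ∀ (c : ℂ) (F : holderClass T α), R (c • F) = c • R F := fun c F => by
    have h := W.smul_mem c ((hW _).2 (hR F))
    exact hu _ _ _ (hR (c • F)) ((hW _).1 h)
  have hc := fun F => (rieszGraph_slices hτ hS hT hΓ hδ hI hα₀ hα (hR F)).1.2.2.2
  have hn : ∀ F : holderClass T α, ‖R F‖ ≤ holderConst α * ‖(F : ℬ(L2Pos K))‖ :=
    fun F => (norm_le_of_mem_rieszGraph hτ hS hT hΓ hδ hI hα₀ hα (p := (F.1, R F)) (hR F)).trans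
      (mul_le_mul_of_nonneg_right (le_add_of_nonneg_left zero_le_one) (norm_nonneg _))
  have hp : ∀ p ∈ rieszGraph T α δ, ∃ F : holderClass T α, p = (F.1, R F) := fun p hp => by
    have h := (rieszGraph_slices hτ hS hT hΓ hδ hI hα₀ hα hp).1.2.2.1
    exact ⟨⟨p.1, h⟩, Prod.ext rfl (hu _ _ _ hp (hR ⟨p.1, h⟩))⟩
  exact ⟨{ toFun := fun F => ⟨R F, hc F⟩
           map_add' := fun F F' => Subtype.ext (hadd F F')
           map_smul' := fun c F => Subtype.ext (hsmul c F) }, hn,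
    fun p => ⟨hp p, fun ⟨F, h⟩ => h ▸ hR F⟩⟩

end Riesz

end SemigroupRiesz

end

open SemigroupRiesz in
theorem theoremA (α : ℝ) (hα₀ : 0 < α) (hα₁ : α < 1) :
    ∃ C : ℝ, 0 < C ∧
      ∀ (K : Type u) [NormedAddCommGroup K] [InnerProductSpace ℂ K] [CompleteSpace K]
        (M : VonNeumannAlgebra K) (τ : (K →L[ℂ] K) → ℝ≥0∞) (_ : IsNSFTrace M τ)
        (T : ℝ → Elem M → Elem M) (_ : IsMarkovSemigroup M τ T)
        (S : NonUnitalStarSubalgebra ℂ (Elem M)) (_ : IsTestAlgebra τ T S)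
        (_ : GradientForm₂Nonneg T S),
        -- the two-sided bound on the test algebra
        (∀ f ∈ S,
          weightedSup α (fun s => √‖spaceTimeGradient T
              (fun r => poisson T r f) (fun r => poisson T r f) s‖)
            ≤ ENNReal.ofReal C * weightedSup α (fun s => ‖poissonDeriv T s f‖) ∧
          weightedSup α (fun s => ‖poissonDeriv T s f‖)
            ≤ ENNReal.ofReal C * weightedSup α (fun s => √‖spaceTimeGradient T
              (fun r => poisson T r f) (fun r => poisson T r f) s‖)) ∧
        ∀ (ι : Type v) (δ : S →ₗ[ℂ] columnModule M ι), Factorizes T δ →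
          -- the two-sided bound on all of `M`, where `Γ` is extended through the closure of `δ`
          (∀ f : Elem M, ∃ η : ℝ → K →L[ℂ] Ampl K ι,
            (∀ s : ℝ, 0 < s → ∀ X : K →L[ℂ] Ampl K ι,
              ((poisson T s f : K →L[ℂ] K), X) ∈ closedGraph δ ↔ X = η s) ∧
            weightedSup α (fun s => √‖ContinuousLinearMap.adjoint (η s) ∘L η s
                + star (poissonDeriv T s f) * poissonDeriv T s f‖)
              ≤ ENNReal.ofReal C * weightedSup α (fun s => ‖poissonDeriv T s f‖) ∧
            weightedSup α (fun s => ‖poissonDeriv T s f‖)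
              ≤ ENNReal.ofReal C *
                weightedSup α (fun s => √‖ContinuousLinearMap.adjoint (η s) ∘L η s
                  + star (poissonDeriv T s f) * poissonDeriv T s f‖)) ∧
          -- boundedness of the Riesz transform
          (Intertwines T δ →
            ∃ R : holderClass T α →ₗ[ℂ] holderColumnClass T α ι,
              (∀ F : holderClass T α, ‖(R F : L2Pos K →L[ℂ] L2Pos (Ampl K ι))‖
                ≤ C * ‖(F : L2Pos K →L[ℂ] L2Pos K)‖) ∧
              ∀ p : (L2Pos K →L[ℂ] L2Pos K) × (L2Pos K →L[ℂ] L2Pos (Ampl K ι)),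
                p ∈ rieszGraph T α δ ↔
                  ∃ F : holderClass T α,
                    p = ((F : L2Pos K →L[ℂ] L2Pos K),
                      (R F : L2Pos K →L[ℂ] L2Pos (Ampl K ι)))) :=
  ⟨holderConst α, holderConst_pos hα₁, fun K _ _ _ M τ hτ T hT S hS hΓ =>
    ⟨fun f hf => hS.weightedSup_spaceTimeGradient hT hΓ hα₀ hα₁ hf, fun ι δ hδ =>
      ⟨fun f => exists_closure_bound hτ hT hS hΓ hδ hα₀ hα₁ f, fun hI =>
        exists_rieszTransform hτ hS hT hΓ hδ hI hα₀ hα₁⟩⟩⟩
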